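/- **Proposition (local well-posedness).** Let $d\ge 5$, $\dot H^1(\mathbb R^d)=\{u:\ \|u\|_{\dot H^1}=\||\nabla|u\|_{L^2}<\infty\}$ (real-valued functions whose Fourier transform $\widehat u$ is a function), and let $(v_0,v_1)\in\dot H^1(\mathbb R^d)\times L^2(\mathbb R^d)$. Write $Q(t)=\frac{\sin(t|\nabla|)}{|\nabla|}$, $S(t)(\phi_0,\phi_1)=\cos(t|\nabla|)\phi_0+Q(t)\phi_1$, $\mathcal N(u)=(|\cdot|^{-4}\ast u^2)\,u$, and, for an interval $I$, $X(I)=L^3_tL^{6d/(3d-8)}_x(I\times\mathbb R^d)$. A (mild) solution on $I=[t_0,t_1]$ of the perturbed Hartree wave equation $$\partial_t^2v-\Delta v+\mathcal N(v+f)=0,\qquad (v,\partial_tv)|_{t=t_0}=(v_0,v_1)$$ is a real-valued function $v\in X(I)$ such that, for almost every $t\in I$, $$v(t)=S(t-t_0)(v_0,v_1)-\int_{t_0}^tQ(t-t')\,\mathcal N(v+f)(t')\,dt'$$ in the sense of tempered distributions on $\mathbb R^d$. Then for all sufficiently small $\eta>0$ (that is, there is $\eta_0>0$ such that for every $0<\eta\le\eta_0$)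 the following holds. For every interval $I=[t_0,t_1]\subset\mathbb R$ with $t_0<t_1$ and every real-valued $f\in X(I)$ with $$\|S(t-t_0)(v_0,v_1)\|_{X(I)}\le\eta\quad\text{and}\quad\|f\|_{X(I)}\le\eta,$$ the equation has a solution $v$ with $(v,\partial_tv)\in C(I;\dot H^1(\mathbb R^d)\times L^2(\mathbb R^d))$, $(v,\partial_tv)|_{t=t_0}=(v_0,v_1)$ and $$\|v\|_{X(I)}\le3\eta,$$ and every solution in $X(I)$ equals $v$ almost everywhere on $I\times\mathbb R^d$. In particular, $v$ is the only solution in the ball $\{v\in X(I):\|v\|_{X(I)}\le3\eta\}$. -/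

import Mathlib

open MeasureTheory Set Filter Topology
open scoped ENNReal FourierTransform SchwartzMap Convolution

noncomputable section

namespace HartreeNLW

/-- The Euclidean space `ℝ^d`. -/
abbrev E (d : ℕ) : Type := EuclideanSpace ℝ (Fin d)

/-! ### Fourier transform of tempered distributions given by functions -/

/-- The (real-valued) function `u` and the function `g` define tempered distributions by
integration, and `g` is the Fourier transform of `u` in the sense of tempered distributions:
`⟨û, φ⟩ = ⟨u, φ̂⟩` for all Schwartz functions `φ`. The normalization is Mathlib's,
`φ̂(ξ) = ∫ exp(-2πi x·ξ) φ(x) dx`, so that `|∇|` has the symbol `2π|ξ|`. -/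
def IsFourierTransform {d : ℕ} (u : E d → ℝ) (g : E d → ℂ) : Prop :=
  AEStronglyMeasurable u volume ∧ AEStronglyMeasurable g volume ∧
    ∀ φ : 𝓢(E d, ℂ),
      Integrable (fun x => (u x : ℂ) * φ x) volume ∧
      Integrable (fun ξ => g ξ * φ ξ) volume ∧
      ∫ x, (u x : ℂ) * (𝓕 φ) x = ∫ ξ, g ξ * φ ξ

open Classical in
/-- The Fourier transform `û` of `u`, where it is a function (unique up to null sets). -/
def fourierFun {d : ℕ} (u : E d → ℝ) : E d → ℂ :=
  if h : ∃ g, IsFourierTransform u g then h.choose else 0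

open Classical in
/-- The real-valued function with Fourier transform `g`, if there is one (unique up to null
sets). -/
def fourierInvFun {d : ℕ} (g : E d → ℂ) : E d → ℝ :=
  if h : ∃ u, IsFourierTransform u g then h.choose else 0

/-- The Fourier multiplier operator `u ↦ 𝓕⁻¹ (m û)` with symbol `m`. -/
def fourierMultiplier {d : ℕ} (m : E d → ℝ) (u : E d → ℝ) : E d → ℝ :=
  fourierInvFun fun ξ => (m ξ : ℂ) * fourierFun u ξ

/-! ### The homogeneous Sobolev space `Ḣ¹` -/

/-- `u ∈ Ḣ¹(ℝ^d)`: the Fourier transform `û` is a function and `|∇| u ∈ L²`, that is,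
`2π|ξ| û ∈ L²`. -/
def MemHomH1 {d : ℕ} (u : E d → ℝ) : Prop :=
  ∃ g, IsFourierTransform u g ∧
    MemLp (fun ξ : E d => ((2 * Real.pi * ‖ξ‖ : ℝ) : ℂ) * g ξ) 2 volume

/-- The norm `‖u‖_{Ḣ¹} = ‖ |∇| u ‖_{L²} = ‖ 2π|ξ| û ‖_{L²}` of `u ∈ Ḣ¹`. -/
def homH1Norm {d : ℕ} (u : E d → ℝ) : ℝ≥0∞ :=
  eLpNorm (fun ξ : E d => ((2 * Real.pi * ‖ξ‖ : ℝ) : ℂ) * fourierFun u ξ) 2 volume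

/-! ### The linear wave propagators -/

/-- `Q(t) = sin(t|∇|) / |∇|`. -/
def Q {d : ℕ} (t : ℝ) (u : E d → ℝ) : E d → ℝ :=
  fourierMultiplier
    (fun ξ => Real.sin (t * (2 * Real.pi * ‖ξ‖)) / (2 * Real.pi * ‖ξ‖)) u

/-- `∂ₜQ(t) = cos(t|∇|)`. -/
def dtQ {d : ℕ} (t : ℝ) (u : E d → ℝ) : E d → ℝ :=
  fourierMultiplier (fun ξ => Real.cos (t * (2 * Real.pi * ‖ξ‖))) u

/-- `S(t)(φ₀, φ₁) = ∂ₜQ(t) φ₀ + Q(t) φ₁`, the linear evolution of the data `(φ₀, φ₁)`. -/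
def S {d : ℕ} (t : ℝ) (φ₀ φ₁ : E d → ℝ) : E d → ℝ :=
  fun x => dtQ t φ₀ x + Q t φ₁ x

/-! ### The nonlinearity and the space `X(I)` -/

/-- The Hartree nonlinearity `𝒩(u) = (|·|⁻⁴ ∗ u²) u`. -/
def hartree {d : ℕ} (u : E d → ℝ) : E d → ℝ :=
  fun x => ((fun y : E d => (‖y‖ ^ 4)⁻¹) ⋆[ContinuousLinearMap.mul ℝ ℝ, volume]
    (fun y : E d => u y ^ 2)) x * u x

/-- The norm of `X(I) = L³_t L^{6d/(3d-8)}_x (I × ℝ^d)`. -/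
def normX {d : ℕ} (I : Set ℝ) (u : ℝ → E d → ℝ) : ℝ≥0∞ :=
  eLpNorm (fun t => eLpNorm (u t) (ENNReal.ofReal (6 * d / (3 * d - 8))) volume) 3
    (volume.restrict I)

/-- `u ∈ X(I)`: `u` is measurable on `I × ℝ^d` and has a finite norm. -/
def MemX {d : ℕ} (I : Set ℝ) (u : ℝ → E d → ℝ) : Prop :=
  AEStronglyMeasurable (Function.uncurry u) ((volume.restrict I).prod volume) ∧
    normX I u < ∞

/-! ### Solutions -/

/-- `v` solves `∂ₜ²v - Δv + 𝒩(v + f) = 0`, `(v, ∂ₜv)|_{t = t₀} = (v₀, v₁)` on `I ∋ t₀` in the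
Duhamel (mild) formulation: for almost every `t ∈ I`,
`v(t) = S(t - t₀)(v₀, v₁) - ∫_{t₀}^t Q(t - t') 𝒩(v + f)(t') dt'`,
as an identity between tempered distributions on `ℝ^d` (the time integral of a
distribution-valued function is taken after pairing with a Schwartz function); all the
integrals are required to converge. -/
def IsMildSolution {d : ℕ} (I : Set ℝ) (t₀ : ℝ) (v₀ v₁ : E d → ℝ) (f v : ℝ → E d → ℝ) : Prop :=
  ∀ᵐ t ∂(volume.restrict I), ∀ φ : 𝓢(E d, ℝ),
    Integrable (fun x => v t x * φ x) volume ∧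
    Integrable (fun x => S (t - t₀) v₀ v₁ x * φ x) volume ∧
    (∀ᵐ t' ∂(volume.restrict (uIoc t₀ t)),
      Integrable (fun x => Q (t - t') (hartree fun y => v t' y + f t' y) x * φ x) volume) ∧
    IntervalIntegrable
      (fun t' => ∫ x, Q (t - t') (hartree fun y => v t' y + f t' y) x * φ x) volume t₀ t ∧
    ∫ x, v t x * φ x =
      (∫ x, S (t - t₀) v₀ v₁ x * φ x) -
        ∫ t' in t₀..t, ∫ x, Q (t - t') (hartree fun y => v t' y + f t' y) x * φ x

/-- `w` is the time derivative of `v` on `I`, as a path of tempered distributions on `ℝ^d`. -/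
def IsTimeDeriv {d : ℕ} (I : Set ℝ) (v w : ℝ → E d → ℝ) : Prop :=
  ∀ φ : 𝓢(E d, ℝ), ∀ t ∈ I,
    HasDerivWithinAt (fun s => ∫ x, v s x * φ x) (∫ x, w t x * φ x) I t

/-- `(v, w) ∈ C(I; Ḣ¹(ℝ^d) × L²(ℝ^d))`. -/
def ContinuousInEnergySpace {d : ℕ} (I : Set ℝ) (v w : ℝ → E d → ℝ) : Prop :=
  ∀ t ∈ I,
    MemHomH1 (v t) ∧ MemLp (w t) 2 volume ∧
    Tendsto (fun s => homH1Norm (fun x => v s x - v t x)) (𝓝[I] t) (𝓝 0) ∧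
    Tendsto (fun s => eLpNorm (fun x => w s x - w t x) 2 volume) (𝓝[I] t) (𝓝 0)

end HartreeNLW

end

open scoped ComplexConjugate

noncomputable section

namespace HartreeNLW

/-! ### The Hardy–Littlewood–Sobolev inequality -/

section HardyLittlewoodSobolev

set_option linter.unusedSectionVars false

variable {V : Type*} [NormedAddCommGroup V] [NormedSpace ℝ V] [FiniteDimensional ℝ V]
  [MeasurableSpace V] [BorelSpace V] (μ : Measure V) [μ.IsAddHaarMeasure]

/-! The solution is the fixed point of `v ↦ L - D[v + f]`, where `L` is the free evolution of the
data and `D[a]` is the retarded integral of `Q(t - t') 𝒩(a)(t')`. The map is a contraction of the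
ball of radius `3η` in `X(I)` because of two estimates. The nonlinear one,
`exists_eLpNorm_hartree_sub_le`, bounds `𝒩(a) - 𝒩(a')` in `L²_x` by `(‖a‖ + ‖a'‖)² ‖a - a'‖` with
norms in `L^{6d/(3d-8)}_x`; it is Hölder plus Hardy–Littlewood–Sobolev with kernel `|x|⁻⁴`, hence
the need for `d > 4`. The linear one, `exists_duhamel_le`, is the retarded Strichartz estimate from
`L¹_t L²_x` to `L³_t L^{6d/(3d-8)}_x`. Hölder in time, with three factors in `L³`, joins them into
the cubic difference estimate `exists_normX_sub_le`.

The linear estimate is proved without frequency decomposition. Its dual form for the half-wave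
propagators, `exists_dualStrichartz`, has the weight `|∇|⁻²`, which is written as `∫₀^∞ s exp(-s|∇|)
ds`. For each `s`, expanding the square leaves `exp(-z|∇|)` with `z = s - iσ(t - t')`. Subordination
to Gaussians bounds its kernel by `|z|^{-(d-1)/2} (Re z)^{-(d+1)/2}` up to a constant; interpolation
with the `L²` bound and integration in `s` give the time kernel `|t - t'|^{-2/3}`, and
one-dimensional Hardy–Littlewood–Sobolev finishes.

Passing to the retarded operator costs nothing because the forcing lies in `L¹_t`: in the pairing of
`D` with a test function `G`, the forcing at time `t'` meets the adjoint evolution of `G` restricted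
to times after `t'`. That restriction is again a test function, so the dual estimate applies
uniformly in `t'` (`exists_lintegral_adjointFT_sq_le`). A converse of Hölder's inequality in `L³_t
L^p_x` turns the bound on pairings into a bound on `D`.

Uniqueness in all of `X(I)` uses no smallness of the solutions. The retarded estimate holds on every
half-line `(-∞, τ]`, so the difference of two solutions satisfies a Volterra inequality; it vanishes
successively on short time intervals, on each of which the coefficient is small by absolute
continuity (`lintegral_eq_zero_of_volterra`).

The remaining work relates functions to their spatial Fourier transforms. If `|ξ| g` is square
integrable and `d ≥ 3`, then `g` is integrable near the origin and square integrable away from it,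
so it is the transform of a function, which can be chosen jointly measurable in time and space. On
the Fourier side the solution is explicit, and at almost every frequency it is controlled for all
times by one function in `L²_ξ` (`energyBound`); dominated convergence then gives the time
derivative and continuity in the energy space. -/

theorem measurable_ofReal_norm_rpow (s : ℝ) :
    Measurable fun y : V => ENNReal.ofReal (‖y‖ ^ s) :=
  (measurable_norm.pow_const s).ennreal_ofReal

/-- Dilation reduces to the unit ball: the measure contributes `ρ^n`, the kernel `ρ^{-s}`.
Finiteness on the unit ball is the condition `s < n`. -/
theorem exists_lintegral_ball_norm_rpow_le {s : ℝ} (hs0 : 0 < s)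
    (hs : s < Module.finrank ℝ V) :
    ∃ C : ℝ≥0∞, C ≠ ∞ ∧ ∀ ρ : ℝ, 0 < ρ →
      ∫⁻ y in Metric.ball (0 : V) ρ, ENNReal.ofReal (‖y‖ ^ (-s)) ∂μ
        ≤ C * ENNReal.ofReal (ρ ^ (Module.finrank ℝ V - s)) := by
  have hn : 1 ≤ Module.finrank ℝ V := by
    have : (0 : ℝ) < Module.finrank ℝ V := hs0.trans hs
    exact_mod_cast this
  have hint : IntegrableOn (fun y : V => ‖y‖ ^ (-s)) (Metric.ball 0 1) μ := by
    refine integrableOn_ball_of_norm_le_rpow (C := 1) hn hs (ae_of_all _ fun y => ?_)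
      (measurable_norm.pow_const _).aestronglyMeasurable
    rw [Real.norm_of_nonneg (by positivity), one_mul]
  refine ⟨∫⁻ y in Metric.ball (0 : V) 1, ENNReal.ofReal (‖y‖ ^ (-s)) ∂μ, ?_, fun ρ hρ => ?_⟩
  · have := hint.2
    rw [hasFiniteIntegral_iff_norm] at this
    refine (lt_of_le_of_lt (le_of_eq ?_) this).ne
    refine lintegral_congr fun y => ?_
    rw [Real.norm_of_nonneg (by positivity)]
  · have h1 : ∫⁻ y in Metric.ball (0 : V) ρ, ENNReal.ofReal (‖y‖ ^ (-s)) ∂μ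
        = ENNReal.ofReal (ρ ^ Module.finrank ℝ V) *
          ∫⁻ y in Metric.ball (0 : V) 1, ENNReal.ofReal (‖ρ • y‖ ^ (-s)) ∂μ := by
      rw [← lintegral_indicator Metric.isOpen_ball.measurableSet,
        ← lintegral_indicator Metric.isOpen_ball.measurableSet]
      have h2 := Measure.map_addHaar_smul μ hρ.ne'
      have h3 := lintegral_map (μ := μ) (f := (Metric.ball (0 : V) ρ).indicator
        fun y => ENNReal.ofReal (‖y‖ ^ (-s))) (g := fun y : V => ρ • y)
        ((measurable_ofReal_norm_rpow _).indicator Metric.isOpen_ball.measurableSet)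
        (measurable_const_smul ρ)
      rw [h2, lintegral_smul_measure] at h3
      have h4 : ∀ y : V, (Metric.ball (0 : V) ρ).indicator
          (fun y => ENNReal.ofReal (‖y‖ ^ (-s))) (ρ • y)
          = (Metric.ball (0 : V) 1).indicator (fun y => ENNReal.ofReal (‖ρ • y‖ ^ (-s))) y := by
        intro y
        have : ρ • y ∈ Metric.ball (0 : V) ρ ↔ y ∈ Metric.ball (0 : V) 1 := by
          simp only [mem_ball_zero_iff, norm_smul, Real.norm_of_nonneg hρ.le]
          constructor
          · intro h; by_contra! h'; nlinarith
          · intro h; nlinarith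
        by_cases hy : y ∈ Metric.ball (0 : V) 1
        · rw [indicator_of_mem hy, indicator_of_mem (this.2 hy)]
        · rw [indicator_of_notMem hy, indicator_of_notMem (fun h => hy (this.1 h))]
      simp_rw [h4] at h3
      rw [← h3, smul_eq_mul, ← mul_assoc, ← ENNReal.ofReal_mul (by positivity),
        abs_of_pos (by positivity), mul_inv_cancel₀ (by positivity), ENNReal.ofReal_one, one_mul]
    rw [h1]
    have h5 : ∀ y : V, ENNReal.ofReal (‖ρ • y‖ ^ (-s))
        = ENNReal.ofReal (ρ ^ (-s)) * ENNReal.ofReal (‖y‖ ^ (-s)) := by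
      intro y
      rw [norm_smul, Real.norm_of_nonneg hρ.le, Real.mul_rpow hρ.le (norm_nonneg _),
        ENNReal.ofReal_mul (by positivity)]
    simp_rw [h5]
    rw [lintegral_const_mul _ (measurable_ofReal_norm_rpow _), ← mul_assoc,
      ← ENNReal.ofReal_mul (by positivity), mul_comm, ← Real.rpow_natCast, ← Real.rpow_add hρ,
      ← sub_eq_add_neg]

/-- Cut at the ball around `x` of radius `ρ` with `ρ^n = μ A`. Inside, the ball estimate gives a
multiple of `ρ^{n-s}`; outside, the kernel is at most `ρ^{-s}`, which contributes `ρ^{-s} μ A`. Both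
are multiples of `μ A ^ (1 - s/n)`, uniformly in `x`. -/
theorem exists_setLIntegral_norm_rpow_le {s : ℝ} (hs0 : 0 < s)
    (hs : s < Module.finrank ℝ V) :
    ∃ C : ℝ≥0∞, C ≠ ∞ ∧ ∀ (A : Set V) (x : V), MeasurableSet A → μ A ≠ ∞ →
      ∫⁻ y in A, ENNReal.ofReal (‖x - y‖ ^ (-s)) ∂μ
        ≤ C * μ A ^ (1 - s / Module.finrank ℝ V) := by
  obtain ⟨C, hC, hball⟩ := exists_lintegral_ball_norm_rpow_le μ hs0 hs
  refine ⟨C + 1, by simp [hC], fun A x hA hAfin => ?_⟩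
  set n : ℝ := (Module.finrank ℝ V : ℝ) with hn
  have hn0 : 0 < n := hs0.trans hs
  rcases eq_or_ne (μ A) 0 with h0 | h0
  · rw [Measure.restrict_eq_zero.2 h0]; simp
  set v : ℝ := (μ A).toReal with hv
  have hv0 : 0 < v := ENNReal.toReal_pos h0 hAfin
  have hAv : μ A = ENNReal.ofReal v := (ENNReal.ofReal_toReal hAfin).symm
  set ρ : ℝ := v ^ (1 / n) with hρ
  have hρ0 : 0 < ρ := by positivity
  have h1 : ∫⁻ y in A, ENNReal.ofReal (‖x - y‖ ^ (-s)) ∂μ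
      ≤ ∫⁻ y in A, ((Metric.ball (0 : V) ρ).indicator
          (fun y => ENNReal.ofReal (‖y‖ ^ (-s))) (x - y) + ENNReal.ofReal (ρ ^ (-s))) ∂μ := by
    refine lintegral_mono fun y => ?_
    by_cases h : x - y ∈ Metric.ball (0 : V) ρ
    · rw [indicator_of_mem h]; exact le_self_add
    · rw [indicator_of_notMem h, zero_add]
      refine ENNReal.ofReal_le_ofReal (Real.rpow_le_rpow_of_nonpos hρ0 ?_ (by linarith))
      simpa using h
  refine h1.trans ?_
  have hm : Measurable ((Metric.ball (0 : V) ρ).indicator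
      (fun y : V => ENNReal.ofReal (‖y‖ ^ (-s)))) :=
    (measurable_ofReal_norm_rpow _).indicator Metric.isOpen_ball.measurableSet
  rw [lintegral_add_right _ measurable_const, lintegral_const, Measure.restrict_apply_univ,
    add_mul, one_mul, hAv, ENNReal.ofReal_rpow_of_pos hv0]
  gcongr
  · calc ∫⁻ y in A, (Metric.ball (0 : V) ρ).indicator
          (fun y => ENNReal.ofReal (‖y‖ ^ (-s))) (x - y) ∂μ
        ≤ ∫⁻ y, (Metric.ball (0 : V) ρ).indicator
          (fun y => ENNReal.ofReal (‖y‖ ^ (-s))) (x - y) ∂μ := setLIntegral_le_lintegral _ _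
      _ = ∫⁻ y, (Metric.ball (0 : V) ρ).indicator
          (fun y => ENNReal.ofReal (‖y‖ ^ (-s))) y ∂μ :=
        lintegral_sub_left_eq_self _ x
      _ = ∫⁻ y in Metric.ball (0 : V) ρ, ENNReal.ofReal (‖y‖ ^ (-s)) ∂μ :=
        lintegral_indicator Metric.isOpen_ball.measurableSet _
      _ ≤ C * ENNReal.ofReal (ρ ^ (n - s)) := hball ρ hρ0
      _ = C * ENNReal.ofReal (v ^ (1 - s / n)) := by
        rw [hρ, ← Real.rpow_mul hv0.le]; congr 3; field_simp
  · rw [← ENNReal.ofReal_mul (by positivity), hρ, ← Real.rpow_mul hv0.le]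
    refine ENNReal.ofReal_le_ofReal (le_of_eq ?_)
    nth_rewrite 2 [← Real.rpow_one v]
    rw [← Real.rpow_add hv0]; congr 1; field_simp; ring

theorem lintegral_indicator_Ioi_lt (c : ℝ≥0∞) :
    ∫⁻ a in Ioi (0 : ℝ), (if ENNReal.ofReal a < c then 1 else 0) = c := by
  have : ∀ a : ℝ, (if ENNReal.ofReal a < c then (1 : ℝ≥0∞) else 0)
      = {a : ℝ | ENNReal.ofReal a < c}.indicator (fun _ => 1) a := fun a => by
    simp [indicator]
  simp_rw [this]
  have hm : MeasurableSet {a : ℝ | ENNReal.ofReal a < c} :=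
    measurableSet_lt ENNReal.measurable_ofReal measurable_const
  rw [lintegral_indicator_const hm, one_mul, Measure.restrict_apply hm]
  rcases eq_or_ne c ∞ with rfl | hc
  · simp
  · have : {a : ℝ | ENNReal.ofReal a < c} ∩ Ioi 0 = Ioo 0 c.toReal := by
      ext a
      simp only [mem_inter_iff, mem_ofPred_eq, mem_Ioi, mem_Ioo]
      constructor
      · rintro ⟨h1, h2⟩; exact ⟨h2, (ENNReal.ofReal_lt_iff_lt_toReal h2.le hc).1 h1⟩
      · rintro ⟨h1, h2⟩; exact ⟨(ENNReal.ofReal_lt_iff_lt_toReal h1.le hc).2 h2, h1⟩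
    rw [this, Real.volume_Ioo, sub_zero, ENNReal.ofReal_toReal hc]

/-- The layer-cake formula applied to both `f` and `h`, with Tonelli. It reduces a bilinear estimate
to pairs of superlevel sets. -/
theorem lintegral_mul_eq_lintegral_layers {α β : Type*} [MeasurableSpace α] [MeasurableSpace β]
    (μ : Measure α) (ν : Measure β) [SFinite μ] [SFinite ν] {f : α → ℝ≥0∞} {h : β → ℝ≥0∞}
    {k : α → β → ℝ≥0∞} (hf : Measurable f) (hh : Measurable h)
    (hk : Measurable (Function.uncurry k)) :
    ∫⁻ x, ∫⁻ y, f x * k x y * h y ∂ν ∂μ =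
      ∫⁻ a in Ioi (0 : ℝ), ∫⁻ b in Ioi (0 : ℝ),
        ∫⁻ x in {x | ENNReal.ofReal a < f x}, ∫⁻ y in {y | ENNReal.ofReal b < h y},
          k x y ∂ν ∂μ := by
  have hmf : Measurable fun q : ℝ × α => if ENNReal.ofReal q.1 < f q.2 then (1 : ℝ≥0∞) else 0 :=
    Measurable.ite (measurableSet_lt (ENNReal.measurable_ofReal.comp measurable_fst)
      (hf.comp measurable_snd)) measurable_const measurable_const
  have hmh : Measurable fun q : ℝ × β => if ENNReal.ofReal q.1 < h q.2 then (1 : ℝ≥0∞) else 0 :=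
    Measurable.ite (measurableSet_lt (ENNReal.measurable_ofReal.comp measurable_fst)
      (hh.comp measurable_snd)) measurable_const measurable_const
  have hsf : ∀ a, MeasurableSet {x | ENNReal.ofReal a < f x} := fun a =>
    measurableSet_lt measurable_const hf
  have hsh : ∀ a, MeasurableSet {x | ENNReal.ofReal a < h x} := fun a =>
    measurableSet_lt measurable_const hh
  have inner : ∀ b x, ∫⁻ y in {y | ENNReal.ofReal b < h y}, k x y ∂ν
      = ∫⁻ y, (if ENNReal.ofReal b < h y then 1 else 0) * k x y ∂ν := by
    intro b x
    rw [← lintegral_indicator (hsh b)]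
    refine lintegral_congr fun y => ?_
    by_cases hy : ENNReal.ofReal b < h y <;> simp [indicator, hy]
  have hkx : ∀ x, Measurable fun y => k x y := fun x => hk.comp measurable_prodMk_left
  have step1 : ∀ x, ∫⁻ y, k x y * h y ∂ν
      = ∫⁻ b in Ioi (0 : ℝ), ∫⁻ y in {y | ENNReal.ofReal b < h y}, k x y ∂ν := by
    intro x
    simp_rw [inner]
    rw [lintegral_lintegral_swap]
    · refine lintegral_congr fun y => ?_
      have h2 : Measurable fun b : ℝ => if ENNReal.ofReal b < h y then (1 : ℝ≥0∞) else 0 :=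
        hmh.comp measurable_prodMk_right
      rw [lintegral_mul_const _ h2, lintegral_indicator_Ioi_lt, mul_comm]
    · exact (hmh.mul ((hkx x).comp measurable_snd)).aemeasurable
  have hM : Measurable fun q : α × ℝ =>
      ∫⁻ y in {y | ENNReal.ofReal q.2 < h y}, k q.1 y ∂ν := by
    simp_rw [inner]
    refine Measurable.lintegral_prod_right' (f := fun q : (α × ℝ) × β =>
      (if ENNReal.ofReal q.1.2 < h q.2 then 1 else 0) * k q.1.1 q.2) ?_
    exact (hmh.comp ((measurable_snd.comp measurable_fst).prodMk measurable_snd)).mul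
      (hk.comp ((measurable_fst.comp measurable_fst).prodMk measurable_snd))
  set L : α → ℝ → ℝ≥0∞ := fun x b => ∫⁻ y in {y | ENNReal.ofReal b < h y}, k x y ∂ν with hL
  have e1 : ∀ x, ∫⁻ y, f x * k x y * h y ∂ν = f x * ∫⁻ b in Ioi (0 : ℝ), L x b := by
    intro x
    have h2 : Measurable fun y => k x y * h y := (hkx x).mul hh
    simp_rw [mul_assoc]
    rw [← step1, ← lintegral_const_mul _ h2]
  simp_rw [e1]
  have e2 : ∀ a, ∫⁻ b in Ioi (0 : ℝ), ∫⁻ x in {x | ENNReal.ofReal a < f x}, L x b ∂μ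
      = ∫⁻ x, (if ENNReal.ofReal a < f x then 1 else 0) * (∫⁻ b in Ioi (0 : ℝ), L x b) ∂μ := by
    intro a
    rw [lintegral_lintegral_swap (f := fun b x => L x b) (hM.comp measurable_swap).aemeasurable,
      ← lintegral_indicator (hsf a)]
    refine lintegral_congr fun x => ?_
    by_cases hx : ENNReal.ofReal a < f x <;> simp [indicator, hx]
  refine Eq.trans ?_ (lintegral_congr e2).symm
  have hB : Measurable fun x => ∫⁻ b in Ioi (0 : ℝ), L x b :=
    hM.lintegral_prod_right'
  rw [lintegral_lintegral_swap]
  · refine lintegral_congr fun x => ?_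
    have h2 : Measurable fun b : ℝ => if ENNReal.ofReal b < f x then (1 : ℝ≥0∞) else 0 :=
      hmf.comp measurable_prodMk_right
    rw [lintegral_mul_const _ h2, lintegral_indicator_Ioi_lt]
  · exact (hmf.mul (hB.comp measurable_snd)).aemeasurable

theorem measure_lt_le_rpow {α : Type*} [MeasurableSpace α] (μ : Measure α) {f : α → ℝ≥0∞}
    (hf : Measurable f) {p : ℝ} (hp : 0 < p) (hfp : ∫⁻ x, f x ^ p ∂μ ≤ 1) {a : ℝ} (ha : 0 < a) :
    μ {x | ENNReal.ofReal a < f x} ≤ ENNReal.ofReal (a ^ (-p)) := by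
  have h1 := mul_meas_ge_le_lintegral (μ := μ) (hf.pow_const p) (ENNReal.ofReal (a ^ p))
  have hap : ENNReal.ofReal (a ^ p) ≠ 0 := by
    simpa using Real.rpow_pos_of_pos ha p
  have h2 : μ {x | ENNReal.ofReal a < f x} ≤ μ {x | ENNReal.ofReal (a ^ p) ≤ f x ^ p} := by
    refine measure_mono fun x hx => ?_
    rw [mem_ofPred_eq] at hx ⊢
    rw [← ENNReal.ofReal_rpow_of_pos ha]
    exact ENNReal.rpow_le_rpow hx.le hp.le
  rw [Real.rpow_neg ha.le, ENNReal.ofReal_inv_of_pos (by positivity)]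
  refine ENNReal.le_inv_iff_mul_le.2 ?_
  rw [mul_comm]
  exact (mul_le_mul_right h2 _).trans (h1.trans hfp)

theorem lintegral_measure_lt_mul_rpow_le {α : Type*} [MeasurableSpace α] (μ : Measure α)
    [SFinite μ] {f : α → ℝ≥0∞} (hf : Measurable f) {p : ℝ} (hp : 0 < p)
    (hfp : ∫⁻ x, f x ^ p ∂μ ≤ 1) :
    ∫⁻ a in Ioi (0 : ℝ), μ {x | ENNReal.ofReal a < f x} * ENNReal.ofReal (a ^ (p - 1))
      ≤ ENNReal.ofReal (1 / p) := by
  have hfin : ∀ᵐ x ∂μ, f x < ∞ := by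
    have h : ∀ᵐ x ∂μ, f x ^ p < ∞ :=
      ae_lt_top (hf.pow_const p) (hfp.trans_lt ENNReal.one_lt_top).ne
    filter_upwards [h] with x hx
    exact (ENNReal.rpow_lt_top_iff_of_pos hp).1 hx
  have h1 := lintegral_rpow_eq_lintegral_meas_lt_mul μ (f := fun x => (f x).toReal)
    (ae_of_all _ fun x => ENNReal.toReal_nonneg) hf.ennreal_toReal.aemeasurable hp
  have h2 : ∫⁻ x, ENNReal.ofReal ((f x).toReal ^ p) ∂μ = ∫⁻ x, f x ^ p ∂μ := by
    refine lintegral_congr_ae ?_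
    filter_upwards [hfin] with x hx
    rw [← ENNReal.ofReal_rpow_of_nonneg ENNReal.toReal_nonneg hp.le, ENNReal.ofReal_toReal hx.ne]
  rw [h2] at h1
  have h3 : ∫⁻ a in Ioi (0 : ℝ), μ {x | ENNReal.ofReal a < f x} * ENNReal.ofReal (a ^ (p - 1))
      = ∫⁻ a in Ioi (0 : ℝ), μ {x | a < (f x).toReal} * ENNReal.ofReal (a ^ (p - 1)) := by
    refine setLIntegral_congr_fun measurableSet_Ioi fun a (ha : 0 < a) => ?_
    have : μ {x | ENNReal.ofReal a < f x} = μ {x | a < (f x).toReal} := by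
      refine measure_congr ?_
      filter_upwards [hfin] with x hx
      exact propext (ENNReal.ofReal_lt_iff_lt_toReal ha.le hx.ne)
    simp only [this]
  rw [h3]
  rw [h1] at hfp
  rw [one_div, ENNReal.ofReal_inv_of_pos hp]
  refine ENNReal.le_inv_iff_mul_le.2 ?_
  rwa [mul_comm]

theorem setLIntegral_Ioc_rpow {s L : ℝ} (hs : -1 < s) (hL : 0 < L) :
    ∫⁻ b in Ioc 0 L, ENNReal.ofReal (b ^ s) = ENNReal.ofReal (L ^ (s + 1) / (s + 1)) := by
  have hint := (intervalIntegral.intervalIntegrable_rpow' (a := 0) (b := L) hs).1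
  rw [← ofReal_integral_eq_lintegral_ofReal hint]
  · rw [← intervalIntegral.integral_of_le hL.le, integral_rpow (Or.inl hs),
      Real.zero_rpow (by linarith), sub_zero]
  · filter_upwards [self_mem_ae_restrict measurableSet_Ioc] with b hb
    exact Real.rpow_nonneg hb.1.le _

/-- **Hardy–Littlewood–Sobolev inequality** in bilinear form, for normalized functions. -/
theorem exists_lintegral_riesz_le_of_normalized {s p r : ℝ} (hs0 : 0 < s)
    (hs : s < Module.finrank ℝ V) (hp : 1 < p) (hr : 1 < r)
    (hpr : 1 / p + 1 / r = 2 - s / Module.finrank ℝ V) :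
    ∃ C : ℝ≥0∞, C ≠ ∞ ∧ ∀ f h : V → ℝ≥0∞, Measurable f → Measurable h →
      ∫⁻ x, f x ^ p ∂μ ≤ 1 → ∫⁻ x, h x ^ r ∂μ ≤ 1 →
      ∫⁻ x, ∫⁻ y, f x * ENNReal.ofReal (‖x - y‖ ^ (-s)) * h y ∂μ ∂μ ≤ C := by
  obtain ⟨C, hC, hset⟩ := exists_setLIntegral_norm_rpow_le μ hs0 hs
  set κ : ℝ := 1 - s / Module.finrank ℝ V with hκ
  have hn0 : (0 : ℝ) < Module.finrank ℝ V := hs0.trans hs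
  have hκ0 : 0 < κ := by rw [hκ, sub_pos, div_lt_one hn0]; exact hs
  have hp0 : 0 < p := by linarith
  have hr0 : 0 < r := by linarith
  have hp1 : 1 / p < 1 := by rw [div_lt_one hp0]; exact hp
  have hr1 : 1 / r < 1 := by rw [div_lt_one hr0]; exact hr
  have hrκ : r * κ < 1 := by
    have : κ < 1 / r := by linarith
    rwa [lt_div_iff₀ hr0, mul_comm] at this
  have hpκ : p * κ < 1 := by
    have : κ < 1 / p := by linarith
    rwa [lt_div_iff₀ hp0, mul_comm] at this
  have hsum : r + p = p * r * (1 + κ) := by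
    have : 1 / p + 1 / r = 1 + κ := by linarith
    field_simp at this; linarith
  refine ⟨C * (ENNReal.ofReal (1 / (1 - r * κ)) * ENNReal.ofReal (1 / p)
    + ENNReal.ofReal (1 / (1 - p * κ)) * ENNReal.ofReal (1 / r)), ?_, fun f h hf hh hfp hhr => ?_⟩
  · exact ENNReal.mul_ne_top hC (by simp [ENNReal.mul_eq_top])
  have hk : Measurable (Function.uncurry fun x y : V => ENNReal.ofReal (‖x - y‖ ^ (-s))) :=
    (measurable_ofReal_norm_rpow (-s)).comp (measurable_fst.sub measurable_snd)
  rw [lintegral_mul_eq_lintegral_layers μ μ hf hh hk]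
  set v : ℝ → ℝ≥0∞ := fun a => μ {x | ENNReal.ofReal a < f x} with hv
  set w : ℝ → ℝ≥0∞ := fun b => μ {x | ENNReal.ofReal b < h x} with hw
  have hvm : Measurable v := by
    refine Antitone.measurable fun a b hab => measure_mono fun x hx => ?_
    rw [mem_ofPred_eq] at hx ⊢
    exact lt_of_le_of_lt (ENNReal.ofReal_le_ofReal hab) hx
  have hwm : Measurable w := by
    refine Antitone.measurable fun a b hab => measure_mono fun x hx => ?_
    rw [mem_ofPred_eq] at hx ⊢
    exact lt_of_le_of_lt (ENNReal.ofReal_le_ofReal hab) hx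
  have hvc : ∀ a, 0 < a → v a ≤ ENNReal.ofReal (a ^ (-p)) := fun a ha =>
    measure_lt_le_rpow μ hf hp0 hfp ha
  have hwc : ∀ a, 0 < a → w a ≤ ENNReal.ofReal (a ^ (-r)) := fun a ha =>
    measure_lt_le_rpow μ hh hr0 hhr ha
  have hpow : ∀ a q : ℝ, 0 < a → ENNReal.ofReal (a ^ (-q)) ^ κ = ENNReal.ofReal (a ^ (-(q * κ))) := by
    intro a q ha
    rw [ENNReal.ofReal_rpow_of_pos (by positivity), ← Real.rpow_mul ha.le, neg_mul]
  -- The kernel integrated over two superlevel sets is at most the measure of one of them times the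
  -- power `κ` of the measure of the other, with either choice of roles. Chebyshev is applied only
  -- to the factor carrying the power `κ`, so that the other factor can still be integrated exactly.
  set J : ℝ → ℝ → ℝ≥0∞ := fun a b => ∫⁻ x in {x | ENNReal.ofReal a < f x},
    ∫⁻ y in {y | ENNReal.ofReal b < h y}, ENNReal.ofReal (‖x - y‖ ^ (-s)) ∂μ ∂μ with hJ
  have hJ1 : ∀ a b, 0 < a → 0 < b → J a b ≤ C * (v a * ENNReal.ofReal (b ^ (-(r * κ)))) := by
    intro a b ha hb
    calc J a b ≤ ∫⁻ x in {x | ENNReal.ofReal a < f x}, C * ENNReal.ofReal (b ^ (-(r * κ))) ∂μ := by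
          refine lintegral_mono fun x => ?_
          refine (hset _ x (measurableSet_lt measurable_const hh)
            ((hwc b hb).trans_lt ENNReal.ofReal_lt_top).ne).trans ?_
          rw [← hpow b r hb]
          gcongr
          exact hwc b hb
      _ = C * (v a * ENNReal.ofReal (b ^ (-(r * κ)))) := by
          rw [lintegral_const, Measure.restrict_apply_univ]; ring
  have hJ2 : ∀ a b, 0 < a → 0 < b → J a b ≤ C * (w b * ENNReal.ofReal (a ^ (-(p * κ)))) := by
    intro a b ha hb
    have : J a b = ∫⁻ y in {y | ENNReal.ofReal b < h y}, ∫⁻ x in {x | ENNReal.ofReal a < f x},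
        ENNReal.ofReal (‖y - x‖ ^ (-s)) ∂μ ∂μ := by
      simp only [hJ]
      rw [lintegral_lintegral_swap hk.aemeasurable]
      simp_rw [norm_sub_rev]
    rw [this]
    calc _ ≤ ∫⁻ x in {x | ENNReal.ofReal b < h x}, C * ENNReal.ofReal (a ^ (-(p * κ))) ∂μ := by
          refine lintegral_mono fun x => ?_
          refine (hset _ x (measurableSet_lt measurable_const hf)
            ((hvc a ha).trans_lt ENNReal.ofReal_lt_top).ne).trans ?_
          rw [← hpow a p ha]
          gcongr
          exact hvc a ha
      _ = C * (w b * ENNReal.ofReal (a ^ (-(p * κ)))) := by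
          rw [lintegral_const, Measure.restrict_apply_univ]; ring
  -- The two regions meet along `a^p = b^r`, where the Chebyshev bounds for `v` and `w` agree.
  -- Together they cover the quadrant; in each the inner variable runs over an interval starting at
  -- `0`, where its power is integrable since `r κ < 1` and `p κ < 1`.
  set S₁ : Set (ℝ × ℝ) := {q | q.2 ≤ q.1 ^ (p / r)} with hS₁
  set S₂ : Set (ℝ × ℝ) := {q | q.1 ≤ q.2 ^ (r / p)} with hS₂
  have hS₁m : MeasurableSet S₁ := measurableSet_le measurable_snd (measurable_fst.pow_const _)
  have hS₂m : MeasurableSet S₂ := measurableSet_le measurable_fst (measurable_snd.pow_const _)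
  set g₁ : ℝ × ℝ → ℝ≥0∞ := S₁.indicator fun q => v q.1 * ENNReal.ofReal (q.2 ^ (-(r * κ)))
    with hg₁
  set g₂ : ℝ × ℝ → ℝ≥0∞ := S₂.indicator fun q => w q.2 * ENNReal.ofReal (q.1 ^ (-(p * κ)))
    with hg₂
  have hg₁m : Measurable g₁ := Measurable.indicator ((hvm.comp measurable_fst).mul
    (measurable_snd.pow_const _).ennreal_ofReal) hS₁m
  have hg₂m : Measurable g₂ := Measurable.indicator ((hwm.comp measurable_snd).mul
    (measurable_fst.pow_const _).ennreal_ofReal) hS₂m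
  have hJle : ∀ a ∈ Ioi (0 : ℝ), ∀ b ∈ Ioi (0 : ℝ), J a b ≤ C * (g₁ (a, b) + g₂ (a, b)) := by
    intro a (ha : 0 < a) b (hb : 0 < b)
    by_cases hab : b ≤ a ^ (p / r)
    · refine (hJ1 a b ha hb).trans ?_
      gcongr
      rw [hg₁, indicator_of_mem (show (a, b) ∈ S₁ from hab)]
      exact le_self_add
    · refine (hJ2 a b ha hb).trans ?_
      gcongr
      have : (a, b) ∈ S₂ := by
        change a ≤ b ^ (r / p)
        have h1 : a = (a ^ (p / r)) ^ (r / p) := by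
          rw [← Real.rpow_mul ha.le, div_mul_div_comm, mul_comm, div_self (by positivity),
            Real.rpow_one]
        rw [h1]
        exact Real.rpow_le_rpow (by positivity) (not_le.1 hab).le (by positivity)
      rw [hg₂, indicator_of_mem this]
      exact le_add_self
  have hI1 : ∀ a ∈ Ioi (0 : ℝ), ∫⁻ b in Ioi (0 : ℝ), g₁ (a, b)
      = ENNReal.ofReal (1 / (1 - r * κ)) * (v a * ENNReal.ofReal (a ^ (p - 1))) := by
    intro a (ha : 0 < a)
    have e : ∀ b ∈ Ioi (0 : ℝ), g₁ (a, b) = (Ioc 0 (a ^ (p / r))).indicator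
        (fun b => v a * ENNReal.ofReal (b ^ (-(r * κ)))) b := by
      intro b (hb : 0 < b)
      simp [hg₁, hS₁, indicator, hb]
    rw [setLIntegral_congr_fun measurableSet_Ioi e, lintegral_indicator measurableSet_Ioc,
      Measure.restrict_restrict measurableSet_Ioc,
      inter_eq_left.2 Ioc_subset_Ioi_self,
      lintegral_const_mul _ (by fun_prop),
      setLIntegral_Ioc_rpow (by linarith) (by positivity), ← Real.rpow_mul ha.le]
    -- This is the scaling relation `1/p + 1/r = 1 + κ`; it makes the outer integral exactly the
    -- layer-cake form of the `p`-th moment.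
    have e2 : p / r * (-(r * κ) + 1) = p - 1 := by
      field_simp; linarith
    rw [e2, mul_left_comm, ← ENNReal.ofReal_mul (one_div_nonneg.2 (by linarith))]
    congr 3; ring
  have hI2 : ∀ b ∈ Ioi (0 : ℝ), ∫⁻ a in Ioi (0 : ℝ), g₂ (a, b)
      = ENNReal.ofReal (1 / (1 - p * κ)) * (w b * ENNReal.ofReal (b ^ (r - 1))) := by
    intro b (hb : 0 < b)
    have e : ∀ a ∈ Ioi (0 : ℝ), g₂ (a, b) = (Ioc 0 (b ^ (r / p))).indicator
        (fun a => w b * ENNReal.ofReal (a ^ (-(p * κ)))) a := by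
      intro a (ha : 0 < a)
      simp [hg₂, hS₂, indicator, ha]
    rw [setLIntegral_congr_fun measurableSet_Ioi e, lintegral_indicator measurableSet_Ioc,
      Measure.restrict_restrict measurableSet_Ioc,
      inter_eq_left.2 Ioc_subset_Ioi_self,
      lintegral_const_mul _ (by fun_prop),
      setLIntegral_Ioc_rpow (by linarith) (by positivity), ← Real.rpow_mul hb.le]
    have e2 : r / p * (-(p * κ) + 1) = r - 1 := by
      field_simp; linarith
    rw [e2, mul_left_comm, ← ENNReal.ofReal_mul (one_div_nonneg.2 (by linarith))]
    congr 3; ring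
  calc ∫⁻ a in Ioi (0 : ℝ), ∫⁻ b in Ioi (0 : ℝ), J a b
      ≤ ∫⁻ a in Ioi (0 : ℝ), ∫⁻ b in Ioi (0 : ℝ), C * (g₁ (a, b) + g₂ (a, b)) :=
        setLIntegral_mono' measurableSet_Ioi fun a ha =>
          setLIntegral_mono' measurableSet_Ioi fun b hb => hJle a ha b hb
    _ = C * ((∫⁻ a in Ioi (0 : ℝ), ∫⁻ b in Ioi (0 : ℝ), g₁ (a, b))
          + ∫⁻ a in Ioi (0 : ℝ), ∫⁻ b in Ioi (0 : ℝ), g₂ (a, b)) := by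
        have e1 : ∀ a, ∫⁻ b in Ioi (0 : ℝ), C * (g₁ (a, b) + g₂ (a, b))
            = C * ((∫⁻ b in Ioi (0 : ℝ), g₁ (a, b)) + ∫⁻ b in Ioi (0 : ℝ), g₂ (a, b)) := by
          intro a
          rw [lintegral_const_mul _ (by fun_prop), lintegral_add_left (by fun_prop)]
        have h1 : Measurable fun a => ∫⁻ b in Ioi (0 : ℝ), g₁ (a, b) := hg₁m.lintegral_prod_right'
        have h2 : Measurable fun a => ∫⁻ b in Ioi (0 : ℝ), g₂ (a, b) := hg₂m.lintegral_prod_right'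
        simp_rw [e1]
        rw [lintegral_const_mul _ (by fun_prop), lintegral_add_left h1]
    _ ≤ _ := by
        rw [lintegral_lintegral_swap (f := fun a b => g₂ (a, b)) hg₂m.aemeasurable,
          setLIntegral_congr_fun measurableSet_Ioi hI1, setLIntegral_congr_fun measurableSet_Ioi hI2,
          lintegral_const_mul _ (by fun_prop),
          lintegral_const_mul _ (by fun_prop)]
        gcongr
        · exact lintegral_measure_lt_mul_rpow_le μ hf hp0 hfp
        · exact lintegral_measure_lt_mul_rpow_le μ hh hr0 hhr

/-- **Hardy–Littlewood–Sobolev inequality** in bilinear form. -/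
theorem exists_lintegral_riesz_le {s p r : ℝ} (hs0 : 0 < s)
    (hs : s < Module.finrank ℝ V) (hp : 1 < p) (hr : 1 < r)
    (hpr : 1 / p + 1 / r = 2 - s / Module.finrank ℝ V) :
    ∃ C : ℝ≥0∞, C ≠ ∞ ∧ ∀ f h : V → ℝ≥0∞, Measurable f → Measurable h →
      ∫⁻ x, ∫⁻ y, f x * ENNReal.ofReal (‖x - y‖ ^ (-s)) * h y ∂μ ∂μ
        ≤ C * (∫⁻ x, f x ^ p ∂μ) ^ (1 / p) * (∫⁻ x, h x ^ r ∂μ) ^ (1 / r) := by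
  obtain ⟨C, hC, hn⟩ := exists_lintegral_riesz_le_of_normalized μ hs0 hs hp hr hpr
  have hp0 : 0 < p := by linarith
  have hr0 : 0 < r := by linarith
  -- A nonzero constant is needed for the right side to be `∞` when one norm is infinite and the
  -- other is not zero.
  refine ⟨C + 1, by simp [hC], fun f h hf hh => ?_⟩
  set A := (∫⁻ x, f x ^ p ∂μ) ^ (1 / p) with hA
  set B := (∫⁻ x, h x ^ r ∂μ) ^ (1 / r) with hB
  rcases eq_or_ne A 0 with hA0 | hA0
  · have h1 : ∫⁻ x, f x ^ p ∂μ = 0 := by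
      simpa [hA, ENNReal.rpow_eq_zero_iff, hp0, hp0.not_gt] using hA0
    rw [lintegral_eq_zero_iff (hf.pow_const p)] at h1
    have : ∫⁻ x, ∫⁻ y, f x * ENNReal.ofReal (‖x - y‖ ^ (-s)) * h y ∂μ ∂μ = 0 := by
      rw [← lintegral_zero (μ := μ)]
      refine lintegral_congr_ae ?_
      filter_upwards [h1] with x hx
      have : f x = 0 := by simpa [hp0, hp0.not_gt] using hx
      simp [this]
    rw [this]; exact zero_le
  rcases eq_or_ne B 0 with hB0 | hB0
  · have h1 : ∫⁻ x, h x ^ r ∂μ = 0 := by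
      simpa [hB, ENNReal.rpow_eq_zero_iff, hr0, hr0.not_gt] using hB0
    rw [lintegral_eq_zero_iff (hh.pow_const r)] at h1
    have : ∫⁻ x, ∫⁻ y, f x * ENNReal.ofReal (‖x - y‖ ^ (-s)) * h y ∂μ ∂μ = 0 := by
      rw [← lintegral_zero (μ := μ)]
      refine lintegral_congr fun x => ?_
      rw [← lintegral_zero (μ := μ)]
      refine lintegral_congr_ae ?_
      filter_upwards [h1] with y hy
      have : h y = 0 := by simpa [hr0, hr0.not_gt] using hy
      simp [this]
    rw [this]; exact zero_le
  rcases eq_or_ne A ∞ with hAt | hAt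
  · rw [hAt, ENNReal.mul_top (by simp), ENNReal.top_mul hB0]; exact le_top
  rcases eq_or_ne B ∞ with hBt | hBt
  · rw [hBt, ENNReal.mul_top (mul_ne_zero (by simp) hA0)]; exact le_top
  have key := hn (fun x => A⁻¹ * f x) (fun x => B⁻¹ * h x) (hf.const_mul _) (hh.const_mul _)
    (by
      simp_rw [ENNReal.mul_rpow_of_nonneg _ _ hp0.le]
      rw [lintegral_const_mul _ (hf.pow_const p)]
      have : ∫⁻ x, f x ^ p ∂μ = A ^ p := by
        rw [hA, ← ENNReal.rpow_mul, one_div_mul_cancel hp0.ne', ENNReal.rpow_one]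
      rw [this, ← ENNReal.mul_rpow_of_nonneg _ _ hp0.le, ENNReal.inv_mul_cancel hA0 hAt,
        ENNReal.one_rpow])
    (by
      simp_rw [ENNReal.mul_rpow_of_nonneg _ _ hr0.le]
      rw [lintegral_const_mul _ (hh.pow_const r)]
      have : ∫⁻ x, h x ^ r ∂μ = B ^ r := by
        rw [hB, ← ENNReal.rpow_mul, one_div_mul_cancel hr0.ne', ENNReal.rpow_one]
      rw [this, ← ENNReal.mul_rpow_of_nonneg _ _ hr0.le, ENNReal.inv_mul_cancel hB0 hBt,
        ENNReal.one_rpow])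
  have e : ∀ x y, f x * ENNReal.ofReal (‖x - y‖ ^ (-s)) * h y
      = (A * B) * (A⁻¹ * f x * ENNReal.ofReal (‖x - y‖ ^ (-s)) * (B⁻¹ * h y)) := by
    intro x y
    calc f x * ENNReal.ofReal (‖x - y‖ ^ (-s)) * h y
        = (A * A⁻¹) * (B * B⁻¹) * (f x * ENNReal.ofReal (‖x - y‖ ^ (-s)) * h y) := by
          rw [ENNReal.mul_inv_cancel hA0 hAt, ENNReal.mul_inv_cancel hB0 hBt]; simp
      _ = _ := by ring
  simp_rw [e, lintegral_const_mul' _ _ (ENNReal.mul_ne_top hAt hBt)]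
  calc A * B * _ ≤ A * B * C := by gcongr
    _ ≤ (C + 1) * A * B := by
      rw [mul_assoc (C + 1), mul_comm]
      gcongr
      exact le_self_add

end HardyLittlewoodSobolev

/-! ### Interpolation between `L¹ × L¹` and `L² × L²` -/

section RieszThorin

variable {α : Type*} [MeasurableSpace α]

/-- Bounded measurable functions that vanish outside a set of finite measure. -/
structure IsBddFin (μ : Measure α) (g : α → ℂ) : Prop where
  measurable : Measurable g
  bounded : ∃ M : ℝ, ∀ x, ‖g x‖ ≤ M
  support_lt_top : μ (Function.support g) < ∞

variable {μ : Measure α}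

theorem IsBddFin.of_norm_le {g h : α → ℂ} (hg : IsBddFin μ g) (hh : Measurable h) {C : ℝ}
    (hle : ∀ x, ‖h x‖ ≤ C * ‖g x‖) : IsBddFin μ h := by
  obtain ⟨M, hM⟩ := hg.bounded
  refine ⟨hh, ⟨|C| * M, fun x => (hle x).trans ?_⟩, lt_of_le_of_lt (measure_mono ?_)
    hg.support_lt_top⟩
  · gcongr
    · exact le_abs_self C
    · exact hM x
  · intro x hx
    rw [Function.mem_support] at hx ⊢
    contrapose! hx
    have := hle x
    rw [hx, norm_zero, mul_zero] at this
    simpa using this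

theorem IsBddFin.integrable_of_le {β : Type*} [NormedAddCommGroup β] {g : α → ℂ}
    (hg : IsBddFin μ g) {f : α → β} (hf : AEStronglyMeasurable f μ) {M : ℝ}
    (hM : ∀ x, ‖f x‖ ≤ M) (h0 : ∀ x, g x = 0 → f x = 0) : Integrable f μ := by
  have hs : MeasurableSet (Function.support g) := measurableSet_support hg.measurable
  have : IntegrableOn f (Function.support g) μ :=
    Measure.integrableOn_of_bounded (M := M) hg.support_lt_top.ne hf (ae_of_all _ hM)
  rw [← integrable_indicator_iff hs] at this
  have e : (Function.support g).indicator f = f := by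
    ext x
    by_cases hx : x ∈ Function.support g
    · rw [indicator_of_mem hx]
    · rw [indicator_of_notMem hx]; exact (h0 x (by simpa using hx)).symm
  rwa [e] at this

theorem IsBddFin.integrable_norm_rpow {g : α → ℂ} (hg : IsBddFin μ g) {q : ℝ} (hq : 0 < q) :
    Integrable (fun x => ‖g x‖ ^ q) μ := by
  obtain ⟨M, hM⟩ := hg.bounded
  refine hg.integrable_of_le (M := M ^ q) (hg.measurable.norm.pow_const q).aestronglyMeasurable
    (fun x => ?_) (fun x hx => by simp [hx, hq.ne'])
  rw [Real.norm_of_nonneg (by positivity)]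
  exact Real.rpow_le_rpow (norm_nonneg _) (hM x) hq.le

theorem IsBddFin.integrable {g : α → ℂ} (hg : IsBddFin μ g) : Integrable g μ := by
  obtain ⟨M, hM⟩ := hg.bounded
  exact hg.integrable_of_le hg.measurable.aestronglyMeasurable hM fun x hx => hx

theorem IsBddFin.integrable_kernel [SFinite μ] {g h : α → ℂ} (hg : IsBddFin μ g)
    (hh : IsBddFin μ h) {k : α × α → ℂ} (hk : Measurable k) {A : ℝ} (hA : ∀ z, ‖k z‖ ≤ A) :
    Integrable (fun z : α × α => g z.1 * h z.2 * k z) (μ.prod μ) := by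
  refine (hg.integrable.mul_prod hh.integrable).mul_bdd (c := A) hk.aestronglyMeasurable
    (ae_of_all _ hA)

/-- The analytic family `c ↦ (c / |c|) |c| ^ s`. -/
def powerFamily (s : ℂ) (c : ℂ) : ℂ :=
  c / ‖c‖ * Complex.exp (s * Real.log ‖c‖)

theorem powerFamily_zero_right (s : ℂ) : powerFamily s 0 = 0 := by simp [powerFamily]

theorem norm_powerFamily {s c : ℂ} (hs : 0 < s.re) : ‖powerFamily s c‖ = ‖c‖ ^ s.re := by
  rcases eq_or_ne c 0 with rfl | hc
  · simp [powerFamily, hs.ne']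
  · have : 0 < ‖c‖ := norm_pos_iff.2 hc
    rw [powerFamily, norm_mul, norm_div, Complex.norm_real, norm_norm, div_self this.ne', one_mul,
      Complex.norm_exp, Complex.re_mul_ofReal, Real.rpow_def_of_pos this, mul_comm]

theorem powerFamily_one (c : ℂ) : powerFamily 1 c = c := by
  rcases eq_or_ne c 0 with rfl | hc
  · simp [powerFamily]
  · have : 0 < ‖c‖ := norm_pos_iff.2 hc
    rw [powerFamily, one_mul, ← Complex.ofReal_exp, Real.exp_log this, div_mul_cancel₀]
    exact_mod_cast this.ne'

theorem differentiable_powerFamily (c : ℂ) : Differentiable ℂ fun s => powerFamily s c := by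
  unfold powerFamily
  fun_prop

/-- For simple functions the form is a finite sum over pairs of values with coefficients independent
of `φ` and `ψ`. Substituting the analytic power family therefore yields an entire function of the
parameter, without differentiation under an integral. -/
theorem integral_kernel_simpleFunc [SFinite μ] (g h : SimpleFunc α ℂ) (hg : IsBddFin μ g)
    (hh : IsBddFin μ h) {k : α × α → ℂ} (hk : Measurable k) {A : ℝ} (hA : ∀ z, ‖k z‖ ≤ A)
    (φ ψ : ℂ → ℂ) (hφ : φ 0 = 0) (hψ : ψ 0 = 0) :
    ∫ z, φ (g z.1) * ψ (h z.2) * k z ∂(μ.prod μ) =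
      ∑ c ∈ g.range, ∑ d ∈ h.range, φ c * ψ d *
        ∫ z, (if g z.1 = c then 1 else 0) * (if h z.2 = d then 1 else 0) * k z ∂(μ.prod μ) := by
  have h1 : ∀ z : α × α, φ (g z.1) * ψ (h z.2) * k z = ∑ c ∈ g.range, ∑ d ∈ h.range,
      φ c * ψ d * ((if g z.1 = c then 1 else 0) * (if h z.2 = d then 1 else 0) * k z) := by
    intro z
    have e1 : φ (g z.1) = ∑ c ∈ g.range, φ c * (if g z.1 = c then 1 else 0) := by
      simp
    have e2 : ψ (h z.2) = ∑ c ∈ h.range, ψ c * (if h z.2 = c then 1 else 0) := by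
      simp
    rw [e1, e2, Finset.sum_mul_sum, Finset.sum_mul]
    refine Finset.sum_congr rfl fun c _ => ?_
    rw [Finset.sum_mul]
    refine Finset.sum_congr rfl fun d _ => ?_
    ring
  simp_rw [h1]
  have hmeas : ∀ (f : SimpleFunc α ℂ) (c : ℂ), Measurable fun x => if f x = c then (1 : ℂ) else 0 :=
    fun f c => Measurable.ite (f.measurableSet_fiber c) measurable_const measurable_const
  have hbdd : ∀ (f : SimpleFunc α ℂ) (c : ℂ), IsBddFin μ f → c ≠ 0 →
      IsBddFin μ fun x => if f x = c then (1 : ℂ) else 0 := by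
    intro f c hf hc
    refine ⟨hmeas f c, ⟨1, fun x => by split_ifs <;> simp⟩,
      lt_of_le_of_lt (measure_mono ?_) hf.support_lt_top⟩
    intro x hx
    rw [Function.mem_support] at hx ⊢
    intro h0
    simp [h0, hc.symm] at hx
  have hint : ∀ c d, Integrable (fun z : α × α => φ c * ψ d *
      ((if g z.1 = c then 1 else 0) * (if h z.2 = d then 1 else 0) * k z)) (μ.prod μ) := by
    intro c d
    rcases eq_or_ne c 0 with rfl | hc
    · simp [hφ]
    rcases eq_or_ne d 0 with rfl | hd
    · simp [hψ]
    exact ((hbdd g c hg hc).integrable_kernel (hbdd h d hh hd) hk hA).const_mul _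
  rw [integral_finsetSum _ fun c _ => integrable_finsetSum _ fun d _ => hint c d]
  refine Finset.sum_congr rfl fun c _ => ?_
  rw [integral_finsetSum _ fun d _ => hint c d]
  refine Finset.sum_congr rfl fun d _ => ?_
  rw [integral_const_mul]

theorem norm_integral_kernel_le_of_bounded [SFinite μ] {g h : α → ℂ} (hg : IsBddFin μ g)
    (hh : IsBddFin μ h) {k : α × α → ℂ} {A : ℝ} (hA : ∀ z, ‖k z‖ ≤ A) :
    ‖∫ z, g z.1 * h z.2 * k z ∂(μ.prod μ)‖ ≤ A * ((∫ x, ‖g x‖ ∂μ) * ∫ x, ‖h x‖ ∂μ) := by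
  rw [← integral_prod_mul, ← integral_const_mul]
  refine norm_integral_le_of_norm_le
    ((hg.integrable.norm.mul_prod hh.integrable.norm).const_mul A) (ae_of_all _ fun z => ?_)
  rw [norm_mul, norm_mul, mul_comm]
  gcongr
  exact hA z

/-- **Riesz–Thorin interpolation** between `L¹ × L¹` and `L² × L²` for a bilinear form given by a
bounded kernel, on simple functions. -/
theorem norm_integral_kernel_simpleFunc_le [SFinite μ] {k : α × α → ℂ} (hk : Measurable k) {A : ℝ}
    (hA0 : 0 ≤ A) (hA : ∀ z, ‖k z‖ ≤ A)
    (hL2 : ∀ g h : α → ℂ, IsBddFin μ g → IsBddFin μ h →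
      ‖∫ z, g z.1 * h z.2 * k z ∂(μ.prod μ)‖
        ≤ (∫ x, ‖g x‖ ^ (2 : ℝ) ∂μ) ^ (1 / 2 : ℝ) * (∫ x, ‖h x‖ ^ (2 : ℝ) ∂μ) ^ (1 / 2 : ℝ))
    {θ : ℝ} (hθ0 : 0 ≤ θ) (hθ1 : θ ≤ 1) (g h : SimpleFunc α ℂ) (hg : IsBddFin μ g)
    (hh : IsBddFin μ h) :
    ‖∫ z, g z.1 * h z.2 * k z ∂(μ.prod μ)‖
      ≤ A ^ θ * (∫ x, ‖g x‖ ^ (2 / (1 + θ)) ∂μ) ^ ((1 + θ) / 2)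
        * (∫ x, ‖h x‖ ^ (2 / (1 + θ)) ∂μ) ^ ((1 + θ) / 2) := by
  set q : ℝ := 2 / (1 + θ) with hq
  have hq0 : 0 < q := by positivity
  set P := ∫ x, ‖g x‖ ^ q ∂μ with hP
  set R := ∫ x, ‖h x‖ ^ q ∂μ with hR
  have hP0 : 0 ≤ P := integral_nonneg fun x => by positivity
  have hR0 : 0 ≤ R := integral_nonneg fun x => by positivity
  -- The affine exponent has real part `q/2` on `Re w = 0`, real part `q` on `Re w = 1`, and equals
  -- `1` at `w = θ`. So the boundary lines see `|g|^{q/2}` in `L²` and `|g|^q` in `L¹`, both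
  -- governed by `∫ |g|^q`, and `F θ` is the original form.
  set a : ℂ → ℂ := fun w => (q / 2 : ℝ) * (1 + w) with ha
  have hare : ∀ w, (a w).re = q / 2 * (1 + w.re) := fun w => by
    rw [ha]; simp only [Complex.re_ofReal_mul, Complex.add_re, Complex.one_re]
  set F : ℂ → ℂ := fun w =>
    ∫ z, powerFamily (a w) (g z.1) * powerFamily (a w) (h z.2) * k z ∂(μ.prod μ) with hF
  have hFsum : F = fun w => ∑ c ∈ g.range, ∑ d ∈ h.range,
      powerFamily (a w) c * powerFamily (a w) d *
        ∫ z, (if g z.1 = c then 1 else 0) * (if h z.2 = d then 1 else 0) * k z ∂(μ.prod μ) := by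
    ext w
    exact integral_kernel_simpleFunc g h hg hh hk hA _ _ (powerFamily_zero_right _)
      (powerFamily_zero_right _)
  have had : Differentiable ℂ a := by fun_prop
  have hFd : Differentiable ℂ F := by
    rw [hFsum]
    refine Differentiable.fun_sum fun c _ => Differentiable.fun_sum fun d _ => ?_
    exact (((differentiable_powerFamily c).comp had).mul
      ((differentiable_powerFamily d).comp had)).mul_const _
  have hpos : ∀ w : ℂ, 0 ≤ w.re → 0 < (a w).re := fun w hw => by rw [hare]; positivity
  have hmeasF : ∀ (s : ℂ) (f : SimpleFunc α ℂ), Measurable fun x => powerFamily s (f x) :=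
    fun s f => (f.map (powerFamily s)).measurable
  have hfin : ∀ (w : ℂ) (f : SimpleFunc α ℂ), IsBddFin μ f → 0 ≤ w.re →
      IsBddFin μ fun x => powerFamily (a w) (f x) := by
    intro w f hf hw
    obtain ⟨M, hM⟩ := hf.bounded
    refine ⟨hmeasF _ f, ⟨M ^ (a w).re, fun x => ?_⟩, lt_of_le_of_lt (measure_mono ?_)
      hf.support_lt_top⟩
    · rw [norm_powerFamily (hpos w hw)]
      exact Real.rpow_le_rpow (norm_nonneg _) (hM x) (hpos w hw).le
    · intro x hx
      rw [Function.mem_support] at hx ⊢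
      intro h0
      rw [h0, powerFamily_zero_right] at hx
      exact hx rfl
  have hθmem : (θ : ℂ) ∈ Complex.HadamardThreeLines.verticalClosedStrip 0 1 := by
    simp [Complex.HadamardThreeLines.verticalClosedStrip, hθ0, hθ1]
  -- The three lines theorem needs boundedness on the strip; on it the real part of the exponent is
  -- at most `q`, so each power is bounded by `(1 + |c|)^q`.
  have hB : BddAbove ((norm ∘ F) '' Complex.HadamardThreeLines.verticalClosedStrip 0 1) := by
    refine ⟨∑ c ∈ g.range, ∑ d ∈ h.range,
      (1 + ‖c‖) ^ q * (1 + ‖d‖) ^ q *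
        ‖∫ z, (if g z.1 = c then 1 else 0) * (if h z.2 = d then 1 else 0) * k z ∂(μ.prod μ)‖, ?_⟩
    rintro _ ⟨w, hw, rfl⟩
    have hw' : 0 ≤ w.re ∧ w.re ≤ 1 := by
      simpa [Complex.HadamardThreeLines.verticalClosedStrip] using hw
    have hpf : ∀ c, ‖powerFamily (a w) c‖ ≤ (1 + ‖c‖) ^ q := by
      intro c
      rw [norm_powerFamily (hpos w hw'.1)]
      calc ‖c‖ ^ (a w).re ≤ (1 + ‖c‖) ^ (a w).re :=
            Real.rpow_le_rpow (norm_nonneg _) (by linarith) (hpos w hw'.1).le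
        _ ≤ (1 + ‖c‖) ^ q := by
            refine Real.rpow_le_rpow_of_exponent_le (by linarith [norm_nonneg c]) ?_
            rw [hare]; nlinarith [hw'.2]
    simp only [Function.comp, hFsum]
    refine (norm_sum_le _ _).trans (Finset.sum_le_sum fun c _ => ?_)
    refine (norm_sum_le _ _).trans (Finset.sum_le_sum fun d _ => ?_)
    rw [norm_mul, norm_mul]
    gcongr
    · exact hpf c
    · exact hpf d
  have key := Complex.HadamardThreeLines.norm_le_interp_of_mem_verticalClosedStrip₀₁' F
    (a := P ^ (1 / 2 : ℝ) * R ^ (1 / 2 : ℝ)) (b := A * (P * R)) hθmem hFd.diffContOnCl hB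
    (by
      intro w hw
      have hw0 : w.re = 0 := by simpa using hw
      refine (hL2 _ _ (hfin w g hg hw0.ge) (hfin w h hh hw0.ge)).trans (le_of_eq ?_)
      have e : ∀ c : ℂ, ‖powerFamily (a w) c‖ ^ (2 : ℝ) = ‖c‖ ^ q := by
        intro c
        rw [norm_powerFamily (hpos w hw0.ge), ← Real.rpow_mul (norm_nonneg _), hare, hw0]
        congr 1; ring
      simp_rw [e]
      rfl)
    (by
      intro w hw
      have hw1 : w.re = 1 := by simpa using hw
      have hw0 : 0 ≤ w.re := by rw [hw1]; exact zero_le_one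
      refine (norm_integral_kernel_le_of_bounded (hfin w g hg hw0) (hfin w h hh hw0) hA).trans
        (le_of_eq ?_)
      have e : ∀ c : ℂ, ‖powerFamily (a w) c‖ = ‖c‖ ^ q := by
        intro c
        rw [norm_powerFamily (hpos w hw0), hare, hw1]
        congr 1; ring
      simp_rw [e]
      rfl)
  have haθ : a θ = 1 := by
    rw [ha]
    have : q / 2 * (1 + θ) = 1 := by rw [hq]; field_simp
    change ((q / 2 : ℝ) : ℂ) * (1 + (θ : ℂ)) = 1
    exact_mod_cast this
  have hFθ : F θ = ∫ z, g z.1 * h z.2 * k z ∂(μ.prod μ) := by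
    simp only [hF, haθ, powerFamily_one]
  rw [hFθ, Complex.ofReal_re] at key
  refine key.trans (le_of_eq ?_)
  rw [Real.mul_rpow (by positivity) (by positivity), Real.mul_rpow hA0 (by positivity),
    Real.mul_rpow hP0 hR0, ← Real.rpow_mul hP0, ← Real.rpow_mul hR0]
  have e : ∀ X : ℝ, 0 ≤ X → X ^ ((1 + θ) / 2) = X ^ (1 / 2 * (1 - θ)) * X ^ θ := by
    intro X hX
    rw [← Real.rpow_add_of_nonneg hX (by linarith) hθ0]
    congr 1; ring
  rw [e P hP0, e R hR0]
  ring

/-- **Riesz–Thorin interpolation** between `L¹ × L¹` and `L² × L²` for a bilinear form given by a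
bounded kernel. -/
theorem norm_integral_kernel_le [SFinite μ] {k : α × α → ℂ} (hk : Measurable k) {A : ℝ}
    (hA0 : 0 ≤ A) (hA : ∀ z, ‖k z‖ ≤ A)
    (hL2 : ∀ g h : α → ℂ, IsBddFin μ g → IsBddFin μ h →
      ‖∫ z, g z.1 * h z.2 * k z ∂(μ.prod μ)‖
        ≤ (∫ x, ‖g x‖ ^ (2 : ℝ) ∂μ) ^ (1 / 2 : ℝ) * (∫ x, ‖h x‖ ^ (2 : ℝ) ∂μ) ^ (1 / 2 : ℝ))
    {θ : ℝ} (hθ0 : 0 ≤ θ) (hθ1 : θ ≤ 1) {g h : α → ℂ} (hg : IsBddFin μ g)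
    (hh : IsBddFin μ h) :
    ‖∫ z, g z.1 * h z.2 * k z ∂(μ.prod μ)‖
      ≤ 4 * A ^ θ * (∫ x, ‖g x‖ ^ (2 / (1 + θ)) ∂μ) ^ ((1 + θ) / 2)
        * (∫ x, ‖h x‖ ^ (2 / (1 + θ)) ∂μ) ^ ((1 + θ) / 2) := by
  have hq0 : 0 < 2 / (1 + θ) := by positivity
  -- The approximating simple functions are dominated by `2 |f|` and not by `|f|`; this is the
  -- source of the factor `4 = 2 · 2`.
  have approx : ∀ f : α → ℂ, IsBddFin μ f → ∃ F : ℕ → SimpleFunc α ℂ,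
      (∀ n, IsBddFin μ (F n)) ∧ (∀ n x, ‖F n x‖ ≤ 2 * ‖f x‖) ∧
      (∀ x, Tendsto (fun n => F n x) atTop (𝓝 (f x))) := by
    intro f hf
    refine ⟨fun n => SimpleFunc.approxOn f hf.measurable univ 0 (mem_univ 0) n, ?_, ?_, ?_⟩
    · intro n
      refine hf.of_norm_le (C := 2) (SimpleFunc.measurable _) fun x => ?_
      rw [two_mul]
      exact SimpleFunc.norm_approxOn_zero_le hf.measurable (mem_univ 0) x n
    · intro n x
      rw [two_mul]
      exact SimpleFunc.norm_approxOn_zero_le hf.measurable (mem_univ 0) x n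
    · intro x
      exact SimpleFunc.tendsto_approxOn hf.measurable (mem_univ 0) (by simp)
  obtain ⟨G, hG1, hG2, hG3⟩ := approx g hg
  obtain ⟨H, hH1, hH2, hH3⟩ := approx h hh
  have hlim : Tendsto (fun n => ∫ z, G n z.1 * H n z.2 * k z ∂(μ.prod μ)) atTop
      (𝓝 (∫ z, g z.1 * h z.2 * k z ∂(μ.prod μ))) := by
    refine tendsto_integral_of_dominated_convergence
      (fun z => 2 * 2 * ‖g z.1 * h z.2 * k z‖) (fun n => ?_) ?_ (fun n => ?_) ?_
    · exact ((hG1 n).integrable_kernel (hH1 n) hk hA).aestronglyMeasurable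
    · exact (hg.integrable_kernel hh hk hA).norm.const_mul _
    · refine ae_of_all _ fun z => ?_
      rw [norm_mul, norm_mul, norm_mul, norm_mul]
      calc ‖G n z.1‖ * ‖H n z.2‖ * ‖k z‖ ≤ (2 * ‖g z.1‖) * (2 * ‖h z.2‖) * ‖k z‖ := by
            gcongr
            · exact hG2 n _
            · exact hH2 n _
        _ = _ := by ring
    · exact ae_of_all _ fun z => ((hG3 z.1).mul (hH3 z.2)).mul_const _
  refine le_of_tendsto hlim.norm (Eventually.of_forall fun n => ?_)
  refine (norm_integral_kernel_simpleFunc_le hk hA0 hA hL2 hθ0 hθ1 (G n) (H n) (hG1 n)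
    (hH1 n)).trans ?_
  have bound : ∀ (f : α → ℂ) (F : SimpleFunc α ℂ), IsBddFin μ f → IsBddFin μ F →
      (∀ x, ‖F x‖ ≤ 2 * ‖f x‖) →
      (∫ x, ‖F x‖ ^ (2 / (1 + θ)) ∂μ) ^ ((1 + θ) / 2)
        ≤ 2 * (∫ x, ‖f x‖ ^ (2 / (1 + θ)) ∂μ) ^ ((1 + θ) / 2) := by
    intro f F hf hF hle
    calc (∫ x, ‖F x‖ ^ (2 / (1 + θ)) ∂μ) ^ ((1 + θ) / 2)
        ≤ (2 ^ (2 / (1 + θ)) * ∫ x, ‖f x‖ ^ (2 / (1 + θ)) ∂μ) ^ ((1 + θ) / 2) := by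
          refine Real.rpow_le_rpow (integral_nonneg fun x => by positivity) ?_ (by positivity)
          rw [← integral_const_mul]
          refine integral_mono (hF.integrable_norm_rpow hq0)
            ((hf.integrable_norm_rpow hq0).const_mul _) fun x => ?_
          rw [← Real.mul_rpow zero_le_two (norm_nonneg _)]
          exact Real.rpow_le_rpow (norm_nonneg _) (hle x) hq0.le
      _ = _ := by
          rw [Real.mul_rpow (by positivity) (integral_nonneg fun x => by positivity),
            ← Real.rpow_mul zero_le_two]
          congr 1
          have : 2 / (1 + θ) * ((1 + θ) / 2) = 1 := by field_simp
          rw [this, Real.rpow_one]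
  calc _ ≤ A ^ θ * (2 * (∫ x, ‖g x‖ ^ (2 / (1 + θ)) ∂μ) ^ ((1 + θ) / 2))
        * (2 * (∫ x, ‖h x‖ ^ (2 / (1 + θ)) ∂μ) ^ ((1 + θ) / 2)) := by
        have : 0 ≤ ∫ x, ‖H n x‖ ^ (2 / (1 + θ)) ∂μ := integral_nonneg fun x => by positivity
        have : 0 ≤ ∫ x, ‖g x‖ ^ (2 / (1 + θ)) ∂μ := integral_nonneg fun x => by positivity
        gcongr
        · exact bound g (G n) hg (hG1 n) (hG2 n)
        · exact bound h (H n) hh (hH1 n) (hH2 n)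
    _ = _ := by ring

end RieszThorin

/-! ### Kernel bound for `exp(-z|∇|)` with complex `z` -/

section PoissonKernel

/-- The preimage of `u` is the positive root of `r² = u r + b`. -/
theorem image_Ioi_sub_div {b : ℝ} (hb : 0 < b) :
    (fun y : ℝ => y - b / y) '' Ioi 0 = univ := by
  refine eq_univ_of_forall fun u => ?_
  have h1 : |u| ≤ √(u ^ 2 + 4 * b) := Real.abs_le_sqrt (by linarith)
  have h2 : |u| < √(u ^ 2 + 4 * b) := by
    rw [← Real.sqrt_sq_eq_abs]
    exact Real.sqrt_lt_sqrt (sq_nonneg u) (by linarith)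
  have hpos : 0 < (u + √(u ^ 2 + 4 * b)) / 2 := by
    have := neg_abs_le u
    linarith
  refine ⟨(u + √(u ^ 2 + 4 * b)) / 2, hpos, ?_⟩
  have h3 : √(u ^ 2 + 4 * b) ^ 2 = u ^ 2 + 4 * b := Real.sq_sqrt (by positivity)
  set r := (u + √(u ^ 2 + 4 * b)) / 2 with hr
  have h4 : r ^ 2 = u * r + b := by rw [hr]; nlinarith
  simp only
  rw [sub_eq_iff_eq_add, ← sub_eq_iff_eq_add', eq_div_iff hpos.ne']
  linarith

theorem hasDerivAt_sub_div (b : ℝ) {y : ℝ} (hy : y ≠ 0) :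
    HasDerivAt (fun y : ℝ => y - b / y) (1 + b / y ^ 2) y := by
  have h := (hasDerivAt_id y).sub ((hasDerivAt_inv hy).const_mul b)
  refine (h.congr_deriv ?_).congr_of_eventuallyEq ?_
  · field_simp; ring
  · exact Eventually.of_forall fun x => by simp [div_eq_mul_inv]

theorem injOn_sub_div {b : ℝ} (hb : 0 < b) : InjOn (fun y : ℝ => y - b / y) (Ioi 0) := by
  intro x (hx : 0 < x) y (hy : 0 < y) hxy
  simp only at hxy
  field_simp at hxy
  have : (x - y) * (x * y + b) = 0 := by linarith
  rcases mul_eq_zero.1 this with h | h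
  · linarith
  · nlinarith [mul_pos hx hy]

/-- The Cauchy–Schlömilch substitution for a Gaussian. -/
theorem integral_Ioi_cexp_neg_mul_sub_div_sq {z : ℂ} (hz : 0 < z.re) {b : ℝ} (hb : 0 < b) :
    2 * ∫ y in Ioi (0 : ℝ), Complex.exp (-z * (y - b / y : ℝ) ^ 2) = (Real.pi / z) ^ (1 / 2 : ℂ) := by
  set g : ℝ → ℂ := fun u => Complex.exp (-z * (u : ℂ) ^ 2) with hg
  have hgint : Integrable g := by
    simpa [hg] using integrable_cexp_neg_mul_sq hz
  have hder : ∀ y ∈ Ioi (0 : ℝ), HasDerivWithinAt (fun y : ℝ => y - b / y) (1 + b / y ^ 2) (Ioi 0) y :=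
    fun y hy => (hasDerivAt_sub_div b (ne_of_gt hy)).hasDerivWithinAt
  have h1 := integral_image_eq_integral_abs_deriv_smul measurableSet_Ioi hder (injOn_sub_div hb) g
  have h2 := integrableOn_image_iff_integrableOn_abs_deriv_smul measurableSet_Ioi hder
    (injOn_sub_div hb) g
  rw [image_Ioi_sub_div hb] at h1 h2
  have hI := h2.1 hgint.integrableOn
  have habs : ∀ y : ℝ, |1 + b / y ^ 2| = 1 + b / y ^ 2 := fun y => abs_of_pos (by positivity)
  have hI1 : IntegrableOn (fun y : ℝ => g (y - b / y)) (Ioi 0) := by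
    refine Integrable.mono hI ?_ ?_
    · refine Measurable.aestronglyMeasurable ?_
      fun_prop
    · refine ae_of_all _ fun y => ?_
      rw [norm_smul, Real.norm_eq_abs, abs_abs, habs]
      exact le_mul_of_one_le_left (norm_nonneg _) (by
        have : 0 ≤ b / y ^ 2 := by positivity
        linarith)
  have hI2 : IntegrableOn (fun y : ℝ => (b / y ^ 2) • g (y - b / y)) (Ioi 0) := by
    refine (hI.sub hI1).congr (ae_of_all _ fun y => ?_)
    simp only [Pi.sub_apply, habs, add_smul, one_smul, add_sub_cancel_left]
  -- The inversion `y ↦ b / y` reverses the sign of `y - b / y`, and `g` is even; hence the two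
  -- terms of the Jacobian `1 + b / y²` contribute equally.
  have h3 : ∫ y in Ioi (0 : ℝ), g (y - b / y) = ∫ y in Ioi (0 : ℝ), (b / y ^ 2) • g (y - b / y) := by
    have hder' : ∀ y ∈ Ioi (0 : ℝ), HasDerivWithinAt (fun y : ℝ => b / y) (-(b / y ^ 2)) (Ioi 0) y := by
      intro y hy
      have h := ((hasDerivAt_inv (ne_of_gt hy)).const_mul b).hasDerivWithinAt (s := Ioi 0)
      refine (h.congr_deriv ?_).congr_of_eventuallyEq ?_ ?_
      · ring
      · exact Eventually.of_forall fun x => by simp [div_eq_mul_inv]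
      · simp [div_eq_mul_inv]
    have hinj : InjOn (fun y : ℝ => b / y) (Ioi 0) := by
      intro x (hx : 0 < x) y (hy : 0 < y) hxy
      simp only at hxy
      field_simp at hxy
      exact hxy.symm
    have himg : (fun y : ℝ => b / y) '' Ioi 0 = Ioi 0 := by
      ext u
      constructor
      · rintro ⟨y, hy, rfl⟩
        exact div_pos hb hy
      · intro (hu : 0 < u)
        exact ⟨b / u, div_pos hb hu, by field_simp⟩
    have h := integral_image_eq_integral_abs_deriv_smul measurableSet_Ioi hder' hinj
      (fun y => g (y - b / y))
    rw [himg] at h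
    rw [h]
    refine setIntegral_congr_fun measurableSet_Ioi fun y (hy : 0 < y) => ?_
    rw [abs_neg, abs_of_pos (by positivity)]
    congr 1
    have : b / y - b / (b / y) = -(y - b / y) := by field_simp; ring
    rw [this, hg]
    simp only [Complex.ofReal_neg, neg_sq]
  have h4 : ∫ u, g u = (∫ y in Ioi (0 : ℝ), g (y - b / y)) + ∫ y in Ioi (0 : ℝ), g (y - b / y) := by
    rw [setIntegral_univ] at h1
    have h6 := integral_add hI1 hI2
    rw [← h3] at h6
    rw [h1, ← h6]
    refine integral_congr_ae (ae_of_all _ fun y => ?_)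
    simp only [habs, add_smul, one_smul]
  have h5 : ∫ u, g u = (Real.pi / z) ^ (1 / 2 : ℂ) := integral_gaussian_complex hz
  rw [← h5, h4, two_mul]

/-- Subordination of the exponential to Gaussians: `z (y - a/(2y))² + z a = z y² + z (a/(2y))²`, so
multiplying the previous identity with `b = a/2` by `exp(-z a)` gives the formula. -/
theorem cpow_mul_cexp_neg_mul {z : ℂ} (hz : 0 < z.re) {a : ℝ} (ha : 0 < a) :
    (Real.pi / z) ^ (1 / 2 : ℂ) * Complex.exp (-z * a) =
      2 * ∫ y in Ioi (0 : ℝ), Complex.exp (-z * y ^ 2) * Complex.exp (-(z * (a / (2 * y)) ^ 2)) := by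
  rw [← integral_Ioi_cexp_neg_mul_sub_div_sq hz (half_pos ha), mul_assoc, ← integral_mul_const]
  congr 1
  refine setIntegral_congr_fun measurableSet_Ioi fun y (hy : 0 < y) => ?_
  simp only [← Complex.exp_add]
  congr 1
  have : (y : ℂ) ≠ 0 := by exact_mod_cast hy.ne'
  push_cast
  field_simp
  ring

variable {V : Type*} [NormedAddCommGroup V] [InnerProductSpace ℝ V] [FiniteDimensional ℝ V]
  [MeasurableSpace V] [BorelSpace V]

/-- The kernel of `exp(-z|∇|)`. -/
def poissonKernel (z : ℂ) (x : V) : ℂ :=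
  ∫ ξ : V, Complex.exp (-z * (2 * Real.pi * ‖ξ‖ : ℝ)) *
    Complex.exp (2 * Real.pi * Complex.I * (inner ℝ x ξ : ℝ))

theorem norm_cexp_two_pi_I_mul (t : ℝ) : ‖Complex.exp (2 * Real.pi * Complex.I * (t : ℂ))‖ = 1 := by
  have : 2 * Real.pi * Complex.I * (t : ℂ) = ((2 * Real.pi * t : ℝ) : ℂ) * Complex.I := by
    push_cast; ring
  rw [this, Complex.norm_exp_ofReal_mul_I]

/-- Justifies exchanging the frequency and subordination integrals. For fixed `y` the modulus is a
Gaussian in `ξ`, whose integral leaves a constant times `y^n exp(-Re z · y²)`. -/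
theorem integrable_gaussian_slices {z : ℂ} (hz : 0 < z.re) (x : V) :
    Integrable (fun q : V × ℝ => Complex.exp (-z * q.2 ^ 2) *
      Complex.exp (-(z * ((2 * Real.pi * ‖q.1‖ : ℝ) / (2 * q.2)) ^ 2)) *
      Complex.exp (2 * Real.pi * Complex.I * (inner ℝ x q.1 : ℝ)))
      (volume.prod (volume.restrict (Ioi 0))) := by
  set s := z.re with hs
  have hmeas : AEStronglyMeasurable (fun q : V × ℝ => Complex.exp (-z * q.2 ^ 2) *
      Complex.exp (-(z * ((2 * Real.pi * ‖q.1‖ : ℝ) / (2 * q.2)) ^ 2)) *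
      Complex.exp (2 * Real.pi * Complex.I * (inner ℝ x q.1 : ℝ)))
      (volume.prod (volume.restrict (Ioi 0))) := by
    refine Measurable.aestronglyMeasurable ?_
    have : Measurable fun q : V × ℝ => (inner ℝ x q.1 : ℝ) :=
      (continuous_const.inner continuous_fst).measurable
    fun_prop
  have hnorm : ∀ (y : ℝ) (ξ : V), ‖Complex.exp (-z * y ^ 2) *
      Complex.exp (-(z * ((2 * Real.pi * ‖ξ‖ : ℝ) / (2 * y)) ^ 2)) *
      Complex.exp (2 * Real.pi * Complex.I * (inner ℝ x ξ : ℝ))‖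
      = Real.exp (-s * y ^ 2) * Real.exp (-(s * (Real.pi / y) ^ 2) * ‖ξ‖ ^ 2) := by
    intro y ξ
    rw [norm_mul, norm_cexp_two_pi_I_mul, mul_one, norm_mul, Complex.norm_exp, Complex.norm_exp]
    have e1 : (-z * (y : ℂ) ^ 2).re = -s * y ^ 2 := by
      rw [← Complex.ofReal_pow, Complex.re_mul_ofReal, Complex.neg_re]
    have e2 : (-(z * (((2 * Real.pi * ‖ξ‖ : ℝ) : ℂ) / (2 * (y : ℂ))) ^ 2)).re
        = -(s * (Real.pi / y) ^ 2) * ‖ξ‖ ^ 2 := by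
      have : (((2 * Real.pi * ‖ξ‖ : ℝ) : ℂ) / (2 * (y : ℂ))) ^ 2
          = (((Real.pi / y) ^ 2 * ‖ξ‖ ^ 2 : ℝ) : ℂ) := by
        have : ((2 * Real.pi * ‖ξ‖ : ℝ) : ℂ) / (2 * (y : ℂ)) = ((Real.pi / y * ‖ξ‖ : ℝ) : ℂ) := by
          push_cast
          rw [mul_assoc, mul_div_mul_left _ _ two_ne_zero]
          ring
        rw [this]; push_cast; ring
      rw [this, Complex.neg_re, Complex.re_mul_ofReal]; ring
    rw [e1, e2]
  have hc : ∀ y : ℝ, 0 < y → 0 < s * (Real.pi / y) ^ 2 := fun y hy => by positivity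
  rw [integrable_prod_iff' hmeas]
  constructor
  · filter_upwards [self_mem_ae_restrict measurableSet_Ioi] with y hy
    have h := (GaussianFourier.integrable_cexp_neg_mul_sq_norm_add (V := V)
      (b := ((s * (Real.pi / y) ^ 2 : ℝ) : ℂ)) (by rw [Complex.ofReal_re]; exact hc y hy) 0 0).norm.const_mul
      (Real.exp (-s * y ^ 2))
    refine Integrable.mono' (g := fun ξ => Real.exp (-s * y ^ 2) *
      Real.exp (-(s * (Real.pi / y) ^ 2) * ‖ξ‖ ^ 2)) ?_ ?_ (ae_of_all _ fun ξ => (hnorm y ξ).le)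
    · refine h.congr (ae_of_all _ fun ξ => ?_)
      simp only
      rw [Complex.norm_exp]
      congr 2
      have : -((s * (Real.pi / y) ^ 2 : ℝ) : ℂ) * (‖ξ‖ : ℂ) ^ 2 + 0 * ((inner ℝ (0 : V) ξ : ℝ) : ℂ)
        = ((-(s * (Real.pi / y) ^ 2) * ‖ξ‖ ^ 2 : ℝ) : ℂ) := by push_cast; ring
      rw [this, Complex.ofReal_re]
    · refine Measurable.aestronglyMeasurable ?_
      have : Measurable fun ξ : V => (inner ℝ x ξ : ℝ) :=
        (continuous_const.inner continuous_id).measurable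
      fun_prop
  · simp_rw [hnorm, integral_const_mul]
    have hI : IntegrableOn (fun y : ℝ => (y ^ (Module.finrank ℝ V : ℝ) * Real.exp (-s * y ^ 2)) *
        (s * Real.pi) ^ (-(Module.finrank ℝ V / 2 : ℝ))) (Ioi 0) := by
      exact (integrableOn_rpow_mul_exp_neg_mul_sq hz
        (lt_of_lt_of_le (by norm_num) (Nat.cast_nonneg _))).mul_const _
    refine hI.congr ?_
    filter_upwards [self_mem_ae_restrict measurableSet_Ioi] with y hy
    have hy0 : (0 : ℝ) < y := hy
    rw [GaussianFourier.integral_rexp_neg_mul_sq_norm (hc y hy)]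
    have : Real.pi / (s * (Real.pi / y) ^ 2) = y ^ (2 : ℝ) * (s * Real.pi)⁻¹ := by
      rw [Real.rpow_two]; field_simp
    rw [this, Real.mul_rpow (x := y ^ (2 : ℝ)) (by positivity) (by positivity),
      ← Real.rpow_mul hy0.le, Real.rpow_neg (by positivity), Real.inv_rpow (by positivity)]
    rw [mul_div_cancel₀ _ (two_ne_zero)]
    ring

theorem cpow_mul_exp_ae [Nontrivial V] {z : ℂ} (hz : 0 < z.re) (x : V) :
    ∀ᵐ ξ : V, (Real.pi / z) ^ (1 / 2 : ℂ) * (Complex.exp (-z * (2 * Real.pi * ‖ξ‖ : ℝ)) *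
      Complex.exp (2 * Real.pi * Complex.I * (inner ℝ x ξ : ℝ)))
      = 2 * ∫ y in Ioi (0 : ℝ), Complex.exp (-z * y ^ 2) *
      Complex.exp (-(z * ((2 * Real.pi * ‖ξ‖ : ℝ) / (2 * y)) ^ 2)) *
      Complex.exp (2 * Real.pi * Complex.I * (inner ℝ x ξ : ℝ)) := by
  have h0 : ∀ᵐ ξ : V, ξ ≠ 0 := by
    rw [ae_iff]; simp
  filter_upwards [h0] with ξ hξ
  have : 0 < ‖ξ‖ := norm_pos_iff.2 hξ
  rw [integral_mul_const, ← mul_assoc, ← mul_assoc, ← cpow_mul_cexp_neg_mul hz (by positivity)]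

theorem cpow_pi_div_ne_zero {z : ℂ} (hz : 0 < z.re) : ((Real.pi : ℂ) / z) ^ (1 / 2 : ℂ) ≠ 0 := by
  have hz0 : z ≠ 0 := by rintro rfl; simp at hz
  rw [Complex.cpow_ne_zero_iff]
  left
  exact div_ne_zero (by exact_mod_cast Real.pi_ne_zero) hz0

theorem integrable_poisson [Nontrivial V] {z : ℂ} (hz : 0 < z.re) (x : V) :
    Integrable fun ξ : V => Complex.exp (-z * (2 * Real.pi * ‖ξ‖ : ℝ)) *
      Complex.exp (2 * Real.pi * Complex.I * (inner ℝ x ξ : ℝ)) := by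
  have h := ((integrable_gaussian_slices hz x).integral_prod_left).const_mul 2
  have h2 := (h.congr ((cpow_mul_exp_ae hz x).mono fun ξ h => h.symm)).const_mul
    ((Real.pi / z) ^ (1 / 2 : ℂ))⁻¹
  refine h2.congr (ae_of_all _ fun ξ => ?_)
  simp only
  rw [inv_mul_cancel_left₀ (cpow_pi_div_ne_zero hz)]

theorem integrable_exp_neg_mul_norm [Nontrivial V] {s : ℝ} (hs : 0 < s) :
    Integrable fun ξ : V => Real.exp (-s * (2 * Real.pi * ‖ξ‖)) := by
  refine ((integrable_poisson (V := V) (z := s) (by simpa using hs) 0).norm).congr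
    (ae_of_all _ fun ξ => ?_)
  simp only
  rw [norm_mul, norm_cexp_two_pi_I_mul, mul_one, Complex.norm_exp]
  congr 1
  rw [Complex.re_mul_ofReal]; simp

/-- After subordination, each slice is a Gaussian of parameter `b = z (π/y)²`; its Fourier integral
has modulus at most `(π|z|)^{-n/2} y^n`. Integrating against `exp(-Re z · y²)` produces `(Re
z)^{-(n+1)/2}`, and division by the prefactor `(π/z)^{1/2}` improves `|z|^{-n/2}` to
`|z|^{-(n-1)/2}`. Keeping `|z|` apart from `Re z` retains the dispersive decay. -/
theorem exists_norm_poissonKernel_le [Nontrivial V] :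
    ∃ C : ℝ, 0 < C ∧ ∀ (z : ℂ) (x : V), 0 < z.re →
      ‖poissonKernel z x‖ ≤ C * ‖z‖ ^ (-((Module.finrank ℝ V - 1) / 2 : ℝ)) *
        z.re ^ (-((Module.finrank ℝ V + 1) / 2 : ℝ)) := by
  set n : ℝ := (Module.finrank ℝ V : ℝ) with hn
  have hn0 : 0 ≤ n := Nat.cast_nonneg _
  refine ⟨Real.pi ^ (-(1 / 2) : ℝ) * (2 * (Real.pi ^ (-(n / 2)) * (1 / 2 * Real.Gamma ((n + 1) / 2)))),
    ?_, fun z x hz => ?_⟩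
  · have : 0 < Real.Gamma ((n + 1) / 2) := Real.Gamma_pos_of_pos (by positivity)
    positivity
  set s := z.re with hs
  have hz0 : z ≠ 0 := by rintro rfl; simp [hs] at hz
  have hzn : 0 < ‖z‖ := norm_pos_iff.2 hz0
  have h1 : (Real.pi / z) ^ (1 / 2 : ℂ) * poissonKernel z x = 2 * ∫ y in Ioi (0 : ℝ), ∫ ξ : V,
      Complex.exp (-z * y ^ 2) * Complex.exp (-(z * ((2 * Real.pi * ‖ξ‖ : ℝ) / (2 * y)) ^ 2)) *
      Complex.exp (2 * Real.pi * Complex.I * (inner ℝ x ξ : ℝ)) := by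
    rw [poissonKernel, ← integral_const_mul, integral_congr_ae (cpow_mul_exp_ae hz x),
      integral_const_mul]
    congr 1
    exact integral_integral_swap (integrable_gaussian_slices hz x)
  have h2 : ‖∫ y in Ioi (0 : ℝ), ∫ ξ : V,
      Complex.exp (-z * y ^ 2) * Complex.exp (-(z * ((2 * Real.pi * ‖ξ‖ : ℝ) / (2 * y)) ^ 2)) *
      Complex.exp (2 * Real.pi * Complex.I * (inner ℝ x ξ : ℝ))‖
      ≤ ∫ y in Ioi (0 : ℝ), (Real.pi * ‖z‖) ^ (-(n / 2)) * (y ^ n * Real.exp (-s * y ^ (2 : ℝ))) := by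
    refine norm_integral_le_of_norm_le ?_ ?_
    · have := (integrableOn_rpow_mul_exp_neg_mul_sq hz
        (lt_of_lt_of_le (by norm_num) hn0)).const_mul ((Real.pi * ‖z‖) ^ (-(n / 2)))
      simpa using this
    · filter_upwards [self_mem_ae_restrict measurableSet_Ioi] with y hy
      have hy0 : (0 : ℝ) < y := hy
      have hyc : (y : ℂ) ≠ 0 := by exact_mod_cast hy0.ne'
      set b : ℂ := z * ((Real.pi / y) ^ 2 : ℝ) with hb
      have hbre : b.re = s * (Real.pi / y) ^ 2 := Complex.re_mul_ofReal _ _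
      have hbpos : 0 < b.re := by rw [hbre]; positivity
      have e : ∀ ξ : V, Complex.exp (-z * y ^ 2) *
          Complex.exp (-(z * ((2 * Real.pi * ‖ξ‖ : ℝ) / (2 * y)) ^ 2)) *
          Complex.exp (2 * Real.pi * Complex.I * (inner ℝ x ξ : ℝ))
          = Complex.exp (-z * y ^ 2) *
            Complex.exp (-b * (‖ξ‖ : ℂ) ^ 2 + (2 * Real.pi * Complex.I) * (inner ℝ x ξ : ℝ)) := by
        intro ξ
        rw [Complex.exp_add, mul_assoc]
        congr 3
        rw [hb]; push_cast; field_simp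
      simp_rw [e]
      rw [integral_const_mul, GaussianFourier.integral_cexp_neg_mul_sq_norm_add hbpos, norm_mul,
        norm_mul]
      have n1 : ‖Complex.exp (-z * y ^ 2)‖ = Real.exp (-s * y ^ (2 : ℝ)) := by
        rw [Complex.norm_exp, ← Complex.ofReal_pow, Complex.re_mul_ofReal, Complex.neg_re,
          Real.rpow_two]
      have n2 : ‖((Real.pi : ℂ) / b) ^ ((Module.finrank ℝ V : ℂ) / 2)‖
          = (Real.pi * ‖z‖) ^ (-(n / 2)) * y ^ n := by
        have : ((Module.finrank ℝ V : ℂ) / 2) = ((n / 2 : ℝ) : ℂ) := by rw [hn]; push_cast; ring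
        rw [this, Complex.norm_cpow_real, norm_div, hb, norm_mul, Complex.norm_real,
          Complex.norm_real, Real.norm_of_nonneg (by positivity), Real.norm_of_nonneg (by positivity)]
        have : Real.pi / (‖z‖ * (Real.pi / y) ^ 2) = (Real.pi * ‖z‖)⁻¹ * y ^ (2 : ℝ) := by
          rw [Real.rpow_two]; field_simp
        rw [this, Real.mul_rpow (by positivity) (by positivity), ← Real.rpow_mul hy0.le,
          Real.rpow_neg (by positivity), Real.inv_rpow (by positivity),
          mul_div_cancel₀ _ (two_ne_zero)]
      -- The transformed Gaussian has exponent `-(π|x|)² / b` and `Re (1/b) ≥ 0`, so the bound is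
      -- uniform in `x`.
      have n3 : ‖Complex.exp ((2 * Real.pi * Complex.I) ^ 2 * (‖x‖ : ℂ) ^ 2 / (4 * b))‖ ≤ 1 := by
        rw [Complex.norm_exp]
        refine Real.exp_le_one_iff.2 ?_
        have : (2 * Real.pi * Complex.I) ^ 2 * (‖x‖ : ℂ) ^ 2 / (4 * b)
            = -(((Real.pi * ‖x‖) ^ 2 : ℝ) : ℂ) * b⁻¹ := by
          rw [mul_pow, Complex.I_sq]; push_cast
          have hb0 : b ≠ 0 := by rintro h; rw [h] at hbpos; simp at hbpos
          field_simp
          ring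
        rw [this, neg_mul, Complex.neg_re, Complex.re_ofReal_mul, Complex.inv_re]
        have : 0 ≤ b.re / Complex.normSq b := div_nonneg hbpos.le (Complex.normSq_nonneg b)
        have := mul_nonneg (sq_nonneg (Real.pi * ‖x‖)) this
        linarith
      rw [n1, n2]
      calc _ ≤ Real.exp (-s * y ^ (2 : ℝ)) * ((Real.pi * ‖z‖) ^ (-(n / 2)) * y ^ n * 1) := by
            gcongr
        _ = _ := by ring
  rw [integral_const_mul, integral_rpow_mul_exp_neg_mul_rpow two_pos (by linarith) hz] at h2
  have h3 : ‖((Real.pi : ℂ) / z) ^ (1 / 2 : ℂ)‖ = Real.pi ^ (1 / 2 : ℝ) * ‖z‖ ^ (-(1 / 2) : ℝ) := by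
    have : (1 / 2 : ℂ) = ((1 / 2 : ℝ) : ℂ) := by push_cast; ring
    rw [this, Complex.norm_cpow_real, norm_div, Complex.norm_real,
      Real.norm_of_nonneg Real.pi_pos.le, Real.div_rpow Real.pi_pos.le hzn.le, Real.rpow_neg hzn.le]
    ring
  have h4 := congrArg norm h1
  rw [norm_mul, norm_mul, h3, Complex.norm_ofNat] at h4
  have h5 : ‖poissonKernel z x‖ = Real.pi ^ (-(1 / 2) : ℝ) * ‖z‖ ^ (1 / 2 : ℝ) *
      (Real.pi ^ (1 / 2 : ℝ) * ‖z‖ ^ (-(1 / 2) : ℝ) * ‖poissonKernel z x‖) := by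
    rw [Real.rpow_neg hzn.le, Real.rpow_neg Real.pi_pos.le]
    field_simp
  rw [h5, h4]
  calc _ ≤ Real.pi ^ (-(1 / 2) : ℝ) * ‖z‖ ^ (1 / 2 : ℝ) * (2 * ((Real.pi * ‖z‖) ^ (-(n / 2)) *
        (s ^ (-(n + 1) / 2) * (1 / 2) * Real.Gamma ((n + 1) / 2)))) := by gcongr
    _ = _ := by
      rw [Real.mul_rpow Real.pi_pos.le hzn.le]
      have : -((n - 1) / 2) = 1 / 2 + -(n / 2) := by ring
      rw [this, Real.rpow_add hzn, neg_div]
      ring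

end PoissonKernel

/-! ### Fourier pairs of functions in the sense of tempered distributions -/

section FourierPairs

variable {d : ℕ}

/-- `g` is the Fourier transform of the complex-valued function `u`, in the sense of tempered
distributions. -/
def IsFT (u g : E d → ℂ) : Prop :=
  AEStronglyMeasurable u volume ∧ AEStronglyMeasurable g volume ∧
    ∀ φ : 𝓢(E d, ℂ), Integrable (fun x => u x * φ x) volume ∧
      Integrable (fun ξ => g ξ * φ ξ) volume ∧ ∫ x, u x * (𝓕 φ) x = ∫ ξ, g ξ * φ ξ

theorem isFourierTransform_iff {u : E d → ℝ} {g : E d → ℂ} :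
    IsFourierTransform u g ↔ IsFT (fun x => (u x : ℂ)) g := by
  unfold IsFourierTransform IsFT
  refine and_congr_left fun _ => ⟨fun h => Complex.continuous_ofReal.comp_aestronglyMeasurable h,
    fun h => ?_⟩
  simpa using Complex.continuous_re.comp_aestronglyMeasurable h

/-- Compactly supported smooth functions are Schwartz. Testing with one that equals `1` on a compact
set shows that `h` is locally integrable, and the fundamental lemma of the calculus of variations
applies. -/
theorem ae_eq_zero_of_integral_schwartz {h : E d → ℂ}
    (hi : ∀ φ : 𝓢(E d, ℂ), Integrable (fun x => h x * φ x) volume)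
    (h0 : ∀ φ : 𝓢(E d, ℂ), ∫ x, h x * φ x = 0) : h =ᵐ[volume] 0 := by
  have toS : ∀ g : E d → ℝ, ContDiff ℝ ((⊤ : ℕ∞) : WithTop ℕ∞) g → HasCompactSupport g →
      ∃ φ : 𝓢(E d, ℂ), ∀ x, φ x = (g x : ℂ) := by
    intro g hg hgs
    have h1 : HasCompactSupport fun x => (g x : ℂ) := hgs.comp_left (g := fun r : ℝ => (r : ℂ)) rfl
    have h2 : ContDiff ℝ ((⊤ : ℕ∞) : WithTop ℕ∞) fun x => (g x : ℂ) :=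
      Complex.ofRealCLM.contDiff.comp hg
    exact ⟨h1.toSchwartzMap h2, fun x => rfl⟩
  have hloc : LocallyIntegrable h volume := by
    rw [locallyIntegrable_iff]
    intro K hK
    obtain ⟨g, hgs, hgK, hg⟩ : ∃ g : E d → ℝ, HasCompactSupport g ∧ (∀ x ∈ K, g x = 1) ∧
        ContDiff ℝ ((⊤ : ℕ∞) : WithTop ℕ∞) g := by
      obtain ⟨g, hg1, hg2, hg3, hg4⟩ := exists_contMDiff_support_eq_eq_one_iff
        (I := modelWithCornersSelf ℝ (E d)) (n := (⊤ : ℕ∞)) (s := Metric.thickening 1 K) (t := K)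
        Metric.isOpen_thickening hK.isClosed
        (Metric.self_subset_thickening one_pos K)
      refine ⟨g, ?_, fun x hx => (hg4 x).1 hx, contMDiff_iff_contDiff.1 hg1⟩
      refine HasCompactSupport.of_support_subset_isCompact (hK.cthickening (r := 1)) ?_
      rw [hg3]
      exact Metric.thickening_subset_cthickening 1 K
    obtain ⟨φ, hφ⟩ := toS g hg hgs
    refine ((hi φ).integrableOn (s := K)).congr_fun (fun x hx => ?_) hK.measurableSet
    simp [hφ, hgK x hx]
  have := ae_eq_zero_of_integral_contDiff_smul_eq_zero hloc fun g hg hgs => by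
    obtain ⟨φ, hφ⟩ := toS g hg hgs
    rw [← h0 φ]
    refine integral_congr_ae (ae_of_all _ fun x => ?_)
    simp [hφ, mul_comm]
  exact this

theorem IsFT.congr {u u' g g' : E d → ℂ} (h : IsFT u g) (hu : u =ᵐ[volume] u')
    (hg : g =ᵐ[volume] g') : IsFT u' g' := by
  refine ⟨h.1.congr hu, h.2.1.congr hg, fun φ => ⟨(h.2.2 φ).1.congr ?_, (h.2.2 φ).2.1.congr ?_, ?_⟩⟩
  · filter_upwards [hu] with x hx; rw [hx]
  · filter_upwards [hg] with x hx; rw [hx]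
  · rw [← integral_congr_ae (f := fun x => u x * (𝓕 φ) x), (h.2.2 φ).2.2]
    · refine integral_congr_ae ?_
      filter_upwards [hg] with x hx; rw [hx]
    · filter_upwards [hu] with x hx; rw [hx]

theorem IsFT.add {u u' g g' : E d → ℂ} (h : IsFT u g) (h' : IsFT u' g') :
    IsFT (fun x => u x + u' x) (fun x => g x + g' x) := by
  refine ⟨h.1.add h'.1, h.2.1.add h'.2.1, fun φ => ⟨?_, ?_, ?_⟩⟩
  · simp_rw [add_mul]; exact (h.2.2 φ).1.add (h'.2.2 φ).1
  · simp_rw [add_mul]; exact (h.2.2 φ).2.1.add (h'.2.2 φ).2.1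
  · simp_rw [add_mul]
    rw [integral_add (h.2.2 (𝓕 φ)).1 (h'.2.2 (𝓕 φ)).1,
      integral_add (h.2.2 φ).2.1 (h'.2.2 φ).2.1, (h.2.2 φ).2.2, (h'.2.2 φ).2.2]

theorem IsFT.const_mul {u g : E d → ℂ} (h : IsFT u g) (c : ℂ) :
    IsFT (fun x => c * u x) (fun x => c * g x) := by
  refine ⟨h.1.const_mul c, h.2.1.const_mul c, fun φ => ⟨?_, ?_, ?_⟩⟩
  · simp_rw [mul_assoc]; exact (h.2.2 φ).1.const_mul c
  · simp_rw [mul_assoc]; exact (h.2.2 φ).2.1.const_mul c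
  · simp_rw [mul_assoc]
    rw [integral_const_mul, integral_const_mul, (h.2.2 φ).2.2]

theorem IsFT.sub {u u' g g' : E d → ℂ} (h : IsFT u g) (h' : IsFT u' g') :
    IsFT (fun x => u x - u' x) (fun x => g x - g' x) := by
  simpa [sub_eq_add_neg] using h.add (h'.const_mul (-1))

theorem IsFT.right_unique {u g g' : E d → ℂ} (h : IsFT u g) (h' : IsFT u g') :
    g =ᵐ[volume] g' := by
  have hs := h.sub h'
  have : (fun x => g x - g' x) =ᵐ[volume] 0 := by
    refine ae_eq_zero_of_integral_schwartz (fun φ => (hs.2.2 φ).2.1) fun φ => ?_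
    rw [← (hs.2.2 φ).2.2]
    simp
  filter_upwards [this] with x hx
  exact sub_eq_zero.1 hx

theorem IsFT.left_unique {u u' g : E d → ℂ} (h : IsFT u g) (h' : IsFT u' g) :
    u =ᵐ[volume] u' := by
  have hs := h.sub h'
  have : (fun x => u x - u' x) =ᵐ[volume] 0 := by
    refine ae_eq_zero_of_integral_schwartz (fun φ => (hs.2.2 φ).1) fun φ => ?_
    have := (hs.2.2 (𝓕⁻ φ)).2.2
    rw [FourierTransform.fourier_fourierInv_eq] at this
    rw [this]
    simp
  filter_upwards [this] with x hx
  exact sub_eq_zero.1 hx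

theorem fourier_fourier_apply (φ : 𝓢(E d, ℂ)) (x : E d) : (𝓕 (𝓕 φ)) x = φ (-x) := by
  have h := congrArg (fun ψ : 𝓢(E d, ℂ) => ψ (-x))
    (FourierTransform.fourierInv_fourier_eq (F := 𝓢(E d, ℂ)) φ)
  simp only [SchwartzMap.fourierInv_apply_eq] at h
  rw [← h]
  simp

theorem aestronglyMeasurable_comp_neg {g : E d → ℂ} (h : AEStronglyMeasurable g volume) :
    AEStronglyMeasurable (fun x => g (-x)) volume :=
  h.comp_measurePreserving (Measure.measurePreserving_neg volume)

theorem IsFT.symm {u g : E d → ℂ} (h : IsFT u g) : IsFT g (fun x => u (-x)) := by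
  have hint : ∀ φ : 𝓢(E d, ℂ), (fun x => u (-x) * φ x) = fun x => (fun y => u y * (𝓕 (𝓕 φ)) y) (-x) := by
    intro φ
    ext x
    simp [fourier_fourier_apply]
  refine ⟨h.2.1, aestronglyMeasurable_comp_neg h.1, fun φ => ⟨(h.2.2 φ).2.1, ?_, ?_⟩⟩
  · rw [hint]
    exact (h.2.2 (𝓕 (𝓕 φ))).1.comp_neg
  · rw [(h.2.2 (𝓕 φ)).2.2.symm, hint]
    exact (integral_neg_eq_self (fun y => u y * (𝓕 (𝓕 φ)) y) volume).symm

theorem isFT_lp (f : Lp (α := E d) ℂ 2 volume) : IsFT f (𝓕 f : Lp (α := E d) ℂ 2 volume) := by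
  have hi : ∀ (f : Lp (α := E d) ℂ 2 volume) (φ : 𝓢(E d, ℂ)), Integrable (fun x => f x * φ x) volume :=
    fun f φ => (Lp.memLp f).integrable_mul (φ.memLp 2)
  refine ⟨Lp.aestronglyMeasurable _, Lp.aestronglyMeasurable _, fun φ => ⟨hi f φ, hi _ φ, ?_⟩⟩
  have h := congrArg (fun T => T φ) (Lp.fourier_toTemperedDistribution_eq f)
  simp only [TemperedDistribution.fourier_apply, Lp.toTemperedDistribution_apply, smul_eq_mul] at h
  simp_rw [mul_comm] at h ⊢
  exact h

theorem exists_isFT_of_memLp {u : E d → ℂ} (hu : MemLp u 2 volume) :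
    ∃ g, IsFT u g ∧ MemLp g 2 volume :=
  ⟨(𝓕 (hu.toLp u) : Lp (α := E d) ℂ 2 volume), (isFT_lp (hu.toLp u)).congr hu.coeFn_toLp EventuallyEq.rfl,
    Lp.memLp _⟩

theorem exists_isFT_of_memLp_right {g : E d → ℂ} (hg : MemLp g 2 volume) :
    ∃ u, IsFT u g ∧ MemLp u 2 volume := by
  refine ⟨(𝓕⁻ (hg.toLp g) : Lp (α := E d) ℂ 2 volume), (isFT_lp _).congr EventuallyEq.rfl ?_, Lp.memLp _⟩
  rw [FourierTransform.fourier_fourierInv_eq]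
  exact hg.coeFn_toLp

/-- Plancherel, valid in `[0, ∞]`: if either function is square integrable then uniqueness
identifies the pair with an `L²` pair, and otherwise both norms are infinite. -/
theorem IsFT.eLpNorm_eq {u g : E d → ℂ} (h : IsFT u g) : eLpNorm g 2 volume = eLpNorm u 2 volume := by
  have key : ∀ {u g : E d → ℂ}, IsFT u g → MemLp u 2 volume →
      eLpNorm g 2 volume = eLpNorm u 2 volume := by
    intro u g h hu
    have h1 : g =ᵐ[volume] (𝓕 (hu.toLp u) : Lp (α := E d) ℂ 2 volume) :=
      h.right_unique ((isFT_lp (hu.toLp u)).congr hu.coeFn_toLp EventuallyEq.rfl)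
    have h2 := Lp.norm_fourier_eq (hu.toLp u)
    rw [Lp.norm_def, Lp.norm_def, ENNReal.toReal_eq_toReal_iff' (Lp.eLpNorm_ne_top _)
      (Lp.eLpNorm_ne_top _)] at h2
    rw [eLpNorm_congr_ae h1, h2, eLpNorm_congr_ae hu.coeFn_toLp]
  by_cases hu : MemLp u 2 volume
  · exact key h hu
  · by_cases hg : MemLp g 2 volume
    · obtain ⟨u', hu', hm⟩ := exists_isFT_of_memLp_right hg
      exact (hu (hm.ae_eq (hu'.left_unique h))).elim
    · have h1 : eLpNorm u 2 volume = ∞ := by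
        by_contra h'
        exact hu ⟨h.1, lt_top_iff_ne_top.2 h'⟩
      have h2 : eLpNorm g 2 volume = ∞ := by
        by_contra h'
        exact hg ⟨h.2.1, lt_top_iff_ne_top.2 h'⟩
      rw [h1, h2]

theorem isFT_of_integrable {u : E d → ℂ} (hu : Integrable u volume) : IsFT u (𝓕 u) := by
  have hc : Continuous (𝓕 u) := by
    exact VectorFourier.fourierIntegral_continuous Real.continuous_fourierChar
      (L := innerₗ (E d)) continuous_inner hu
  have hb : ∀ x, ‖𝓕 u x‖ ≤ ∫ y, ‖u y‖ :=
    fun x => VectorFourier.norm_fourierIntegral_le_integral_norm _ _ _ _ _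
  refine ⟨hu.1, hc.aestronglyMeasurable, fun φ => ⟨?_, ?_, ?_⟩⟩
  · exact hu.mul_bdd (c := SchwartzMap.seminorm ℝ 0 0 φ) φ.continuous.aestronglyMeasurable
      (ae_of_all _ fun x => SchwartzMap.norm_le_seminorm ℝ φ x)
  · exact φ.integrable.bdd_mul (c := ∫ y, ‖u y‖) hc.aestronglyMeasurable (ae_of_all _ hb)
  · have h := VectorFourier.integral_fourierIntegral_smul_eq_flip (L := innerₗ (E d))
      (μ := volume) (ν := volume) Real.continuous_fourierChar continuous_inner hu φ.integrable
    simp only [smul_eq_mul, flip_innerₗ] at h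
    exact h.symm

theorem isFT_fourierInv_of_integrable {g : E d → ℂ} (hg : Integrable g volume) :
    IsFT (𝓕⁻ g) g := by
  have h := (isFT_of_integrable (u := fun x => g (-x)) hg.comp_neg).symm
  simp only [neg_neg] at h
  have e : 𝓕 (fun x => g (-x)) = 𝓕⁻ g := by
    rw [Real.fourierInv_eq_fourier_comp_neg]
  rwa [e] at h

theorem exists_schwartz_conj (φ : 𝓢(E d, ℂ)) : ∃ ψ : 𝓢(E d, ℂ), ∀ x, ψ x = conj (φ x) := by
  refine ⟨φ.postcompCLM (Complex.conjLIE.toContinuousLinearEquiv.toContinuousLinearMap), fun x => ?_⟩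
  rw [SchwartzMap.postcompCLM_apply]
  rfl

theorem fourier_conj_apply {φ ψ : 𝓢(E d, ℂ)} (h : ∀ x, ψ x = conj (φ x)) (x : E d) :
    (𝓕 ψ) x = conj ((𝓕 φ) (-x)) := by
  rw [SchwartzMap.fourier_coe, SchwartzMap.fourier_coe, Real.fourier_eq', Real.fourier_eq',
    ← integral_conj]
  refine integral_congr_ae (ae_of_all _ fun y => ?_)
  simp only [smul_eq_mul, map_mul, h, ← Complex.exp_conj, Complex.conj_I, Complex.conj_ofReal]
  congr 2
  simp

/-- With uniqueness of transforms, this makes real values of `u` equivalent to the symmetry `g(-ξ) =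
conj g(ξ)`. -/
theorem IsFT.conj {u g : E d → ℂ} (h : IsFT u g) :
    IsFT (fun x => conj (u x)) (fun ξ => conj (g (-ξ))) := by
  have hconj : ∀ {f : E d → ℂ}, Integrable f volume → Integrable (fun x => conj (f x)) volume :=
    fun hf => (Complex.conjLIE.toContinuousLinearEquiv.toContinuousLinearMap).integrable_comp hf
  have hneg : ∀ φ : 𝓢(E d, ℂ), ∃ ψ : 𝓢(E d, ℂ), ∀ x, ψ x = φ (-x) := fun φ =>
    ⟨𝓕 (𝓕 φ), fun x => fourier_fourier_apply φ x⟩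
  refine ⟨Complex.continuous_conj.comp_aestronglyMeasurable h.1,
    Complex.continuous_conj.comp_aestronglyMeasurable (aestronglyMeasurable_comp_neg h.2.1),
    fun φ => ?_⟩
  obtain ⟨ψ, hψ⟩ := exists_schwartz_conj φ
  obtain ⟨χ, hχ⟩ := hneg ψ
  refine ⟨?_, ?_, ?_⟩
  · refine (hconj (h.2.2 ψ).1).congr (ae_of_all _ fun x => ?_)
    simp [hψ]
  · refine (hconj (h.2.2 χ).2.1.comp_neg).congr (ae_of_all _ fun x => ?_)
    simp [hψ, hχ]
  · have h1 := congrArg conj (h.2.2 χ).2.2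
    rw [← integral_conj, ← integral_conj] at h1
    rw [← integral_neg_eq_self (fun ξ => (starRingEnd ℂ) (g ξ * χ ξ))] at h1
    refine Eq.trans ?_ (h1.trans ?_)
    · refine integral_congr_ae (ae_of_all _ fun x => ?_)
      have e : (𝓕 χ) x = conj ((𝓕 φ) x) := by
        have hc : ∀ y, χ y = conj ((𝓕 (𝓕 φ)) y) := fun y => by
          rw [hχ, hψ, fourier_fourier_apply]
        rw [fourier_conj_apply hc, fourier_fourier_apply, neg_neg]
      simp [e]
    · refine integral_congr_ae (ae_of_all _ fun x => ?_)
      simp [hψ, hχ]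

end FourierPairs

/-! ### The dual homogeneous Strichartz estimate -/

section DualStrichartz

variable {d : ℕ}

theorem memLp_two_of_isBddFin {g : E d → ℂ} (hg : IsBddFin volume g) : MemLp g 2 volume := by
  refine (memLp_two_iff_integrable_sq_norm hg.measurable.aestronglyMeasurable).2 ?_
  simpa using hg.integrable_norm_rpow (q := 2) two_pos

theorem integral_norm_rpow_two_eq_of_eLpNorm_eq {g h : E d → ℂ} (hg : MemLp g 2 volume)
    (hh : MemLp h 2 volume) (e : eLpNorm g 2 volume = eLpNorm h 2 volume) :
    (∫ x, ‖g x‖ ^ (2 : ℝ)) ^ (1 / 2 : ℝ) = (∫ x, ‖h x‖ ^ (2 : ℝ)) ^ (1 / 2 : ℝ) := by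
  rw [hg.eLpNorm_eq_integral_rpow_norm two_ne_zero ENNReal.ofNat_ne_top,
    hh.eLpNorm_eq_integral_rpow_norm two_ne_zero ENNReal.ofNat_ne_top] at e
  have := (ENNReal.ofReal_eq_ofReal_iff (by positivity) (by positivity)).1 e
  simpa using this

theorem norm_cexp_neg_mul_ofReal (z : ℂ) (r : ℝ) : ‖Complex.exp (-z * (r : ℂ))‖ = Real.exp (-z.re * r) := by
  rw [Complex.norm_exp, Complex.re_mul_ofReal, Complex.neg_re]

theorem norm_cexp_neg_mul_norm_le_one {z : ℂ} (hz : 0 ≤ z.re) (ξ : E d) :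
    ‖Complex.exp (-z * (2 * Real.pi * ‖ξ‖ : ℝ))‖ ≤ 1 := by
  rw [norm_cexp_neg_mul_ofReal]
  refine Real.exp_le_one_iff.2 ?_
  have : 0 ≤ 2 * Real.pi * ‖ξ‖ := by positivity
  nlinarith [mul_nonneg hz this]

/-- The `L²` endpoint: the multiplier is at most `1` in modulus for `Re z ≥ 0`, so Cauchy–Schwarz
and Plancherel suffice. -/
theorem norm_integral_cexp_mul_fourier_le_L2 {z : ℂ} (hz : 0 ≤ z.re) {g h : E d → ℂ}
    (hg : IsBddFin volume g) (hh : IsBddFin volume h) :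
    ‖∫ ξ, Complex.exp (-z * (2 * Real.pi * ‖ξ‖ : ℝ)) * (𝓕⁻ g ξ * 𝓕 h ξ)‖
      ≤ (∫ x, ‖g x‖ ^ (2 : ℝ)) ^ (1 / 2 : ℝ) * (∫ x, ‖h x‖ ^ (2 : ℝ)) ^ (1 / 2 : ℝ) := by
  have hgi := isFT_fourierInv_of_integrable hg.integrable
  have hhi := isFT_of_integrable hh.integrable
  have hg2 := memLp_two_of_isBddFin hg
  have hh2 := memLp_two_of_isBddFin hh
  have hg3 : MemLp (𝓕⁻ g) 2 volume := ⟨hgi.1, by rw [← hgi.eLpNorm_eq]; exact hg2.2⟩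
  have hh3 : MemLp (𝓕 h) 2 volume := ⟨hhi.2.1, by rw [hhi.eLpNorm_eq]; exact hh2.2⟩
  rw [integral_norm_rpow_two_eq_of_eLpNorm_eq hg2 hg3 hgi.eLpNorm_eq,
    integral_norm_rpow_two_eq_of_eLpNorm_eq hh2 hh3 hhi.eLpNorm_eq.symm]
  refine (norm_integral_le_of_norm_le (g := fun ξ => ‖𝓕⁻ g ξ‖ * ‖𝓕 h ξ‖) ?_
    (ae_of_all _ fun ξ => ?_)).trans ?_
  · exact hg3.norm.integrable_mul hh3.norm
  · rw [norm_mul, norm_mul]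
    exact mul_le_of_le_one_left (by positivity) (norm_cexp_neg_mul_norm_le_one hz ξ)
  · exact integral_mul_norm_le_Lp_mul_Lq (p := 2) (q := 2) Real.HolderConjugate.two_two
      (by simpa using hg3) (by simpa using hh3)

/-- Puts the multiplier form into the bounded-kernel form required for interpolation. Damping by `Re
z > 0` makes the triple integral absolutely convergent. -/
theorem integral_cexp_mul_fourier_eq [Nontrivial (E d)] {z : ℂ} (hz : 0 < z.re) {g h : E d → ℂ}
    (hg : IsBddFin volume g) (hh : IsBddFin volume h) :
    ∫ ξ, Complex.exp (-z * (2 * Real.pi * ‖ξ‖ : ℝ)) * (𝓕⁻ g ξ * 𝓕 h ξ) =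
      ∫ w : E d × E d, g w.1 * h w.2 * poissonKernel z (w.1 - w.2) := by
  have hgh : Integrable (fun w : E d × E d => g w.1 * h w.2) (volume.prod volume) :=
    hg.integrable.mul_prod hh.integrable
  have hz0 := integrable_poisson (V := E d) hz 0
  have hint : Integrable (fun q : (E d × E d) × E d => (g q.1.1 * h q.1.2) *
      (Complex.exp (-z * (2 * Real.pi * ‖q.2‖ : ℝ)) *
        Complex.exp (2 * Real.pi * Complex.I * (inner ℝ (q.1.1 - q.1.2) q.2 : ℝ))))
      ((volume.prod volume).prod volume) := by
    have hexp : Integrable fun ξ : E d => Complex.exp (-z * (2 * Real.pi * ‖ξ‖ : ℝ)) := by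
      simpa using hz0
    have h1 := hgh.mul_prod hexp
    have h2 := h1.mul_bdd (c := 1) (g := fun q : (E d × E d) × E d =>
      Complex.exp (2 * Real.pi * Complex.I * (inner ℝ (q.1.1 - q.1.2) q.2 : ℝ))) ?_ ?_
    · refine h2.congr (ae_of_all _ fun q => ?_)
      simp only; ring
    · exact Continuous.aestronglyMeasurable (by fun_prop)
    · exact ae_of_all _ fun q => (norm_cexp_two_pi_I_mul _).le
  have hswap := integral_integral_swap (f := fun (w : E d × E d) (ξ : E d) => (g w.1 * h w.2) *
      (Complex.exp (-z * (2 * Real.pi * ‖ξ‖ : ℝ)) *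
        Complex.exp (2 * Real.pi * Complex.I * (inner ℝ (w.1 - w.2) ξ : ℝ)))) hint
  rw [Measure.volume_eq_prod]
  refine Eq.trans ?_ (hswap.symm.trans ?_)
  · refine integral_congr_ae (ae_of_all _ fun ξ => ?_)
    simp only
    rw [Real.fourierInv_eq', Real.fourier_eq', ← integral_prod_mul, ← integral_const_mul]
    refine integral_congr_ae (ae_of_all _ fun w => ?_)
    simp only [smul_eq_mul]
    rw [inner_sub_left]
    have : Complex.exp (2 * Real.pi * Complex.I * ((inner ℝ w.1 ξ - inner ℝ w.2 ξ : ℝ) : ℂ))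
        = Complex.exp (((2 * Real.pi * inner ℝ w.1 ξ : ℝ) : ℂ) * Complex.I) *
          Complex.exp (((-2 * Real.pi * inner ℝ w.2 ξ : ℝ) : ℂ) * Complex.I) := by
      rw [← Complex.exp_add]; congr 1; push_cast; ring
    rw [this]; ring
  · refine integral_congr_ae (ae_of_all _ fun w => ?_)
    simp only
    rw [integral_const_mul, poissonKernel]

theorem measurable_poissonKernel {z : ℂ} : Measurable (poissonKernel z : E d → ℂ) := by
  have : StronglyMeasurable (fun x : E d => ∫ ξ : E d, Complex.exp (-z * (2 * Real.pi * ‖ξ‖ : ℝ)) *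
      Complex.exp (2 * Real.pi * Complex.I * (inner ℝ x ξ : ℝ))) := by
    refine StronglyMeasurable.integral_prod_right' (f := fun q : E d × E d =>
      Complex.exp (-z * (2 * Real.pi * ‖q.2‖ : ℝ)) *
      Complex.exp (2 * Real.pi * Complex.I * (inner ℝ q.1 q.2 : ℝ))) ?_
    exact Continuous.stronglyMeasurable (by fun_prop)
  exact this.measurable

/-- The `L^q → L^{q'}` bound of `exp(-z|∇|)`, `1/q = (1 + θ)/2`, in bilinear form. -/
theorem exists_norm_integral_cexp_mul_fourier_le [Nontrivial (E d)] {θ : ℝ} (hθ0 : 0 ≤ θ)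
    (hθ1 : θ ≤ 1) :
    ∃ C : ℝ, 0 < C ∧ ∀ (z : ℂ) (g h : E d → ℂ), 0 < z.re → IsBddFin volume g →
      IsBddFin volume h →
      ‖∫ ξ, Complex.exp (-z * (2 * Real.pi * ‖ξ‖ : ℝ)) * (𝓕⁻ g ξ * 𝓕 h ξ)‖ₑ
        ≤ ENNReal.ofReal (C * (‖z‖ ^ (-((d - 1) / 2 : ℝ)) * z.re ^ (-((d + 1) / 2 : ℝ))) ^ θ) *
          (∫⁻ x, ‖g x‖ₑ ^ (2 / (1 + θ))) ^ ((1 + θ) / 2) *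
          (∫⁻ x, ‖h x‖ₑ ^ (2 / (1 + θ))) ^ ((1 + θ) / 2) := by
  obtain ⟨C, hC, hP⟩ := exists_norm_poissonKernel_le (V := E d)
  have hq0 : 0 < 2 / (1 + θ) := by positivity
  refine ⟨4 * C ^ θ, by positivity, fun z g h hz hg hh => ?_⟩
  set A : ℝ := C * ‖z‖ ^ (-((d - 1) / 2 : ℝ)) * z.re ^ (-((d + 1) / 2 : ℝ)) with hA
  have hA0 : 0 ≤ A := by positivity
  have hkm : Measurable fun w : E d × E d => poissonKernel z (w.1 - w.2) :=
    measurable_poissonKernel.comp (measurable_fst.sub measurable_snd)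
  have hkA : ∀ w : E d × E d, ‖poissonKernel z (w.1 - w.2)‖ ≤ A := by
    intro w
    have := hP z (w.1 - w.2) hz
    rwa [finrank_euclideanSpace, Fintype.card_fin] at this
  have key := norm_integral_kernel_le hkm hA0 hkA (fun g h hg hh => by
    have h1 := norm_integral_cexp_mul_fourier_le_L2 hz.le hg hh
    rw [integral_cexp_mul_fourier_eq hz hg hh] at h1
    exact h1) hθ0 hθ1 hg hh
  rw [integral_cexp_mul_fourier_eq hz hg hh]
  have conv : ∀ f : E d → ℂ, IsBddFin volume f →
      ENNReal.ofReal ((∫ x, ‖f x‖ ^ (2 / (1 + θ))) ^ ((1 + θ) / 2))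
        = (∫⁻ x, ‖f x‖ₑ ^ (2 / (1 + θ))) ^ ((1 + θ) / 2) := by
    intro f hf
    have h0 : 0 ≤ ∫ x, ‖f x‖ ^ (2 / (1 + θ)) := integral_nonneg fun x => by positivity
    rw [← ENNReal.ofReal_rpow_of_nonneg h0 (by positivity),
      ofReal_integral_eq_lintegral_ofReal (hf.integrable_norm_rpow hq0)
        (ae_of_all _ fun x => by positivity)]
    congr 1
    refine lintegral_congr fun x => ?_
    rw [← ENNReal.ofReal_rpow_of_nonneg (norm_nonneg _) hq0.le, ofReal_norm]
  rw [← conv g hg, ← conv h hh, ← ENNReal.ofReal_mul (by positivity),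
    ← ENNReal.ofReal_mul (by
      have : 0 ≤ ∫ x, ‖g x‖ ^ (2 / (1 + θ)) := integral_nonneg fun x => by positivity
      positivity), ← ofReal_norm]
  refine ENNReal.ofReal_le_ofReal (key.trans (le_of_eq ?_))
  rw [hA, mul_assoc C, Real.mul_rpow hC.le (by positivity)]
  ring

/-- With `a = 4(d+1)/(3d)` and `b = 4(d-1)/(3d)` the integrand is a constant times `s^{1-a} |s +
iτ|^{-b}`. For `s ≤ |τ|` use `|s + iτ| ≥ |τ|`; integrability at `0` is `a < 2`, that is, `d > 2`.
For `s ≥ |τ|` use `|s + iτ| ≥ s`, which leaves `s^{1-a-b} = s^{-5/3}`. Both parts scale like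
`|τ|^{2-a-b} = |τ|^{-2/3}`. -/
theorem exists_lintegral_time_kernel_le (hd : 3 ≤ d) {C₀ : ℝ} (hC₀ : 0 ≤ C₀) :
    ∃ C : ℝ≥0∞, C ≠ ∞ ∧ ∀ τ : ℝ, τ ≠ 0 →
      ∫⁻ s in Ioi (0 : ℝ), ENNReal.ofReal s * ENNReal.ofReal (C₀ *
        (‖(s : ℂ) + τ * Complex.I‖ ^ (-((d - 1) / 2 : ℝ)) * s ^ (-((d + 1) / 2 : ℝ))) ^
          (8 / (3 * d) : ℝ)) ≤ C * ENNReal.ofReal (‖τ‖ ^ (-(2 / 3) : ℝ)) := by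
  have hd' : (3 : ℝ) ≤ d := by exact_mod_cast hd
  set a : ℝ := 4 * (d + 1) / (3 * d) with ha
  set b : ℝ := 4 * (d - 1) / (3 * d) with hb
  have hab : a + b = 8 / 3 := by rw [ha, hb]; field_simp; ring
  have ha2 : a < 2 := by rw [ha, div_lt_iff₀ (by positivity)]; linarith
  have hb0 : 0 ≤ b := by rw [hb]; exact div_nonneg (by linarith) (by linarith)
  have hint : ∀ L : ℝ, 0 < L → ∫⁻ s in Ioi L, ENNReal.ofReal (s ^ (-(5 / 3) : ℝ))
      = ENNReal.ofReal (3 / 2 * L ^ (-(2 / 3) : ℝ)) := by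
    intro L hL
    rw [← ofReal_integral_eq_lintegral_ofReal (integrableOn_Ioi_rpow_of_lt (by norm_num) hL),
      integral_Ioi_rpow_of_lt (by norm_num) hL]
    · congr 1; ring_nf
    · filter_upwards [self_mem_ae_restrict measurableSet_Ioi] with s hs
      exact Real.rpow_nonneg (hL.le.trans (le_of_lt hs)) _
  refine ⟨ENNReal.ofReal (C₀ * (1 / (2 - a) + 3 / 2)), ENNReal.ofReal_ne_top, fun τ hτ => ?_⟩
  have hτ0 : 0 < |τ| := abs_pos.2 hτ
  have hpt : ∀ s ∈ Ioi (0 : ℝ), ∀ m : ℝ, 0 < m → m ≤ ‖(s : ℂ) + τ * Complex.I‖ →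
      ENNReal.ofReal s * ENNReal.ofReal (C₀ *
        (‖(s : ℂ) + τ * Complex.I‖ ^ (-((d - 1) / 2 : ℝ)) * s ^ (-((d + 1) / 2 : ℝ))) ^
          (8 / (3 * d) : ℝ)) ≤ ENNReal.ofReal (C₀ * m ^ (-b)) * ENNReal.ofReal (s ^ (1 - a)) := by
    intro s (hs : 0 < s) m hm hms
    rw [← ENNReal.ofReal_mul hs.le, ← ENNReal.ofReal_mul (by positivity)]
    refine ENNReal.ofReal_le_ofReal ?_
    rw [Real.mul_rpow (by positivity) (by positivity), ← Real.rpow_mul (norm_nonneg _),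
      ← Real.rpow_mul hs.le]
    have e1 : -((d - 1) / 2 : ℝ) * (8 / (3 * d)) = -b := by rw [hb]; field_simp; ring
    have e2 : -((d + 1) / 2 : ℝ) * (8 / (3 * d)) = -a := by rw [ha]; field_simp; ring
    rw [e1, e2, sub_eq_add_neg, Real.rpow_add hs, Real.rpow_one]
    have : ‖(s : ℂ) + τ * Complex.I‖ ^ (-b) ≤ m ^ (-b) :=
      Real.rpow_le_rpow_of_nonpos hm hms (by linarith)
    calc s * (C₀ * (‖(s : ℂ) + τ * Complex.I‖ ^ (-b) * s ^ (-a)))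
        ≤ s * (C₀ * (m ^ (-b) * s ^ (-a))) := by gcongr
      _ = _ := by ring
  have hre : ∀ s : ℝ, s ≤ ‖(s : ℂ) + τ * Complex.I‖ := fun s => by
    have := Complex.re_le_norm ((s : ℂ) + τ * Complex.I)
    simpa using this
  have him : ∀ s : ℝ, |τ| ≤ ‖(s : ℂ) + τ * Complex.I‖ := fun s => by
    have := Complex.abs_im_le_norm ((s : ℂ) + τ * Complex.I)
    simpa using this
  rw [← Ioc_union_Ioi_eq_Ioi hτ0.le, lintegral_union measurableSet_Ioi
    (Ioc_disjoint_Ioi le_rfl)]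
  calc _ ≤ (∫⁻ s in Ioc 0 |τ|, ENNReal.ofReal (C₀ * |τ| ^ (-b)) * ENNReal.ofReal (s ^ (1 - a)))
        + ∫⁻ s in Ioi |τ|, ENNReal.ofReal C₀ * ENNReal.ofReal (s ^ (-(5 / 3) : ℝ)) := by
        refine add_le_add (setLIntegral_mono' measurableSet_Ioc fun s hs => ?_)
          (setLIntegral_mono' measurableSet_Ioi fun s hs => ?_)
        · exact hpt s hs.1 _ hτ0 (him s)
        · have hs0 : 0 < s := hτ0.trans hs
          refine (hpt s hs0 s hs0 (hre s)).trans (le_of_eq ?_)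
          rw [ENNReal.ofReal_mul hC₀, mul_assoc, ← ENNReal.ofReal_mul (by positivity),
            ← Real.rpow_add hs0]
          congr 3; linarith
    _ = ENNReal.ofReal (C₀ * |τ| ^ (-b) * (|τ| ^ (2 - a) / (2 - a)))
        + ENNReal.ofReal (C₀ * (3 / 2 * |τ| ^ (-(2 / 3) : ℝ))) := by
        rw [lintegral_const_mul _ (by fun_prop), lintegral_const_mul _ (by fun_prop),
          setLIntegral_Ioc_rpow (by linarith) hτ0, hint _ hτ0, ← ENNReal.ofReal_mul (by positivity),
          ← ENNReal.ofReal_mul hC₀]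
        congr 4 <;> ring_nf
    _ ≤ _ := by
        have h2a : 0 < 2 - a := by linarith
        rw [← ENNReal.ofReal_add (by positivity) (by positivity), ← ENNReal.ofReal_mul (by positivity),
          Real.norm_eq_abs]
        refine ENNReal.ofReal_le_ofReal (le_of_eq ?_)
        have : |τ| ^ (-b) * |τ| ^ (2 - a) = |τ| ^ (-(2 / 3) : ℝ) := by
          rw [← Real.rpow_add hτ0]; congr 1; linarith
        rw [← this]; field_simp

/-- With `c = 2π|ξ|` this writes `|∇|⁻²` as a superposition of the damping factors `exp(-s|∇|)`. The
damping parameter plays the part usually played by dyadic frequencies. -/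
theorem lintegral_mul_exp_neg {c : ℝ} (hc : 0 < c) :
    ∫⁻ s in Ioi (0 : ℝ), ENNReal.ofReal s * ENNReal.ofReal (Real.exp (-s * c))
      = ENNReal.ofReal ((1 / c) ^ 2) := by
  have h := Real.integral_rpow_mul_exp_neg_mul_Ioi (a := 2) two_pos hc
  rw [Real.Gamma_two, mul_one, Real.rpow_two] at h
  rw [← h, ofReal_integral_eq_lintegral_ofReal]
  · refine setLIntegral_congr_fun measurableSet_Ioi fun s (hs : 0 < s) => ?_
    rw [← ENNReal.ofReal_mul hs.le]
    congr 2
    · norm_num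
    · congr 1; ring
  · have h3 : 0 < ((1 / c) ^ 2) := by positivity
    by_contra h4
    rw [integral_undef h4] at h
    linarith
  · filter_upwards [self_mem_ae_restrict measurableSet_Ioi] with s hs
    have : (0 : ℝ) < s := hs
    positivity

/-- Bounded measurable functions on space-time with bounded support. -/
structure IsTestFn (G : ℝ → E d → ℝ) : Prop where
  measurable : Measurable (Function.uncurry G)
  bounded : ∃ M : ℝ, ∀ t x, |G t x| ≤ M
  support : ∃ R : ℝ, ∀ t x, G t x ≠ 0 → |t| ≤ R ∧ ‖x‖ ≤ R

theorem IsTestFn.slice {G : ℝ → E d → ℝ} (hG : IsTestFn G) (t : ℝ) :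
    IsBddFin volume fun x => (G t x : ℂ) := by
  obtain ⟨M, hM⟩ := hG.bounded
  obtain ⟨R, hR⟩ := hG.support
  refine ⟨Complex.measurable_ofReal.comp (hG.measurable.comp measurable_prodMk_left),
    ⟨M, fun x => by simpa using hM t x⟩, lt_of_le_of_lt (measure_mono ?_)
      (measure_closedBall_lt_top (x := (0 : E d)) (r := R))⟩
  intro x hx
  rw [Function.mem_support] at hx
  simpa using (hR t x (by simpa using hx)).2

/-- The space-time Fourier transform of `G` at the frequencies `(-σ|ξ|, -ξ)` of the cone. -/
def coneFourier (σ : ℝ) (G : ℝ → E d → ℝ) (ξ : E d) : ℂ :=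
  ∫ t : ℝ, Complex.exp (2 * Real.pi * Complex.I * (σ * t * ‖ξ‖ : ℝ)) *
    𝓕⁻ (fun x => (G t x : ℂ)) ξ

theorem conj_cexp_two_pi_I_mul (r : ℝ) :
    conj (Complex.exp (2 * Real.pi * Complex.I * (r : ℂ)))
      = Complex.exp (2 * Real.pi * Complex.I * ((-r : ℝ) : ℂ)) := by
  have : 2 * Real.pi * Complex.I * (r : ℂ) = ((2 * Real.pi * r : ℝ) : ℂ) * Complex.I := by
    push_cast; ring
  rw [this, ← Complex.exp_conj, map_mul, Complex.conj_ofReal, Complex.conj_I]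
  congr 1
  push_cast; ring

theorem conj_fourierInv_ofReal (g : E d → ℝ) (ξ : E d) :
    conj (𝓕⁻ (fun x => (g x : ℂ)) ξ) = 𝓕 (fun x => (g x : ℂ)) ξ := by
  rw [Real.fourierInv_eq', Real.fourier_eq', ← integral_conj]
  refine integral_congr_ae (ae_of_all _ fun x => ?_)
  simp only [smul_eq_mul, map_mul, Complex.conj_ofReal, ← Complex.exp_conj, Complex.conj_I]
  congr 2
  push_cast; ring

theorem stronglyMeasurable_fourierInv_slices {G : ℝ → E d → ℂ}
    (hG : Measurable (Function.uncurry G)) :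
    StronglyMeasurable fun q : ℝ × E d => 𝓕⁻ (G q.1) q.2 := by
  simp_rw [Real.fourierInv_eq']
  refine StronglyMeasurable.integral_prod_right' (f := fun q : (ℝ × E d) × E d =>
    Complex.exp (((2 * Real.pi * inner ℝ q.2 q.1.2 : ℝ) : ℂ) * Complex.I) • G q.1.1 q.2) ?_
  have h1 : StronglyMeasurable fun q : (ℝ × E d) × E d =>
      Complex.exp (((2 * Real.pi * inner ℝ q.2 q.1.2 : ℝ) : ℂ) * Complex.I) :=
    Continuous.stronglyMeasurable (by fun_prop)
  refine h1.smul ?_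
  exact (hG.comp ((measurable_fst.comp measurable_fst).prodMk measurable_snd)).stronglyMeasurable

theorem IsTestFn.measurable_ofReal {G : ℝ → E d → ℝ} (hG : IsTestFn G) :
    Measurable (Function.uncurry fun t x => (G t x : ℂ)) :=
  Complex.measurable_ofReal.comp hG.measurable

theorem IsTestFn.exists_norm_fourierInv_le {G : ℝ → E d → ℝ} (hG : IsTestFn G) :
    ∃ K R : ℝ, 0 ≤ K ∧ ∀ t ξ, ‖𝓕⁻ (fun x => (G t x : ℂ)) ξ‖ ≤ (Icc (-R) R).indicator (fun _ => K) t := by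
  obtain ⟨M, hM⟩ := hG.bounded
  obtain ⟨R, hR⟩ := hG.support
  have hM0 : 0 ≤ M := (abs_nonneg _).trans (hM 0 0)
  refine ⟨∫ x in Metric.closedBall (0 : E d) R, M, R, integral_nonneg fun x => hM0, fun t ξ => ?_⟩
  have h1 : ‖𝓕⁻ (fun x => (G t x : ℂ)) ξ‖ ≤ ∫ x, ‖(G t x : ℂ)‖ := by
    rw [Real.fourierInv_eq_fourier_neg]
    exact VectorFourier.norm_fourierIntegral_le_integral_norm _ _ _ _ _
  refine h1.trans ?_
  by_cases ht : t ∈ Icc (-R) R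
  · rw [indicator_of_mem ht, ← integral_indicator measurableSet_closedBall]
    refine integral_mono (hG.slice t).integrable.norm ?_ fun x => ?_
    · exact (integrable_indicator_iff measurableSet_closedBall).2
        (integrableOn_const measure_closedBall_lt_top.ne)
    · by_cases hx : G t x = 0
      · simp only [hx, Complex.ofReal_zero, norm_zero]
        exact indicator_nonneg (fun _ _ => hM0) x
      · rw [indicator_of_mem (by simpa using (hR t x hx).2)]
        simpa using hM t x
  · rw [indicator_of_notMem ht]
    have : ∀ x, G t x = 0 := fun x => by
      by_contra hx
      exact ht (abs_le.1 (hR t x hx).1)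
    simp [this]

theorem IsTestFn.integrable_fourierInv {G : ℝ → E d → ℝ} (hG : IsTestFn G) (ξ : E d) :
    Integrable fun t => 𝓕⁻ (fun x => (G t x : ℂ)) ξ := by
  obtain ⟨K, R, hK, h⟩ := hG.exists_norm_fourierInv_le
  refine Integrable.mono' (g := (Icc (-R) R).indicator fun _ => K) ?_ ?_ (ae_of_all _ fun t => h t ξ)
  · exact (integrable_indicator_iff measurableSet_Icc).2 (integrableOn_const (by simp))
  · exact ((stronglyMeasurable_fourierInv_slices hG.measurable_ofReal).comp_measurable
      measurable_prodMk_right).aestronglyMeasurable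

/-- The `TT*` expansion: the square of the time integral is a double time integral, and Fubini moves
the frequency integral inside before absolute values are taken, so its oscillation is not lost. -/
theorem lintegral_mul_enorm_integral_sq_le {α β : Type*} [MeasurableSpace α] [MeasurableSpace β]
    {μ : Measure α} {ν : Measure β} [SFinite μ] [SFinite ν] {H : α → β → ℂ}
    (hH : Measurable (Function.uncurry H)) {k : α → ℝ} (hk : Integrable k μ)
    (hHk : ∀ t ξ, ‖H t ξ‖ ≤ k t) {w : β → ℝ} (hw : Measurable w) (hw0 : ∀ ξ, 0 ≤ w ξ)
    (hwi : Integrable w ν) :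
    ∫⁻ ξ, ENNReal.ofReal (w ξ) * ‖∫ t, H t ξ ∂μ‖ₑ ^ 2 ∂ν ≤
      ∫⁻ t, ∫⁻ t', ‖∫ ξ, (w ξ : ℂ) * (H t ξ * conj (H t' ξ)) ∂ν‖ₑ ∂μ ∂μ := by
  have hsq : ∀ ξ, ((‖∫ t, H t ξ ∂μ‖ ^ 2 : ℝ) : ℂ)
      = ∫ p : α × α, H p.1 ξ * conj (H p.2 ξ) ∂(μ.prod μ) := by
    intro ξ
    rw [integral_prod_mul (fun t => H t ξ) (fun t => conj (H t ξ)), integral_conj,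
      Complex.mul_conj, Complex.normSq_eq_norm_sq]
  have hint : Integrable (fun q : β × (α × α) =>
      (w q.1 : ℂ) * (H q.2.1 q.1 * conj (H q.2.2 q.1))) (ν.prod (μ.prod μ)) := by
    refine Integrable.mono' (hwi.mul_prod (hk.mul_prod hk)) ?_ (ae_of_all _ fun q => ?_)
    · have m1 : Measurable fun q : β × (α × α) => H q.2.1 q.1 :=
        hH.comp ((measurable_fst.comp measurable_snd).prodMk measurable_fst)
      have m2 : Measurable fun q : β × (α × α) => H q.2.2 q.1 :=
        hH.comp ((measurable_snd.comp measurable_snd).prodMk measurable_fst)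
      have mc : Measurable (fun z : ℂ => conj z) := Complex.continuous_conj.measurable
      exact ((Complex.measurable_ofReal.comp (hw.comp measurable_fst)).mul
        (m1.mul (mc.comp m2))).aestronglyMeasurable
    · rw [norm_mul, norm_mul, RCLike.norm_conj, Complex.norm_real, Real.norm_of_nonneg (hw0 _)]
      have := hw0 q.1
      have := (norm_nonneg _).trans (hHk q.2.1 q.1)
      gcongr
      · exact hHk _ _
      · exact hHk _ _
  have hval : (∫ ξ, ((w ξ * ‖∫ t, H t ξ ∂μ‖ ^ 2 : ℝ) : ℂ) ∂ν)
      = ∫ p : α × α, ∫ ξ, (w ξ : ℂ) * (H p.1 ξ * conj (H p.2 ξ)) ∂ν ∂(μ.prod μ) := by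
    rw [← integral_integral_swap (f := fun (ξ : β) (p : α × α) =>
      (w ξ : ℂ) * (H p.1 ξ * conj (H p.2 ξ))) hint]
    refine integral_congr_ae (ae_of_all _ fun ξ => ?_)
    simp only
    rw [integral_const_mul, ← hsq]
    push_cast; rfl
  have hreal : Integrable (fun ξ => w ξ * ‖∫ t, H t ξ ∂μ‖ ^ 2) ν := by
    refine (hint.integral_prod_left.re).congr (ae_of_all _ fun ξ => ?_)
    simp only
    rw [integral_const_mul, ← hsq, ← Complex.ofReal_mul]
    exact Complex.ofReal_re _
  have hL : ∫⁻ ξ, ENNReal.ofReal (w ξ) * ‖∫ t, H t ξ ∂μ‖ₑ ^ 2 ∂ν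
      = ‖∫ ξ, ((w ξ * ‖∫ t, H t ξ ∂μ‖ ^ 2 : ℝ) : ℂ) ∂ν‖ₑ := by
    rw [integral_complex_ofReal, ← ofReal_norm, Complex.norm_real, Real.norm_of_nonneg
      (integral_nonneg fun ξ => mul_nonneg (hw0 ξ) (by positivity)),
      ofReal_integral_eq_lintegral_ofReal hreal
      (ae_of_all _ fun ξ => mul_nonneg (hw0 ξ) (by positivity))]
    refine lintegral_congr fun ξ => ?_
    rw [ENNReal.ofReal_mul (hw0 ξ), ENNReal.ofReal_pow (norm_nonneg _), ofReal_norm]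
  rw [hL, hval]
  refine (enorm_integral_le_lintegral_enorm _).trans (le_of_eq ?_)
  rw [lintegral_prod]
  exact AEStronglyMeasurable.enorm hint.integral_prod_right.aestronglyMeasurable

/-- The damping and the two half-wave phases combine into the single multiplier `exp(-z|∇|)` with `z
= s - iσ(t - t')`, `Re z = s > 0`. -/
theorem lintegral_exp_mul_coneFourier_le [Nontrivial (E d)] {σ : ℝ} {s : ℝ}
    (hs : 0 < s) {G : ℝ → E d → ℝ} (hG : IsTestFn G) :
    ∫⁻ ξ, ENNReal.ofReal (Real.exp (-s * (2 * Real.pi * ‖ξ‖))) * ‖coneFourier σ G ξ‖ₑ ^ 2 ≤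
      ∫⁻ t, ∫⁻ t', ‖∫ ξ, Complex.exp (-((s : ℂ) + (-(σ * (t - t')) : ℝ) * Complex.I) *
        (2 * Real.pi * ‖ξ‖ : ℝ)) *
        (𝓕⁻ (fun x => (G t x : ℂ)) ξ * 𝓕 (fun x => (G t' x : ℂ)) ξ)‖ₑ := by
  obtain ⟨K, R, hK, hbd⟩ := hG.exists_norm_fourierInv_le
  have hm1 : Measurable fun q : ℝ × E d =>
      Complex.exp (2 * Real.pi * Complex.I * (σ * q.1 * ‖q.2‖ : ℝ)) :=
    Continuous.measurable (by fun_prop)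
  have key := lintegral_mul_enorm_integral_sq_le (μ := (volume : Measure ℝ))
    (ν := (volume : Measure (E d)))
    (H := fun t ξ => Complex.exp (2 * Real.pi * Complex.I * (σ * t * ‖ξ‖ : ℝ)) *
      𝓕⁻ (fun x => (G t x : ℂ)) ξ) (k := (Icc (-R) R).indicator fun _ => K)
    (w := fun ξ => Real.exp (-s * (2 * Real.pi * ‖ξ‖)))
    (hm1.mul (stronglyMeasurable_fourierInv_slices hG.measurable_ofReal).measurable)
    ((integrable_indicator_iff measurableSet_Icc).2 (integrableOn_const (by simp)))
    (fun t ξ => by rw [norm_mul, norm_cexp_two_pi_I_mul, one_mul]; exact hbd t ξ)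
    (Continuous.measurable (by fun_prop)) (fun ξ => Real.exp_nonneg _)
    (integrable_exp_neg_mul_norm hs)
  refine key.trans (le_of_eq ?_)
  refine lintegral_congr fun t => lintegral_congr fun t' => ?_
  congr 1
  refine integral_congr_ae (ae_of_all _ fun ξ => ?_)
  simp only
  rw [map_mul, conj_fourierInv_ofReal, conj_cexp_two_pi_I_mul]
  have : Complex.exp (-((s : ℂ) + (-(σ * (t - t')) : ℝ) * Complex.I) *
    (2 * Real.pi * ‖ξ‖ : ℝ)) = (Real.exp (-s * (2 * Real.pi * ‖ξ‖)) : ℂ) *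
      (Complex.exp (2 * Real.pi * Complex.I * (σ * t * ‖ξ‖ : ℝ)) *
        Complex.exp (2 * Real.pi * Complex.I * ((-(σ * t' * ‖ξ‖) : ℝ) : ℂ))) := by
    rw [Complex.ofReal_exp, ← Complex.exp_add, ← Complex.exp_add]
    congr 1
    push_cast; ring
  rw [this]; ring

theorem IsTestFn.measurable_coneFourier {G : ℝ → E d → ℝ} (hG : IsTestFn G) {σ : ℝ} :
    Measurable (coneFourier σ G) := by
  have h2 := (stronglyMeasurable_fourierInv_slices hG.measurable_ofReal).comp_measurable
    (measurable_swap (α := E d) (β := ℝ))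
  have h1 : StronglyMeasurable fun p : E d × ℝ =>
      Complex.exp (2 * Real.pi * Complex.I * (σ * p.2 * ‖p.1‖ : ℝ)) :=
    Continuous.stronglyMeasurable (by fun_prop)
  exact (StronglyMeasurable.integral_prod_right' (h1.mul h2)).measurable

theorem lintegral_mul_lintegral_kernel {κ : ℝ → ℝ → ℝ≥0∞}
    (hκ : Measurable fun p : ℝ × ℝ => κ p.1 p.2) {γ : ℝ → ℝ≥0∞} (hγ : Measurable γ) (σ : ℝ) :
    ∫⁻ s in Ioi (0 : ℝ), ENNReal.ofReal s *
        ∫⁻ t, ∫⁻ t', κ s (-(σ * (t - t'))) * (γ t * γ t') =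
      ∫⁻ t, ∫⁻ t', (∫⁻ s in Ioi (0 : ℝ), ENNReal.ofReal s * κ s (-(σ * (t - t')))) *
        (γ t * γ t') := by
  have m0 : Measurable fun p : (ℝ × ℝ) × ℝ => κ p.1.1 (-(σ * (p.1.2 - p.2))) *
      (γ p.1.2 * γ p.2) := by
    refine Measurable.mul ?_ ?_
    · exact hκ.comp (f := fun p : (ℝ × ℝ) × ℝ => (p.1.1, -(σ * (p.1.2 - p.2)))) (by fun_prop)
    · exact (hγ.comp (measurable_snd.comp measurable_fst)).mul (hγ.comp measurable_snd)
  have m1 : Measurable fun p : ℝ × ℝ => ∫⁻ t', κ p.1 (-(σ * (p.2 - t'))) * (γ p.2 * γ t') :=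
    m0.lintegral_prod_right'
  have step : ∀ s, ENNReal.ofReal s * ∫⁻ t, ∫⁻ t', κ s (-(σ * (t - t'))) * (γ t * γ t')
      = ∫⁻ t, ENNReal.ofReal s * ∫⁻ t', κ s (-(σ * (t - t'))) * (γ t * γ t') := fun s =>
    (lintegral_const_mul _ (m1.comp measurable_prodMk_left)).symm
  simp_rw [step]
  rw [lintegral_lintegral_swap ((ENNReal.measurable_ofReal.comp measurable_fst).mul
    m1).aemeasurable]
  refine lintegral_congr fun t => ?_
  have m2 : ∀ s, Measurable fun t' => κ s (-(σ * (t - t'))) * (γ t * γ t') := fun s =>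
    m0.comp (measurable_prodMk_left (x := (s, t)))
  have step2 : ∀ s, ENNReal.ofReal s * ∫⁻ t', κ s (-(σ * (t - t'))) * (γ t * γ t')
      = ∫⁻ t', ENNReal.ofReal s * (κ s (-(σ * (t - t'))) * (γ t * γ t')) := fun s =>
    (lintegral_const_mul _ (m2 s)).symm
  simp_rw [step2]
  rw [lintegral_lintegral_swap]
  · refine lintegral_congr fun t' => ?_
    simp_rw [← mul_assoc (ENNReal.ofReal _)]
    rw [lintegral_mul_const]
    exact ENNReal.measurable_ofReal.mul (hκ.comp measurable_prodMk_right)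
  · refine Measurable.aemeasurable ?_
    exact (ENNReal.measurable_ofReal.comp measurable_fst).mul
      (m0.comp (f := fun p : ℝ × ℝ => (((p.1, t), p.2) : (ℝ × ℝ) × ℝ)) (by fun_prop))

/-- The dual form of the homogeneous Strichartz estimate for the half-wave propagators
`exp(±it|∇|)/|∇|` with the exponents of `X(I)`. -/
theorem exists_dualStrichartz (hd : 3 ≤ d) :
    ∃ C : ℝ≥0∞, C ≠ ∞ ∧ ∀ σ : ℝ, |σ| = 1 → ∀ G : ℝ → E d → ℝ, IsTestFn G →
      ∫⁻ ξ, ENNReal.ofReal ((1 / (2 * Real.pi * ‖ξ‖)) ^ 2) * ‖coneFourier σ G ξ‖ₑ ^ 2 ≤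
        C * (∫⁻ t, (∫⁻ x, ‖G t x‖ₑ ^ (6 * d / (3 * d + 8) : ℝ)) ^
          ((3 * d + 8) / (6 * d) * (3 / 2) : ℝ)) ^ (4 / 3 : ℝ) := by
  have hd' : (3 : ℝ) ≤ d := by exact_mod_cast hd
  have : Nontrivial (E d) := by
    refine Module.nontrivial_of_finrank_pos (R := ℝ) ?_
    rw [finrank_euclideanSpace, Fintype.card_fin]; omega
  -- This `θ` gives `(1 + θ)/2 = (3d + 8)/(6d)`, the reciprocal of the exponent conjugate to `6d/(3d
  -- - 8)`; `θ ≤ 1` since `d ≥ 3`.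
  obtain ⟨C₀, hC₀, hker⟩ := exists_norm_integral_cexp_mul_fourier_le (d := d)
    (θ := 8 / (3 * d)) (by positivity) (by rw [div_le_one (by positivity)]; linarith)
  obtain ⟨C₁, hC₁, htime⟩ := exists_lintegral_time_kernel_le hd hC₀.le
  -- On the time axis `2/3 + 2/3 = 2 - 2/3`, and `3/2` is the exponent conjugate to the `3` of
  -- `X(I)`.
  obtain ⟨C₂, hC₂, hhls⟩ := exists_lintegral_riesz_le (V := ℝ) volume (s := 2 / 3) (p := 3 / 2)
    (r := 3 / 2) (by norm_num) (by norm_num) (by norm_num) (by norm_num) (by norm_num)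
  refine ⟨C₁ * C₂, ENNReal.mul_ne_top hC₁ hC₂, fun σ hσ G hG => ?_⟩
  have e1 : 2 / (1 + 8 / (3 * d : ℝ)) = 6 * d / (3 * d + 8) := by field_simp; ring
  have e2 : (1 + 8 / (3 * d : ℝ)) / 2 = (3 * d + 8) / (6 * d) := by field_simp; ring
  rw [e1, e2] at hker
  set q : ℝ := 6 * d / (3 * d + 8) with hq
  set γ : ℝ → ℝ≥0∞ := fun t => (∫⁻ x, ‖G t x‖ₑ ^ q) ^ ((3 * d + 8) / (6 * d) : ℝ) with hγ
  have hγm : Measurable γ := by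
    refine Measurable.pow_const (Measurable.lintegral_prod_right' (f := fun p : ℝ × E d =>
      ‖G p.1 p.2‖ₑ ^ q) ?_) _
    exact hG.measurable.enorm.pow_const q
  have hne : ∀ᵐ ξ : E d, ξ ≠ 0 := by
    rw [ae_iff]; simp
  have hCm : Measurable fun ξ => ‖coneFourier σ G ξ‖ₑ ^ 2 := by
    exact Measurable.pow_const hG.measurable_coneFourier.enorm _
  set κ : ℝ → ℝ → ℝ≥0∞ := fun s τ => ENNReal.ofReal (C₀ *
        (‖(s : ℂ) + τ * Complex.I‖ ^ (-((d - 1) / 2 : ℝ)) * s ^ (-((d + 1) / 2 : ℝ))) ^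
          (8 / (3 * d) : ℝ)) with hκ
  have hκm : Measurable fun p : ℝ × ℝ => κ p.1 p.2 := by
    simp only [hκ]
    fun_prop
  have hI : ∀ s ∈ Ioi (0 : ℝ),
      ∫⁻ ξ, ENNReal.ofReal (Real.exp (-s * (2 * Real.pi * ‖ξ‖))) * ‖coneFourier σ G ξ‖ₑ ^ 2
        ≤ ∫⁻ t, ∫⁻ t', κ s (-(σ * (t - t'))) * (γ t * γ t') := by
    intro s (hs : 0 < s)
    refine (lintegral_exp_mul_coneFourier_le hs hG).trans ?_
    refine lintegral_mono fun t => lintegral_mono fun t' => ?_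
    have h := hker ((s : ℂ) + (-(σ * (t - t')) : ℝ) * Complex.I) _ _ (by simpa using hs)
      (hG.slice t) (hG.slice t')
    refine h.trans (le_of_eq ?_)
    have hre : ((s : ℂ) + (-(σ * (t - t')) : ℝ) * Complex.I).re = s := by simp
    rw [hre, mul_assoc]
    simp only [hκ, hγ, ← ofReal_norm, Complex.norm_real]
  calc ∫⁻ ξ, ENNReal.ofReal ((1 / (2 * Real.pi * ‖ξ‖)) ^ 2) * ‖coneFourier σ G ξ‖ₑ ^ 2
      = ∫⁻ ξ, ∫⁻ s in Ioi (0 : ℝ), ENNReal.ofReal s *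
          ENNReal.ofReal (Real.exp (-s * (2 * Real.pi * ‖ξ‖))) * ‖coneFourier σ G ξ‖ₑ ^ 2 := by
        refine lintegral_congr_ae ?_
        filter_upwards [hne] with ξ hξ
        have : 0 < ‖ξ‖ := norm_pos_iff.2 hξ
        rw [lintegral_mul_const _ (by fun_prop), lintegral_mul_exp_neg (by positivity)]
    _ = ∫⁻ s in Ioi (0 : ℝ), ENNReal.ofReal s *
          ∫⁻ ξ, ENNReal.ofReal (Real.exp (-s * (2 * Real.pi * ‖ξ‖))) * ‖coneFourier σ G ξ‖ₑ ^ 2 := by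
        rw [lintegral_lintegral_swap]
        · refine lintegral_congr fun s => ?_
          simp_rw [mul_assoc]
          rw [lintegral_const_mul _ (by fun_prop)]
        · refine Measurable.aemeasurable ?_
          have : Measurable fun p : E d × ℝ => ‖coneFourier σ G p.1‖ₑ ^ 2 := hCm.comp measurable_fst
          refine Measurable.mul ?_ this
          fun_prop
    _ ≤ ∫⁻ s in Ioi (0 : ℝ), ENNReal.ofReal s *
          ∫⁻ t, ∫⁻ t', κ s (-(σ * (t - t'))) * (γ t * γ t') := by
        refine setLIntegral_mono' measurableSet_Ioi fun s hs => ?_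
        gcongr
        exact hI s hs
    _ = ∫⁻ t, ∫⁻ t', (∫⁻ s in Ioi (0 : ℝ), ENNReal.ofReal s * κ s (-(σ * (t - t')))) *
          (γ t * γ t') := lintegral_mul_lintegral_kernel hκm hγm σ
    _ ≤ ∫⁻ t, ∫⁻ t', C₁ * (γ t * ENNReal.ofReal (‖t - t'‖ ^ (-(2 / 3) : ℝ)) * γ t') := by
        refine lintegral_mono fun t => lintegral_mono_ae ?_
        have hnet : ∀ᵐ t' : ℝ, t' ≠ t := by
          rw [ae_iff]; simp
        filter_upwards [hnet] with t' ht'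
        have hτ : -(σ * (t - t')) ≠ 0 := by
          have : σ ≠ 0 := by rintro rfl; simp at hσ
          exact neg_ne_zero.2 (mul_ne_zero this (sub_ne_zero.2 ht'.symm))
        have h := htime _ hτ
        have hn : ‖-(σ * (t - t'))‖ = ‖t - t'‖ := by
          rw [norm_neg, norm_mul, Real.norm_eq_abs, hσ, one_mul]
        rw [hn] at h
        calc _ ≤ C₁ * ENNReal.ofReal (‖t - t'‖ ^ (-(2 / 3) : ℝ)) * (γ t * γ t') := by
              gcongr
          _ = _ := by ring
    _ = C₁ * ∫⁻ t, ∫⁻ t', γ t * ENNReal.ofReal (‖t - t'‖ ^ (-(2 / 3) : ℝ)) * γ t' := by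
        simp_rw [lintegral_const_mul' _ _ hC₁]
    _ ≤ C₁ * (C₂ * (∫⁻ t, γ t ^ (3 / 2 : ℝ)) ^ (1 / (3 / 2) : ℝ) *
          (∫⁻ t, γ t ^ (3 / 2 : ℝ)) ^ (1 / (3 / 2) : ℝ)) := by
        gcongr
        exact hhls γ γ hγm hγm
    _ = _ := by
        rw [mul_assoc C₂, ← ENNReal.rpow_add_of_nonneg _ _ (by norm_num) (by norm_num), ← mul_assoc]
        congr 2
        · refine lintegral_congr fun t => ?_
          rw [hγ]; simp only
          rw [← ENNReal.rpow_mul]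
        · norm_num

end DualStrichartz

/-! ### Jointly measurable functions with prescribed Fourier transforms -/

section Realization

variable {d : ℕ}

theorem ae_tendsto_zero_of_tsum_lintegral_ne_top {α : Type*} [MeasurableSpace α] {μ : Measure α}
    {f : ℕ → α → ℝ≥0∞} (hf : ∀ n, AEMeasurable (f n) μ) (h : ∑' n, ∫⁻ x, f n x ∂μ ≠ ∞) :
    ∀ᵐ x ∂μ, Tendsto (fun n => f n x) atTop (𝓝 0) := by
  rw [← lintegral_tsum hf] at h
  filter_upwards [ae_lt_top' (AEMeasurable.tsum hf) h] with x hx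
  exact ENNReal.tendsto_atTop_zero_of_tsum_ne_top hx.ne

theorem lintegral_enorm_sq_eq {α F : Type*} [MeasurableSpace α] {μ : Measure α}
    [NormedAddCommGroup F] (f : α → F) : ∫⁻ x, ‖f x‖ₑ ^ 2 ∂μ = eLpNorm f 2 μ ^ 2 := by
  rw [eLpNorm_eq_lintegral_rpow_enorm_toReal two_ne_zero ENNReal.ofNat_ne_top,
    ← ENNReal.rpow_natCast, ← ENNReal.rpow_mul]
  simp

theorem integrable_indicator_closedBall_of_memLp {g : E d → ℂ} (hg : MemLp g 2 volume) (r : ℝ) :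
    Integrable ((Metric.closedBall (0 : E d) r).indicator g) volume := by
  rw [integrable_indicator_iff measurableSet_closedBall]
  have : IsFiniteMeasure (volume.restrict (Metric.closedBall (0 : E d) r)) :=
    isFiniteMeasure_restrict.2 measure_closedBall_lt_top.ne
  exact (hg.restrict _).integrable one_le_two

/-- The `L²` Fourier inverse is defined for each time separately, up to null sets, so measurability
in `(t, x)` must be arranged. The inverse transform of a frequency truncation is an absolutely
convergent integral, measurable in both variables; if the truncations converge fast enough in `L²`,
their pointwise limit is a measurable representative. -/
theorem exists_measurable_isFT_of_memLp {g : ℝ → E d → ℂ} (hg : Measurable (Function.uncurry g))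
    (h2 : ∀ t, MemLp (g t) 2 volume) :
    ∃ u : ℝ → E d → ℂ, Measurable (Function.uncurry u) ∧ ∀ t, IsFT (u t) (g t) := by
  classical
  let A : ℕ → ℝ → ℝ≥0∞ := fun n t =>
    ∫⁻ ξ, ‖(if ‖ξ‖ ≤ n then g t ξ else 0) - g t ξ‖ₑ ^ 2
  have hAm : ∀ n, Measurable (A n) := fun n => by
    refine Measurable.lintegral_prod_right' (f := fun q : ℝ × E d =>
      ‖(if ‖q.2‖ ≤ n then g q.1 q.2 else 0) - g q.1 q.2‖ₑ ^ 2) ?_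
    refine Measurable.pow_const (Measurable.enorm (Measurable.sub ?_ hg)) 2
    exact Measurable.ite (measurableSet_le (by fun_prop) measurable_const) hg measurable_const
  have hA0 : ∀ t, Tendsto (fun n => A n t) atTop (𝓝 0) := fun t => by
    have hgt : Measurable (g t) := hg.comp measurable_prodMk_left
    have := tendsto_lintegral_of_dominated_convergence (μ := (volume : Measure (E d)))
      (F := fun (n : ℕ) ξ => ‖(if ‖ξ‖ ≤ n then g t ξ else 0) - g t ξ‖ₑ ^ 2)
      (f := fun _ => 0) (fun ξ => ‖g t ξ‖ₑ ^ 2) (fun n => ?_) (fun n => ae_of_all _ fun ξ => ?_) ?_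
      (ae_of_all _ fun ξ => ?_)
    · simpa using this
    · refine Measurable.pow_const (Measurable.enorm (Measurable.sub ?_ hgt)) 2
      exact Measurable.ite (measurableSet_le (by fun_prop) measurable_const) hgt measurable_const
    · dsimp only
      split_ifs <;> simp
    · rw [lintegral_enorm_sq_eq]
      exact ENNReal.pow_ne_top (h2 t).2.ne
    · refine tendsto_const_nhds.congr' ?_
      filter_upwards [eventually_ge_atTop ⌈‖ξ‖⌉₊] with n hn
      rw [if_pos (Nat.ceil_le.1 hn)]
      simp
  have hex : ∀ k t, ∃ n, A n t ≤ (1 / 2) ^ k := fun k t =>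
    ((hA0 t).eventually (eventually_le_nhds (b := (1 / 2 : ℝ≥0∞) ^ k)
      (ENNReal.pow_pos (by norm_num) k))).exists
  -- Taking the least admissible cutoff makes it measurable in `t`. The squared `L²` errors `2^{-k}`
  -- are summable, which forces almost everywhere convergence.
  let N : ℕ → ℝ → ℕ := fun k t => Nat.find (hex k t)
  have hNm : ∀ k, Measurable (N k) := fun k =>
    measurable_find (fun t => hex k t) fun n => measurableSet_le (hAm n) measurable_const
  let gk : ℕ → ℝ → E d → ℂ := fun k t ξ => if ‖ξ‖ ≤ N k t then g t ξ else 0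
  have hgkm : ∀ k, Measurable (Function.uncurry (gk k)) := fun k => by
    refine Measurable.ite (measurableSet_le (by fun_prop) ?_) hg measurable_const
    exact (measurable_from_top (f := fun n : ℕ => (n : ℝ))).comp ((hNm k).comp measurable_fst)
  have hum : ∀ k, StronglyMeasurable fun q : ℝ × E d => 𝓕⁻ (gk k q.1) q.2 := fun k =>
    stronglyMeasurable_fourierInv_slices (hgkm k)
  refine ⟨fun t x => limUnder atTop fun k => 𝓕⁻ (gk k t) x,
    (StronglyMeasurable.limUnder hum).measurable, fun t => ?_⟩
  obtain ⟨u, hu, -⟩ := exists_isFT_of_memLp_right (h2 t)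
  have hk : ∀ k, IsFT (𝓕⁻ (gk k t)) (gk k t) := fun k => by
    refine isFT_fourierInv_of_integrable ?_
    refine (integrable_indicator_closedBall_of_memLp (h2 t) (N k t)).congr
      (ae_of_all _ fun ξ => ?_)
    simp only [gk, indicator_apply, mem_closedBall_zero_iff]
  have hle : ∀ k, ∫⁻ x, ‖𝓕⁻ (gk k t) x - u x‖ₑ ^ 2 ≤ (1 / 2) ^ k := fun k => by
    rw [lintegral_enorm_sq_eq (fun x => 𝓕⁻ (gk k t) x - u x), ← ((hk k).sub hu).eLpNorm_eq,
      ← lintegral_enorm_sq_eq]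
    exact Nat.find_spec (hex k t)
  have hae := ae_tendsto_zero_of_tsum_lintegral_ne_top (μ := (volume : Measure (E d)))
    (f := fun k x => ‖𝓕⁻ (gk k t) x - u x‖ₑ ^ 2)
    (fun k => (((hk k).sub hu).1.enorm).pow_const 2) (ne_top_of_le_ne_top ?_
      (ENNReal.tsum_le_tsum hle))
  · refine hu.congr ?_ EventuallyEq.rfl
    filter_upwards [hae] with x hx
    refine (Tendsto.limUnder_eq ?_).symm
    rw [tendsto_iff_edist_tendsto_0]
    have h2 := hx.ennrpow_const (1 / 2)
    rw [ENNReal.zero_rpow_of_pos (by norm_num)] at h2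
    refine h2.congr fun k => ?_
    rw [edist_eq_enorm_sub, ← ENNReal.rpow_natCast, ← ENNReal.rpow_mul]
    simp
  · rw [ENNReal.tsum_geometric]
    simp

/-- The symbol `2π|ξ|` of `|∇|`. -/
def freq (ξ : E d) : ℝ := 2 * Real.pi * ‖ξ‖

theorem freq_nonneg (ξ : E d) : 0 ≤ freq ξ := by unfold freq; positivity

theorem freq_neg (ξ : E d) : freq (-ξ) = freq ξ := by simp [freq]

theorem continuous_freq : Continuous (freq : E d → ℝ) := by unfold freq; fun_prop

theorem ae_freq_pos (hd : 3 ≤ d) : ∀ᵐ ξ : E d, 0 < freq ξ := by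
  have : Nontrivial (E d) := by
    refine Module.nontrivial_of_finrank_pos (R := ℝ) ?_
    rw [finrank_euclideanSpace, Fintype.card_fin]; omega
  have hne : ∀ᵐ ξ : E d, ξ ≠ 0 := by
    rw [ae_iff]; simp
  filter_upwards [hne] with ξ hξ
  have := norm_pos_iff.2 hξ
  unfold freq
  positivity

/-- The function `|ξ|⁻²` is locally integrable exactly when `2 < d`. This is how the dimension
enters the definition of functions from their `Ḣ¹` profile. -/
theorem memLp_indicator_inv_freq (hd : 3 ≤ d) :
    MemLp ((Metric.closedBall (0 : E d) 1).indicator fun ξ => (freq ξ)⁻¹) 2 volume := by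
  have hd' : (3 : ℝ) ≤ d := by exact_mod_cast hd
  obtain ⟨C, hC, h⟩ := exists_setLIntegral_norm_rpow_le (V := E d) volume (s := 2) two_pos
    (by rw [finrank_euclideanSpace, Fintype.card_fin]; linarith)
  have h1 := h (Metric.closedBall 0 1) 0 measurableSet_closedBall measure_closedBall_lt_top.ne
  have hm : Measurable fun ξ : E d => (freq ξ)⁻¹ := continuous_freq.measurable.inv
  refine ⟨(hm.indicator measurableSet_closedBall).aestronglyMeasurable, ?_⟩
  refine (ENNReal.pow_lt_top_iff.1 (?_ : _ ^ 2 < ∞)).resolve_right two_ne_zero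
  rw [← lintegral_enorm_sq_eq]
  refine lt_of_le_of_lt ?_ (lt_of_le_of_lt h1 (ENNReal.mul_lt_top hC.lt_top
    (ENNReal.rpow_lt_top_of_nonneg ?_ measure_closedBall_lt_top.ne)))
  · rw [← lintegral_indicator measurableSet_closedBall]
    refine lintegral_mono fun ξ => ?_
    by_cases hx : ξ ∈ Metric.closedBall (0 : E d) 1
    · rw [indicator_of_mem hx, indicator_of_mem hx, ← ofReal_norm,
        ← ENNReal.ofReal_pow (norm_nonneg _)]
      refine ENNReal.ofReal_le_ofReal ?_
      rw [zero_sub, norm_neg, Real.rpow_neg (norm_nonneg _), norm_inv, inv_pow,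
        Real.norm_of_nonneg (freq_nonneg ξ)]
      norm_cast
      rcases (norm_nonneg ξ).eq_or_lt with h0 | h0
      · simp [freq, ← h0]
      · refine inv_anti₀ (by positivity) ?_
        refine pow_le_pow_left₀ h0.le ?_ 2
        unfold freq
        nlinarith [Real.pi_gt_three]
    · rw [indicator_of_notMem hx]; simp
  · rw [finrank_euclideanSpace, Fintype.card_fin, sub_nonneg, div_le_one (by linarith)]
    linarith

/-- Low frequencies of functions with `|ξ| g ∈ L²` are integrable. -/
theorem integrable_indicator_closedBall_of_freq (hd : 3 ≤ d) {g : E d → ℂ}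
    (hg : AEStronglyMeasurable g volume)
    (h : MemLp (fun ξ => (freq ξ : ℂ) * g ξ) 2 volume) :
    Integrable ((Metric.closedBall (0 : E d) 1).indicator g) volume := by
  have h1 : Integrable (fun ξ => (Metric.closedBall (0 : E d) 1).indicator (fun ξ => (freq ξ)⁻¹) ξ *
      ‖(freq ξ : ℂ) * g ξ‖) volume := (memLp_indicator_inv_freq hd).integrable_mul h.norm
  refine h1.mono' (hg.indicator measurableSet_closedBall) ?_
  filter_upwards [ae_freq_pos hd] with ξ hξ
  by_cases hx : ξ ∈ Metric.closedBall (0 : E d) 1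
  · rw [indicator_of_mem hx, indicator_of_mem hx, norm_mul, Complex.norm_real,
      Real.norm_of_nonneg hξ.le, inv_mul_cancel_left₀ hξ.ne']
  · rw [indicator_of_notMem hx, indicator_of_notMem hx]; simp

theorem memLp_indicator_compl_of_freq {g : E d → ℂ}
    (hg : AEStronglyMeasurable g volume)
    (h : MemLp (fun ξ => (freq ξ : ℂ) * g ξ) 2 volume) :
    MemLp ((Metric.closedBall (0 : E d) 1)ᶜ.indicator g) 2 volume := by
  refine h.of_le (hg.indicator measurableSet_closedBall.compl) (ae_of_all _ fun ξ => ?_)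
  by_cases hx : ξ ∈ (Metric.closedBall (0 : E d) 1)ᶜ
  · rw [indicator_of_mem hx, norm_mul, Complex.norm_real, Real.norm_of_nonneg (freq_nonneg ξ)]
    refine le_mul_of_one_le_left (norm_nonneg _) ?_
    have : 1 ≤ ‖ξ‖ := by
      simp only [mem_compl_iff, mem_closedBall_zero_iff, not_le] at hx
      exact hx.le
    unfold freq
    nlinarith [Real.pi_gt_three]
  · rw [indicator_of_notMem hx, norm_zero]; exact norm_nonneg _

/-- Low frequencies are integrable, so an integral inverts them; high frequencies are square
integrable because `|∇|` has symbol at least `1` there. -/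
theorem exists_measurable_isFT (hd : 3 ≤ d) {V : ℝ → E d → ℂ}
    (hV : Measurable (Function.uncurry V))
    (h : ∀ t, MemLp (fun ξ => (freq ξ : ℂ) * V t ξ) 2 volume) :
    ∃ u : ℝ → E d → ℂ, Measurable (Function.uncurry u) ∧ ∀ t, IsFT (u t) (V t) := by
  have hVt : ∀ t, Measurable (V t) := fun t => hV.comp measurable_prodMk_left
  have hm : ∀ s : Set (E d), MeasurableSet s →
      Measurable (Function.uncurry fun t => s.indicator (V t)) := fun s hs => by
    have : (Function.uncurry fun t => s.indicator (V t)) =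
        (Prod.snd ⁻¹' s).indicator (Function.uncurry V) := by
      ext ⟨t, ξ⟩
      rfl
    rw [this]
    exact hV.indicator (measurable_snd hs)
  obtain ⟨u, hu, huV⟩ := exists_measurable_isFT_of_memLp
    (hm (Metric.closedBall (0 : E d) 1)ᶜ measurableSet_closedBall.compl)
    fun t => memLp_indicator_compl_of_freq (hVt t).aestronglyMeasurable (h t)
  refine ⟨fun t x => 𝓕⁻ ((Metric.closedBall (0 : E d) 1).indicator (V t)) x + u t x,
    (stronglyMeasurable_fourierInv_slices (hm _ measurableSet_closedBall)).measurable.add hu,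
    fun t => ?_⟩
  refine ((isFT_fourierInv_of_integrable (integrable_indicator_closedBall_of_freq hd
    (hVt t).aestronglyMeasurable (h t))).add (huV t)).congr EventuallyEq.rfl
    (ae_of_all _ fun ξ => ?_)
  exact congrFun (indicator_self_add_compl _ _) ξ

theorem IsFT.isFourierTransform_re {u g : E d → ℂ} (h : IsFT u g)
    (hg : ∀ᵐ ξ, g (-ξ) = conj (g ξ)) : IsFourierTransform (fun x => (u x).re) g := by
  rw [isFourierTransform_iff]
  refine h.congr ?_ EventuallyEq.rfl
  have h1 : IsFT (fun x => conj (u x)) g := h.conj.congr EventuallyEq.rfl (by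
    filter_upwards [hg] with ξ hξ
    rw [hξ, Complex.conj_conj])
  filter_upwards [h1.left_unique h] with x hx
  exact (Complex.conj_eq_iff_re.1 hx).symm

theorem IsFourierTransform.hermitian {u : E d → ℝ} {g : E d → ℂ} (h : IsFourierTransform u g) :
    ∀ᵐ ξ, g (-ξ) = conj (g ξ) := by
  rw [isFourierTransform_iff] at h
  have h1 := h.conj.right_unique (h.congr (ae_of_all _ fun x => by simp) EventuallyEq.rfl)
  filter_upwards [h1] with ξ hξ
  rw [← hξ, Complex.conj_conj]

theorem exists_measurable_isFourierTransform (hd : 3 ≤ d) {V : ℝ → E d → ℂ}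
    (hV : Measurable (Function.uncurry V))
    (h : ∀ t, MemLp (fun ξ => (freq ξ : ℂ) * V t ξ) 2 volume)
    (herm : ∀ t, ∀ᵐ ξ, V t (-ξ) = conj (V t ξ)) :
    ∃ u : ℝ → E d → ℝ, Measurable (Function.uncurry u) ∧ ∀ t, IsFourierTransform (u t) (V t) := by
  obtain ⟨u, hu, huV⟩ := exists_measurable_isFT hd hV h
  exact ⟨fun t x => (u t x).re, Complex.measurable_re.comp hu,
    fun t => (huV t).isFourierTransform_re (herm t)⟩

theorem exists_isFourierTransform_of_memLp {g : E d → ℂ} (hg : MemLp g 2 volume)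
    (herm : ∀ᵐ ξ, g (-ξ) = conj (g ξ)) : ∃ u : E d → ℝ, IsFourierTransform u g := by
  obtain ⟨u, hu, -⟩ := exists_isFT_of_memLp_right hg
  exact ⟨_, hu.isFourierTransform_re herm⟩

theorem exists_measurable_fourier {F : ℝ → E d → ℝ} (hF : Measurable (Function.uncurry F))
    (h2 : ∀ t, MemLp (F t) 2 volume) :
    ∃ g : ℝ → E d → ℂ, Measurable (Function.uncurry g) ∧ (∀ t, IsFourierTransform (F t) (g t)) ∧
      ∀ t ξ, g t (-ξ) = conj (g t ξ) := by
  obtain ⟨u, hu, huF⟩ := exists_measurable_isFT_of_memLp (g := fun t x => (F t x : ℂ))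
    (Complex.measurable_ofReal.comp hF) fun t => (h2 t).ofReal
  have hf : ∀ t, IsFourierTransform (F t) (fun x => u t (-x)) := fun t =>
    isFourierTransform_iff.2 (huF t).symm
  have hn : Measurable fun q : ℝ × E d => u q.1 (-q.2) :=
    hu.comp (measurable_fst.prodMk measurable_snd.neg)
  -- Symmetrizing gives hermitian symmetry at every point, where the transform alone has it only
  -- almost everywhere.
  refine ⟨fun t ξ => (u t (-ξ) + conj (u t ξ)) / 2, ?_, fun t => ?_, fun t ξ => ?_⟩
  · exact (hn.add (Complex.continuous_conj.measurable.comp hu)).div_const 2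
  · rw [isFourierTransform_iff]
    refine (isFourierTransform_iff.1 (hf t)).congr EventuallyEq.rfl ?_
    filter_upwards [(hf t).hermitian] with ξ hξ
    rw [neg_neg] at hξ
    rw [hξ, Complex.conj_conj]
    ring
  · simp only [neg_neg, map_div₀, map_add, Complex.conj_conj]
    rw [add_comm]
    congr 1
    exact (Complex.conj_ofNat 2).symm

theorem IsFT.integral_conj_mul {a A b B : E d → ℂ} (ha : IsFT a A) (hb : IsFT b B)
    (ha2 : MemLp a 2 volume) (hb2 : MemLp b 2 volume) :
    ∫ x, conj (a x) * b x = ∫ ξ, conj (A ξ) * B ξ := by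
  have key := Lp.inner_fourier_eq (ha2.toLp a) (hb2.toLp b)
  rw [L2.inner_def, L2.inner_def] at key
  have e : ∀ {u g : E d → ℂ}, IsFT u g → ∀ hu : MemLp u 2 volume,
      g =ᵐ[volume] (𝓕 (hu.toLp u) : Lp (α := E d) ℂ 2 volume) := fun h hu =>
    h.right_unique ((isFT_lp (hu.toLp _)).congr hu.coeFn_toLp EventuallyEq.rfl)
  refine Eq.trans ?_ (key.symm.trans ?_)
  · refine integral_congr_ae ?_
    filter_upwards [ha2.coeFn_toLp, hb2.coeFn_toLp] with x h1 h2
    rw [h1, h2, RCLike.inner_apply, mul_comm]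
  · refine integral_congr_ae ?_
    filter_upwards [e ha ha2, e hb hb2] with x h1 h2
    rw [h1, h2, RCLike.inner_apply, mul_comm]

theorem fourierInv_eq_conj_fourier_conj {G : E d → ℂ} (ξ : E d) :
    𝓕⁻ G ξ = conj (𝓕 (fun x => conj (G x)) ξ) := by
  rw [Real.fourier_eq', Real.fourierInv_eq', ← integral_conj]
  refine integral_congr_ae (ae_of_all _ fun y => ?_)
  simp only [smul_eq_mul, map_mul, ← Complex.exp_conj, Complex.conj_I, Complex.conj_ofReal,
    Complex.conj_conj]
  congr 2
  push_cast; ring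

/-- Parseval's formula against bounded functions supported in sets of finite measure. -/
theorem IsFT.integral_mul_fourierInv (hd : 3 ≤ d) {v V G : E d → ℂ} (h : IsFT v V)
    (hV : MemLp (fun ξ => (freq ξ : ℂ) * V ξ) 2 volume) (hG : IsBddFin volume G) :
    Integrable (fun x => v x * G x) volume ∧ Integrable (fun ξ => V ξ * 𝓕⁻ G ξ) volume ∧
      ∫ x, v x * G x = ∫ ξ, V ξ * 𝓕⁻ G ξ := by
  -- The Fourier pairing is given only against Schwartz functions. To reach bounded `G`, the
  -- low-frequency part is treated by the multiplication formula for integrable functions and the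
  -- high-frequency part by Parseval in `L²`.
  set B := Metric.closedBall (0 : E d) 1 with hB
  have h1 := integrable_indicator_closedBall_of_freq hd h.2.1 hV
  have h2 := memLp_indicator_compl_of_freq h.2.1 hV
  obtain ⟨u, hu, hu2⟩ := exists_isFT_of_memLp_right h2
  have hG2 := memLp_two_of_isBddFin hG
  have hGi := hG.integrable
  have hGF : IsFT (fun x => conj (G x)) (fun ξ => conj (𝓕⁻ G ξ)) := by
    have := isFT_of_integrable (u := fun x => conj (G x))
      ((Complex.conjLIE.toContinuousLinearEquiv.toContinuousLinearMap).integrable_comp hGi)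
    refine this.congr EventuallyEq.rfl (ae_of_all _ fun ξ => ?_)
    simp only
    rw [fourierInv_eq_conj_fourier_conj, Complex.conj_conj]
  have hGF2 : MemLp (𝓕⁻ G) 2 volume := by
    have := isFT_fourierInv_of_integrable hGi
    exact ⟨this.1, by rw [← this.eLpNorm_eq]; exact hG2.2⟩
  have hv : v =ᵐ[volume] fun x => 𝓕⁻ (B.indicator V) x + u x := by
    refine h.left_unique (((isFT_fourierInv_of_integrable h1).add hu).congr EventuallyEq.rfl
      (ae_of_all _ fun ξ => congrFun (indicator_self_add_compl _ _) ξ))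
  have hbd : ∀ (f : E d → ℂ) (x : E d), ‖𝓕⁻ f x‖ ≤ ∫ y, ‖f y‖ := fun f x => by
    rw [Real.fourierInv_eq_fourier_neg]
    exact VectorFourier.norm_fourierIntegral_le_integral_norm _ _ _ _ _
  have i1 : Integrable (fun x => 𝓕⁻ (B.indicator V) x * G x) volume :=
    hGi.bdd_mul (isFT_fourierInv_of_integrable h1).1 (ae_of_all _ fun x => hbd _ x)
  have i2 : Integrable (fun x => u x * G x) volume := hu2.integrable_mul hG2
  have j1 : Integrable (fun ξ => B.indicator V ξ * 𝓕⁻ G ξ) volume :=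
    h1.mul_bdd (isFT_fourierInv_of_integrable hGi).1 (ae_of_all _ fun x => hbd _ x)
  have j2 : Integrable (fun ξ => Bᶜ.indicator V ξ * 𝓕⁻ G ξ) volume := h2.integrable_mul hGF2
  have ev : (fun x => v x * G x) =ᵐ[volume] fun x => 𝓕⁻ (B.indicator V) x * G x + u x * G x := by
    filter_upwards [hv] with x hx
    rw [hx, add_mul]
  have eV : ∀ ξ, V ξ * 𝓕⁻ G ξ = B.indicator V ξ * 𝓕⁻ G ξ + Bᶜ.indicator V ξ * 𝓕⁻ G ξ := fun ξ => by
    rw [← add_mul]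
    congr 1
    exact (congrFun (indicator_self_add_compl _ _) ξ).symm
  refine ⟨(i1.add i2).congr ev.symm, (j1.add j2).congr (ae_of_all _ fun ξ => (eV ξ).symm), ?_⟩
  rw [integral_congr_ae ev, integral_add i1 i2, integral_congr_ae (ae_of_all _ eV),
    integral_add j1 j2]
  congr 1
  · have hp := VectorFourier.integral_fourierIntegral_smul_eq_flip (L := innerₗ (E d))
      (μ := volume) (ν := volume) Real.continuous_fourierChar continuous_inner h1 hGi.comp_neg
    simp only [smul_eq_mul, flip_innerₗ] at hp
    rw [Real.fourierInv_eq_fourier_comp_neg G]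
    refine Eq.trans ?_ hp
    rw [← integral_neg_eq_self]
    refine integral_congr_ae (ae_of_all _ fun x => ?_)
    simp only
    rw [Real.fourierInv_eq_fourier_neg, neg_neg]
    rfl
  · have hp := hGF.integral_conj_mul hu (by exact hG2.star) hu2
    simp only [Complex.conj_conj] at hp
    simp_rw [mul_comm (u _), mul_comm (Bᶜ.indicator V _)]
    exact hp

end Realization

/-! ### The Duhamel term on the Fourier side and its adjoint -/

section Duhamel

variable {d : ℕ}

theorem lintegral_mul_le_sqrt {α : Type*} [MeasurableSpace α] {μ : Measure α} {f g : α → ℝ≥0∞}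
    (hf : AEMeasurable f μ) (hg : AEMeasurable g μ) :
    ∫⁻ x, f x * g x ∂μ ≤
      (∫⁻ x, f x ^ 2 ∂μ) ^ (1 / 2 : ℝ) * (∫⁻ x, g x ^ 2 ∂μ) ^ (1 / 2 : ℝ) := by
  have := ENNReal.lintegral_mul_le_Lp_mul_Lq μ Real.HolderConjugate.two_two hf hg
  simpa using this

/-- Minkowski's integral inequality in `L²`. -/
theorem lintegral_lintegral_sq_le {α β : Type*} [MeasurableSpace α] [MeasurableSpace β]
    {μ : Measure α} {ν : Measure β} [SFinite μ] [SFinite ν] {h : α → β → ℝ≥0∞}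
    (hh : Measurable (Function.uncurry h)) :
    ∫⁻ y, (∫⁻ x, h x y ∂μ) ^ 2 ∂ν ≤ (∫⁻ x, (∫⁻ y, h x y ^ 2 ∂ν) ^ (1 / 2 : ℝ) ∂μ) ^ 2 := by
  have hy : ∀ y, Measurable fun x => h x y := fun y => hh.comp measurable_prodMk_right
  have hx : ∀ x, Measurable fun y => h x y := fun x => hh.comp measurable_prodMk_left
  have m3 : Measurable fun q : (β × α) × α => h q.1.2 q.1.1 * h q.2 q.1.1 :=
    (hh.comp ((measurable_snd.comp measurable_fst).prodMk
      (measurable_fst.comp measurable_fst))).mul (hh.comp (measurable_snd.prodMk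
      (measurable_fst.comp measurable_fst)))
  have hN : Measurable fun x => (∫⁻ y, h x y ^ 2 ∂ν) ^ (1 / 2 : ℝ) :=
    (Measurable.lintegral_prod_right' (f := fun q : α × β => h q.1 q.2 ^ 2)
      (hh.pow_const 2)).pow_const _
  calc ∫⁻ y, (∫⁻ x, h x y ∂μ) ^ 2 ∂ν
      = ∫⁻ y, ∫⁻ x, ∫⁻ x', h x y * h x' y ∂μ ∂μ ∂ν := by
        refine lintegral_congr fun y => ?_
        simp_rw [lintegral_const_mul _ (hy y)]
        rw [lintegral_mul_const _ (hy y), sq]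
    _ = ∫⁻ x, ∫⁻ x', ∫⁻ y, h x y * h x' y ∂ν ∂μ ∂μ := by
        rw [lintegral_lintegral_swap (Measurable.lintegral_prod_right' m3).aemeasurable]
        refine lintegral_congr fun x => ?_
        rw [lintegral_lintegral_swap]
        exact (m3.comp (f := fun q : β × α => ((q.1, x), q.2)) (by fun_prop)).aemeasurable
    _ ≤ ∫⁻ x, ∫⁻ x', (∫⁻ y, h x y ^ 2 ∂ν) ^ (1 / 2 : ℝ) *
          (∫⁻ y, h x' y ^ 2 ∂ν) ^ (1 / 2 : ℝ) ∂μ ∂μ :=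
        lintegral_mono fun x => lintegral_mono fun x' =>
          lintegral_mul_le_sqrt (hx x).aemeasurable (hx x').aemeasurable
    _ = _ := by
        simp_rw [lintegral_const_mul _ hN]
        rw [lintegral_mul_const _ hN, sq]

/-- The forcing term `F ∈ L¹_t L²_x` together with its spatial Fourier transform `g`. -/
structure IsForcing (F : ℝ → E d → ℝ) (g : ℝ → E d → ℂ) : Prop where
  measurable : Measurable (Function.uncurry F)
  memLp : ∀ t, MemLp (F t) 2 volume
  measurable_ft : Measurable (Function.uncurry g)
  ft : ∀ t, IsFourierTransform (F t) (g t)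
  hermitian : ∀ t ξ, g t (-ξ) = conj (g t ξ)
  lt_top : ∫⁻ t, eLpNorm (F t) 2 volume < ∞

/-- `∫ |g(t, ξ)| dt`. -/
def majorant (g : ℝ → E d → ℂ) (ξ : E d) : ℝ≥0∞ := ∫⁻ t, ‖g t ξ‖ₑ

theorem measurable_majorant {g : ℝ → E d → ℂ} (hg : Measurable (Function.uncurry g)) :
    Measurable (majorant g) :=
  Measurable.lintegral_prod_right' (f := fun q : E d × ℝ => ‖g q.2 q.1‖ₑ)
    (hg.comp measurable_swap).enorm

theorem IsForcing.eLpNorm_ft {F : ℝ → E d → ℝ} {g : ℝ → E d → ℂ} (h : IsForcing F g) (t : ℝ) :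
    eLpNorm (g t) 2 volume = eLpNorm (F t) 2 volume := by
  rw [(isFourierTransform_iff.1 (h.ft t)).eLpNorm_eq]
  refine eLpNorm_congr_norm_ae (ae_of_all _ fun x => ?_)
  simp

/-- Minkowski's inequality turns `L¹_t L²` into `L²_ξ L¹_t`. The gain is a single square-integrable
function of `ξ` that bounds the Duhamel integrals at all times at once. -/
theorem lintegral_majorant_sq_le {g : ℝ → E d → ℂ} (hg : Measurable (Function.uncurry g)) :
    ∫⁻ ξ, majorant g ξ ^ 2 ≤ (∫⁻ t, eLpNorm (g t) 2 volume) ^ 2 := by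
  refine (lintegral_lintegral_sq_le (h := fun t ξ => ‖g t ξ‖ₑ) hg.enorm).trans (le_of_eq ?_)
  congr 1
  refine lintegral_congr fun t => ?_
  rw [lintegral_enorm_sq_eq, ← ENNReal.rpow_natCast, ← ENNReal.rpow_mul]
  simp

theorem IsForcing.lintegral_majorant_sq_lt_top {F : ℝ → E d → ℝ} {g : ℝ → E d → ℂ}
    (h : IsForcing F g) : ∫⁻ ξ, majorant g ξ ^ 2 < ∞ := by
  refine (lintegral_majorant_sq_le h.measurable_ft).trans_lt (ENNReal.pow_lt_top ?_)
  simp_rw [h.eLpNorm_ft]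
  exact h.lt_top

theorem IsForcing.ae_majorant_lt_top {F : ℝ → E d → ℝ} {g : ℝ → E d → ℂ}
    (h : IsForcing F g) : ∀ᵐ ξ, majorant g ξ < ∞ := by
  filter_upwards [ae_lt_top ((measurable_majorant h.measurable_ft).pow_const 2)
    h.lintegral_majorant_sq_lt_top.ne] with ξ hξ
  exact (ENNReal.pow_lt_top_iff.1 hξ).resolve_right two_ne_zero

/-- The symbol of the retarded propagator `1_{s > 0} sin(s|∇|)/|∇|`. -/
def sinKer (s : ℝ) (ξ : E d) : ℝ := if 0 < s then Real.sin (s * freq ξ) / freq ξ else 0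

/-- The symbol of `1_{s > 0} cos(s|∇|)`. -/
def cosKer (s : ℝ) (ξ : E d) : ℝ := if 0 < s then Real.cos (s * freq ξ) else 0

theorem measurable_sinKer : Measurable fun q : ℝ × E d => sinKer q.1 q.2 := by
  have := (continuous_freq (d := d)).measurable
  exact Measurable.ite (measurableSet_lt measurable_const measurable_fst)
    (by fun_prop) measurable_const

theorem measurable_cosKer : Measurable fun q : ℝ × E d => cosKer q.1 q.2 := by
  have := (continuous_freq (d := d)).measurable
  exact Measurable.ite (measurableSet_lt measurable_const measurable_fst)
    (by fun_prop) measurable_const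

theorem abs_sinKer_le (s : ℝ) (ξ : E d) : |sinKer s ξ| ≤ (freq ξ)⁻¹ := by
  unfold sinKer
  have := freq_nonneg ξ
  split_ifs
  · rw [abs_div, abs_of_nonneg this, div_eq_mul_inv]
    exact mul_le_of_le_one_left (by positivity) (Real.abs_sin_le_one _)
  · rw [abs_zero]; positivity

theorem freq_mul_abs_sinKer_le (s : ℝ) (ξ : E d) : freq ξ * |sinKer s ξ| ≤ 1 := by
  have h0 := freq_nonneg ξ
  refine (mul_le_mul_of_nonneg_left (abs_sinKer_le s ξ) h0).trans ?_
  exact mul_inv_le_one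

theorem abs_cosKer_le (s : ℝ) (ξ : E d) : |cosKer s ξ| ≤ 1 := by
  unfold cosKer
  split_ifs
  · exact Real.abs_cos_le_one _
  · simp

theorem sinKer_neg (s : ℝ) (ξ : E d) : sinKer s (-ξ) = sinKer s ξ := by
  simp [sinKer, freq_neg]

theorem cosKer_neg (s : ℝ) (ξ : E d) : cosKer s (-ξ) = cosKer s ξ := by
  simp [cosKer, freq_neg]

/-- The Fourier transform of `∫ 1_{t' < t} sin((t - t')|∇|)/|∇| F(t') dt'`. -/
def duhamelFT (g : ℝ → E d → ℂ) (t : ℝ) (ξ : E d) : ℂ :=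
  ∫ t', (sinKer (t - t') ξ : ℂ) * g t' ξ

/-- The Fourier transform of `∫ 1_{t' < t} cos((t - t')|∇|) F(t') dt'`. -/
def duhamelDerivFT (g : ℝ → E d → ℂ) (t : ℝ) (ξ : E d) : ℂ :=
  ∫ t', (cosKer (t - t') ξ : ℂ) * g t' ξ

theorem measurable_sinKer_mul {g : ℝ → E d → ℂ} (hg : Measurable (Function.uncurry g)) :
    Measurable fun q : (ℝ × E d) × ℝ => (sinKer (q.1.1 - q.2) q.1.2 : ℂ) * g q.2 q.1.2 := by
  refine Measurable.mul (Complex.measurable_ofReal.comp ?_)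
    (hg.comp (measurable_snd.prodMk (measurable_snd.comp measurable_fst)))
  exact measurable_sinKer.comp (f := fun q : (ℝ × E d) × ℝ => (q.1.1 - q.2, q.1.2)) (by fun_prop)

theorem measurable_cosKer_mul {g : ℝ → E d → ℂ} (hg : Measurable (Function.uncurry g)) :
    Measurable fun q : (ℝ × E d) × ℝ => (cosKer (q.1.1 - q.2) q.1.2 : ℂ) * g q.2 q.1.2 := by
  refine Measurable.mul (Complex.measurable_ofReal.comp ?_)
    (hg.comp (measurable_snd.prodMk (measurable_snd.comp measurable_fst)))
  exact measurable_cosKer.comp (f := fun q : (ℝ × E d) × ℝ => (q.1.1 - q.2, q.1.2)) (by fun_prop)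

theorem measurable_duhamelFT {g : ℝ → E d → ℂ} (hg : Measurable (Function.uncurry g)) :
    Measurable (Function.uncurry (duhamelFT g)) :=
  (StronglyMeasurable.integral_prod_right' (measurable_sinKer_mul hg).stronglyMeasurable).measurable

theorem measurable_duhamelDerivFT {g : ℝ → E d → ℂ} (hg : Measurable (Function.uncurry g)) :
    Measurable (Function.uncurry (duhamelDerivFT g)) :=
  (StronglyMeasurable.integral_prod_right' (measurable_cosKer_mul hg).stronglyMeasurable).measurable

theorem enorm_freq_mul_duhamelFT_le (g : ℝ → E d → ℂ) (t : ℝ) (ξ : E d) :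
    ‖(freq ξ : ℂ) * duhamelFT g t ξ‖ₑ ≤ majorant g ξ := by
  rw [duhamelFT, ← integral_const_mul]
  refine (enorm_integral_le_lintegral_enorm _).trans (lintegral_mono fun t' => ?_)
  rw [← mul_assoc, enorm_mul, ← ofReal_norm, norm_mul, Complex.norm_real, Complex.norm_real,
    Real.norm_of_nonneg (freq_nonneg ξ), Real.norm_eq_abs]
  refine mul_le_of_le_one_left (zero_le) ?_
  rw [← ENNReal.ofReal_one]
  exact ENNReal.ofReal_le_ofReal (freq_mul_abs_sinKer_le _ _)

theorem enorm_duhamelDerivFT_le (g : ℝ → E d → ℂ) (t : ℝ) (ξ : E d) :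
    ‖duhamelDerivFT g t ξ‖ₑ ≤ majorant g ξ := by
  refine (enorm_integral_le_lintegral_enorm _).trans (lintegral_mono fun t' => ?_)
  rw [enorm_mul, ← ofReal_norm, Complex.norm_real, Real.norm_eq_abs]
  refine mul_le_of_le_one_left (zero_le) ?_
  rw [← ENNReal.ofReal_one]
  exact ENNReal.ofReal_le_ofReal (abs_cosKer_le _ _)

theorem memLp_of_enorm_le {f : E d → ℂ} {M : E d → ℝ≥0∞}
    (hf : AEStronglyMeasurable f volume) (h : ∀ ξ, ‖f ξ‖ₑ ≤ M ξ) (hM : ∫⁻ ξ, M ξ ^ 2 < ∞) :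
    MemLp f 2 volume := by
  refine ⟨hf, (ENNReal.pow_lt_top_iff.1 (?_ : _ ^ 2 < ∞)).resolve_right two_ne_zero⟩
  rw [← lintegral_enorm_sq_eq]
  refine lt_of_le_of_lt (lintegral_mono fun ξ => ?_) hM
  gcongr
  exact h ξ

theorem IsForcing.memLp_freq_mul_duhamelFT {F : ℝ → E d → ℝ} {g : ℝ → E d → ℂ}
    (h : IsForcing F g) (t : ℝ) : MemLp (fun ξ => (freq ξ : ℂ) * duhamelFT g t ξ) 2 volume := by
  refine memLp_of_enorm_le ?_ (enorm_freq_mul_duhamelFT_le g t) h.lintegral_majorant_sq_lt_top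
  exact ((Complex.measurable_ofReal.comp continuous_freq.measurable).mul
    ((measurable_duhamelFT h.measurable_ft).comp measurable_prodMk_left)).aestronglyMeasurable

theorem duhamelFT_neg {g : ℝ → E d → ℂ} (h : ∀ t ξ, g t (-ξ) = conj (g t ξ)) (t : ℝ) (ξ : E d) :
    duhamelFT g t (-ξ) = conj (duhamelFT g t ξ) := by
  rw [duhamelFT, duhamelFT, ← integral_conj]
  simp [h, sinKer_neg]

theorem duhamelDerivFT_neg {g : ℝ → E d → ℂ} (h : ∀ t ξ, g t (-ξ) = conj (g t ξ)) (t : ℝ)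
    (ξ : E d) : duhamelDerivFT g t (-ξ) = conj (duhamelDerivFT g t ξ) := by
  rw [duhamelDerivFT, duhamelDerivFT, ← integral_conj]
  simp [h, cosKer_neg]

/-- `D(t) = ∫ 1_{t' < t} sin((t - t')|∇|)/|∇| F(t') dt'` for all times `t`, where `g` is the
Fourier transform of `F`. -/
structure IsDuhamel (g : ℝ → E d → ℂ) (D : ℝ → E d → ℝ) : Prop where
  measurable : Measurable (Function.uncurry D)
  ft : ∀ t, IsFourierTransform (D t) (duhamelFT g t)

theorem IsForcing.exists_isDuhamel (hd : 3 ≤ d) {F : ℝ → E d → ℝ} {g : ℝ → E d → ℂ}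
    (h : IsForcing F g) : ∃ D, IsDuhamel g D := by
  obtain ⟨D, h1, h2⟩ := exists_measurable_isFourierTransform hd (measurable_duhamelFT
    h.measurable_ft) h.memLp_freq_mul_duhamelFT
    fun t => ae_of_all _ (duhamelFT_neg h.hermitian t)
  exact ⟨D, h1, h2⟩

/-! ### The pairing of Duhamel terms with test functions -/

/-- `∫ 1_{t' < t} sin((t - t')|ξ|)/|ξ| 𝓕⁻¹G(t)(ξ) dt`. -/
def adjointFT (G : ℝ → E d → ℝ) (t' : ℝ) (ξ : E d) : ℂ :=
  ∫ t, (sinKer (t - t') ξ : ℂ) * 𝓕⁻ (fun x => (G t x : ℂ)) ξ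

theorem IsTestFn.measurable_sinKer_mul_fourierInv {G : ℝ → E d → ℝ} (hG : IsTestFn G) :
    Measurable fun q : (ℝ × E d) × ℝ =>
      (sinKer (q.2 - q.1.1) q.1.2 : ℂ) * 𝓕⁻ (fun x => (G q.2 x : ℂ)) q.1.2 := by
  have h1 := (stronglyMeasurable_fourierInv_slices hG.measurable_ofReal).measurable
  have h2 : Measurable fun q : (ℝ × E d) × ℝ => (q.2, q.1.2) := by fun_prop
  have h3 := h1.comp h2
  refine Measurable.mul (Complex.measurable_ofReal.comp ?_) h3
  exact measurable_sinKer.comp (f := fun q : (ℝ × E d) × ℝ => (q.2 - q.1.1, q.1.2)) (by fun_prop)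

theorem IsTestFn.measurable_adjointFT {G : ℝ → E d → ℝ} (hG : IsTestFn G) :
    Measurable (Function.uncurry (adjointFT G)) :=
  (StronglyMeasurable.integral_prod_right'
    hG.measurable_sinKer_mul_fourierInv.stronglyMeasurable).measurable

/-- Test functions are merely measurable, so the causal factor `1_{t' < t}` can be absorbed into
them. -/
theorem IsTestFn.cutoff {G : ℝ → E d → ℝ} (hG : IsTestFn G) (t' : ℝ) :
    IsTestFn fun t x => if t' < t then G t x else 0 := by
  obtain ⟨M, hM⟩ := hG.bounded
  obtain ⟨R, hR⟩ := hG.support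
  refine ⟨?_, ⟨M, fun t x => ?_⟩, ⟨R, fun t x h => ?_⟩⟩
  · exact Measurable.ite (measurableSet_lt measurable_const measurable_fst) hG.measurable
      measurable_const
  · split_ifs
    · exact hM t x
    · rw [abs_zero]; exact (abs_nonneg _).trans (hM t x)
  · exact hR t x fun h0 => h (by simp [h0])

theorem sinKer_eq_exp (t' : ℝ) (t : ℝ) (ξ : E d) (h : t' < t) :
    (sinKer (t - t') ξ : ℂ) = (1 / freq ξ : ℂ) * (1 / (2 * Complex.I)) *
      (Complex.exp (-(t' * freq ξ : ℝ) * Complex.I) *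
        Complex.exp (2 * Real.pi * Complex.I * ((1 : ℝ) * t * ‖ξ‖ : ℝ)) -
      Complex.exp ((t' * freq ξ : ℝ) * Complex.I) *
        Complex.exp (2 * Real.pi * Complex.I * ((-1 : ℝ) * t * ‖ξ‖ : ℝ))) := by
  have e1 : Complex.exp (-(t' * freq ξ : ℝ) * Complex.I) *
        Complex.exp (2 * Real.pi * Complex.I * ((1 : ℝ) * t * ‖ξ‖ : ℝ)) =
      Complex.exp ((((t - t') * freq ξ : ℝ) : ℂ) * Complex.I) := by
    rw [← Complex.exp_add]; congr 1; unfold freq; push_cast; ring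
  have e2 : Complex.exp ((t' * freq ξ : ℝ) * Complex.I) *
        Complex.exp (2 * Real.pi * Complex.I * ((-1 : ℝ) * t * ‖ξ‖ : ℝ)) =
      Complex.exp (-(((t - t') * freq ξ : ℝ) : ℂ) * Complex.I) := by
    rw [← Complex.exp_add]; congr 1; unfold freq; push_cast; ring
  rw [e1, e2, sinKer, if_pos (sub_pos.2 h), Complex.ofReal_div, Complex.ofReal_sin, Complex.sin]
  rw [div_eq_mul_one_div, mul_comm, mul_assoc]
  congr 1
  have : Complex.I ≠ 0 := Complex.I_ne_zero
  field_simp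
  rw [Complex.I_sq]
  ring

/-- Once the causal factor sits in `G`, the addition formula separates `t` from `t'`: the sine is a
difference of two half-waves, and the `t'`-dependent phases have modulus one. -/
theorem IsTestFn.enorm_adjointFT_sq_le {G : ℝ → E d → ℝ} (hG : IsTestFn G) (t' : ℝ) (ξ : E d) :
    ‖adjointFT G t' ξ‖ₑ ^ 2 ≤ ENNReal.ofReal ((1 / freq ξ) ^ 2) *
      ‖coneFourier 1 (fun t x => if t' < t then G t x else 0) ξ‖ₑ ^ 2 +
      ENNReal.ofReal ((1 / freq ξ) ^ 2) *
      ‖coneFourier (-1) (fun t x => if t' < t then G t x else 0) ξ‖ₑ ^ 2 := by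
  have hc := hG.cutoff t'
  set H : ℝ → E d → ℝ := fun t x => if t' < t then G t x else 0 with hH
  have hi : ∀ σ : ℝ, Integrable fun t : ℝ =>
      Complex.exp (2 * Real.pi * Complex.I * (σ * t * ‖ξ‖ : ℝ)) *
        𝓕⁻ (fun x => (H t x : ℂ)) ξ := fun σ => by
    refine (hc.integrable_fourierInv ξ).bdd_mul (c := 1)
      (Continuous.aestronglyMeasurable (by fun_prop)) (ae_of_all _ fun t => ?_)
    exact (norm_cexp_two_pi_I_mul _).le
  have key : adjointFT G t' ξ = (1 / freq ξ : ℂ) * (1 / (2 * Complex.I)) *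
      (Complex.exp (-(t' * freq ξ : ℝ) * Complex.I) * coneFourier 1 H ξ -
        Complex.exp ((t' * freq ξ : ℝ) * Complex.I) * coneFourier (-1) H ξ) := by
    rw [coneFourier, coneFourier, ← integral_const_mul, ← integral_const_mul,
      ← integral_sub ((hi 1).const_mul _) ((hi (-1)).const_mul _), ← integral_const_mul]
    refine integral_congr_ae (ae_of_all _ fun t => ?_)
    simp only
    by_cases h : t' < t
    · rw [sinKer_eq_exp t' t ξ h]
      simp only [hH, if_pos h]
      ring
    · have h0 : 𝓕⁻ (fun x => (H t x : ℂ)) ξ = 0 := by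
        rw [Real.fourierInv_eq']
        simp [hH, if_neg h]
      rw [h0, sinKer, if_neg (by linarith)]
      simp
  have n1 : ∀ r : ℝ, ‖Complex.exp ((r : ℂ) * Complex.I)‖ = 1 := Complex.norm_exp_ofReal_mul_I
  have n2 : ‖Complex.exp (-(t' * freq ξ : ℝ) * Complex.I)‖ = 1 := by
    rw [← Complex.ofReal_neg]; exact n1 _
  have hle : ‖adjointFT G t' ξ‖ ^ 2 ≤ (1 / freq ξ) ^ 2 * ‖coneFourier 1 H ξ‖ ^ 2 +
      (1 / freq ξ) ^ 2 * ‖coneFourier (-1) H ξ‖ ^ 2 := by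
    have h1 : ‖adjointFT G t' ξ‖ ≤ (1 / freq ξ) * (1 / 2) *
        (‖coneFourier 1 H ξ‖ + ‖coneFourier (-1) H ξ‖) := by
      rw [key, norm_mul, norm_mul]
      have a1 : ‖(1 / freq ξ : ℂ)‖ = 1 / freq ξ := by
        rw [norm_div, norm_one, Complex.norm_real, Real.norm_of_nonneg (freq_nonneg ξ)]
      have a2 : ‖(1 / (2 * Complex.I) : ℂ)‖ = 1 / 2 := by simp
      rw [a1, a2]
      have := freq_nonneg ξ
      gcongr
      refine (norm_sub_le _ _).trans (le_of_eq ?_)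
      rw [norm_mul, norm_mul, n1, n2, one_mul, one_mul]
    refine (pow_le_pow_left₀ (norm_nonneg _) h1 2).trans ?_
    have : 0 ≤ (1 / freq ξ) ^ 2 := by positivity
    nlinarith [mul_nonneg this (sq_nonneg (‖coneFourier 1 H ξ‖ - ‖coneFourier (-1) H ξ‖)),
      mul_nonneg this (sq_nonneg (‖coneFourier 1 H ξ‖ + ‖coneFourier (-1) H ξ‖))]
  rw [← ofReal_norm, ← ofReal_norm, ← ofReal_norm, ← ENNReal.ofReal_pow (norm_nonneg _),
    ← ENNReal.ofReal_pow (norm_nonneg _), ← ENNReal.ofReal_pow (norm_nonneg _),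
    ← ENNReal.ofReal_mul (by positivity), ← ENNReal.ofReal_mul (by positivity),
    ← ENNReal.ofReal_add (by positivity) (by positivity)]
  exact ENNReal.ofReal_le_ofReal hle

/-- The dual estimate for the restricted test function. The restriction only decreases the norm of
`G`, so the bound is uniform in `t'`; this replaces any argument of Christ–Kiselev type. -/
theorem exists_lintegral_adjointFT_sq_le (hd : 3 ≤ d) :
    ∃ C : ℝ≥0∞, C ≠ ∞ ∧ ∀ (G : ℝ → E d → ℝ) (t' : ℝ), IsTestFn G →
      ∫⁻ ξ, ‖adjointFT G t' ξ‖ₑ ^ 2 ≤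
        C * (∫⁻ t, (∫⁻ x, ‖G t x‖ₑ ^ (6 * d / (3 * d + 8) : ℝ)) ^
          ((3 * d + 8) / (6 * d) * (3 / 2) : ℝ)) ^ (4 / 3 : ℝ) := by
  obtain ⟨C, hC, h⟩ := exists_dualStrichartz hd
  refine ⟨C + C, by simp [hC], fun G t' hG => ?_⟩
  refine (lintegral_mono fun ξ => hG.enorm_adjointFT_sq_le t' ξ).trans ?_
  have hm : ∀ σ : ℝ, Measurable fun ξ => ENNReal.ofReal ((1 / freq ξ) ^ 2) *
      ‖coneFourier σ (fun t x => if t' < t then G t x else 0) ξ‖ₑ ^ 2 := fun σ => by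
    have := (continuous_freq (d := d)).measurable
    have h2 := (hG.cutoff t').measurable_coneFourier (σ := σ)
    fun_prop
  rw [lintegral_add_left (hm 1), add_mul]
  have hle : (∫⁻ t, (∫⁻ x, ‖if t' < t then G t x else 0‖ₑ ^ (6 * d / (3 * d + 8) : ℝ)) ^
          ((3 * d + 8) / (6 * d) * (3 / 2) : ℝ)) ^ (4 / 3 : ℝ) ≤
      (∫⁻ t, (∫⁻ x, ‖G t x‖ₑ ^ (6 * d / (3 * d + 8) : ℝ)) ^
          ((3 * d + 8) / (6 * d) * (3 / 2) : ℝ)) ^ (4 / 3 : ℝ) := by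
    gcongr with t x
    split_ifs <;> simp
  refine add_le_add ((h 1 (by simp) _ (hG.cutoff t')).trans ?_)
    ((h (-1) (by simp) _ (hG.cutoff t')).trans ?_)
  · gcongr
  · gcongr

end Duhamel

/-! ### The retarded Strichartz estimate in dual form -/

section RetardedStrichartz

variable {d : ℕ}

theorem measurable_eLpNorm_slice {F : Type*} [NormedAddCommGroup F] [MeasurableSpace F]
    [OpensMeasurableSpace F] {u : ℝ → E d → F} (hu : Measurable (Function.uncurry u)) {p : ℝ≥0∞}
    (hp0 : p ≠ 0) (hp : p ≠ ∞) : Measurable fun t => eLpNorm (u t) p volume := by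
  simp_rw [eLpNorm_eq_lintegral_rpow_enorm_toReal hp0 hp]
  exact (Measurable.lintegral_prod_right' (f := fun q : ℝ × E d => ‖u q.1 q.2‖ₑ ^ p.toReal)
    (hu.enorm.pow_const _)).pow_const _

theorem IsTestFn.lintegral_eLpNorm_lt_top {G : ℝ → E d → ℝ} (hG : IsTestFn G) :
    ∫⁻ t, eLpNorm (G t) 2 volume < ∞ := by
  obtain ⟨M, hM⟩ := hG.bounded
  obtain ⟨R, hR⟩ := hG.support
  set f : E d → ℝ := (Metric.closedBall (0 : E d) R).indicator fun _ => M with hf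
  have hf2 : MemLp f 2 volume := memLp_indicator_const 2 measurableSet_closedBall M
    (Or.inr measure_closedBall_lt_top.ne)
  have hle : ∀ t, eLpNorm (G t) 2 volume ≤ (Icc (-R) R).indicator (fun _ => eLpNorm f 2 volume) t := by
    intro t
    by_cases ht : t ∈ Icc (-R) R
    · rw [indicator_of_mem ht]
      refine eLpNorm_mono fun x => ?_
      by_cases hx : G t x = 0
      · rw [hx, norm_zero]; exact norm_nonneg _
      · rw [hf, indicator_of_mem (by simpa using (hR t x hx).2), Real.norm_eq_abs, Real.norm_eq_abs]
        exact (hM t x).trans (le_abs_self M)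
    · have : G t = 0 := by
        ext x
        by_contra hx
        exact ht (abs_le.1 (hR t x hx).1)
      rw [this]; simp
  refine (lintegral_mono hle).trans_lt ?_
  rw [lintegral_indicator measurableSet_Icc, setLIntegral_const]
  exact ENNReal.mul_lt_top hf2.2 (by simp)

theorem IsTestFn.eLpNorm_fourierInv {G : ℝ → E d → ℝ} (hG : IsTestFn G) (t : ℝ) :
    eLpNorm (𝓕⁻ fun x => (G t x : ℂ)) 2 volume = eLpNorm (G t) 2 volume := by
  rw [← (isFT_fourierInv_of_integrable (hG.slice t).integrable).eLpNorm_eq]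
  exact eLpNorm_congr_norm_ae (ae_of_all _ fun x => by simp)

/-- Near the origin the majorant is bounded and `|ξ|⁻¹` is locally square integrable; away from it
the factor is at most `1` and the majorant is square integrable. With Cauchy–Schwarz this supplies
the absolute convergence for the Fubini steps below. -/
theorem IsTestFn.lintegral_inv_freq_mul_majorant_lt_top (hd : 3 ≤ d) {G : ℝ → E d → ℝ}
    (hG : IsTestFn G) :
    ∫⁻ ξ, (ENNReal.ofReal (freq ξ)⁻¹ * majorant (fun t => 𝓕⁻ fun x => (G t x : ℂ)) ξ) ^ 2 < ∞ := by
  have hm := (stronglyMeasurable_fourierInv_slices hG.measurable_ofReal).measurable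
  set W : E d → ℝ≥0∞ := majorant (fun t => 𝓕⁻ fun x => (G t x : ℂ)) with hW
  obtain ⟨K, R, hK, hbd⟩ := hG.exists_norm_fourierInv_le
  have hWle : ∀ ξ, W ξ ≤ ENNReal.ofReal K * volume (Icc (-R) R) := fun ξ => by
    rw [← setLIntegral_const, ← lintegral_indicator measurableSet_Icc]
    refine lintegral_mono fun t => ?_
    rw [← ofReal_norm]
    refine (ENNReal.ofReal_le_ofReal (hbd t ξ)).trans (le_of_eq ?_)
    by_cases ht : t ∈ Icc (-R) R
    · simp [ht]
    · simp [ht]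
  have hw : ENNReal.ofReal K * volume (Icc (-R) R) < ∞ := ENNReal.mul_lt_top (by simp) (by simp)
  have hW2 : ∫⁻ ξ, W ξ ^ 2 < ∞ := by
    refine (lintegral_majorant_sq_le hm).trans_lt (ENNReal.pow_lt_top ?_)
    simp_rw [hG.eLpNorm_fourierInv]
    exact hG.lintegral_eLpNorm_lt_top
  have hI := ENNReal.pow_lt_top (n := 2) (memLp_indicator_inv_freq hd).2
  rw [← lintegral_enorm_sq_eq] at hI
  have hle : ∀ ξ, (ENNReal.ofReal (freq ξ)⁻¹ * W ξ) ^ 2 ≤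
      ‖(Metric.closedBall (0 : E d) 1).indicator (fun ξ => (freq ξ)⁻¹) ξ‖ₑ ^ 2 *
        (ENNReal.ofReal K * volume (Icc (-R) R)) ^ 2 + W ξ ^ 2 := by
    intro ξ
    have h0 := freq_nonneg ξ
    by_cases hx : ξ ∈ Metric.closedBall (0 : E d) 1
    · rw [indicator_of_mem hx, ← mul_pow]
      refine le_add_right ?_
      have : ‖(freq ξ)⁻¹‖ₑ = ENNReal.ofReal (freq ξ)⁻¹ := by
        rw [← ofReal_norm, Real.norm_of_nonneg (by positivity)]
      rw [this]
      gcongr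
      exact hWle ξ
    · refine le_add_left ?_
      gcongr
      refine mul_le_of_le_one_left zero_le ?_
      rw [← ENNReal.ofReal_one]
      refine ENNReal.ofReal_le_ofReal (inv_le_one_of_one_le₀ ?_)
      simp only [mem_closedBall_zero_iff, not_le] at hx
      unfold freq
      nlinarith [Real.pi_gt_three]
  refine (lintegral_mono hle).trans_lt ?_
  rw [lintegral_add_right _ ((measurable_majorant hm).pow_const 2),
    lintegral_mul_const' _ _ (ENNReal.pow_ne_top hw.ne)]
  exact ENNReal.add_lt_top.2 ⟨ENNReal.mul_lt_top hI (ENNReal.pow_lt_top hw), hW2⟩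

theorem IsForcing.lintegral_majorant_mul_lt_top (hd : 3 ≤ d) {F : ℝ → E d → ℝ}
    {g : ℝ → E d → ℂ} (h : IsForcing F g) {G : ℝ → E d → ℝ} (hG : IsTestFn G) :
    ∫⁻ ξ, majorant g ξ * (ENNReal.ofReal (freq ξ)⁻¹ *
      majorant (fun t => 𝓕⁻ fun x => (G t x : ℂ)) ξ) < ∞ := by
  have hm := (stronglyMeasurable_fourierInv_slices hG.measurable_ofReal).measurable
  have hf := (continuous_freq (d := d)).measurable
  refine (lintegral_mul_le_sqrt (measurable_majorant h.measurable_ft).aemeasurable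
    ((by fun_prop : Measurable fun ξ : E d => ENNReal.ofReal (freq ξ)⁻¹).mul
      (measurable_majorant (g := fun t => 𝓕⁻ fun x => (G t x : ℂ)) hm)).aemeasurable).trans_lt (ENNReal.mul_lt_top ?_ ?_)
  · exact ENNReal.rpow_lt_top_of_nonneg (by norm_num) h.lintegral_majorant_sq_lt_top.ne
  · exact ENNReal.rpow_lt_top_of_nonneg (by norm_num)
      (hG.lintegral_inv_freq_mul_majorant_lt_top hd).ne

theorem enorm_duhamelFT_le {g : ℝ → E d → ℂ} {t : ℝ} {ξ : E d} (hξ : 0 < freq ξ) :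
    ‖duhamelFT g t ξ‖ₑ ≤ ENNReal.ofReal (freq ξ)⁻¹ * majorant g ξ := by
  have h := enorm_freq_mul_duhamelFT_le g t ξ
  have h1 : ‖duhamelFT g t ξ‖ₑ = ENNReal.ofReal (freq ξ)⁻¹ * ‖(freq ξ : ℂ) * duhamelFT g t ξ‖ₑ := by
    rw [enorm_mul, ← ofReal_norm (freq ξ : ℂ), Complex.norm_real, Real.norm_of_nonneg hξ.le,
      ← mul_assoc, ← ENNReal.ofReal_mul (by positivity), inv_mul_cancel₀ hξ.ne',
      ENNReal.ofReal_one, one_mul]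
  rw [h1]
  gcongr

theorem IsForcing.integrable_duhamelFT_mul (hd : 3 ≤ d) {F : ℝ → E d → ℝ}
    {g : ℝ → E d → ℂ} (h : IsForcing F g) {G : ℝ → E d → ℝ} (hG : IsTestFn G) :
    Integrable (fun q : ℝ × E d => duhamelFT g q.1 q.2 * 𝓕⁻ (fun x => (G q.1 x : ℂ)) q.2)
      (volume.prod volume) := by
  have hm := (stronglyMeasurable_fourierInv_slices hG.measurable_ofReal).measurable
  have hV := measurable_duhamelFT h.measurable_ft
  have hΦ : Measurable fun q : ℝ × E d =>
      duhamelFT g q.1 q.2 * 𝓕⁻ (fun x => (G q.1 x : ℂ)) q.2 := Measurable.mul hV hm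
  refine ⟨hΦ.aestronglyMeasurable, ?_⟩
  rw [HasFiniteIntegral, lintegral_prod_symm _ hΦ.enorm.aemeasurable]
  refine (lintegral_mono_ae ?_).trans_lt (h.lintegral_majorant_mul_lt_top hd hG)
  filter_upwards [ae_freq_pos hd] with ξ hξ
  have hmξ : Measurable fun t => ‖𝓕⁻ (fun x => (G t x : ℂ)) ξ‖ₑ :=
    (hm.comp (measurable_prodMk_right (y := ξ))).enorm
  calc ∫⁻ t, ‖duhamelFT g t ξ * 𝓕⁻ (fun x => (G t x : ℂ)) ξ‖ₑ
      ≤ ∫⁻ t, ENNReal.ofReal (freq ξ)⁻¹ * majorant g ξ * ‖𝓕⁻ (fun x => (G t x : ℂ)) ξ‖ₑ := by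
        refine lintegral_mono fun t => ?_
        rw [enorm_mul]
        gcongr
        exact enorm_duhamelFT_le hξ
    _ = _ := by
        rw [lintegral_const_mul _ hmξ, majorant, majorant]
        ring

theorem integral_duhamelFT_mul_eq {g : ℝ → E d → ℂ} (hg : Measurable (Function.uncurry g))
    {ξ : E d} (hξ : majorant g ξ < ∞) {G : ℝ → E d → ℝ} (hG : IsTestFn G) :
    ∫ t, duhamelFT g t ξ * 𝓕⁻ (fun x => (G t x : ℂ)) ξ = ∫ t', g t' ξ * adjointFT G t' ξ := by
  have hgi : Integrable fun t' => g t' ξ :=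
    ⟨(hg.comp measurable_prodMk_right).aestronglyMeasurable, hξ⟩
  have hint : Integrable (fun q : ℝ × ℝ => (sinKer (q.1 - q.2) ξ : ℂ) *
      (𝓕⁻ (fun x => (G q.1 x : ℂ)) ξ * g q.2 ξ)) (volume.prod volume) := by
    refine ((hG.integrable_fourierInv ξ).mul_prod hgi).bdd_mul (c := (freq ξ)⁻¹) ?_
      (ae_of_all _ fun q => ?_)
    · exact (Complex.measurable_ofReal.comp (measurable_sinKer.comp
        (f := fun q : ℝ × ℝ => (q.1 - q.2, ξ)) (by fun_prop))).aestronglyMeasurable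
    · rw [Complex.norm_real]
      exact abs_sinKer_le _ _
  have hs := integral_integral_swap (f := fun t t' => (sinKer (t - t') ξ : ℂ) *
      (𝓕⁻ (fun x => (G t x : ℂ)) ξ * g t' ξ)) hint
  refine Eq.trans ?_ (hs.trans ?_)
  · refine integral_congr_ae (ae_of_all _ fun t => ?_)
    simp only
    rw [duhamelFT, ← integral_mul_const]
    refine integral_congr_ae (ae_of_all _ fun t' => ?_)
    simp only
    ring
  · refine integral_congr_ae (ae_of_all _ fun t' => ?_)
    simp only
    rw [adjointFT, ← integral_const_mul]
    refine integral_congr_ae (ae_of_all _ fun t => ?_)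
    simp only
    ring

/-- Transposition: Parseval at each time moves the pairing to frequency space, and exchanging the
two time integrals lets the retarded operator act on `G` instead of `F`. -/
theorem IsForcing.integral_integral_mul_eq (hd : 3 ≤ d) {F : ℝ → E d → ℝ}
    {g : ℝ → E d → ℂ} (h : IsForcing F g) {D : ℝ → E d → ℝ} (hD : IsDuhamel g D)
    {G : ℝ → E d → ℝ} (hG : IsTestFn G) :
    ((∫ t, ∫ x, D t x * G t x : ℝ) : ℂ) = ∫ ξ, ∫ t', g t' ξ * adjointFT G t' ξ := by
  have h1 : ∀ t, ((∫ x, D t x * G t x : ℝ) : ℂ) =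
      ∫ ξ, duhamelFT g t ξ * 𝓕⁻ (fun x => (G t x : ℂ)) ξ := fun t => by
    rw [← ((isFourierTransform_iff.1 (hD.ft t)).integral_mul_fourierInv hd
      (h.memLp_freq_mul_duhamelFT t) (hG.slice t)).2.2, ← integral_complex_ofReal]
    simp
  rw [← integral_complex_ofReal]
  simp_rw [h1]
  rw [integral_integral_swap (h.integrable_duhamelFT_mul hd hG)]
  refine integral_congr_ae ?_
  filter_upwards [h.ae_majorant_lt_top] with ξ hξ
  exact integral_duhamelFT_mul_eq h.measurable_ft hξ hG

theorem adjointFT_eq_zero {G : ℝ → E d → ℝ} {τ : ℝ} (hτ : ∀ t, τ < t → ∀ x, G t x = 0) {t' : ℝ}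
    (ht' : τ < t') (ξ : E d) : adjointFT G t' ξ = 0 := by
  refine integral_eq_zero_of_ae (ae_of_all _ fun t => ?_)
  simp only [Pi.zero_apply, mul_eq_zero, Complex.ofReal_eq_zero]
  by_cases h : t' < t
  · right
    rw [Real.fourierInv_eq']
    simp [hτ t (ht'.trans h)]
  · left
    rw [sinKer, if_neg (by linarith)]

/-- Cauchy–Schwarz in `ξ` at each `t'`, with the adjoint bounded in `L²` uniformly in `t'`, pairs
`L¹_t` with `L^∞_t`. If `G` vanishes after `τ`, so does its adjoint evolution, and only the forcing
up to `τ` counts; uniqueness relies on this localization. -/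
theorem exists_enorm_integral_mul_le (hd : 3 ≤ d) :
    ∃ C : ℝ≥0∞, C ≠ ∞ ∧ ∀ (F : ℝ → E d → ℝ) (g : ℝ → E d → ℂ) (D G : ℝ → E d → ℝ) (τ : ℝ),
      IsForcing F g → IsDuhamel g D → IsTestFn G → (∀ t, τ < t → ∀ x, G t x = 0) →
      ‖∫ t, ∫ x, D t x * G t x‖ₑ ≤ C * (∫⁻ t in Iic τ, eLpNorm (F t) 2 volume) *
        (∫⁻ t, (∫⁻ x, ‖G t x‖ₑ ^ (6 * d / (3 * d + 8) : ℝ)) ^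
          ((3 * d + 8) / (6 * d) * (3 / 2) : ℝ)) ^ (2 / 3 : ℝ) := by
  obtain ⟨C, hC, hY⟩ := exists_lintegral_adjointFT_sq_le hd
  refine ⟨C ^ (1 / 2 : ℝ), ENNReal.rpow_ne_top_of_nonneg (by norm_num) hC,
    fun F g D G τ h hD hG hτ => ?_⟩
  set N := ∫⁻ t, (∫⁻ x, ‖G t x‖ₑ ^ (6 * d / (3 * d + 8) : ℝ)) ^
          ((3 * d + 8) / (6 * d) * (3 / 2) : ℝ) with hN
  have e : ‖∫ t, ∫ x, D t x * G t x‖ₑ = ‖∫ ξ, ∫ t', g t' ξ * adjointFT G t' ξ‖ₑ := by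
    rw [← h.integral_integral_mul_eq hd hD hG, ← ofReal_norm, ← ofReal_norm, Complex.norm_real]
  rw [e]
  have hgs : ∀ t', AEMeasurable (fun ξ => ‖g t' ξ‖ₑ) volume := fun t' =>
    (h.measurable_ft.comp (measurable_prodMk_left (x := t'))).enorm.aemeasurable
  have hYs : ∀ t', AEMeasurable (fun ξ => ‖adjointFT G t' ξ‖ₑ) volume := fun t' =>
    (hG.measurable_adjointFT.comp (measurable_prodMk_left (x := t'))).enorm.aemeasurable
  calc ‖∫ ξ, ∫ t', g t' ξ * adjointFT G t' ξ‖ₑ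
      ≤ ∫⁻ ξ, ∫⁻ t', ‖g t' ξ‖ₑ * ‖adjointFT G t' ξ‖ₑ := by
        refine (enorm_integral_le_lintegral_enorm _).trans (lintegral_mono fun ξ => ?_)
        refine (enorm_integral_le_lintegral_enorm _).trans (le_of_eq ?_)
        simp_rw [enorm_mul]
    _ = ∫⁻ t', ∫⁻ ξ, ‖g t' ξ‖ₑ * ‖adjointFT G t' ξ‖ₑ := by
        rw [lintegral_lintegral_swap]
        exact ((h.measurable_ft.comp measurable_swap).enorm.mul
          (hG.measurable_adjointFT.comp measurable_swap).enorm).aemeasurable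
    _ ≤ ∫⁻ t', (Iic τ).indicator (fun t => eLpNorm (F t) 2 volume * (C ^ (1 / 2 : ℝ) *
          N ^ (2 / 3 : ℝ))) t' := by
        refine lintegral_mono fun t' => ?_
        by_cases ht : t' ∈ Iic τ
        · rw [indicator_of_mem ht]
          refine (lintegral_mul_le_sqrt (hgs t') (hYs t')).trans ?_
          refine mul_le_mul' (le_of_eq ?_) ?_
          · rw [lintegral_enorm_sq_eq, h.eLpNorm_ft, ← ENNReal.rpow_natCast, ← ENNReal.rpow_mul]
            simp
          · refine (ENNReal.rpow_le_rpow (hY G t' hG) (by norm_num)).trans (le_of_eq ?_)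
            rw [ENNReal.mul_rpow_of_nonneg _ _ (by norm_num), ← ENNReal.rpow_mul]
            rw [hN]
            norm_num
        · rw [indicator_of_notMem ht]
          simp_rw [adjointFT_eq_zero hτ (not_le.1 ht)]
          simp
    _ = _ := by
        rw [lintegral_indicator measurableSet_Iic, lintegral_mul_const _
          (measurable_eLpNorm_slice h.measurable two_ne_zero ENNReal.ofNat_ne_top)]
        ring

end RetardedStrichartz

/-! ### Duality for `L³_t L^p_x` -/

section ConverseHolder

variable {d : ℕ}

/-- Dividing by `J^{2/3}` is legitimate only for finite `J`, which is why the duality argument runs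
on truncations. -/
theorem le_pow_three_of_le_mul_rpow {J K : ℝ≥0∞} (hJ : J ≠ ∞) (h : J ≤ K * J ^ (2 / 3 : ℝ)) :
    J ≤ K ^ 3 := by
  rcases eq_or_ne J 0 with h0 | h0
  · rw [h0]; exact zero_le
  have h1 : J ^ (1 / 3 : ℝ) ≤ K := by
    have e : J = J ^ (1 / 3 : ℝ) * J ^ (2 / 3 : ℝ) := by
      rw [← ENNReal.rpow_add _ _ h0 hJ]; norm_num
    have hne0 : J ^ (2 / 3 : ℝ) ≠ 0 := by simp [h0, hJ]
    have hnet : J ^ (2 / 3 : ℝ) ≠ ∞ := ENNReal.rpow_ne_top_of_nonneg (by norm_num) hJ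
    rw [e] at h
    have e2 : (J ^ (1 / 3 : ℝ) * J ^ (2 / 3 : ℝ)) ^ (2 / 3 : ℝ) = J ^ (2 / 3 : ℝ) := by rw [← e]
    rw [e2] at h
    exact (ENNReal.mul_le_mul_iff_left hne0 hnet).1 h
  calc J = (J ^ (1 / 3 : ℝ)) ^ 3 := by
        rw [← ENNReal.rpow_natCast, ← ENNReal.rpow_mul]; norm_num
    _ ≤ K ^ 3 := by gcongr

/-- The truncation of `u` to times in `S` and to bounded times, positions and values. -/
def truncation (S : Set ℝ) (u : ℝ → E d → ℝ) (n : ℕ) (t : ℝ) (x : E d) : ℝ :=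
  {q : ℝ × E d | q.1 ∈ S ∧ |q.1| ≤ n ∧ ‖q.2‖ ≤ n ∧ |u q.1 q.2| ≤ n}.indicator
    (Function.uncurry u) (t, x)

theorem measurable_truncation {S : Set ℝ} (hS : MeasurableSet S) {u : ℝ → E d → ℝ}
    (hu : Measurable (Function.uncurry u)) (n : ℕ) :
    Measurable (Function.uncurry (truncation S u n)) := by
  refine hu.indicator ?_
  refine MeasurableSet.inter (measurable_fst hS) (MeasurableSet.inter ?_ (MeasurableSet.inter ?_ ?_))
  · exact measurableSet_le (f := fun q : ℝ × E d => |q.1|) (by fun_prop) measurable_const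
  · exact measurableSet_le (f := fun q : ℝ × E d => ‖q.2‖) (by fun_prop) measurable_const
  · exact measurableSet_le (continuous_abs.measurable.comp hu) measurable_const

theorem truncation_of_ne_zero {S : Set ℝ} {u : ℝ → E d → ℝ} {n : ℕ} {t : ℝ} {x : E d}
    (h : truncation S u n t x ≠ 0) : (t ∈ S ∧ |t| ≤ n ∧ ‖x‖ ≤ n ∧ |u t x| ≤ n) ∧
      truncation S u n t x = u t x := by
  have hm := mem_of_indicator_ne_zero h
  exact ⟨hm, indicator_of_mem hm _⟩

theorem abs_truncation_le (S : Set ℝ) (u : ℝ → E d → ℝ) (n : ℕ) (t : ℝ) (x : E d) :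
    |truncation S u n t x| ≤ n := by
  by_cases h : truncation S u n t x = 0
  · rw [h]; simp
  · obtain ⟨h1, h2⟩ := truncation_of_ne_zero h
    rw [h2]; exact h1.2.2.2

theorem eventually_truncation_eq {S : Set ℝ} {u : ℝ → E d → ℝ} {t : ℝ} (ht : t ∈ S) (x : E d) :
    ∀ᶠ n in atTop, truncation S u n t x = u t x := by
  filter_upwards [eventually_ge_atTop ⌈|t|⌉₊, eventually_ge_atTop ⌈‖x‖⌉₊,
    eventually_ge_atTop ⌈|u t x|⌉₊] with n h1 h2 h3
  exact indicator_of_mem (show (t, x) ∈ {q : ℝ × E d | q.1 ∈ S ∧ |q.1| ≤ n ∧ ‖q.2‖ ≤ n ∧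
    |u q.1 q.2| ≤ n} from ⟨ht, Nat.ceil_le.1 h1, Nat.ceil_le.1 h2, Nat.ceil_le.1 h3⟩) _

/-- `∫ |u_n(t, x)|^p dx` for the truncation `u_n` of `u`. -/
def truncMass (S : Set ℝ) (u : ℝ → E d → ℝ) (p : ℝ) (n : ℕ) (t : ℝ) : ℝ≥0∞ :=
  ∫⁻ x, ‖truncation S u n t x‖ₑ ^ p

theorem measurable_truncMass {S : Set ℝ} (hS : MeasurableSet S) {u : ℝ → E d → ℝ}
    (hu : Measurable (Function.uncurry u)) (p : ℝ) (n : ℕ) : Measurable (truncMass S u p n) :=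
  Measurable.lintegral_prod_right' (f := fun q : ℝ × E d => ‖truncation S u n q.1 q.2‖ₑ ^ p)
    ((measurable_truncation hS hu n).enorm.pow_const p)

theorem exists_truncMass_le {S : Set ℝ} {u : ℝ → E d → ℝ} {p : ℝ} (hp : 0 < p) (n : ℕ) :
    ∃ A : ℝ, 0 ≤ A ∧ ∀ t, truncMass S u p n t ≤ ENNReal.ofReal A := by
  refine ⟨(ENNReal.ofReal n ^ p * volume (Metric.closedBall (0 : E d) n)).toReal,
    ENNReal.toReal_nonneg, fun t => ?_⟩
  rw [ENNReal.ofReal_toReal (ENNReal.mul_ne_top (ENNReal.rpow_ne_top_of_nonneg hp.le (by simp))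
    measure_closedBall_lt_top.ne), ← setLIntegral_const,
    ← lintegral_indicator measurableSet_closedBall]
  refine lintegral_mono fun x => ?_
  by_cases h : truncation S u n t x = 0
  · simp only [h, enorm_zero, ENNReal.zero_rpow_of_pos hp]; exact zero_le
  · rw [indicator_of_mem (by simpa using (truncation_of_ne_zero h).1.2.2.1), ← ofReal_norm,
      Real.norm_eq_abs]
    gcongr
    exact abs_truncation_le _ _ _ _ _

theorem tendsto_truncMass {S : Set ℝ} (hS : MeasurableSet S) {u : ℝ → E d → ℝ}
    (hu : Measurable (Function.uncurry u)) {p : ℝ} (hp : 0 < p) {t : ℝ} (ht : t ∈ S) :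
    Tendsto (fun n => truncMass S u p n t) atTop (𝓝 (∫⁻ x, ‖u t x‖ₑ ^ p)) := by
  refine lintegral_tendsto_of_tendsto_of_monotone (fun n => ?_) (ae_of_all _ fun x => ?_)
    (ae_of_all _ fun x => ?_)
  · exact (((measurable_truncation hS hu n).comp measurable_prodMk_left).enorm.pow_const
      p).aemeasurable
  · intro m n hmn
    by_cases h : truncation S u m t x = 0
    · simp only [h, enorm_zero, ENNReal.zero_rpow_of_pos hp]; exact zero_le
    · obtain ⟨⟨h1, h2, h3, h4⟩, h5⟩ := truncation_of_ne_zero h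
      have hmn' : (m : ℝ) ≤ n := by exact_mod_cast hmn
      have : truncation S u n t x = u t x :=
        indicator_of_mem (show (t, x) ∈ {q : ℝ × E d | q.1 ∈ S ∧ |q.1| ≤ n ∧ ‖q.2‖ ≤ n ∧
          |u q.1 q.2| ≤ n} from ⟨h1, h2.trans hmn', h3.trans hmn', h4.trans hmn'⟩) _
      simp only [h5, this, le_refl]
  · refine tendsto_const_nhds.congr' ?_
    filter_upwards [eventually_truncation_eq ht x] with n hn
    rw [hn]

/-- The factor normalizing the test function at time `t`. -/
def testWeight (S : Set ℝ) (u : ℝ → E d → ℝ) (p : ℝ) (n : ℕ) (t : ℝ) : ℝ :=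
  -- The exponent `(3 - p)/p` is negative when `p > 3`; discarding times of small mass keeps the
  -- weight bounded.
  if (n : ℝ≥0∞)⁻¹ < truncMass S u p n t then (truncMass S u p n t).toReal ^ ((3 - p) / p) else 0

/-- The test function dual to the truncation of `u` in `L³_t L^p_x`. -/
def dualTest (S : Set ℝ) (u : ℝ → E d → ℝ) (p : ℝ) (n : ℕ) (t : ℝ) (x : E d) : ℝ :=
  testWeight S u p n t * (|truncation S u n t x| ^ (p - 2) * truncation S u n t x)

theorem exists_abs_testWeight_le {S : Set ℝ} {u : ℝ → E d → ℝ} {p : ℝ} (hp : 0 < p) (n : ℕ) :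
    ∃ K, ∀ t, |testWeight S u p n t| ≤ K := by
  obtain ⟨A, hA, h⟩ := exists_truncMass_le (S := S) (u := u) hp n
  refine ⟨A ^ ((3 - p) / p) + (n : ℝ)⁻¹ ^ ((3 - p) / p), fun t => ?_⟩
  unfold testWeight
  have a0 : 0 ≤ A ^ ((3 - p) / p) := by positivity
  have a1 : 0 ≤ (n : ℝ)⁻¹ ^ ((3 - p) / p) := by positivity
  split_ifs with hlt
  · have hfin : truncMass S u p n t ≠ ∞ := ne_top_of_le_ne_top ENNReal.ofReal_ne_top (h t)
    have hα0 : 0 ≤ (truncMass S u p n t).toReal := ENNReal.toReal_nonneg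
    have hαA : (truncMass S u p n t).toReal ≤ A := ENNReal.toReal_le_of_le_ofReal hA (h t)
    -- In `[0, ∞]` the inverse of `0` is `∞`, so no time passes the threshold for `n = 0`.
    have hn : n ≠ 0 := by
      rintro rfl
      simp at hlt
    have hαn : (n : ℝ)⁻¹ ≤ (truncMass S u p n t).toReal := by
      have := ENNReal.toReal_mono hfin hlt.le
      simpa using this
    have hn0 : 0 < (n : ℝ)⁻¹ := by positivity
    rw [abs_of_nonneg (by positivity)]
    rcases le_total 0 ((3 - p) / p) with hs | hs
    · exact (Real.rpow_le_rpow hα0 hαA hs).trans (by linarith)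
    · exact (Real.rpow_le_rpow_of_nonpos hn0 hαn hs).trans (by linarith)
  · rw [abs_zero]; linarith

theorem abs_rpow_mul_self {p : ℝ} (hp : 1 < p) (y : ℝ) : |(|y| ^ (p - 2) * y)| = |y| ^ (p - 1) := by
  rcases eq_or_ne y 0 with h | h
  · rw [h, mul_zero, abs_zero, Real.zero_rpow (by linarith)]
  · have := abs_pos.2 h
    rw [abs_mul, abs_of_nonneg (by positivity), ← Real.rpow_add_one this.ne']
    congr 1; ring

theorem isTestFn_dualTest {S : Set ℝ} (hS : MeasurableSet S) {u : ℝ → E d → ℝ}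
    (hu : Measurable (Function.uncurry u)) {p : ℝ} (hp : 1 < p) (n : ℕ) :
    IsTestFn (dualTest S u p n) := by
  have hm := measurable_truncation hS hu n
  have hM := measurable_truncMass hS hu p n
  obtain ⟨K, hK⟩ := exists_abs_testWeight_le (S := S) (u := u) (by linarith : 0 < p) n
  refine ⟨?_, ⟨K * n ^ (p - 1), fun t x => ?_⟩, ⟨n, fun t x h => ?_⟩⟩
  · have hw : Measurable (testWeight S u p n) :=
      Measurable.ite (measurableSet_lt measurable_const hM) (hM.ennreal_toReal.pow_const _)
        measurable_const
    exact (hw.comp measurable_fst).mul (((continuous_abs.measurable.comp hm).pow_const _).mul hm)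
  · unfold dualTest
    rw [abs_mul, abs_rpow_mul_self hp]
    have h1 := abs_truncation_le S u n t x
    have : 0 ≤ K := (abs_nonneg _).trans (hK t)
    gcongr
    exact hK t
  · have h0 : truncation S u n t x ≠ 0 := fun h0 => h (by simp [dualTest, h0])
    obtain ⟨⟨-, h2, h3, -⟩, -⟩ := truncation_of_ne_zero h0
    exact ⟨h2, h3⟩

/-- The quantity `(∫ |u_n(t, x)|^p dx)^{3/p}`, cut off where it is small. -/
def truncNorm (S : Set ℝ) (u : ℝ → E d → ℝ) (p : ℝ) (n : ℕ) (t : ℝ) : ℝ≥0∞ :=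
  if (n : ℝ≥0∞)⁻¹ < truncMass S u p n t then truncMass S u p n t ^ (3 / p) else 0

theorem measurable_truncNorm {S : Set ℝ} (hS : MeasurableSet S) {u : ℝ → E d → ℝ}
    (hu : Measurable (Function.uncurry u)) (p : ℝ) (n : ℕ) : Measurable (truncNorm S u p n) :=
  have hM := measurable_truncMass hS hu p n
  Measurable.ite (measurableSet_lt measurable_const hM) (hM.pow_const _) measurable_const

theorem truncNorm_ne_top {S : Set ℝ} {u : ℝ → E d → ℝ} {p : ℝ} (hp : 0 < p) (n : ℕ) (t : ℝ) :
    truncNorm S u p n t ≠ ∞ := by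
  obtain ⟨A, hA, h⟩ := exists_truncMass_le (S := S) (u := u) hp n
  unfold truncNorm
  split_ifs
  · exact ENNReal.rpow_ne_top_of_nonneg (by positivity)
      (ne_top_of_le_ne_top ENNReal.ofReal_ne_top (h t))
  · simp

theorem lintegral_truncNorm_ne_top {S : Set ℝ} {u : ℝ → E d → ℝ} {p : ℝ} (hp : 0 < p) (n : ℕ) :
    ∫⁻ t, truncNorm S u p n t ≠ ∞ := by
  obtain ⟨A, hA, h⟩ := exists_truncMass_le (S := S) (u := u) hp n
  have hle : ∀ t, truncNorm S u p n t ≤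
      (Icc (-(n : ℝ)) n).indicator (fun _ => ENNReal.ofReal A ^ (3 / p)) t := fun t => by
    by_cases ht : t ∈ Icc (-(n : ℝ)) n
    · rw [indicator_of_mem ht]
      unfold truncNorm
      split_ifs
      · gcongr
        exact h t
      · exact zero_le
    · have : truncMass S u p n t = 0 := by
        have h0 : ∀ x, truncation S u n t x = 0 := fun x => by
          by_contra hx
          exact ht (abs_le.1 (truncation_of_ne_zero hx).1.2.1)
        simp [truncMass, h0, ENNReal.zero_rpow_of_pos hp]
      simp [truncNorm, this]
  refine ne_top_of_le_ne_top ?_ (lintegral_mono hle)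
  rw [lintegral_indicator measurableSet_Icc, setLIntegral_const]
  exact ENNReal.mul_ne_top (ENNReal.rpow_ne_top_of_nonneg (by positivity) ENNReal.ofReal_ne_top)
    (by simp)

/-- The test function is supported where the truncation agrees with `u`, so the pairing sees only
the mass `M = ∫ |u_n|^p`; weight times mass is `M^{(3-p)/p} · M = M^{3/p}`. -/
theorem integral_mul_dualTest {S : Set ℝ} (hS : MeasurableSet S) {u : ℝ → E d → ℝ}
    (hu : Measurable (Function.uncurry u)) {p : ℝ} (hp : 1 < p) (n : ℕ) (t : ℝ) :
    ∫ x, u t x * dualTest S u p n t x = (truncNorm S u p n t).toReal := by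
  have hp0 : 0 < p := by linarith
  have hm : Measurable fun x => truncation S u n t x :=
    (measurable_truncation hS hu n).comp measurable_prodMk_left
  have e1 : ∀ x, u t x * dualTest S u p n t x =
      testWeight S u p n t * |truncation S u n t x| ^ p := fun x => by
    unfold dualTest
    rcases eq_or_ne (truncation S u n t x) 0 with h | h
    · simp [h, hp0.ne']
    · have h2 := (truncation_of_ne_zero h).2
      have h3 := abs_pos.2 h
      have : |truncation S u n t x| ^ p = |truncation S u n t x| ^ (p - 2) *
          (truncation S u n t x * truncation S u n t x) := by
        rw [← abs_mul_abs_self, ← sq, ← Real.rpow_natCast, ← Real.rpow_add h3]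
        congr 1; push_cast; ring
      rw [this, ← h2]
      ring
  have hmp : Measurable fun x => |truncation S u n t x| ^ p :=
    (continuous_abs.measurable.comp hm).pow_const p
  simp_rw [e1]
  rw [integral_const_mul, integral_eq_lintegral_of_nonneg_ae (ae_of_all _ fun x => by positivity)
    hmp.aestronglyMeasurable]
  have e2 : ∫⁻ x, ENNReal.ofReal (|truncation S u n t x| ^ p) = truncMass S u p n t := by
    refine lintegral_congr fun x => ?_
    rw [← ENNReal.ofReal_rpow_of_nonneg (abs_nonneg _) hp0.le, ← Real.norm_eq_abs, ofReal_norm]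
  rw [e2]
  unfold testWeight truncNorm
  split_ifs with h
  · obtain ⟨A, hA, hle⟩ := exists_truncMass_le (S := S) (u := u) hp0 n
    have hfin : truncMass S u p n t ≠ ∞ := ne_top_of_le_ne_top ENNReal.ofReal_ne_top (hle t)
    have hpos : 0 < (truncMass S u p n t).toReal :=
      ENNReal.toReal_pos (ne_bot_of_gt h) hfin
    rw [← ENNReal.toReal_rpow, ← Real.rpow_add_one hpos.ne']
    congr 1; field_simp; ring
  · simp

/-- Since `(p - 1) q = p`, the left side is a power of the same mass, with exponent `(3/2)((3 - p)/p
+ 1/q) = 3/p`. Thus pairing and dual norm are governed by one quantity. -/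
theorem lintegral_dualTest_rpow {S : Set ℝ} (hS : MeasurableSet S) {u : ℝ → E d → ℝ}
    (hu : Measurable (Function.uncurry u)) {p q : ℝ} (hp : 1 < p) (hq : 0 < q)
    (hpq : 1 / p + 1 / q = 1) (n : ℕ) (t : ℝ) :
    (∫⁻ x, ‖dualTest S u p n t x‖ₑ ^ q) ^ (1 / q * (3 / 2)) = truncNorm S u p n t := by
  have hp0 : 0 < p := by linarith
  have hm : Measurable fun x => ‖truncation S u n t x‖ₑ ^ p :=
    ((measurable_truncation hS hu n).comp measurable_prodMk_left).enorm.pow_const p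
  have hpq' : (p - 1) * q = p := by field_simp at hpq; linarith
  have e1 : ∀ x, ‖dualTest S u p n t x‖ₑ ^ q =
      ‖testWeight S u p n t‖ₑ ^ q * ‖truncation S u n t x‖ₑ ^ p := fun x => by
    rw [dualTest, enorm_mul, ENNReal.mul_rpow_of_nonneg _ _ hq.le]
    congr 1
    rw [← ofReal_norm, Real.norm_eq_abs, abs_rpow_mul_self hp,
      ENNReal.ofReal_rpow_of_nonneg (by positivity) hq.le, ← Real.rpow_mul (abs_nonneg _), hpq',
      ← ofReal_norm, Real.norm_eq_abs, ENNReal.ofReal_rpow_of_nonneg (by positivity) hp0.le]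
  simp_rw [e1]
  rw [lintegral_const_mul _ hm]
  change (‖testWeight S u p n t‖ₑ ^ q * truncMass S u p n t) ^ _ = _
  unfold testWeight truncNorm
  split_ifs with h
  · obtain ⟨A, hA, hle⟩ := exists_truncMass_le (S := S) (u := u) hp0 n
    have hfin : truncMass S u p n t ≠ ∞ := ne_top_of_le_ne_top ENNReal.ofReal_ne_top (hle t)
    have h0 : truncMass S u p n t ≠ 0 := ne_bot_of_gt h
    have hpos : 0 < (truncMass S u p n t).toReal := ENNReal.toReal_pos h0 hfin
    rw [← ofReal_norm, Real.norm_of_nonneg (by positivity), ← ENNReal.ofReal_rpow_of_pos hpos,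
      ENNReal.ofReal_toReal hfin, ← ENNReal.rpow_mul]
    nth_rewrite 2 [← ENNReal.rpow_one (truncMass S u p n t)]
    rw [← ENNReal.rpow_add _ _ h0 hfin, ← ENNReal.rpow_mul]
    congr 1
    have : q * (p - 1) = p := by linarith
    field_simp
    nlinarith
  · rw [enorm_zero, ENNReal.zero_rpow_of_pos hq, zero_mul, ENNReal.zero_rpow_of_pos (by positivity)]

/-- At a time of positive mass the threshold `1/n` is eventually passed; at a time of zero mass
there is nothing to prove. -/
theorem liminf_truncNorm {S : Set ℝ} (hS : MeasurableSet S) {u : ℝ → E d → ℝ}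
    (hu : Measurable (Function.uncurry u)) {p : ℝ} (hp : 0 < p) {t : ℝ} (ht : t ∈ S) :
    (∫⁻ x, ‖u t x‖ₑ ^ p) ^ (3 / p) ≤ liminf (fun n => truncNorm S u p n t) atTop := by
  have ht := tendsto_truncMass hS hu hp ht
  rcases eq_or_ne (∫⁻ x, ‖u t x‖ₑ ^ p) 0 with h0 | h0
  · rw [h0, ENNReal.zero_rpow_of_pos (by positivity)]; exact zero_le
  · refine (Tendsto.liminf_eq ?_).ge
    refine (ht.ennrpow_const (3 / p)).congr' ?_
    obtain ⟨c, hc0, hc⟩ := exists_between (pos_iff_ne_zero.2 h0)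
    filter_upwards [ht.eventually (lt_mem_nhds hc),
      ENNReal.tendsto_inv_nat_nhds_zero.eventually (gt_mem_nhds hc0)] with n h1 h2
    rw [truncNorm, if_pos (h2.trans h1)]

/-- A converse of Hölder's inequality in `L³_t L^p_x`. -/
theorem lintegral_rpow_le_of_pairing_le {S : Set ℝ} (hS : MeasurableSet S) {u : ℝ → E d → ℝ}
    (hu : Measurable (Function.uncurry u)) {p q : ℝ} (hp : 1 < p) (hq : 0 < q)
    (hpq : 1 / p + 1 / q = 1) {K : ℝ≥0∞}
    (h : ∀ G, IsTestFn G → (∀ t, t ∉ S → ∀ x, G t x = 0) →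
      ‖∫ t, ∫ x, u t x * G t x‖ₑ ≤
        K * (∫⁻ t, (∫⁻ x, ‖G t x‖ₑ ^ q) ^ (1 / q * (3 / 2))) ^ (2 / 3 : ℝ)) :
    ∫⁻ t in S, (∫⁻ x, ‖u t x‖ₑ ^ p) ^ (3 / p) ≤ K ^ 3 := by
  have hp0 : 0 < p := by linarith
  -- With `J = ∫ truncNorm`, testing against `dualTest` reads `J ≤ K J^{2/3}`, and `J` is finite by
  -- truncation. Fatou then removes the truncation.
  have hn : ∀ n, ∫⁻ t, truncNorm S u p n t ≤ K ^ 3 := fun n => by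
    refine le_pow_three_of_le_mul_rpow (lintegral_truncNorm_ne_top hp0 n) ?_
    have h1 := h _ (isTestFn_dualTest hS hu hp n) fun t ht x => by
      have : truncation S u n t x = 0 := by
        by_contra hx
        exact ht (truncation_of_ne_zero hx).1.1
      simp [dualTest, this]
    simp_rw [lintegral_dualTest_rpow hS hu hp hq hpq, integral_mul_dualTest hS hu hp] at h1
    refine le_trans (le_of_eq ?_) h1
    rw [integral_toReal (measurable_truncNorm hS hu p n).aemeasurable
      (ae_of_all _ fun t => (truncNorm_ne_top hp0 n t).lt_top), ← ofReal_norm,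
      Real.norm_of_nonneg ENNReal.toReal_nonneg,
      ENNReal.ofReal_toReal (lintegral_truncNorm_ne_top hp0 n)]
  calc ∫⁻ t in S, (∫⁻ x, ‖u t x‖ₑ ^ p) ^ (3 / p)
      ≤ ∫⁻ t in S, liminf (fun n => truncNorm S u p n t) atTop :=
        setLIntegral_mono' hS fun t ht => liminf_truncNorm hS hu hp0 ht
    _ ≤ ∫⁻ t, liminf (fun n => truncNorm S u p n t) atTop := setLIntegral_le_lintegral _ _
    _ ≤ liminf (fun n => ∫⁻ t, truncNorm S u p n t) atTop :=
        lintegral_liminf_le fun n => measurable_truncNorm hS hu p n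
    _ ≤ K ^ 3 := by
        refine (liminf_le_liminf (Eventually.of_forall hn)).trans ?_
        simp

/-- The exponent `6d/(3d-8)` of `X(I)` in the space variable. -/
def expX (d : ℕ) : ℝ := 6 * d / (3 * d - 8)

theorem one_lt_expX (hd : 3 ≤ d) : 1 < expX d := by
  have hd' : (3 : ℝ) ≤ d := by exact_mod_cast hd
  unfold expX
  rw [lt_div_iff₀ (by linarith)]
  linarith

/-- The retarded Strichartz estimate, on all intervals `(-∞, τ]`. -/
theorem exists_duhamel_le (hd : 3 ≤ d) :
    ∃ C : ℝ≥0∞, C ≠ ∞ ∧ ∀ (F : ℝ → E d → ℝ) (g : ℝ → E d → ℂ) (D : ℝ → E d → ℝ) (τ : ℝ),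
      IsForcing F g → IsDuhamel g D →
      ∫⁻ t in Iic τ, eLpNorm (D t) (ENNReal.ofReal (expX d)) volume ^ 3 ≤
        (C * ∫⁻ t in Iic τ, eLpNorm (F t) 2 volume) ^ 3 := by
  have hd' : (3 : ℝ) ≤ d := by exact_mod_cast hd
  have hp := one_lt_expX hd
  obtain ⟨C, hC, h⟩ := exists_enorm_integral_mul_le hd
  refine ⟨C, hC, fun F g D τ hF hD => ?_⟩
  have e1 : (3 * d + 8) / (6 * d) = 1 / (6 * d / (3 * d + 8) : ℝ) := by field_simp
  have key := lintegral_rpow_le_of_pairing_le (S := Iic τ) measurableSet_Iic hD.measurable hp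
    (q := 6 * d / (3 * d + 8)) (by positivity)
    (by have : (3 * d - 8 : ℝ) ≠ 0 := by linarith
        unfold expX; field_simp; ring) (K := C * ∫⁻ t in Iic τ, eLpNorm (F t) 2 volume)
    fun G hG hS => by
      have := h F g D G τ hF hD hG fun t ht x => hS t (by simpa using ht) x
      rwa [e1] at this
  refine le_trans (le_of_eq ?_) key
  refine lintegral_congr fun t => ?_
  rw [eLpNorm_eq_lintegral_rpow_enorm_toReal (by simp; linarith) ENNReal.ofReal_ne_top,
    ENNReal.toReal_ofReal (by linarith), ← ENNReal.rpow_natCast, ← ENNReal.rpow_mul]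
  congr 1
  push_cast; ring

end ConverseHolder

/-! ### Estimates for the Hartree nonlinearity -/

section Nonlinearity

variable {d : ℕ}

/-- `|·|⁻⁴ ∗ f` for nonnegative `f`. -/
def rieszPot (f : E d → ℝ≥0∞) (x : E d) : ℝ≥0∞ :=
  ∫⁻ y, ENNReal.ofReal (‖x - y‖ ^ (-4 : ℝ)) * f y

theorem measurable_ofReal_norm_sub_rpow :
    Measurable fun q : E d × E d => ENNReal.ofReal (‖q.1 - q.2‖ ^ (-4 : ℝ)) := by
  fun_prop

theorem measurable_rieszPot {f : E d → ℝ≥0∞} (hf : Measurable f) : Measurable (rieszPot f) :=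
  Measurable.lintegral_prod_right' (f := fun q : E d × E d =>
    ENNReal.ofReal (‖q.1 - q.2‖ ^ (-4 : ℝ)) * f q.2)
    (measurable_ofReal_norm_sub_rpow.mul (hf.comp measurable_snd))

/-- The exponent of `X(I)` in the space variable, as an extended real. -/
def pX (d : ℕ) : ℝ≥0∞ := ENNReal.ofReal (expX d)

theorem one_le_pX (hd : 3 ≤ d) : 1 ≤ pX d := by
  rw [pX, ← ENNReal.ofReal_one]
  exact ENNReal.ofReal_le_ofReal (one_lt_expX hd).le

theorem pX_ne_zero (hd : 3 ≤ d) : pX d ≠ 0 := (zero_lt_one.trans_le (one_le_pX hd)).ne'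

theorem pX_ne_top : pX d ≠ ∞ := ENNReal.ofReal_ne_top

theorem eLpNorm_pX (hd : 3 ≤ d) {ε : Type*} [ENorm ε] (f : E d → ε) :
    eLpNorm f (pX d) volume = (∫⁻ x, ‖f x‖ₑ ^ expX d) ^ (1 / expX d) := by
  rw [eLpNorm_eq_lintegral_rpow_enorm_toReal (pX_ne_zero hd) pX_ne_top, pX,
    ENNReal.toReal_ofReal (by linarith [one_lt_expX hd])]

/-- A nonnegative function is in `L²` if its pairings with `L²` functions are bounded. -/
theorem eLpNorm_two_le_of_pairing_le {h : E d → ℝ≥0∞} (hh : Measurable h) {K : ℝ≥0∞}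
    (hK : ∀ φ : E d → ℝ≥0∞, Measurable φ →
      ∫⁻ x, h x * φ x ≤ K * (∫⁻ x, φ x ^ 2) ^ (1 / 2 : ℝ)) :
    eLpNorm h 2 volume ≤ K := by
  -- The test functions are truncations of `h` itself: `∫ φ²` is finite and at most `∫ h φ ≤ K (∫
  -- φ²)^{1/2}`, and they increase to `h`.
  let φ : ℕ → E d → ℝ≥0∞ := fun n =>
    (Metric.closedBall (0 : E d) n).indicator fun x => min (h x) n
  have hφm : ∀ n, Measurable (φ n) := fun n =>
    (hh.min measurable_const).indicator measurableSet_closedBall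
  have hφh : ∀ n x, φ n x ≤ h x := fun n x => by
    refine (indicator_le_self' (fun _ _ => zero_le) x).trans (min_le_left _ _)
  have hfin : ∀ n, ∫⁻ x, φ n x ^ 2 ≠ ∞ := fun n => by
    have hle : ∀ x, φ n x ^ 2 ≤ (Metric.closedBall (0 : E d) n).indicator
        (fun _ => (n : ℝ≥0∞) ^ 2) x := fun x => by
      by_cases hx : x ∈ Metric.closedBall (0 : E d) n
      · simp only [φ, indicator_of_mem hx]
        gcongr
        exact min_le_right _ _
      · simp [φ, indicator_of_notMem hx]
    refine ne_top_of_le_ne_top ?_ (lintegral_mono hle)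
    rw [lintegral_indicator measurableSet_closedBall, setLIntegral_const]
    exact ENNReal.mul_ne_top (by simp) measure_closedBall_lt_top.ne
  have hn : ∀ n, ∫⁻ x, φ n x ^ 2 ≤ K ^ 2 := fun n => by
    set J := ∫⁻ x, φ n x ^ 2 with hJ
    have h1 : J ≤ K * J ^ (1 / 2 : ℝ) := by
      refine le_trans (lintegral_mono fun x => ?_) (hK _ (hφm n))
      rw [sq]
      gcongr
      exact hφh n x
    rcases eq_or_ne J 0 with h0 | h0
    · rw [h0]; exact zero_le
    have e : J ^ (1 / 2 : ℝ) * J ^ (1 / 2 : ℝ) = J := by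
      rw [← ENNReal.rpow_add _ _ h0 (hfin n)]; norm_num
    have h2 : J ^ (1 / 2 : ℝ) ≤ K := by
      refine (ENNReal.mul_le_mul_iff_left (c := J ^ (1 / 2 : ℝ)) (by simp [h0])
        (ENNReal.rpow_ne_top_of_nonneg (by norm_num) (hfin n))).1 ?_
      rwa [e]
    rw [← e, sq]
    gcongr
  have hlim : Tendsto (fun n => ∫⁻ x, φ n x ^ 2) atTop (𝓝 (∫⁻ x, h x ^ 2)) := by
    refine lintegral_tendsto_of_tendsto_of_monotone (fun n => ((hφm n).pow_const 2).aemeasurable)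
      (ae_of_all _ fun x m n hmn => ?_) (ae_of_all _ fun x => ?_)
    · have hmn' : (m : ℝ) ≤ n := by exact_mod_cast hmn
      have hmn'' : (m : ℝ≥0∞) ≤ n := by exact_mod_cast hmn
      have : φ m x ≤ φ n x := by
        by_cases hx : x ∈ Metric.closedBall (0 : E d) m
        · have hx' : x ∈ Metric.closedBall (0 : E d) n := Metric.closedBall_subset_closedBall hmn' hx
          simp only [φ, indicator_of_mem hx, indicator_of_mem hx']
          exact min_le_min le_rfl hmn''
        · simp [φ, indicator_of_notMem hx]
      simp only
      gcongr
    · have h1 : Tendsto (fun n : ℕ => min (h x) (n : ℝ≥0∞)) atTop (𝓝 (h x)) := by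
        have := (tendsto_const_nhds (x := h x) (f := atTop (α := ℕ))).min ENNReal.tendsto_nat_nhds_top
        simpa using this
      have h2 : Tendsto (fun n => φ n x) atTop (𝓝 (h x)) := by
        refine h1.congr' ?_
        filter_upwards [eventually_ge_atTop ⌈‖x‖⌉₊] with n hn
        exact (indicator_of_mem (show x ∈ Metric.closedBall (0 : E d) n by
          simpa using Nat.ceil_le.1 hn) fun x => min (h x) (n : ℝ≥0∞)).symm
      exact ((ENNReal.continuous_pow 2).tendsto _).comp h2
  have := le_of_tendsto' hlim hn
  have e : eLpNorm h 2 volume = (∫⁻ x, h x ^ 2) ^ (1 / 2 : ℝ) := by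
    rw [eLpNorm_eq_lintegral_rpow_enorm_toReal two_ne_zero ENNReal.ofNat_ne_top]
    simp
  rw [e]
  refine (ENNReal.rpow_le_rpow this (by norm_num)).trans (le_of_eq ?_)
  rw [← ENNReal.rpow_natCast, ← ENNReal.rpow_mul]
  simp

/-- Paired with `φ ∈ L²` this is a Riesz form of order `4`. Hölder puts `a b` in `L^{3d/(3d-8)}` and
`c φ` in `L^{3d/(3d-4)}`, and `(3d-8)/(3d) + (3d-4)/(3d) = 2 - 4/d` is the Hardy–Littlewood–Sobolev
relation. -/
theorem exists_eLpNorm_rieszPot_mul_le (hd : 5 ≤ d) :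
    ∃ C : ℝ≥0∞, C ≠ ∞ ∧ ∀ a b c : E d → ℝ≥0∞, Measurable a → Measurable b → Measurable c →
      eLpNorm (fun x => rieszPot (fun y => a y * b y) x * c x) 2 volume ≤
        C * eLpNorm a (pX d) volume * eLpNorm b (pX d) volume * eLpNorm c (pX d) volume := by
  have hd' : (5 : ℝ) ≤ d := by exact_mod_cast hd
  have hd3 : 3 ≤ d := by omega
  have hp := one_lt_expX hd3
  have h38 : (0 : ℝ) < 3 * d - 8 := by linarith
  have h34 : (0 : ℝ) < 3 * d - 4 := by linarith
  obtain ⟨C, hC, h⟩ := exists_lintegral_riesz_le (V := E d) volume (s := 4)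
    (p := 3 * d / (3 * d - 4)) (r := 3 * d / (3 * d - 8)) (by norm_num)
    (by rw [finrank_euclideanSpace, Fintype.card_fin]; linarith)
    (by rw [lt_div_iff₀ h34]; linarith) (by rw [lt_div_iff₀ h38]; linarith)
    (by rw [finrank_euclideanSpace, Fintype.card_fin]; field_simp; ring)
  refine ⟨C, hC, fun a b c ha hb hc => ?_⟩
  refine eLpNorm_two_le_of_pairing_le ((measurable_rieszPot (ha.mul hb)).mul hc) fun φ hφ => ?_
  have h1 := h (fun x => c x * φ x) (fun y => a y * b y) (hc.mul hφ) (ha.mul hb)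
  have e1 : ∫⁻ x, rieszPot (fun y => a y * b y) x * c x * φ x =
      ∫⁻ x, ∫⁻ y, c x * φ x * ENNReal.ofReal (‖x - y‖ ^ (-4 : ℝ)) * (a y * b y) := by
    refine lintegral_congr fun x => ?_
    have hm : Measurable fun y => ENNReal.ofReal (‖x - y‖ ^ (-4 : ℝ)) * (a y * b y) :=
      (measurable_ofReal_norm_sub_rpow.comp measurable_prodMk_left).mul (ha.mul hb)
    simp_rw [mul_assoc (c x * φ x)]
    rw [lintegral_const_mul _ hm, rieszPot]
    ring
  have h2 := ENNReal.lintegral_Lp_mul_le_Lq_mul_Lr (μ := (volume : Measure (E d)))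
    (p := 3 * d / (3 * d - 8)) (q := expX d) (r := expX d) (by positivity)
    (by unfold expX; gcongr; linarith) (by unfold expX; field_simp; norm_num) ha.aemeasurable
    hb.aemeasurable
  have h3 := ENNReal.lintegral_Lp_mul_le_Lq_mul_Lr (μ := (volume : Measure (E d)))
    (p := 3 * d / (3 * d - 4)) (q := expX d) (r := 2) (by positivity)
    (by unfold expX; rw [div_lt_div_iff₀ h34 h38]; nlinarith)
    (by unfold expX; field_simp; ring) hc.aemeasurable hφ.aemeasurable
  simp only [Pi.mul_apply] at h2 h3
  refine e1.trans_le ?_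
  rw [eLpNorm_pX hd3, eLpNorm_pX hd3, eLpNorm_pX hd3]
  simp only [enorm_eq_self]
  calc _ ≤ _ := h1
    _ ≤ C * ((∫⁻ x, c x ^ expX d) ^ (1 / expX d) * (∫⁻ x, φ x ^ (2 : ℝ)) ^ (1 / 2 : ℝ)) *
        ((∫⁻ x, a x ^ expX d) ^ (1 / expX d) * (∫⁻ x, b x ^ expX d) ^ (1 / expX d)) := by
        gcongr
    _ = _ := by
        simp only [ENNReal.rpow_ofNat]
        ring

/-! ### The Hartree nonlinearity -/

theorem hartree_apply (u : E d → ℝ) (x : E d) :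
    hartree u x = (∫ y, ‖x - y‖ ^ (-4 : ℝ) * u y ^ 2) * u x := by
  rw [hartree, convolution_eq_swap]
  congr 1
  refine integral_congr_ae (ae_of_all _ fun y => ?_)
  simp only [ContinuousLinearMap.mul_apply']
  congr 1
  rw [Real.rpow_neg (norm_nonneg _)]
  norm_cast

theorem hartree_congr_ae {u w : E d → ℝ} (h : u =ᵐ[volume] w) : hartree u =ᵐ[volume] hartree w := by
  filter_upwards [h] with x hx
  rw [hartree_apply, hartree_apply, hx]
  congr 1
  refine integral_congr_ae ?_
  filter_upwards [h] with y hy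
  rw [hy]

theorem hartree_zero : hartree (0 : E d → ℝ) = 0 := by
  ext x; simp [hartree]

theorem measurable_hartree {u : ℝ → E d → ℝ} (hu : Measurable (Function.uncurry u)) :
    Measurable (Function.uncurry fun t => hartree (u t)) := by
  have hm : Measurable fun q : (ℝ × E d) × E d => ‖q.1.2 - q.2‖ ^ (-4 : ℝ) * u q.1.1 q.2 ^ 2 := by
    refine Measurable.mul (by fun_prop) (Measurable.pow_const ?_ 2)
    exact hu.comp (f := fun q : (ℝ × E d) × E d => (q.1.1, q.2)) (by fun_prop)
  have : (Function.uncurry fun t => hartree (u t)) = fun q : ℝ × E d =>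
      (∫ y, ‖q.2 - y‖ ^ (-4 : ℝ) * u q.1 y ^ 2) * u q.1 q.2 := by
    ext ⟨t, x⟩
    exact hartree_apply _ _
  rw [this]
  exact (StronglyMeasurable.integral_prod_right' hm.stronglyMeasurable).measurable.mul hu

/-- Taking indicators of balls for the third factor in the trilinear bound makes the potential
square integrable on every ball. -/
theorem ae_rieszPot_lt_top (hd : 5 ≤ d) {a b : E d → ℝ≥0∞} (ha : Measurable a) (hb : Measurable b)
    (ha' : eLpNorm a (pX d) volume ≠ ∞) (hb' : eLpNorm b (pX d) volume ≠ ∞) :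
    ∀ᵐ x, rieszPot (fun y => a y * b y) x < ∞ := by
  obtain ⟨C, hC, h⟩ := exists_eLpNorm_rieszPot_mul_le hd
  have hn : ∀ n : ℕ, ∀ᵐ x : E d, x ∈ Metric.closedBall (0 : E d) n →
      rieszPot (fun y => a y * b y) x < ∞ := fun n => by
    let c : E d → ℝ≥0∞ := (Metric.closedBall (0 : E d) n).indicator fun _ => 1
    have hc : Measurable c := measurable_const.indicator measurableSet_closedBall
    have hc' : eLpNorm c (pX d) volume ≠ ∞ := by
      rw [eLpNorm_pX (by omega)]
      refine ENNReal.rpow_ne_top_of_nonneg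
        (by have := one_lt_expX (d := d) (by omega); positivity) ?_
      refine ne_top_of_le_ne_top (measure_closedBall_lt_top (μ := volume) (x := (0 : E d))
        (r := n)).ne ?_
      rw [← lintegral_indicator_one measurableSet_closedBall]
      refine lintegral_mono fun x => ?_
      by_cases hx : x ∈ Metric.closedBall (0 : E d) n
      · simp [c, indicator_of_mem hx]
      · simp only [c, indicator_of_notMem hx, enorm_zero]
        rw [ENNReal.zero_rpow_of_pos (by linarith [one_lt_expX (d := d) (by omega)])]
    have h1 := (h a b c ha hb hc).trans_lt (ENNReal.mul_lt_top (ENNReal.mul_lt_top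
      (ENNReal.mul_lt_top hC.lt_top ha'.lt_top) hb'.lt_top) hc'.lt_top)
    rw [eLpNorm_eq_lintegral_rpow_enorm_toReal two_ne_zero ENNReal.ofNat_ne_top] at h1
    have h2 := (ENNReal.rpow_lt_top_iff_of_pos (by simp)).1 h1
    have hm : Measurable fun x => ‖rieszPot (fun y => a y * b y) x * c x‖ₑ ^ (2 : ℝ≥0∞).toReal :=
      (((measurable_rieszPot (ha.mul hb)).mul hc).enorm).pow_const _
    filter_upwards [ae_lt_top hm h2.ne] with x hx hxn
    have h3 := (ENNReal.rpow_lt_top_iff_of_pos (by simp)).1 hx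
    simpa [c, indicator_of_mem hxn] using h3
  filter_upwards [ae_all_iff.2 hn] with x hx
  exact hx ⌈‖x‖⌉₊ (by simpa using Nat.le_ceil ‖x‖)

theorem integrable_riesz_mul {f : E d → ℝ} (hf : Measurable f) {x : E d}
    (h : rieszPot (fun y => ‖f y‖ₑ) x < ∞) :
    Integrable (fun y => ‖x - y‖ ^ (-4 : ℝ) * f y) volume := by
  have hm : Measurable fun y => ‖x - y‖ ^ (-4 : ℝ) * f y := by fun_prop
  refine ⟨hm.aestronglyMeasurable, ?_⟩
  refine lt_of_le_of_lt (lintegral_mono fun y => ?_) h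
  rw [enorm_mul, ← ofReal_norm, Real.norm_of_nonneg (by positivity)]

theorem enorm_integral_riesz_mul_le (f : E d → ℝ) (x : E d) :
    ‖∫ y, ‖x - y‖ ^ (-4 : ℝ) * f y‖ₑ ≤ rieszPot (fun y => ‖f y‖ₑ) x := by
  refine (enorm_integral_le_lintegral_enorm _).trans (lintegral_mono fun y => ?_)
  rw [enorm_mul, ← ofReal_norm, Real.norm_of_nonneg (by positivity)]

theorem rieszPot_mono {f g : E d → ℝ≥0∞} (h : ∀ y, f y ≤ g y) (x : E d) :
    rieszPot f x ≤ rieszPot g x :=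
  lintegral_mono fun y => by gcongr; exact h y

/-- Uses `𝒩(u) - 𝒩(w) = (|·|⁻⁴ ∗ u²)(u - w) + (|·|⁻⁴ ∗ (u - w)(u + w)) w`. Finite potentials are
required: a divergent Bochner integral is `0` by default, and subtracting the two convolutions would
then be unjustified. -/
theorem enorm_hartree_sub_le {u w : E d → ℝ} (hu : Measurable u) (hw : Measurable w) {x : E d}
    (h1 : rieszPot (fun y => ‖u y‖ₑ * ‖u y‖ₑ) x < ∞)
    (h2 : rieszPot (fun y => ‖w y‖ₑ * ‖w y‖ₑ) x < ∞) :
    ‖hartree u x - hartree w x‖ₑ ≤ rieszPot (fun y => ‖u y‖ₑ * ‖u y‖ₑ) x * ‖u x - w x‖ₑ +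
      rieszPot (fun y => ‖u y - w y‖ₑ * (‖u y‖ₑ + ‖w y‖ₑ)) x * ‖w x‖ₑ := by
  have e : ∀ f : E d → ℝ, (fun y => ‖f y ^ 2‖ₑ) = fun y => ‖f y‖ₑ * ‖f y‖ₑ := fun f => by
    ext y; rw [sq, enorm_mul]
  have i1 := integrable_riesz_mul (hu.pow_const 2) (x := x) (by rwa [e])
  have i2 := integrable_riesz_mul (hw.pow_const 2) (x := x) (by rwa [e])
  have key : hartree u x - hartree w x = (∫ y, ‖x - y‖ ^ (-4 : ℝ) * u y ^ 2) * (u x - w x) +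
      (∫ y, ‖x - y‖ ^ (-4 : ℝ) * (u y ^ 2 - w y ^ 2)) * w x := by
    simp_rw [mul_sub (‖x - _‖ ^ (-4 : ℝ))]
    rw [hartree_apply, hartree_apply, integral_sub i1 i2]
    ring
  rw [key]
  refine (enorm_add_le _ _).trans ?_
  rw [enorm_mul, enorm_mul]
  gcongr
  · refine (enorm_integral_riesz_mul_le _ _).trans (le_of_eq ?_)
    rw [e]
  · refine (enorm_integral_riesz_mul_le _ _).trans (rieszPot_mono (fun y => ?_) x)
    have : u y ^ 2 - w y ^ 2 = (u y - w y) * (u y + w y) := by ring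
    rw [this, enorm_mul]
    gcongr
    exact enorm_add_le _ _

theorem eLpNorm_le_add_of_enorm_le {f : E d → ℝ} {A B : E d → ℝ≥0∞} (hA : Measurable A)
    (hB : Measurable B) (h : ∀ᵐ x, ‖f x‖ₑ ≤ A x + B x) :
    eLpNorm f 2 volume ≤ eLpNorm A 2 volume + eLpNorm B 2 volume := by
  refine (eLpNorm_mono_enorm_ae (g := A + B) h).trans ?_
  exact eLpNorm_add_le hA.aestronglyMeasurable hB.aestronglyMeasurable one_le_two

/-- The trilinear estimate applied to both terms of the difference identity; with `U`, `W` the two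
norms the coefficients add up to `U² + UW + W² ≤ (U + W)²`. -/
theorem exists_eLpNorm_hartree_sub_le (hd : 5 ≤ d) :
    ∃ C : ℝ≥0∞, C ≠ ∞ ∧ ∀ u w : E d → ℝ, Measurable u → Measurable w →
      eLpNorm u (pX d) volume ≠ ∞ → eLpNorm w (pX d) volume ≠ ∞ →
      eLpNorm (fun x => hartree u x - hartree w x) 2 volume ≤
        C * (eLpNorm u (pX d) volume + eLpNorm w (pX d) volume) ^ 2 *
          eLpNorm (fun x => u x - w x) (pX d) volume := by
  obtain ⟨C, hC, h⟩ := exists_eLpNorm_rieszPot_mul_le hd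
  refine ⟨C, hC, fun u w hu hw hu' hw' => ?_⟩
  have hp := one_le_pX (d := d) (by omega)
  have mu := hu.enorm
  have mw := hw.enorm
  have md := (hu.sub hw).enorm
  simp only [Pi.sub_apply] at md
  have n1 : eLpNorm (fun x => ‖u x‖ₑ) (pX d) volume = eLpNorm u (pX d) volume := eLpNorm_enorm u
  have n2 : eLpNorm (fun x => ‖w x‖ₑ) (pX d) volume = eLpNorm w (pX d) volume := eLpNorm_enorm w
  have n3 : eLpNorm (fun x => ‖u x - w x‖ₑ) (pX d) volume =
    eLpNorm (fun x => u x - w x) (pX d) volume := eLpNorm_enorm fun x => u x - w x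
  have n4 : eLpNorm (fun x => ‖u x‖ₑ + ‖w x‖ₑ) (pX d) volume ≤
      eLpNorm u (pX d) volume + eLpNorm w (pX d) volume := by
    have h4 := eLpNorm_add_le mu.aestronglyMeasurable mw.aestronglyMeasurable hp (μ := volume)
    rw [n1, n2] at h4
    exact h4
  have a1 := ae_rieszPot_lt_top hd mu mu (by rwa [n1]) (by rwa [n1])
  have a2 := ae_rieszPot_lt_top hd mw mw (by rwa [n2]) (by rwa [n2])
  have b1 := h _ _ _ mu mu md
  have b2 := h _ _ _ md (mu.add mw) mw
  have b0 := eLpNorm_le_add_of_enorm_le (f := fun x => hartree u x - hartree w x)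
    ((measurable_rieszPot (mu.mul mu)).mul md)
    ((measurable_rieszPot (md.mul (mu.add mw))).mul mw) (by
      filter_upwards [a1, a2] with x h1 h2
      exact enorm_hartree_sub_le hu hw h1 h2)
  have b3 := b0.trans (add_le_add b1 b2)
  rw [n1, n2, n3] at b3
  generalize eLpNorm u (pX d) volume = U at *
  generalize eLpNorm w (pX d) volume = W at *
  generalize eLpNorm (fun x => u x - w x) (pX d) volume = Z at *
  calc eLpNorm (fun x => hartree u x - hartree w x) 2 volume
      ≤ _ := b3
    _ ≤ C * U * U * Z + C * Z * (U + W) * W := by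
        gcongr
        exact n4
    _ = C * Z * (U * U + (U + W) * W) := by ring
    _ ≤ C * Z * (U + W) ^ 2 := by
        gcongr
        calc U * U + (U + W) * W ≤ U * U + (U + W) * W + U * W := le_self_add
          _ = _ := by ring
    _ = _ := by ring

end Nonlinearity

/-! ### The space `X(I)`: triangle inequality, Fatou, completeness -/

section SpaceX

variable {d : ℕ}

theorem normX_eq (I : Set ℝ) (u : ℝ → E d → ℝ) :
    normX I u = (∫⁻ t in I, eLpNorm (u t) (pX d) volume ^ 3) ^ (1 / 3 : ℝ) := by
  rw [normX, eLpNorm_eq_lintegral_rpow_enorm_toReal (by norm_num) ENNReal.ofNat_ne_top]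
  simp only [enorm_eq_self, ENNReal.toReal_ofNat, ENNReal.rpow_ofNat]
  rfl

theorem normX_pow_three (I : Set ℝ) (u : ℝ → E d → ℝ) :
    normX I u ^ 3 = ∫⁻ t in I, eLpNorm (u t) (pX d) volume ^ 3 := by
  rw [normX_eq, ← ENNReal.rpow_natCast, ← ENNReal.rpow_mul]
  simp

theorem normX_le_iff {I : Set ℝ} {u : ℝ → E d → ℝ} {B : ℝ≥0∞} :
    normX I u ≤ B ↔ ∫⁻ t in I, eLpNorm (u t) (pX d) volume ^ 3 ≤ B ^ 3 := by
  rw [← normX_pow_three]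
  exact (ENNReal.pow_le_pow_left_iff three_ne_zero).symm

theorem normX_congr {I : Set ℝ} {u w : ℝ → E d → ℝ}
    (h : ∀ᵐ t ∂(volume.restrict I), u t =ᵐ[volume] w t) : normX I u = normX I w := by
  refine eLpNorm_congr_ae ?_
  filter_upwards [h] with t ht
  exact eLpNorm_congr_ae ht

theorem measurable_eLpNorm_pX (hd : 3 ≤ d) {u : ℝ → E d → ℝ} (hu : Measurable (Function.uncurry u)) :
    Measurable fun t => eLpNorm (u t) (pX d) volume :=
  measurable_eLpNorm_slice hu (pX_ne_zero hd) pX_ne_top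

theorem measurable_slice {u : ℝ → E d → ℝ} (hu : Measurable (Function.uncurry u)) (t : ℝ) :
    Measurable (u t) := hu.comp measurable_prodMk_left

theorem normX_add_le (hd : 3 ≤ d) {I : Set ℝ} {u w : ℝ → E d → ℝ}
    (hu : Measurable (Function.uncurry u)) (hw : Measurable (Function.uncurry w)) :
    normX I (fun t x => u t x + w t x) ≤ normX I u + normX I w := by
  refine (eLpNorm_mono_enorm (g := (fun t => eLpNorm (u t) (pX d) volume) +
    fun t => eLpNorm (w t) (pX d) volume) fun t => ?_).trans (eLpNorm_add_le
      (measurable_eLpNorm_pX hd hu).aestronglyMeasurable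
      (measurable_eLpNorm_pX hd hw).aestronglyMeasurable (by norm_num))
  simp only [enorm_eq_self, Pi.add_apply]
  exact eLpNorm_add_le (measurable_slice hu t).aestronglyMeasurable
    (measurable_slice hw t).aestronglyMeasurable (one_le_pX hd)

theorem normX_sub_comm (I : Set ℝ) (u w : ℝ → E d → ℝ) :
    normX I (fun t x => u t x - w t x) = normX I (fun t x => w t x - u t x) := by
  rw [normX_eq, normX_eq]
  congr 1
  refine lintegral_congr fun t => ?_
  congr 1
  exact eLpNorm_sub_comm (u t) (w t) _ _

theorem normX_sub_le (hd : 3 ≤ d) {I : Set ℝ} {u w : ℝ → E d → ℝ}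
    (hu : Measurable (Function.uncurry u)) (hw : Measurable (Function.uncurry w)) :
    normX I (fun t x => u t x - w t x) ≤ normX I u + normX I w := by
  have h := normX_add_le (I := I) hd hu (w := fun t x => -w t x) hw.neg
  have e : normX I (fun t x => -w t x) = normX I w := by
    rw [normX_eq, normX_eq]
    congr 1
    refine lintegral_congr fun t => ?_
    congr 1
    exact eLpNorm_neg (w t) _ _
  rw [e] at h
  simpa only [sub_eq_add_neg] using h

theorem normX_sub_le_add (hd : 3 ≤ d) {I : Set ℝ} {u v w : ℝ → E d → ℝ}
    (hu : Measurable (Function.uncurry u)) (hv : Measurable (Function.uncurry v))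
    (hw : Measurable (Function.uncurry w)) :
    normX I (fun t x => u t x - w t x) ≤
      normX I (fun t x => u t x - v t x) + normX I (fun t x => v t x - w t x) := by
  have h := normX_add_le (I := I) hd (u := fun t x => u t x - v t x)
    (w := fun t x => v t x - w t x) (hu.sub hv) (hv.sub hw)
  simpa only [sub_add_sub_cancel] using h

theorem ae_ae_eq_of_normX_sub_eq_zero (hd : 3 ≤ d) {I : Set ℝ} {u w : ℝ → E d → ℝ}
    (hu : Measurable (Function.uncurry u)) (hw : Measurable (Function.uncurry w))
    (h : normX I (fun t x => u t x - w t x) = 0) :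
    ∀ᵐ t ∂(volume.restrict I), u t =ᵐ[volume] w t := by
  have h3 := normX_pow_three I fun t x => u t x - w t x
  rw [h, zero_pow three_ne_zero, eq_comm, lintegral_eq_zero_iff
    ((measurable_eLpNorm_pX hd (u := fun t x => u t x - w t x) (hu.sub hw)).pow_const 3)] at h3
  filter_upwards [h3] with t ht
  have h0 := eq_zero_of_pow_eq_zero ht
  have hm : Measurable fun x => u t x - w t x := (measurable_slice hu t).sub (measurable_slice hw t)
  filter_upwards [(eLpNorm_eq_zero_iff hm.aestronglyMeasurable (pX_ne_zero hd)).1 h0] with x hx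
  exact sub_eq_zero.1 hx

/-- Fatou's lemma in `X(I)`. -/
theorem normX_le_of_tendsto (hd : 3 ≤ d) {I : Set ℝ} {u : ℕ → ℝ → E d → ℝ} {v : ℝ → E d → ℝ}
    (hu : ∀ n, Measurable (Function.uncurry (u n)))
    (h : ∀ᵐ t ∂(volume.restrict I), ∀ᵐ x, Tendsto (fun n => u n t x) atTop (𝓝 (v t x)))
    {B : ℝ≥0∞} (hB : ∀ᶠ n in atTop, normX I (u n) ≤ B) : normX I v ≤ B := by
  rw [normX_le_iff]
  calc ∫⁻ t in I, eLpNorm (v t) (pX d) volume ^ 3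
      ≤ ∫⁻ t in I, liminf (fun n => eLpNorm (u n t) (pX d) volume ^ 3) atTop := by
        refine lintegral_mono_ae ?_
        filter_upwards [h] with t ht
        have h1 := Lp.eLpNorm_lim_le_liminf_eLpNorm (p := pX d)
          (fun n => (measurable_slice (hu n) t).aestronglyMeasurable) (v t) ht
        refine (pow_le_pow_left₀ zero_le h1 3).trans (le_of_eq ?_)
        exact (Monotone.map_liminf_of_continuousAt (F := atTop) (f := fun y : ℝ≥0∞ => y ^ 3)
          (fun a b hab => pow_le_pow_left₀ zero_le hab 3) _
          (ENNReal.continuous_pow 3).continuousAt)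
    _ ≤ liminf (fun n => ∫⁻ t in I, eLpNorm (u n t) (pX d) volume ^ 3) atTop :=
        lintegral_liminf_le fun n => (measurable_eLpNorm_pX hd (hu n)).pow_const 3
    _ ≤ B ^ 3 := by
        refine (liminf_le_liminf (v := fun _ => B ^ 3) ?_).trans (by simp)
        filter_upwards [hB] with n hn
        exact normX_le_iff.1 hn

theorem eLpNorm_sub_le_sum {p : ℝ≥0∞} (hp : 1 ≤ p) {f : ℕ → E d → ℝ} (hf : ∀ n, Measurable (f n))
    (N j : ℕ) : eLpNorm (f (N + j) - f N) p volume ≤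
      ∑ k ∈ Finset.range j, eLpNorm (f (N + k + 1) - f (N + k)) p volume := by
  induction j with
  | zero => simp
  | succ j ih =>
    rw [Finset.sum_range_succ]
    have e : f (N + (j + 1)) - f N = (f (N + j) - f N) + (f (N + j + 1) - f (N + j)) := by
      rw [← add_assoc]; abel
    rw [e]
    exact (eLpNorm_add_le ((hf _).sub (hf _)).aestronglyMeasurable
      ((hf _).sub (hf _)).aestronglyMeasurable hp).trans (by gcongr)

theorem ae_exists_tendsto_of_eLpNorm_sub_le {p : ℝ≥0∞} (hp : 1 ≤ p) {f : ℕ → E d → ℝ}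
    (hf : ∀ n, Measurable (f n)) {K : ℝ≥0∞} (hK : K ≠ ∞)
    (h : ∀ n, eLpNorm (f (n + 1) - f n) p volume ≤ K * (1 / 2) ^ n) :
    ∀ᵐ x, ∃ l, Tendsto (fun n => f n x) atTop (𝓝 l) := by
  have hgeo : ∑' n : ℕ, (1 / 2 : ℝ≥0∞) ^ n = 2 := by
    rw [ENNReal.tsum_geometric, one_div, ENNReal.one_sub_inv_two, inv_inv]
  have h1 : ∀ N j, eLpNorm (f (N + j) - f N) p volume ≤ 2 * K * (1 / 2) ^ N := fun N j => by
    refine (eLpNorm_sub_le_sum hp hf N j).trans ?_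
    calc ∑ k ∈ Finset.range j, eLpNorm (f (N + k + 1) - f (N + k)) p volume
        ≤ ∑ k ∈ Finset.range j, K * (1 / 2) ^ N * (1 / 2) ^ k := by
          refine Finset.sum_le_sum fun k _ => (h (N + k)).trans (le_of_eq ?_)
          rw [pow_add, mul_assoc]
      _ = K * (1 / 2) ^ N * ∑ k ∈ Finset.range j, (1 / 2) ^ k := by rw [Finset.mul_sum]
      _ ≤ K * (1 / 2) ^ N * 2 := by
          gcongr
          exact (ENNReal.sum_le_tsum _).trans hgeo.le
      _ = _ := by ring
  -- Two tails of size `2 K 2^{-N}` give `4 K 2^{-N}`; the extra `1` secures the strict inequality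
  -- even when `K = 0`.
  refine Lp.ae_tendsto_of_cauchy_eLpNorm (fun n => (hf n).aestronglyMeasurable) hp
    (B := fun N => (4 * K + 1) * (1 / 2) ^ N) ?_ fun N n m hn hm => ?_
  · rw [ENNReal.tsum_mul_left, hgeo]
    exact ENNReal.mul_ne_top (by simp [hK, ENNReal.mul_eq_top]) (by simp)
  · obtain ⟨i, rfl⟩ := Nat.exists_eq_add_of_le hn
    obtain ⟨j, rfl⟩ := Nat.exists_eq_add_of_le hm
    have e : f (N + i) - f (N + j) = (f (N + i) - f N) - (f (N + j) - f N) := by abel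
    rw [e]
    refine (eLpNorm_sub_le ((hf _).sub (hf _)).aestronglyMeasurable
      ((hf _).sub (hf _)).aestronglyMeasurable hp).trans_lt ?_
    refine (add_le_add (h1 N i) (h1 N j)).trans_lt ?_
    have hpos : (1 / 2 : ℝ≥0∞) ^ N ≠ 0 := (ENNReal.pow_pos (by norm_num) N).ne'
    have hfin : (1 / 2 : ℝ≥0∞) ^ N ≠ ∞ := ENNReal.pow_ne_top (by simp)
    calc 2 * K * (1 / 2) ^ N + 2 * K * (1 / 2) ^ N = 4 * K * (1 / 2) ^ N := by ring
      _ < (4 * K + 1) * (1 / 2) ^ N := by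
          refine (ENNReal.mul_lt_mul_iff_left hpos hfin).2 ?_
          exact ENNReal.lt_add_right (ENNReal.mul_ne_top (by simp) hK) one_ne_zero

/-- Completeness of `X(I)` along rapidly converging sequences. -/
theorem exists_limit_of_normX_sub_le (hd : 3 ≤ d) {I : Set ℝ} {u : ℕ → ℝ → E d → ℝ}
    (hu : ∀ n, Measurable (Function.uncurry (u n))) {K : ℝ≥0∞} (hK : K ≠ ∞)
    (h : ∀ n, normX I (fun t x => u (n + 1) t x - u n t x) ≤ K * (1 / 4) ^ n) :
    ∃ v : ℝ → E d → ℝ, Measurable (Function.uncurry v) ∧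
      ∀ᵐ t ∂(volume.restrict I), ∀ᵐ x, Tendsto (fun n => u n t x) atTop (𝓝 (v t x)) := by
  refine ⟨fun t x => limUnder atTop fun n => u n t x,
    (StronglyMeasurable.limUnder (l := atTop) (f := fun n => Function.uncurry (u n))
      fun n => (hu n).stronglyMeasurable).measurable, ?_⟩
  have hm : ∀ n, Measurable fun t => eLpNorm (fun x => u (n + 1) t x - u n t x) (pX d) volume ^ 3 :=
    fun n => (measurable_eLpNorm_pX hd (u := fun t x => u (n + 1) t x - u n t x)
      ((hu _).sub (hu _))).pow_const 3
  -- The cubes of the increments decay like `64^{-n}` in the time integral, which leaves room for a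
  -- weight `8^n`. Finiteness of the weighted sum at almost every time gives increments of size
  -- `2^{-n}` in `L^p_x`, hence convergence almost everywhere in `x`.
  have hsum : ∑' n, ∫⁻ t in I, 8 ^ n *
      eLpNorm (fun x => u (n + 1) t x - u n t x) (pX d) volume ^ 3 ≠ ∞ := by
    have hle : ∀ n, ∫⁻ t in I, 8 ^ n *
        eLpNorm (fun x => u (n + 1) t x - u n t x) (pX d) volume ^ 3 ≤ K ^ 3 * (1 / 8) ^ n := by
      intro n
      rw [lintegral_const_mul _ (hm n)]
      refine (mul_le_mul_right (normX_le_iff.1 (h n)) _).trans (le_of_eq ?_)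
      have : (8 : ℝ≥0∞) * (1 / 4) ^ 3 = 1 / 8 := by
        rw [← ENNReal.toReal_eq_toReal_iff' (by finiteness) (by finiteness)]
        simp
        norm_num
      rw [mul_pow, ← pow_mul, mul_comm n 3, pow_mul, mul_left_comm, ← mul_pow, this]
    refine ne_top_of_le_ne_top ?_ (ENNReal.tsum_le_tsum hle)
    rw [ENNReal.tsum_mul_left, ENNReal.tsum_geometric]
    refine ENNReal.mul_ne_top (ENNReal.pow_ne_top hK) ?_
    rw [ENNReal.inv_ne_top]
    exact (tsub_pos_of_lt (by norm_num)).ne'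
  rw [← lintegral_tsum fun n => ((hm n).const_mul _).aemeasurable] at hsum
  filter_upwards [ae_lt_top (Measurable.tsum fun n => (hm n).const_mul _) hsum]
    with t ht
  have hE : ∀ n, eLpNorm (u (n + 1) t - u n t) (pX d) volume ≤
      (∑' n, 8 ^ n * eLpNorm (fun x => u (n + 1) t x - u n t x) (pX d) volume ^ 3) ^ (1 / 3 : ℝ) *
        (1 / 2) ^ n := by
    intro n
    refine (ENNReal.pow_le_pow_left_iff three_ne_zero).1 ?_
    rw [mul_pow, ← ENNReal.rpow_natCast (_ ^ (1 / 3 : ℝ)), ← ENNReal.rpow_mul, ← pow_mul,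
      mul_comm n 3, pow_mul]
    have h8 : ((1 / 2 : ℝ≥0∞) ^ 3) * 8 = 1 := by
      rw [← ENNReal.toReal_eq_toReal_iff' (by finiteness) (by finiteness)]
      simp
      norm_num
    calc eLpNorm (u (n + 1) t - u n t) (pX d) volume ^ 3
        = (8 ^ n * eLpNorm (fun x => u (n + 1) t x - u n t x) (pX d) volume ^ 3) *
          ((1 / 2) ^ 3) ^ n := by
          rw [mul_comm, ← mul_assoc, ← mul_pow, h8, one_pow, one_mul]
          rfl
      _ ≤ _ := by
          gcongr
          norm_num
          exact ENNReal.le_tsum n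
  filter_upwards [ae_exists_tendsto_of_eLpNorm_sub_le (one_le_pX hd)
    (fun n => measurable_slice (hu n) t) (ENNReal.rpow_ne_top_of_nonneg (by norm_num) ht.ne) hE]
    with x hx
  exact tendsto_nhds_limUnder hx

end SpaceX

/-! ### Duhamel terms of the nonlinearity and their differences -/

section FixedPoint

variable {d : ℕ}

theorem IsFourierTransform.sub {u w : E d → ℝ} {g h : E d → ℂ} (hu : IsFourierTransform u g)
    (hw : IsFourierTransform w h) :
    IsFourierTransform (fun x => u x - w x) (fun ξ => g ξ - h ξ) := by
  rw [isFourierTransform_iff] at hu hw ⊢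
  simpa using hu.sub hw

theorem IsFourierTransform.congr {u w : E d → ℝ} {g h : E d → ℂ} (hu : IsFourierTransform u g)
    (huw : u =ᵐ[volume] w) (hgh : g =ᵐ[volume] h) : IsFourierTransform w h := by
  rw [isFourierTransform_iff] at hu ⊢
  refine hu.congr ?_ hgh
  filter_upwards [huw] with x hx
  rw [hx]

theorem isFourierTransform_zero : IsFourierTransform (0 : E d → ℝ) 0 :=
  ⟨aestronglyMeasurable_const, aestronglyMeasurable_const, fun φ => by simp⟩

theorem IsForcing.sub {F F' : ℝ → E d → ℝ} {g g' : ℝ → E d → ℂ} (h : IsForcing F g)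
    (h' : IsForcing F' g') :
    IsForcing (fun t x => F t x - F' t x) (fun t ξ => g t ξ - g' t ξ) := by
  refine ⟨h.measurable.sub h'.measurable, fun t => (h.memLp t).sub (h'.memLp t),
    h.measurable_ft.sub h'.measurable_ft, fun t => (h.ft t).sub (h'.ft t), fun t ξ => ?_, ?_⟩
  · rw [h.hermitian, h'.hermitian, map_sub]
  · have hm := measurable_eLpNorm_slice h.measurable two_ne_zero ENNReal.ofNat_ne_top
    refine (lintegral_mono fun t => eLpNorm_sub_le (h.memLp t).1 (h'.memLp t).1 one_le_two).trans_lt ?_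
    rw [lintegral_add_left hm]
    exact ENNReal.add_lt_top.2 ⟨h.lt_top, h'.lt_top⟩

theorem integrable_sinKer_mul {g : ℝ → E d → ℂ} (hg : Measurable (Function.uncurry g)) {ξ : E d}
    (hξ : majorant g ξ < ∞) (t : ℝ) : Integrable fun t' => (sinKer (t - t') ξ : ℂ) * g t' ξ := by
  have hgi : Integrable fun t' => g t' ξ :=
    ⟨(hg.comp measurable_prodMk_right).aestronglyMeasurable, hξ⟩
  refine hgi.bdd_mul (c := (freq ξ)⁻¹) ?_ (ae_of_all _ fun t' => ?_)
  · exact (Complex.measurable_ofReal.comp (measurable_sinKer.comp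
      (f := fun t' : ℝ => (t - t', ξ)) (by fun_prop))).aestronglyMeasurable
  · rw [Complex.norm_real]
    exact abs_sinKer_le _ _

theorem IsDuhamel.sub {F F' : ℝ → E d → ℝ} {g g' : ℝ → E d → ℂ} {D D' : ℝ → E d → ℝ}
    (h : IsForcing F g) (h' : IsForcing F' g') (hD : IsDuhamel g D) (hD' : IsDuhamel g' D') :
    IsDuhamel (fun t ξ => g t ξ - g' t ξ) (fun t x => D t x - D' t x) := by
  refine ⟨hD.measurable.sub hD'.measurable, fun t => ((hD.ft t).sub (hD'.ft t)).congr
    EventuallyEq.rfl ?_⟩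
  filter_upwards [h.ae_majorant_lt_top, h'.ae_majorant_lt_top] with ξ h1 h2
  rw [duhamelFT, duhamelFT, duhamelFT, ← integral_sub (integrable_sinKer_mul h.measurable_ft h1 t)
    (integrable_sinKer_mul h'.measurable_ft h2 t)]
  refine integral_congr_ae (ae_of_all _ fun t' => ?_)
  simp only
  ring

/-- `D` is the Duhamel term of the forcing `F`, which is `𝒩(a)` on `I` and vanishes elsewhere;
`g` is the spatial Fourier transform of `F`. -/
structure IsHartreeDuhamel (I : Set ℝ) (a F : ℝ → E d → ℝ) (g : ℝ → E d → ℂ)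
    (D : ℝ → E d → ℝ) : Prop where
  forcing : IsForcing F g
  duhamel : IsDuhamel g D
  eq_zero : ∀ t, t ∉ I → F t = 0
  ae_eq : ∀ᵐ t ∂(volume.restrict I), F t =ᵐ[volume] hartree (a t)

theorem isHartreeDuhamel_zero (I : Set ℝ) :
    IsHartreeDuhamel (d := d) I (fun _ => 0) (fun _ => 0) (fun _ => 0) (fun _ => 0) := by
  refine ⟨⟨measurable_const, fun t => MemLp.zero, measurable_const,
    fun t => isFourierTransform_zero, fun t ξ => by simp, by simp⟩,
    ⟨measurable_const, fun t => ?_⟩, fun t _ => rfl, ae_of_all _ fun t => ?_⟩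
  · have : duhamelFT (fun _ => (0 : E d → ℂ)) t = 0 := by
      ext ξ; simp [duhamelFT]
    rw [this]
    exact isFourierTransform_zero
  · simp only [hartree_zero]
    rfl

theorem ae_eLpNorm_lt_top (hd : 3 ≤ d) {I : Set ℝ} {a : ℝ → E d → ℝ}
    (ha : Measurable (Function.uncurry a)) (hI : normX I a ≠ ∞) :
    ∀ᵐ t ∂(volume.restrict I), eLpNorm (a t) (pX d) volume < ∞ := by
  have h := normX_pow_three I a
  have h1 := ae_lt_top ((measurable_eLpNorm_pX hd ha).pow_const 3) (μ := volume.restrict I)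
    (by rw [← h]; exact ENNReal.pow_ne_top hI)
  filter_upwards [h1] with t ht
  exact (ENNReal.pow_lt_top_iff.1 ht).resolve_right three_ne_zero

/-- The cubic bound on `𝒩(a(t))` in `L²` together with `a ∈ L³_t L^p_x` makes the forcing integrable
in time with values in `L²`. -/
theorem exists_isHartreeDuhamel (hd : 5 ≤ d) {I : Set ℝ} (hI : MeasurableSet I) {a : ℝ → E d → ℝ}
    (ha : Measurable (Function.uncurry a)) (haI : normX I a ≠ ∞) :
    ∃ F g D, IsHartreeDuhamel I a F g D := by
  have hd3 : 3 ≤ d := by omega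
  obtain ⟨C, hC, hN⟩ := exists_eLpNorm_hartree_sub_le hd
  have hNa : ∀ t, eLpNorm (a t) (pX d) volume ≠ ∞ →
      eLpNorm (hartree (a t)) 2 volume ≤ C * eLpNorm (a t) (pX d) volume ^ 3 := fun t ht => by
    have h1 := hN (a t) 0 (measurable_slice ha t) measurable_const ht (by simp)
    simp only [hartree_zero, eLpNorm_zero, add_zero, Pi.zero_apply, sub_zero] at h1
    refine h1.trans (le_of_eq ?_)
    ring
  have hem := measurable_eLpNorm_pX hd3 ha
  -- Almost every time of `I` belongs to `T`. Setting the forcing to zero elsewhere makes it square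
  -- integrable at every time, so Fourier transforms can be taken time by time.
  set T : Set ℝ := {t | t ∈ I ∧ eLpNorm (a t) (pX d) volume < ∞} with hT
  have hTm : MeasurableSet T := hI.inter (measurableSet_lt hem measurable_const)
  have hTne : ∀ t ∈ T, eLpNorm (a t) (pX d) volume ≠ ∞ := fun t ht => ht.2.ne
  let F : ℝ → E d → ℝ := T.indicator fun t => hartree (a t)
  have hFT : ∀ t ∈ T, F t = hartree (a t) := fun t ht => indicator_of_mem ht _
  have hFT0 : ∀ t, t ∉ T → F t = 0 := fun t ht => indicator_of_notMem ht _
  have hFm : Measurable (Function.uncurry F) := by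
    have : Function.uncurry F =
        (Prod.fst ⁻¹' T).indicator (Function.uncurry fun t => hartree (a t)) := by
      ext ⟨t, x⟩
      by_cases ht : t ∈ T
      · rw [indicator_of_mem (show (t, x) ∈ Prod.fst ⁻¹' T from ht)]
        exact congrFun (hFT t ht) x
      · rw [indicator_of_notMem (show (t, x) ∉ Prod.fst ⁻¹' T from ht)]
        exact congrFun (hFT0 t ht) x
    rw [this]
    exact (measurable_hartree ha).indicator (measurable_fst hTm)
  have hFle : ∀ t, eLpNorm (F t) 2 volume ≤
      I.indicator (fun t => C * eLpNorm (a t) (pX d) volume ^ 3) t := fun t => by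
    by_cases ht : t ∈ T
    · rw [hFT t ht, indicator_of_mem ht.1]
      exact hNa t (hTne t ht)
    · rw [hFT0 t ht, eLpNorm_zero]
      exact zero_le
  have hF2 : ∀ t, MemLp (F t) 2 volume := fun t => by
    refine ⟨(measurable_slice hFm t).aestronglyMeasurable, ?_⟩
    by_cases ht : t ∈ T
    · rw [hFT t ht]
      exact (hNa t (hTne t ht)).trans_lt (ENNReal.mul_lt_top hC.lt_top (ENNReal.pow_lt_top ht.2))
    · rw [hFT0 t ht, eLpNorm_zero]
      exact ENNReal.zero_lt_top
  obtain ⟨g, hg1, hg2, hg3⟩ := exists_measurable_fourier hFm hF2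
  have hFor : IsForcing F g := by
    refine ⟨hFm, hF2, hg1, hg2, hg3, (lintegral_mono hFle).trans_lt ?_⟩
    rw [lintegral_indicator hI, lintegral_const_mul _ (hem.pow_const 3), ← normX_pow_three]
    exact ENNReal.mul_lt_top hC.lt_top (ENNReal.pow_lt_top haI.lt_top)
  obtain ⟨D, hD⟩ := hFor.exists_isDuhamel hd3
  refine ⟨F, g, D, hFor, hD, fun t ht => hFT0 t fun h => ht h.1, ?_⟩
  filter_upwards [ae_eLpNorm_lt_top hd3 ha haI, ae_restrict_mem hI] with t h1 h2
  rw [hFT t ⟨h2, h1⟩]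

/-- The retarded estimate for the difference of forcings, followed by the pointwise-in-time
difference bound for `𝒩`. The free endpoint `τ` is kept for uniqueness; the contraction needs only
`τ = t₁`. -/
theorem exists_normX_duhamel_sub_le (hd : 5 ≤ d) :
    ∃ C : ℝ≥0∞, C ≠ ∞ ∧ ∀ (I : Set ℝ) (a F : ℝ → E d → ℝ) (g : ℝ → E d → ℂ)
      (D a' F' : ℝ → E d → ℝ) (g' : ℝ → E d → ℂ) (D' : ℝ → E d → ℝ) (τ : ℝ), MeasurableSet I →
      Measurable (Function.uncurry a) → Measurable (Function.uncurry a') →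
      normX I a ≠ ∞ → normX I a' ≠ ∞ →
      IsHartreeDuhamel I a F g D → IsHartreeDuhamel I a' F' g' D' →
      ∫⁻ t in Iic τ, eLpNorm (fun x => D t x - D' t x) (pX d) volume ^ 3 ∂(volume.restrict I) ≤
        (C * ∫⁻ t in Iic τ, (eLpNorm (a t) (pX d) volume + eLpNorm (a' t) (pX d) volume) ^ 2 *
          eLpNorm (fun x => a t x - a' t x) (pX d) volume ∂(volume.restrict I)) ^ 3 := by
  have hd3 : 3 ≤ d := by omega
  obtain ⟨C, hC, hN⟩ := exists_eLpNorm_hartree_sub_le hd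
  obtain ⟨C', hC', hS⟩ := exists_duhamel_le hd3
  refine ⟨C' * C, ENNReal.mul_ne_top hC' hC,
    fun I a F g D a' F' g' D' τ hI ha ha' haI haI' h h' => ?_⟩
  have h1 := hS _ _ _ τ (h.forcing.sub h'.forcing)
    (IsDuhamel.sub h.forcing h'.forcing h.duhamel h'.duhamel)
  refine le_trans (lintegral_mono' (Measure.restrict_mono le_rfl Measure.restrict_le_self) le_rfl)
    (h1.trans ?_)
  rw [mul_assoc]
  -- The linear estimate integrates over the whole half-line, but both forcings vanish outside `I`.
  have hsupp : ∫⁻ t in Iic τ, eLpNorm (fun x => F t x - F' t x) 2 volume =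
      ∫⁻ t in Iic τ, eLpNorm (fun x => F t x - F' t x) 2 volume ∂(volume.restrict I) := by
    rw [Measure.restrict_restrict measurableSet_Iic, ← lintegral_indicator measurableSet_Iic,
      ← lintegral_indicator (measurableSet_Iic.inter hI)]
    refine lintegral_congr fun t => ?_
    by_cases ht : t ∈ I
    · by_cases hτ : t ∈ Iic τ
      · rw [indicator_of_mem hτ, indicator_of_mem (mem_inter hτ ht)]
      · rw [indicator_of_notMem hτ, indicator_of_notMem fun h => hτ h.1]
    · rw [indicator_of_notMem (s := Iic τ ∩ I) fun h => ht h.2]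
      have : (fun x => F t x - F' t x) = 0 := by
        rw [h.eq_zero t ht, h'.eq_zero t ht]; ext; simp
      rw [indicator_apply, this]
      simp
  gcongr
  rw [hsupp]
  have hm : Measurable fun t => (eLpNorm (a t) (pX d) volume + eLpNorm (a' t) (pX d) volume) ^ 2 *
      eLpNorm (fun x => a t x - a' t x) (pX d) volume :=
    (((measurable_eLpNorm_pX hd3 ha).add (measurable_eLpNorm_pX hd3 ha')).pow_const 2).mul
      (measurable_eLpNorm_pX hd3 (u := fun t x => a t x - a' t x) (ha.sub ha'))
  rw [← lintegral_const_mul _ hm]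
  refine lintegral_mono_ae (ae_restrict_of_ae ?_)
  filter_upwards [h.ae_eq, h'.ae_eq, ae_eLpNorm_lt_top hd3 ha haI,
    ae_eLpNorm_lt_top hd3 ha' haI'] with t e1 e2 e3 e4
  rw [← mul_assoc]
  refine le_trans (le_of_eq (eLpNorm_congr_ae ?_))
    (hN (a t) (a' t) (measurable_slice ha t) (measurable_slice ha' t) e3.ne e4.ne)
  filter_upwards [e1, e2] with x h1 h2
  rw [h1, h2]

theorem lintegral_sq_mul_le {α : Type*} [MeasurableSpace α] {μ : Measure α} {k e : α → ℝ≥0∞}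
    (hk : AEMeasurable k μ) (he : AEMeasurable e μ) :
    (∫⁻ t, k t ^ 2 * e t ∂μ) ^ 3 ≤ (∫⁻ t, k t ^ 3 ∂μ) ^ 2 * ∫⁻ t, e t ^ 3 ∂μ := by
  have hpq : (3 / 2 : ℝ).HolderConjugate 3 := by
    rw [Real.holderConjugate_iff]; norm_num
  have h := ENNReal.lintegral_mul_le_Lp_mul_Lq μ hpq (hk.pow_const 2) he
  have e1 : ∀ t, (k t ^ 2) ^ (3 / 2 : ℝ) = k t ^ 3 := fun t => by
    rw [← ENNReal.rpow_natCast, ← ENNReal.rpow_mul, ← ENNReal.rpow_natCast]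
    norm_num
  simp only [e1, Pi.mul_apply, ENNReal.rpow_ofNat] at h
  refine (pow_le_pow_left₀ zero_le h 3).trans (le_of_eq ?_)
  rw [mul_pow, ← ENNReal.rpow_natCast, ← ENNReal.rpow_mul, ← ENNReal.rpow_natCast (_ ^ (1 / 3 : ℝ)),
    ← ENNReal.rpow_mul, ← ENNReal.rpow_natCast (∫⁻ t, k t ^ 3 ∂μ) 2]
  norm_num

/-- Hölder in time: two factors of the sum and one of the difference, each in `L³`. -/
theorem exists_normX_sub_le (hd : 5 ≤ d) :
    ∃ C : ℝ≥0∞, C ≠ ∞ ∧ ∀ (t₀ t₁ : ℝ) (a F : ℝ → E d → ℝ) (g : ℝ → E d → ℂ)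
      (D a' F' : ℝ → E d → ℝ) (g' : ℝ → E d → ℂ) (D' : ℝ → E d → ℝ),
      Measurable (Function.uncurry a) → Measurable (Function.uncurry a') →
      normX (Icc t₀ t₁) a ≠ ∞ → normX (Icc t₀ t₁) a' ≠ ∞ →
      IsHartreeDuhamel (Icc t₀ t₁) a F g D → IsHartreeDuhamel (Icc t₀ t₁) a' F' g' D' →
      normX (Icc t₀ t₁) (fun t x => D t x - D' t x) ≤
        C * (normX (Icc t₀ t₁) a + normX (Icc t₀ t₁) a') ^ 2 *
          normX (Icc t₀ t₁) (fun t x => a t x - a' t x) := by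
  have hd3 : 3 ≤ d := by omega
  obtain ⟨C, hC, h⟩ := exists_normX_duhamel_sub_le hd
  refine ⟨C, hC, fun t₀ t₁ a F g D a' F' g' D' ha ha' haI haI' hD hD' => ?_⟩
  have h1 := h _ a F g D a' F' g' D' t₁ measurableSet_Icc ha ha' haI haI' hD hD'
  have e : (volume.restrict (Icc t₀ t₁)).restrict (Iic t₁) = volume.restrict (Icc t₀ t₁) := by
    rw [Measure.restrict_restrict measurableSet_Iic, inter_eq_right.2 Icc_subset_Iic_self]
  rw [e] at h1
  rw [normX_le_iff]
  refine h1.trans ?_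
  have mk := (measurable_eLpNorm_pX hd3 ha).add (measurable_eLpNorm_pX hd3 ha')
  have me := measurable_eLpNorm_pX hd3 (u := fun t x => a t x - a' t x) (ha.sub ha')
  have h2 := lintegral_sq_mul_le (μ := volume.restrict (Icc t₀ t₁)) mk.aemeasurable me.aemeasurable
  rw [← normX_pow_three] at h2
  have h3 : ∫⁻ t in Icc t₀ t₁, (eLpNorm (a t) (pX d) volume + eLpNorm (a' t) (pX d) volume) ^ 3 ≤
      (normX (Icc t₀ t₁) a + normX (Icc t₀ t₁) a') ^ 3 := by
    have h4 := eLpNorm_add_le (μ := volume.restrict (Icc t₀ t₁)) (p := 3)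
      (measurable_eLpNorm_pX hd3 ha).aestronglyMeasurable
      (measurable_eLpNorm_pX hd3 ha').aestronglyMeasurable (by norm_num)
    have h5 := pow_le_pow_left₀ zero_le h4 3
    refine le_trans (le_of_eq ?_) h5
    rw [eLpNorm_eq_lintegral_rpow_enorm_toReal (by norm_num) ENNReal.ofNat_ne_top,
      ← ENNReal.rpow_natCast (_ ^ _), ← ENNReal.rpow_mul]
    simp
  rw [mul_assoc, mul_pow, mul_pow]
  refine mul_le_mul' le_rfl (h2.trans ?_)
  rw [mul_pow, ← pow_mul, mul_comm 2 3, pow_mul]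
  gcongr
  exact h3

end FixedPoint

/-! ### Existence by Picard iteration and unconditional uniqueness -/

section Contraction

variable {d : ℕ}

theorem normX_zero (I : Set ℝ) : normX (d := d) I (fun _ _ => 0) = 0 := by
  rw [normX_eq]
  have : eLpNorm (fun _ : E d => (0 : ℝ)) (pX d) volume = 0 := eLpNorm_zero
  simp [this]

theorem IsHartreeDuhamel.congr {I : Set ℝ} {a a' F : ℝ → E d → ℝ} {g : ℝ → E d → ℂ}
    {D : ℝ → E d → ℝ} (h : IsHartreeDuhamel I a F g D)
    (haa' : ∀ᵐ t ∂(volume.restrict I), a t =ᵐ[volume] a' t) : IsHartreeDuhamel I a' F g D := by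
  refine ⟨h.forcing, h.duhamel, h.eq_zero, ?_⟩
  filter_upwards [h.ae_eq, haa'] with t h1 h2
  exact h1.trans (hartree_congr_ae h2)

/-- The smallness condition on the size `η` of the data, `C` being the constant of the
difference estimate for Duhamel terms. -/
theorem exists_pos_mul_sq_le {C : ℝ≥0∞} (hC : C ≠ ∞) :
    ∃ η₀ : ℝ, 0 < η₀ ∧ ∀ η : ℝ, η ≤ η₀ → C * (8 * ENNReal.ofReal η) ^ 2 ≤ 1 / 4 := by
  have h : Tendsto (fun η : ℝ => C * (8 * ENNReal.ofReal η) ^ 2) (𝓝 0) (𝓝 0) := by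
    have h1 : Tendsto (fun η : ℝ => ENNReal.ofReal η) (𝓝 0) (𝓝 0) := by
      simpa using ENNReal.tendsto_ofReal (tendsto_id (α := ℝ) (x := 𝓝 0))
    have h2 := ENNReal.Tendsto.const_mul h1 (a := 8) (Or.inr (by simp))
    have h3 := ((ENNReal.continuous_pow 2).tendsto _).comp h2
    have h4 := ENNReal.Tendsto.const_mul h3 (a := C) (Or.inr hC)
    simpa using h4
  have h1 := h.eventually (eventually_le_nhds (b := (1 / 4 : ℝ≥0∞)) (by norm_num))
  obtain ⟨ε, hε, hb⟩ := Metric.eventually_nhds_iff.1 h1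
  refine ⟨ε / 2, by positivity, fun η hη => ?_⟩
  refine le_trans ?_ (hb (y := ε / 2) ?_)
  · gcongr
  · rw [dist_zero_right, Real.norm_of_nonneg (by positivity)]; linarith

/-- Inside the ball of radius `3η` the argument `v + f` has norm at most `4η`. Smallness makes the
Duhamel term at most `2η`, so adding the free part of size `η` stays in the ball, and differences
shrink by the factor `1/4`. -/
theorem exists_fixedPoint (hd : 5 ≤ d) :
    ∃ η₀ : ℝ, 0 < η₀ ∧ ∀ η : ℝ, 0 < η → η ≤ η₀ → ∀ (t₀ t₁ : ℝ) (L f : ℝ → E d → ℝ),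
      Measurable (Function.uncurry L) → Measurable (Function.uncurry f) →
      normX (Icc t₀ t₁) L ≤ ENNReal.ofReal η → normX (Icc t₀ t₁) f ≤ ENNReal.ofReal η →
      ∃ (v F : ℝ → E d → ℝ) (g : ℝ → E d → ℂ) (D : ℝ → E d → ℝ), Measurable (Function.uncurry v) ∧
        IsHartreeDuhamel (Icc t₀ t₁) (fun t x => v t x + f t x) F g D ∧
        (∀ t x, v t x = L t x - D t x) ∧ normX (Icc t₀ t₁) v ≤ ENNReal.ofReal (3 * η) := by
  have hd3 : 3 ≤ d := by omega
  obtain ⟨C, hC, hdiff⟩ := exists_normX_sub_le hd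
  obtain ⟨η₀, hη₀, hsmall⟩ := exists_pos_mul_sq_le hC
  refine ⟨η₀, hη₀, fun η hη hηle t₀ t₁ L f hL hf hLn hfn => ?_⟩
  have hs := hsmall η hηle
  set e : ℝ≥0∞ := ENNReal.ofReal η with he
  have he0 : e ≠ ∞ := ENNReal.ofReal_ne_top
  have h3e : ENNReal.ofReal (3 * η) = 3 * e := by
    rw [ENNReal.ofReal_mul (by norm_num), he]; simp
  set I := Icc t₀ t₁ with hI
  -- Honest measurable functions, not classes: each iterate is a pointwise expression, and equality
  -- almost everywhere enters only in the limit.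
  let Ball := {u : ℝ → E d → ℝ // Measurable (Function.uncurry u) ∧ normX I u ≤ 3 * e}
  have hadd : ∀ u : Ball, normX I (fun t x => u.1 t x + f t x) ≤ 4 * e := fun u => by
    refine (normX_add_le hd3 u.2.1 hf).trans ?_
    calc _ ≤ 3 * e + e := add_le_add u.2.2 hfn
      _ = 4 * e := by ring
  have hfin : ∀ u : Ball, normX I (fun t x => u.1 t x + f t x) ≠ ∞ := fun u =>
    ne_top_of_le_ne_top (ENNReal.mul_ne_top (by simp) he0) (hadd u)
  have hstep : ∀ u : Ball, ∃ (w : Ball) (F : ℝ → E d → ℝ) (g : ℝ → E d → ℂ) (D : ℝ → E d → ℝ),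
      IsHartreeDuhamel I (fun t x => u.1 t x + f t x) F g D ∧
        ∀ t x, w.1 t x = L t x - D t x := fun u => by
    obtain ⟨F, g, D, hD⟩ := exists_isHartreeDuhamel hd measurableSet_Icc
      (a := fun t x => u.1 t x + f t x) (u.2.1.add hf) (hfin u)
    have h1 := hdiff t₀ t₁ (fun t x => u.1 t x + f t x) F g D _ _ _ _ (u.2.1.add hf) measurable_const (hfin u)
      (by rw [← hI]; exact (normX_zero I).trans_ne ENNReal.zero_ne_top) hD
      (isHartreeDuhamel_zero _)
    simp only [Pi.zero_apply, sub_zero] at h1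
    -- Comparison with the zero forcing turns the difference estimate into the cubic bound for a
    -- single Duhamel term.
    have h2 : normX I D ≤ 2 * e := by
      refine h1.trans ?_
      have hz : normX (d := d) I (fun _ => 0) = 0 := normX_zero I
      rw [← hI, hz, add_zero]
      calc C * normX I (fun t x => u.1 t x + f t x) ^ 2 * normX I (fun t x => u.1 t x + f t x)
          ≤ C * (8 * e) ^ 2 * (4 * e) := by
            gcongr
            · refine (hadd u).trans ?_
              gcongr
              norm_num
            · exact hadd u
        _ ≤ 1 / 4 * (4 * e) := by gcongr
        _ = (1 / 4 * 4) * e := by ring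
        _ ≤ 2 * e := by
            gcongr
            rw [one_div, ENNReal.inv_mul_cancel (by norm_num) (by norm_num)]
            norm_num
    refine ⟨⟨fun t x => L t x - D t x, hL.sub hD.duhamel.measurable,
      (normX_sub_le hd3 hL hD.duhamel.measurable).trans ?_⟩, F, g, D, hD, fun t x => rfl⟩
    calc _ ≤ e + 2 * e := add_le_add hLn h2
      _ = 3 * e := by ring
  choose Φ FF gg DD hDD hΦ using hstep
  have hcontr : ∀ u w : Ball, normX I (fun t x => (Φ u).1 t x - (Φ w).1 t x) ≤
      1 / 4 * normX I (fun t x => u.1 t x - w.1 t x) := fun u w => by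
    have h1 := hdiff t₀ t₁ (fun t x => w.1 t x + f t x) _ _ _
      (fun t x => u.1 t x + f t x) _ _ _ (w.2.1.add hf) (u.2.1.add hf) (hfin w) (hfin u)
      (hDD w) (hDD u)
    have e1 : (fun t x => (Φ u).1 t x - (Φ w).1 t x) = fun t x => DD w t x - DD u t x := by
      ext t x; rw [hΦ, hΦ]; ring
    have e2 : (fun t x => w.1 t x + f t x - (u.1 t x + f t x)) = fun t x => w.1 t x - u.1 t x := by
      ext t x; ring
    rw [e1]
    rw [e2] at h1
    refine h1.trans ?_
    rw [normX_sub_comm _ w.1]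
    gcongr
    refine le_trans ?_ hs
    gcongr
    calc _ ≤ 4 * e + 4 * e := add_le_add (hadd w) (hadd u)
      _ = 8 * e := by ring
  let u0 : Ball := ⟨fun _ _ => 0, measurable_const, (normX_zero I).trans_le zero_le⟩
  let u : ℕ → Ball := fun n => Φ^[n] u0
  have hsucc : ∀ n, u (n + 1) = Φ (u n) := fun n => Function.iterate_succ_apply' Φ n u0
  -- Any two elements of the ball are at distance at most `6η`, and each step gains `1/4`.
  have hu6 : ∀ n j, normX I (fun t x => (u (n + j)).1 t x - (u n).1 t x) ≤
      6 * e * (1 / 4) ^ n := fun n j => by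
    induction n with
    | zero =>
      rw [pow_zero, mul_one]
      refine (normX_sub_le hd3 (u _).2.1 (u _).2.1).trans ?_
      calc _ ≤ 3 * e + 3 * e := add_le_add (u _).2.2 (u _).2.2
        _ = 6 * e := by ring
    | succ n ih =>
      rw [show n + 1 + j = (n + j) + 1 by ring, hsucc, hsucc]
      refine (hcontr _ _).trans ((mul_le_mul' le_rfl ih).trans (le_of_eq ?_))
      ring
  have h6 : 6 * e ≠ ∞ := ENNReal.mul_ne_top (by simp) he0
  obtain ⟨v, hvm, hv⟩ := exists_limit_of_normX_sub_le hd3 (fun n => (u n).2.1) h6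
    fun n => hu6 n 1
  have hvn : normX I v ≤ 3 * e := normX_le_of_tendsto hd3 (fun n => (u n).2.1) hv
    (Eventually.of_forall fun n => (u n).2.2)
  let v' : Ball := ⟨v, hvm, hvn⟩
  have hvu : ∀ n, normX I (fun t x => v t x - (u n).1 t x) ≤ 6 * e * (1 / 4) ^ n := fun n => by
    refine normX_le_of_tendsto hd3 (u := fun m t x => (u m).1 t x - (u n).1 t x)
      (fun m => (u m).2.1.sub (u n).2.1) ?_ ?_
    · filter_upwards [hv] with t ht
      filter_upwards [ht] with x hx
      exact hx.sub_const _
    · filter_upwards [eventually_ge_atTop n] with m hm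
      obtain ⟨j, rfl⟩ := Nat.exists_eq_add_of_le hm
      exact hu6 n j
  have hΦv : normX I (fun t x => v t x - (Φ v').1 t x) = 0 := by
    have hle : ∀ n, normX I (fun t x => v t x - (Φ v').1 t x) ≤ 6 * e * (1 / 4) ^ n := fun n => by
      refine (normX_sub_le_add hd3 hvm (u (n + 1)).2.1 (Φ v').2.1).trans ?_
      refine (add_le_add (hvu (n + 1)) ((hsucc n ▸ hcontr (u n) v').trans
        (mul_le_mul' le_rfl ((normX_sub_comm _ _ _).trans_le (hvu n))))).trans ?_
      rw [pow_succ]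
      calc 6 * e * ((1 / 4) ^ n * (1 / 4)) + 1 / 4 * (6 * e * (1 / 4) ^ n)
          = 6 * e * (1 / 4) ^ n * (1 / 4 + 1 / 4) := by ring
        _ ≤ 6 * e * (1 / 4) ^ n * 1 := by
            gcongr
            rw [← ENNReal.toReal_le_toReal (by finiteness) (by finiteness),
              ENNReal.toReal_add (by finiteness) (by finiteness)]
            norm_num
        _ = _ := mul_one _
    have hlim : Tendsto (fun n : ℕ => 6 * e * (1 / 4 : ℝ≥0∞) ^ n) atTop (𝓝 0) := by
      have h1 := ENNReal.tendsto_pow_atTop_nhds_zero_of_lt_one (r := 1 / 4) (by norm_num)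
      simpa using ENNReal.Tendsto.const_mul h1 (a := 6 * e) (Or.inr h6)
    exact le_antisymm (ge_of_tendsto' hlim hle) zero_le
  have hae := ae_ae_eq_of_normX_sub_eq_zero hd3 hvm (Φ v').2.1 hΦv
  -- The limit `v` is fixed only up to null sets. Its image under `Φ` is an equivalent
  -- representative satisfying `v = L - D` at every `(t, x)`, which the regularity statements need
  -- at each time, including `t₀`; the forcing may stay that of the limit, since only its almost
  -- everywhere values matter.
  refine ⟨(Φ v').1, FF v', gg v', DD v', (Φ v').2.1, (hDD v').congr ?_, hΦ v', ?_⟩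
  · filter_upwards [hae] with t ht
    filter_upwards [ht] with x hx
    rw [← hx]
  · rw [h3e]
    exact (Φ v').2.2

/-! ### Uniqueness -/

/-- March forward in steps of fixed length `r`. If `e` vanishes up to `T`, Hölder on the next step
bounds the mass `H` of `e³` up to `T + r` by `C³ (∫ k³)² H`, where `∫ k³` runs over the step only.
Choosing `r` so that the coefficient is below `1` forces `H = 0`, because `H` is finite. -/
theorem lintegral_eq_zero_of_volterra {t₀ t₁ : ℝ} {C : ℝ≥0∞} (hC : C ≠ ∞) {k e : ℝ → ℝ≥0∞}
    (hk : Measurable k) (he : Measurable e) (hk3 : ∫⁻ t in Icc t₀ t₁, k t ^ 3 ≠ ∞)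
    (he3 : ∫⁻ t in Icc t₀ t₁, e t ^ 3 ≠ ∞)
    (h : ∀ τ, ∫⁻ t in Iic τ, e t ^ 3 ∂(volume.restrict (Icc t₀ t₁)) ≤
      (C * ∫⁻ t in Iic τ, k t ^ 2 * e t ∂(volume.restrict (Icc t₀ t₁))) ^ 3) :
    ∫⁻ t in Icc t₀ t₁, e t ^ 3 = 0 := by
  set μ := volume.restrict (Icc t₀ t₁) with hμ
  have hCt : Tendsto (fun ε : ℝ≥0∞ => C ^ 3 * ε ^ 2) (𝓝 0) (𝓝 0) := by
    have h3 := (ENNReal.continuous_pow 2).tendsto 0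
    have h4 := ENNReal.Tendsto.const_mul h3 (a := C ^ 3) (Or.inr (ENNReal.pow_ne_top hC))
    simpa using h4
  obtain ⟨ε, hε, hε1⟩ : ∃ ε : ℝ≥0∞, ε ≠ 0 ∧ C ^ 3 * ε ^ 2 < 1 := by
    have h1 := (hCt.eventually (gt_mem_nhds zero_lt_one)).filter_mono
      (nhdsWithin_le_nhds (s := Ioi 0))
    have h2 : ∀ᶠ ε : ℝ≥0∞ in 𝓝[>] 0, ε ≠ 0 := by
      filter_upwards [self_mem_nhdsWithin] with ε hε
      exact (ne_of_gt hε)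
    exact (h2.and h1).exists
  -- Absolute continuity of the integral: the step length depends on `k` but is the same for every
  -- step, so finitely many steps reach `t₁`.
  obtain ⟨δ, hδ0, hδ⟩ := exists_pos_setLIntegral_lt_of_measure_lt (μ := μ) hk3 hε
  obtain ⟨r, hr0, hrδ⟩ : ∃ r : ℝ, 0 < r ∧ ENNReal.ofReal r < δ := by
    obtain ⟨c, hc0, hc⟩ := ENNReal.lt_iff_exists_nnreal_btwn.1 hδ0
    refine ⟨c, by exact_mod_cast hc0, by simpa using hc⟩
  have hz : ∀ n : ℕ, ∫⁻ t in Iic (t₀ + n * r), e t ^ 3 ∂μ = 0 := by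
    intro n
    induction n with
    | zero =>
      rw [hμ, Measure.restrict_restrict measurableSet_Iic]
      refine setLIntegral_measure_zero _ _ (measure_mono_null (t := {t₀}) ?_ (by simp))
      rintro t ⟨h1, h2⟩
      simp only [Nat.cast_zero, zero_mul, add_zero, mem_Iic] at h1
      exact le_antisymm h1 h2.1
    | succ n ih =>
      set T := t₀ + n * r with hT
      have hT' : t₀ + (n + 1 : ℕ) * r = T + r := by rw [hT]; push_cast; ring
      rw [hT']
      have hsplit : Iic (T + r) = Iic T ∪ Ioc T (T + r) :=
        (Iic_union_Ioc_eq_Iic (by linarith)).symm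
      have hae0 : ∀ᵐ t ∂(μ.restrict (Iic T)), e t = 0 := by
        have := (lintegral_eq_zero_iff (he.pow_const 3)).1 ih
        filter_upwards [this] with t ht
        exact eq_zero_of_pow_eq_zero ht
      have h1 : ∫⁻ t in Iic (T + r), k t ^ 2 * e t ∂μ = ∫⁻ t in Ioc T (T + r), k t ^ 2 * e t ∂μ := by
        rw [hsplit, lintegral_union measurableSet_Ioc (Iic_disjoint_Ioc le_rfl)]
        have : ∫⁻ t in Iic T, k t ^ 2 * e t ∂μ = 0 := by
          refine (lintegral_eq_zero_iff (f := fun t => k t ^ 2 * e t) ((hk.pow_const 2).mul he)).2 ?_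
          filter_upwards [hae0] with t ht
          simp [ht]
        rw [this, zero_add]
      have h2 := lintegral_sq_mul_le (μ := μ.restrict (Ioc T (T + r))) hk.aemeasurable he.aemeasurable
      have hkε : ∫⁻ t in Ioc T (T + r), k t ^ 3 ∂μ ≤ ε := by
        refine (hδ _ ((Measure.restrict_apply_le _ _).trans_lt ?_)).le
        rw [Real.volume_Ioc]
        simpa using hrδ
      set H := ∫⁻ t in Iic (T + r), e t ^ 3 ∂μ with hH
      have hHfin : H ≠ ∞ := ne_top_of_le_ne_top he3 (setLIntegral_le_lintegral _ _)
      have h3 : H ≤ C ^ 3 * ε ^ 2 * H := by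
        refine (h (T + r)).trans ?_
        rw [h1, mul_pow, mul_assoc]
        refine mul_le_mul' le_rfl (h2.trans ?_)
        gcongr
        rw [hH, hsplit]
        exact lintegral_mono_set subset_union_right
      by_contra hne
      have : C ^ 3 * ε ^ 2 * H < 1 * H := (ENNReal.mul_lt_mul_iff_left hne hHfin).2 hε1
      rw [one_mul] at this
      exact absurd h3 (not_le.2 this)
  obtain ⟨n, hn⟩ := exists_nat_gt ((t₁ - t₀) / r)
  rw [div_lt_iff₀ hr0] at hn
  have := hz n
  rwa [hμ, Measure.restrict_restrict measurableSet_Iic, inter_eq_right.2] at this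
  exact fun t ht => (ht.2.trans (by linarith) : t ≤ t₀ + n * r)

/-- Both solutions share the free part, so their difference is a difference of Duhamel terms, and
the localized estimate is a Volterra inequality with `k(t)` the sum of the norms of `v + f` and `v'
+ f` at time `t`. Finiteness of the norms suffices. -/
theorem ae_ae_eq_of_isHartreeDuhamel (hd : 5 ≤ d) {t₀ t₁ : ℝ} {L f v F D v' F' D' : ℝ → E d → ℝ}
    {g g' : ℝ → E d → ℂ} (hf : Measurable (Function.uncurry f))
    (hv : Measurable (Function.uncurry v)) (hv' : Measurable (Function.uncurry v'))
    (hfn : normX (Icc t₀ t₁) f ≠ ∞) (hvn : normX (Icc t₀ t₁) v ≠ ∞)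
    (hvn' : normX (Icc t₀ t₁) v' ≠ ∞)
    (hD : IsHartreeDuhamel (Icc t₀ t₁) (fun t x => v t x + f t x) F g D)
    (hD' : IsHartreeDuhamel (Icc t₀ t₁) (fun t x => v' t x + f t x) F' g' D')
    (h : ∀ᵐ t ∂(volume.restrict (Icc t₀ t₁)), v t =ᵐ[volume] fun x => L t x - D t x)
    (h' : ∀ᵐ t ∂(volume.restrict (Icc t₀ t₁)), v' t =ᵐ[volume] fun x => L t x - D' t x) :
    ∀ᵐ t ∂(volume.restrict (Icc t₀ t₁)), v' t =ᵐ[volume] v t := by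
  have hd3 : 3 ≤ d := by omega
  obtain ⟨C, hC, hdiff⟩ := exists_normX_duhamel_sub_le hd
  have ha : normX (Icc t₀ t₁) (fun t x => v t x + f t x) ≠ ∞ :=
    ne_top_of_le_ne_top (ENNReal.add_ne_top.2 ⟨hvn, hfn⟩) (normX_add_le hd3 hv hf)
  have ha' : normX (Icc t₀ t₁) (fun t x => v' t x + f t x) ≠ ∞ :=
    ne_top_of_le_ne_top (ENNReal.add_ne_top.2 ⟨hvn', hfn⟩) (normX_add_le hd3 hv' hf)
  have hsub : normX (Icc t₀ t₁) (fun t x => v' t x - v t x) ≠ ∞ :=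
    ne_top_of_le_ne_top (ENNReal.add_ne_top.2 ⟨hvn', hvn⟩) (normX_sub_le hd3 hv' hv)
  have mk := measurable_eLpNorm_pX hd3 (u := fun t x => v t x + f t x) (hv.add hf)
  have mk' := measurable_eLpNorm_pX hd3 (u := fun t x => v' t x + f t x) (hv'.add hf)
  have me := measurable_eLpNorm_pX hd3 (u := fun t x => v' t x - v t x) (hv'.sub hv)
  have key := lintegral_eq_zero_of_volterra (t₀ := t₀) (t₁ := t₁) hC (mk.add mk') me ?_ ?_ fun τ => ?_
  · refine ae_ae_eq_of_normX_sub_eq_zero hd3 hv' hv ?_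
    have := normX_pow_three (Icc t₀ t₁) fun t x => v' t x - v t x
    rw [key] at this
    exact eq_zero_of_pow_eq_zero this
  · have h4 := eLpNorm_add_le (μ := volume.restrict (Icc t₀ t₁)) (p := 3)
      mk.aestronglyMeasurable mk'.aestronglyMeasurable (by norm_num)
    have h5 : eLpNorm ((fun t => eLpNorm (fun x => v t x + f t x) (pX d) volume) +
        fun t => eLpNorm (fun x => v' t x + f t x) (pX d) volume) 3
        (volume.restrict (Icc t₀ t₁)) ^ 3 ≠ ∞ :=
      ENNReal.pow_ne_top (ne_top_of_le_ne_top (ENNReal.add_ne_top.2 ⟨ha, ha'⟩) h4)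
    refine ne_of_eq_of_ne ?_ h5
    rw [eLpNorm_eq_lintegral_rpow_enorm_toReal (by norm_num) ENNReal.ofNat_ne_top,
      ← ENNReal.rpow_natCast (_ ^ _), ← ENNReal.rpow_mul]
    simp
  · rw [← normX_pow_three]
    exact ENNReal.pow_ne_top hsub
  · have h1 := hdiff (Icc t₀ t₁) (fun t x => v t x + f t x) F g D
      (fun t x => v' t x + f t x) F' g' D' τ measurableSet_Icc (hv.add hf) (hv'.add hf)
      ha ha' hD hD'
    have e1 : ∫⁻ t in Iic τ, eLpNorm (fun x => v' t x - v t x) (pX d) volume ^ 3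
          ∂(volume.restrict (Icc t₀ t₁)) = ∫⁻ t in Iic τ,
          eLpNorm (fun x => D t x - D' t x) (pX d) volume ^ 3 ∂(volume.restrict (Icc t₀ t₁)) := by
      refine lintegral_congr_ae (ae_restrict_of_ae ?_)
      filter_upwards [h, h'] with t ht ht'
      congr 1
      refine eLpNorm_congr_ae ?_
      filter_upwards [ht, ht'] with x hx hx'
      rw [hx, hx']
      ring
    rw [e1]
    refine h1.trans (le_of_eq ?_)
    congr 2
    refine lintegral_congr fun t => ?_
    simp only [Pi.add_apply]
    congr 1
    rw [← eLpNorm_neg]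
    congr 1
    ext x
    simp only [Pi.neg_apply]
    ring

end Contraction

/-! ### Fourier multipliers and the Duhamel term as a distribution -/

section MildSolutions

variable {d : ℕ}

/-! ### Fourier multipliers -/

theorem IsFourierTransform.right_unique {u : E d → ℝ} {g h : E d → ℂ} (hg : IsFourierTransform u g)
    (hh : IsFourierTransform u h) : g =ᵐ[volume] h :=
  IsFT.right_unique (isFourierTransform_iff.1 hg) (isFourierTransform_iff.1 hh)

theorem IsFourierTransform.left_unique {u w : E d → ℝ} {g : E d → ℂ} (hu : IsFourierTransform u g)
    (hw : IsFourierTransform w g) : u =ᵐ[volume] w := by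
  filter_upwards [IsFT.left_unique (isFourierTransform_iff.1 hu) (isFourierTransform_iff.1 hw)]
    with x hx
  exact_mod_cast hx

theorem IsFourierTransform.fourierFun_ae_eq {u : E d → ℝ} {g : E d → ℂ}
    (h : IsFourierTransform u g) : fourierFun u =ᵐ[volume] g := by
  have hex : ∃ g, IsFourierTransform u g := ⟨g, h⟩
  rw [fourierFun, dif_pos hex]
  exact hex.choose_spec.right_unique h

theorem IsFourierTransform.fourierInvFun_ae_eq {u : E d → ℝ} {g : E d → ℂ}
    (h : IsFourierTransform u g) : fourierInvFun g =ᵐ[volume] u := by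
  have hex : ∃ u, IsFourierTransform u g := ⟨u, h⟩
  rw [fourierInvFun, dif_pos hex]
  exact hex.choose_spec.left_unique h

/-- The transforms are chosen among candidates, with default `0` if there is none; exhibiting one
candidate `w` pins the result down up to null sets. -/
theorem IsFourierTransform.fourierMultiplier_ae_eq {u w : E d → ℝ} {g : E d → ℂ} {m : E d → ℝ}
    (h : IsFourierTransform u g) (hw : IsFourierTransform w fun ξ => (m ξ : ℂ) * g ξ) :
    fourierMultiplier m u =ᵐ[volume] w := by
  refine IsFourierTransform.fourierInvFun_ae_eq (hw.congr EventuallyEq.rfl ?_)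
  filter_upwards [h.fourierFun_ae_eq] with ξ hξ
  rw [hξ]

theorem exists_isFourierTransform_of_freq (hd : 3 ≤ d) {g : E d → ℂ} (hg : Measurable g)
    (h : MemLp (fun ξ => (freq ξ : ℂ) * g ξ) 2 volume) (herm : ∀ᵐ ξ, g (-ξ) = conj (g ξ)) :
    ∃ u, IsFourierTransform u g := by
  obtain ⟨u, -, hu⟩ := exists_measurable_isFourierTransform hd (V := fun _ => g)
    (hg.comp measurable_snd) (fun _ => h) fun _ => herm
  exact ⟨u 0, hu 0⟩

theorem IsFourierTransform.exists_measurable {u : E d → ℝ} {g : E d → ℂ}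
    (h : IsFourierTransform u g) : ∃ g', Measurable g' ∧ g =ᵐ[volume] g' ∧ IsFourierTransform u g' :=
  ⟨h.2.1.mk g, h.2.1.stronglyMeasurable_mk.measurable, h.2.1.ae_eq_mk,
    h.congr EventuallyEq.rfl h.2.1.ae_eq_mk⟩

/-- Fourier side of data in `Ḣ¹ × L²`. -/
structure IsEnergyData (v₀ v₁ : E d → ℝ) (g₀ g₁ : E d → ℂ) : Prop where
  measurable₀ : Measurable g₀
  measurable₁ : Measurable g₁
  ft₀ : IsFourierTransform v₀ g₀
  ft₁ : IsFourierTransform v₁ g₁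
  memLp₀ : MemLp (fun ξ => (freq ξ : ℂ) * g₀ ξ) 2 volume
  memLp₁ : MemLp g₁ 2 volume

theorem exists_isEnergyData {v₀ v₁ : E d → ℝ} (h₀ : MemHomH1 v₀) (h₁ : MemLp v₁ 2 volume) :
    ∃ g₀ g₁, IsEnergyData v₀ v₁ g₀ g₁ := by
  obtain ⟨g₀, hg₀, hm₀⟩ := h₀
  obtain ⟨g₁, hg₁, hm₁⟩ := exists_isFT_of_memLp (u := fun x => (v₁ x : ℂ)) h₁.ofReal
  obtain ⟨g₀', a1, a2, a3⟩ := hg₀.exists_measurable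
  obtain ⟨g₁', b1, b2, b3⟩ := (isFourierTransform_iff.2 hg₁).exists_measurable
  refine ⟨g₀', g₁', a1, b1, a3, b3, hm₀.ae_eq ?_, hm₁.ae_eq b2⟩
  filter_upwards [a2] with ξ hξ
  rw [hξ]
  rfl

/-- The symbol of `sin(t|∇|)/|∇|`. -/
def sinSym (t : ℝ) (ξ : E d) : ℝ := Real.sin (t * freq ξ) / freq ξ

/-- The symbol of `cos(t|∇|)`. -/
def cosSym (t : ℝ) (ξ : E d) : ℝ := Real.cos (t * freq ξ)

theorem measurable_sinSym : Measurable fun q : ℝ × E d => sinSym q.1 q.2 := by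
  have := (continuous_freq (d := d)).measurable
  unfold sinSym
  fun_prop

theorem measurable_cosSym : Measurable fun q : ℝ × E d => cosSym q.1 q.2 := by
  have := (continuous_freq (d := d)).measurable
  unfold cosSym
  fun_prop

theorem freq_mul_abs_sinSym_le (t : ℝ) (ξ : E d) : freq ξ * |sinSym t ξ| ≤ 1 := by
  have h0 := freq_nonneg ξ
  rw [sinSym, abs_div, abs_of_nonneg h0, mul_div_assoc']
  rcases h0.eq_or_lt with h | h
  · simp [← h]
  · rw [mul_div_cancel_left₀ _ h.ne']
    exact Real.abs_sin_le_one _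

theorem sinSym_neg (t : ℝ) (ξ : E d) : sinSym t (-ξ) = sinSym t ξ := by
  simp [sinSym, freq_neg]

theorem cosSym_neg (t : ℝ) (ξ : E d) : cosSym t (-ξ) = cosSym t ξ := by
  simp [cosSym, freq_neg]

theorem ae_hermitian_symbol_mul {m : E d → ℝ} (hm : ∀ ξ, m (-ξ) = m ξ) {g : E d → ℂ}
    (hg : ∀ᵐ ξ, g (-ξ) = conj (g ξ)) :
    ∀ᵐ ξ, (m (-ξ) : ℂ) * g (-ξ) = conj ((m ξ : ℂ) * g ξ) := by
  filter_upwards [hg] with ξ hξ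
  rw [hm, hξ, map_mul, Complex.conj_ofReal]

theorem memLp_freq_mul_sinSym_mul {g : E d → ℂ} (hg : Measurable g) (h : MemLp g 2 volume) (t : ℝ) :
    MemLp (fun ξ => (freq ξ : ℂ) * ((sinSym t ξ : ℂ) * g ξ)) 2 volume := by
  refine h.of_le ?_ (ae_of_all _ fun ξ => ?_)
  · exact ((Complex.measurable_ofReal.comp continuous_freq.measurable).mul
      ((Complex.measurable_ofReal.comp (measurable_sinSym.comp
        (measurable_prodMk_left (x := t)))).mul hg)).aestronglyMeasurable
  · rw [← mul_assoc, norm_mul, norm_mul, Complex.norm_real, Complex.norm_real,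
      Real.norm_of_nonneg (freq_nonneg ξ), Real.norm_eq_abs]
    exact mul_le_of_le_one_left (norm_nonneg _) (freq_mul_abs_sinSym_le t ξ)

theorem memLp_freq_mul_cosSym_mul {g : E d → ℂ} (hg : Measurable g)
    (h : MemLp (fun ξ => (freq ξ : ℂ) * g ξ) 2 volume) (t : ℝ) :
    MemLp (fun ξ => (freq ξ : ℂ) * ((cosSym t ξ : ℂ) * g ξ)) 2 volume := by
  refine h.of_le ?_ (ae_of_all _ fun ξ => ?_)
  · exact ((Complex.measurable_ofReal.comp continuous_freq.measurable).mul
      ((Complex.measurable_ofReal.comp (measurable_cosSym.comp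
        (measurable_prodMk_left (x := t)))).mul hg)).aestronglyMeasurable
  · rw [mul_left_comm, norm_mul, Complex.norm_real, Real.norm_eq_abs]
    exact mul_le_of_le_one_left (norm_nonneg _) (Real.abs_cos_le_one _)

/-- `Q(t)u` has the expected Fourier transform for `u ∈ L²`. -/
theorem isFourierTransform_Q (hd : 3 ≤ d) {u : E d → ℝ} {g : E d → ℂ} (hu : IsFourierTransform u g)
    (hg : Measurable g) (h2 : MemLp g 2 volume) (t : ℝ) :
    IsFourierTransform (Q t u) fun ξ => (sinSym t ξ : ℂ) * g ξ := by
  obtain ⟨w, hw⟩ := exists_isFourierTransform_of_freq hd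
    (g := fun ξ => (sinSym t ξ : ℂ) * g ξ)
    ((Complex.measurable_ofReal.comp (measurable_sinSym.comp
      (measurable_prodMk_left (x := t)))).mul hg) (memLp_freq_mul_sinSym_mul hg h2 t)
    (ae_hermitian_symbol_mul (sinSym_neg t) hu.hermitian)
  exact hw.congr (hu.fourierMultiplier_ae_eq hw).symm EventuallyEq.rfl

/-- The Fourier transform of `S(t)(v₀, v₁)`. -/
def freeFT (g₀ g₁ : E d → ℂ) (t : ℝ) (ξ : E d) : ℂ :=
  (cosSym t ξ : ℂ) * g₀ ξ + (sinSym t ξ : ℂ) * g₁ ξ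

theorem IsEnergyData.measurable_freeFT {v₀ v₁ : E d → ℝ} {g₀ g₁ : E d → ℂ}
    (h : IsEnergyData v₀ v₁ g₀ g₁) : Measurable (Function.uncurry (freeFT g₀ g₁)) :=
  ((Complex.measurable_ofReal.comp measurable_cosSym).mul (h.measurable₀.comp measurable_snd)).add
    ((Complex.measurable_ofReal.comp measurable_sinSym).mul (h.measurable₁.comp measurable_snd))

theorem IsEnergyData.memLp_freeFT {v₀ v₁ : E d → ℝ} {g₀ g₁ : E d → ℂ}
    (h : IsEnergyData v₀ v₁ g₀ g₁) (t : ℝ) :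
    MemLp (fun ξ => (freq ξ : ℂ) * freeFT g₀ g₁ t ξ) 2 volume := by
  simp_rw [freeFT, mul_add]
  exact (memLp_freq_mul_cosSym_mul h.measurable₀ h.memLp₀ t).add
    (memLp_freq_mul_sinSym_mul h.measurable₁ h.memLp₁ t)

theorem IsEnergyData.hermitian_freeFT {v₀ v₁ : E d → ℝ} {g₀ g₁ : E d → ℂ}
    (h : IsEnergyData v₀ v₁ g₀ g₁) (t : ℝ) :
    ∀ᵐ ξ, freeFT g₀ g₁ t (-ξ) = conj (freeFT g₀ g₁ t ξ) := by
  filter_upwards [ae_hermitian_symbol_mul (cosSym_neg t) h.ft₀.hermitian,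
    ae_hermitian_symbol_mul (sinSym_neg t) h.ft₁.hermitian] with ξ h1 h2
  rw [freeFT, freeFT, map_add, h1, h2]

theorem IsEnergyData.exists_free (hd : 3 ≤ d) {v₀ v₁ : E d → ℝ} {g₀ g₁ : E d → ℂ}
    (h : IsEnergyData v₀ v₁ g₀ g₁) (t₀ : ℝ) :
    ∃ L : ℝ → E d → ℝ, Measurable (Function.uncurry L) ∧
      ∀ t, IsFourierTransform (L t) (freeFT g₀ g₁ (t - t₀)) :=
  exists_measurable_isFourierTransform hd (V := fun t => freeFT g₀ g₁ (t - t₀))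
    (h.measurable_freeFT.comp (f := fun q : ℝ × E d => (q.1 - t₀, q.2)) (by fun_prop))
    (fun t => h.memLp_freeFT (t - t₀)) fun t => h.hermitian_freeFT (t - t₀)

theorem IsFourierTransform.add {u w : E d → ℝ} {g h : E d → ℂ} (hu : IsFourierTransform u g)
    (hw : IsFourierTransform w h) :
    IsFourierTransform (fun x => u x + w x) (fun ξ => g ξ + h ξ) := by
  rw [isFourierTransform_iff] at hu hw ⊢
  simpa using hu.add hw

theorem IsEnergyData.isFourierTransform_S (hd : 3 ≤ d) {v₀ v₁ : E d → ℝ} {g₀ g₁ : E d → ℂ}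
    (h : IsEnergyData v₀ v₁ g₀ g₁) (t : ℝ) :
    IsFourierTransform (S t v₀ v₁) (freeFT g₀ g₁ t) := by
  refine IsFourierTransform.add ?_ (isFourierTransform_Q hd h.ft₁ h.measurable₁ h.memLp₁ t)
  obtain ⟨w, hw⟩ := exists_isFourierTransform_of_freq hd
    (g := fun ξ => (cosSym t ξ : ℂ) * g₀ ξ)
    ((Complex.measurable_ofReal.comp (measurable_cosSym.comp
      (measurable_prodMk_left (x := t)))).mul h.measurable₀)
    (memLp_freq_mul_cosSym_mul h.measurable₀ h.memLp₀ t)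
    (ae_hermitian_symbol_mul (cosSym_neg t) h.ft₀.hermitian)
  exact hw.congr (h.ft₀.fourierMultiplier_ae_eq hw).symm EventuallyEq.rfl

/-! ### Pairings with Schwartz functions -/

theorem exists_fourier_eq_ofReal (φ : 𝓢(E d, ℝ)) : ∃ ψ : 𝓢(E d, ℂ), ∀ x, (𝓕 ψ) x = (φ x : ℂ) := by
  refine ⟨𝓕⁻ (φ.postcompCLM Complex.ofRealCLM), fun x => ?_⟩
  rw [FourierTransform.fourier_fourierInv_eq, SchwartzMap.postcompCLM_apply]
  rfl

theorem IsFourierTransform.integral_mul {u : E d → ℝ} {g : E d → ℂ} (h : IsFourierTransform u g)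
    {φ : 𝓢(E d, ℝ)} {ψ : 𝓢(E d, ℂ)} (hψ : ∀ x, (𝓕 ψ) x = (φ x : ℂ)) :
    Integrable (fun x => u x * φ x) volume ∧ Integrable (fun ξ => g ξ * ψ ξ) volume ∧
      ((∫ x, u x * φ x : ℝ) : ℂ) = ∫ ξ, g ξ * ψ ξ := by
  have h1 := (h.2.2 (𝓕 ψ)).1
  simp only [hψ] at h1
  refine ⟨h1.re.congr (ae_of_all _ fun x => ?_), (h.2.2 ψ).2.1, ?_⟩
  · simp only [← Complex.ofReal_mul]
    exact Complex.ofReal_re _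
  · rw [← (h.2.2 ψ).2.2, ← integral_complex_ofReal]
    simp [hψ]

theorem ae_eq_zero_of_integral_real_schwartz {h : E d → ℝ}
    (hi : ∀ φ : 𝓢(E d, ℝ), Integrable (fun x => h x * φ x) volume ∧ ∫ x, h x * φ x = 0) :
    h =ᵐ[volume] 0 := by
  have hsplit : ∀ φ : 𝓢(E d, ℂ), ∃ φ₁ φ₂ : 𝓢(E d, ℝ), ∀ x, (h x : ℂ) * φ x =
      ((h x * φ₁ x : ℝ) : ℂ) + ((h x * φ₂ x : ℝ) : ℂ) * Complex.I := fun φ => by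
    refine ⟨φ.postcompCLM Complex.reCLM, φ.postcompCLM Complex.imCLM, fun x => ?_⟩
    rw [SchwartzMap.postcompCLM_apply, SchwartzMap.postcompCLM_apply]
    simp only [Complex.reCLM_apply, Complex.imCLM_apply]
    rw [Complex.ofReal_mul, Complex.ofReal_mul, mul_assoc, ← mul_add, Complex.re_add_im]
  have key := ae_eq_zero_of_integral_schwartz (h := fun x => (h x : ℂ))
    (fun φ => ?_) fun φ => ?_
  · filter_upwards [key] with x hx
    exact Complex.ofReal_eq_zero.1 hx
  · obtain ⟨φ₁, φ₂, hφ⟩ := hsplit φ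
    simp_rw [hφ]
    exact (hi φ₁).1.ofReal.add ((hi φ₂).1.ofReal.mul_const _)
  · obtain ⟨φ₁, φ₂, hφ⟩ := hsplit φ
    simp_rw [hφ]
    rw [integral_add (hi φ₁).1.ofReal ((hi φ₂).1.ofReal.mul_const _), integral_mul_const,
      integral_complex_ofReal, integral_complex_ofReal, (hi φ₁).2, (hi φ₂).2]
    simp

/-! ### The Duhamel term as a distribution-valued integral -/

/-- The function `majorant / |ξ|` has a square-integrable product with `|ξ|`, so it is itself a
Fourier transform, and integrability against Schwartz functions is part of that notion. -/
theorem IsForcing.lintegral_majorant_mul_schwartz_lt_top (hd : 3 ≤ d) {F : ℝ → E d → ℝ}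
    {g : ℝ → E d → ℂ} (h : IsForcing F g) (ψ : 𝓢(E d, ℂ)) :
    ∫⁻ ξ, ENNReal.ofReal (freq ξ)⁻¹ * majorant g ξ * ‖ψ ξ‖ₑ < ∞ := by
  have hMm := measurable_majorant h.measurable_ft
  set V : E d → ℂ := fun ξ => (((freq ξ)⁻¹ * (majorant g ξ).toReal : ℝ) : ℂ) with hV
  have hVm : Measurable V := by
    have := (continuous_freq (d := d)).measurable
    have := hMm.ennreal_toReal
    exact Complex.measurable_ofReal.comp (by fun_prop)
  have hV2 : MemLp (fun ξ => (freq ξ : ℂ) * V ξ) 2 volume := by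
    refine memLp_of_enorm_le ((Complex.measurable_ofReal.comp
      continuous_freq.measurable).mul hVm).aestronglyMeasurable (fun ξ => ?_)
      h.lintegral_majorant_sq_lt_top
    have h0 := freq_nonneg ξ
    rw [hV, ← Complex.ofReal_mul, ← ofReal_norm, Complex.norm_real,
      Real.norm_of_nonneg (by positivity), ← mul_assoc]
    refine (ENNReal.ofReal_le_ofReal (mul_le_of_le_one_left ENNReal.toReal_nonneg
      mul_inv_le_one)).trans ENNReal.ofReal_toReal_le
  obtain ⟨u, -, hu⟩ := exists_measurable_isFT hd (V := fun _ => V) (hVm.comp measurable_snd)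
    fun _ => hV2
  refine lt_of_le_of_lt (le_of_eq (lintegral_congr_ae ?_)) ((hu 0).2.2 ψ).2.1.2
  filter_upwards [h.ae_majorant_lt_top] with ξ hξ
  have h0 := freq_nonneg ξ
  rw [enorm_mul, hV]
  congr 1
  rw [← ofReal_norm, Complex.norm_real, Real.norm_of_nonneg (by positivity),
    ENNReal.ofReal_mul (by positivity), ENNReal.ofReal_toReal hξ.ne]

theorem IsForcing.integrable_sinKer_mul_schwartz (hd : 3 ≤ d) {F : ℝ → E d → ℝ}
    {g : ℝ → E d → ℂ} (h : IsForcing F g) (ψ : 𝓢(E d, ℂ)) (t : ℝ) :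
    Integrable (fun q : ℝ × E d => (sinKer (t - q.1) q.2 : ℂ) * g q.1 q.2 * ψ q.2)
      (volume.prod volume) := by
  have hm : Measurable fun q : ℝ × E d => (sinKer (t - q.1) q.2 : ℂ) * g q.1 q.2 * ψ q.2 := by
    refine Measurable.mul (Measurable.mul (Complex.measurable_ofReal.comp ?_) h.measurable_ft)
      (ψ.continuous.measurable.comp measurable_snd)
    exact measurable_sinKer.comp (f := fun q : ℝ × E d => (t - q.1, q.2)) (by fun_prop)
  refine ⟨hm.aestronglyMeasurable, ?_⟩
  rw [HasFiniteIntegral, lintegral_prod_symm _ hm.enorm.aemeasurable]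
  refine lt_of_le_of_lt (lintegral_mono fun ξ => ?_)
    (h.lintegral_majorant_mul_schwartz_lt_top hd ψ)
  have hgξ : Measurable fun t' => ‖g t' ξ‖ₑ :=
    (h.measurable_ft.comp (measurable_prodMk_right (y := ξ))).enorm
  calc ∫⁻ t', ‖(sinKer (t - t') ξ : ℂ) * g t' ξ * ψ ξ‖ₑ
      ≤ ∫⁻ t', ENNReal.ofReal (freq ξ)⁻¹ * ‖g t' ξ‖ₑ * ‖ψ ξ‖ₑ := by
        refine lintegral_mono fun t' => ?_
        rw [enorm_mul, enorm_mul]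
        gcongr
        rw [← ofReal_norm, Complex.norm_real]
        exact ENNReal.ofReal_le_ofReal (abs_sinKer_le _ _)
    _ = _ := by
        rw [lintegral_mul_const _ (hgξ.const_mul _), lintegral_const_mul _ hgξ, majorant]

theorem integral_duhamelFT_mul_schwartz (hd : 3 ≤ d) {F : ℝ → E d → ℝ}
    {g : ℝ → E d → ℂ} (h : IsForcing F g) (ψ : 𝓢(E d, ℂ)) (t : ℝ) :
    ∫ ξ, duhamelFT g t ξ * ψ ξ = ∫ t', ∫ ξ, (sinKer (t - t') ξ : ℂ) * g t' ξ * ψ ξ := by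
  rw [integral_integral_swap (h.integrable_sinKer_mul_schwartz hd ψ t)]
  refine integral_congr_ae (ae_of_all _ fun ξ => ?_)
  simp only
  rw [duhamelFT, integral_mul_const]

/-- Identifies the function `D`, built by integrating in time at fixed frequency, with the time
integral of distributions in the mild formulation. Both become the same double integral after
pairing, by Fubini on the Fourier side. -/
theorem IsHartreeDuhamel.duhamel_pairing (hd : 3 ≤ d) {t₀ t₁ : ℝ} {a F : ℝ → E d → ℝ}
    {g : ℝ → E d → ℂ} {D : ℝ → E d → ℝ} (h : IsHartreeDuhamel (Icc t₀ t₁) a F g D) {t : ℝ}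
    (ht : t ∈ Icc t₀ t₁) (φ : 𝓢(E d, ℝ)) :
    (∀ᵐ t' ∂(volume.restrict (uIoc t₀ t)),
      Integrable (fun x => Q (t - t') (hartree (a t')) x * φ x) volume) ∧
    IntervalIntegrable (fun t' => ∫ x, Q (t - t') (hartree (a t')) x * φ x) volume t₀ t ∧
    ∫ x, D t x * φ x = ∫ t' in t₀..t, ∫ x, Q (t - t') (hartree (a t')) x * φ x := by
  obtain ⟨ψ, hψ⟩ := exists_fourier_eq_ofReal φ
  have hF := h.forcing
  have hQ : ∀ᵐ t' ∂(volume.restrict (Ioc t₀ t)),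
      IsFourierTransform (Q (t - t') (hartree (a t')))
        fun ξ => (sinKer (t - t') ξ : ℂ) * g t' ξ := by
    have hsub : Ioc t₀ t ⊆ Icc t₀ t₁ := fun s hs => ⟨hs.1.le, hs.2.trans ht.2⟩
    have hne : ∀ᵐ t' ∂(volume.restrict (Ioc t₀ t)), t' ≠ t :=
      ae_restrict_of_ae (by rw [ae_iff]; simp)
    filter_upwards [ae_restrict_of_ae_restrict_of_subset hsub h.ae_eq, hne,
      ae_restrict_mem measurableSet_Ioc] with t' h1 h2 h3
    have hlt : t' < t := lt_of_le_of_ne h3.2 h2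
    have hg2 : MemLp (g t') 2 volume := ⟨(hF.ft t').2.1, by
      rw [hF.eLpNorm_ft]; exact (hF.memLp t').2⟩
    have h4 := isFourierTransform_Q hd ((hF.ft t').congr h1 EventuallyEq.rfl)
      (hF.measurable_ft.comp measurable_prodMk_left) hg2 (t - t')
    refine h4.congr EventuallyEq.rfl (ae_of_all _ fun ξ => ?_)
    simp only [sinSym, sinKer]
    rw [if_pos (sub_pos.2 hlt)]
  have hint := (hF.integrable_sinKer_mul_schwartz hd ψ t).integral_prod_left
  have hEq : ∀ᵐ t' ∂(volume.restrict (Ioc t₀ t)),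
      ((∫ x, Q (t - t') (hartree (a t')) x * φ x : ℝ) : ℂ) =
        ∫ ξ, (sinKer (t - t') ξ : ℂ) * g t' ξ * ψ ξ := by
    filter_upwards [hQ] with t' ht'
    exact (ht'.integral_mul hψ).2.2
  have hle : t₀ ≤ t := ht.1
  refine ⟨?_, ?_, ?_⟩
  · rw [uIoc_of_le hle]
    filter_upwards [hQ] with t' ht'
    exact (ht'.integral_mul hψ).1
  · rw [intervalIntegrable_iff_integrableOn_Ioc_of_le hle]
    have h1 : IntegrableOn (fun t' => (∫ ξ, (sinKer (t - t') ξ : ℂ) * g t' ξ * ψ ξ).re)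
      (Ioc t₀ t) volume := hint.re.integrableOn
    refine h1.congr ?_
    filter_upwards [hEq] with t' ht'
    rw [← ht', Complex.ofReal_re]
  · have h1 := ((h.duhamel.ft t).integral_mul hψ).2.2
    rw [integral_duhamelFT_mul_schwartz hd hF ψ t] at h1
    -- The integral over all times reduces to `(t₀, t]`: the retarded kernel vanishes for `t' ≥ t`,
    -- and the forcing vanishes for `t' < t₀`.
    have h2 : ∫ t', ∫ ξ, (sinKer (t - t') ξ : ℂ) * g t' ξ * ψ ξ =
        ∫ t' in Ioc t₀ t, ∫ ξ, (sinKer (t - t') ξ : ℂ) * g t' ξ * ψ ξ := by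
      refine (setIntegral_eq_integral_of_ae_compl_eq_zero ?_).symm
      have hne : ∀ᵐ t' : ℝ, t' ≠ t₀ := by rw [ae_iff]; simp
      filter_upwards [hne] with t' hne hnot
      rcases lt_or_ge t t' with hlt | hge
      · have : ∀ ξ : E d, sinKer (t - t') ξ = 0 := fun ξ => by
          rw [sinKer, if_neg (by linarith)]
        simp [this]
      · have hlt : t' < t₀ := by
          by_contra hcon
          exact hnot ⟨lt_of_le_of_ne (not_lt.1 hcon) (Ne.symm hne), hge⟩
        have hF0 : F t' = 0 := h.eq_zero t' fun hmem => absurd hmem.1 (not_le.2 hlt)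
        have hg0 : g t' =ᵐ[volume] 0 := by
          have := hF.ft t'
          rw [hF0] at this
          exact this.right_unique isFourierTransform_zero
        refine integral_eq_zero_of_ae ?_
        filter_upwards [hg0] with ξ hξ
        simp [hξ]
    rw [h2, ← integral_congr_ae hEq, integral_complex_ofReal] at h1
    rw [intervalIntegral.integral_of_le hle]
    exact_mod_cast h1

end MildSolutions

/-! ### The mild equation as an identity of functions -/

section MildEquation

variable {d : ℕ}

theorem isMildSolution_of_ae_eq (hd : 3 ≤ d) {v₀ v₁ : E d → ℝ} {g₀ g₁ : E d → ℂ}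
    (hE : IsEnergyData v₀ v₁ g₀ g₁) {t₀ t₁ : ℝ} {L f v F D : ℝ → E d → ℝ} {g : ℝ → E d → ℂ}
    (hL : ∀ t, IsFourierTransform (L t) (freeFT g₀ g₁ (t - t₀)))
    (hD : IsHartreeDuhamel (Icc t₀ t₁) (fun t x => v t x + f t x) F g D)
    (h : ∀ᵐ t ∂(volume.restrict (Icc t₀ t₁)), v t =ᵐ[volume] fun x => L t x - D t x) :
    IsMildSolution (Icc t₀ t₁) t₀ v₀ v₁ f v := by
  filter_upwards [h, ae_restrict_mem measurableSet_Icc] with t hv ht φ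
  obtain ⟨ψ, hψ⟩ := exists_fourier_eq_ofReal φ
  obtain ⟨h1, h2, h3⟩ := hD.duhamel_pairing hd ht φ
  have hS := ((hE.isFourierTransform_S hd (t - t₀)).integral_mul hψ).1
  have hDi := ((hD.duhamel.ft t).integral_mul hψ).1
  have hvS : (fun x => v t x * φ x) =ᵐ[volume]
      fun x => S (t - t₀) v₀ v₁ x * φ x - D t x * φ x := by
    filter_upwards [hv, (hE.isFourierTransform_S hd (t - t₀)).left_unique (hL t)] with x hx hy
    rw [hx, hy, sub_mul]
  refine ⟨(hS.sub hDi).congr hvS.symm, hS, h1, h2, ?_⟩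
  rw [← h3, integral_congr_ae hvS, integral_sub hS hDi]

/-- A distributional identity between functions holds almost everywhere. Hence any mild solution in
the sense of pairings satisfies `v = L - D` at almost every time, and the uniqueness argument can
use it. -/
theorem IsMildSolution.ae_eq (hd : 3 ≤ d) {v₀ v₁ : E d → ℝ} {g₀ g₁ : E d → ℂ}
    (hE : IsEnergyData v₀ v₁ g₀ g₁) {t₀ t₁ : ℝ} {L f v F D : ℝ → E d → ℝ} {g : ℝ → E d → ℂ}
    (h : IsMildSolution (Icc t₀ t₁) t₀ v₀ v₁ f v)
    (hL : ∀ t, IsFourierTransform (L t) (freeFT g₀ g₁ (t - t₀)))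
    (hD : IsHartreeDuhamel (Icc t₀ t₁) (fun t x => v t x + f t x) F g D) :
    ∀ᵐ t ∂(volume.restrict (Icc t₀ t₁)), v t =ᵐ[volume] fun x => L t x - D t x := by
  filter_upwards [h, ae_restrict_mem measurableSet_Icc] with t ht hmem
  have hS := hE.isFourierTransform_S hd (t - t₀)
  have key := ae_eq_zero_of_integral_real_schwartz
    (h := fun x => v t x - S (t - t₀) v₀ v₁ x + D t x) fun φ => ?_
  · filter_upwards [key, hS.left_unique (hL t)] with x hx hy
    simp only [Pi.zero_apply] at hx
    linarith
  · obtain ⟨h1, h2, -, -, h5⟩ := ht φ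
    obtain ⟨ψ, hψ⟩ := exists_fourier_eq_ofReal φ
    have hDi := ((hD.duhamel.ft t).integral_mul hψ).1
    simp_rw [add_mul, sub_mul]
    have h12 : Integrable (fun x => v t x * φ x - S (t - t₀) v₀ v₁ x * φ x) volume := h1.sub h2
    refine ⟨h12.add hDi, ?_⟩
    rw [integral_add h12 hDi, integral_sub h1 h2, h5, (hD.duhamel_pairing hd hmem φ).2.2]
    ring

end MildEquation

/-! ### Time derivative, energy continuity and initial values -/

section Regularity

variable {d : ℕ}

/-! ### Time regularity on the Fourier side -/

/-- The retarded symbol is `sin(max(s, 0)|ξ|)/|ξ|`, hence `1`-Lipschitz in `s` uniformly in `ξ`,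
across the onset at `s = 0` as well. -/
theorem abs_sinKer_sub_le (s s' : ℝ) (ξ : E d) : |sinKer s ξ - sinKer s' ξ| ≤ |s - s'| := by
  have h0 := freq_nonneg ξ
  have e : ∀ s, sinKer s ξ = Real.sin (max s 0 * freq ξ) / freq ξ := fun s => by
    unfold sinKer
    split_ifs with h
    · rw [max_eq_left h.le]
    · rw [max_eq_right (not_lt.1 h)]; simp
  rw [e, e, ← sub_div, abs_div, abs_of_nonneg h0]
  refine (div_le_of_le_mul₀ h0 (abs_nonneg _) ?_).trans (abs_max_sub_max_le_abs s s' 0)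
  have h1 := Real.lipschitzWith_sin.dist_le_mul (max s 0 * freq ξ) (max s' 0 * freq ξ)
  rw [Real.dist_eq, Real.dist_eq, ← sub_mul, abs_mul, abs_of_nonneg h0] at h1
  simpa using h1

theorem hasDerivAt_sinKer {s : ℝ} (hs : s ≠ 0) {ξ : E d} (hξ : 0 < freq ξ) :
    HasDerivAt (fun s => sinKer s ξ) (cosKer s ξ) s := by
  rcases hs.lt_or_gt with h | h
  · rw [cosKer, if_neg (not_lt.2 h.le)]
    refine (hasDerivAt_const s (0 : ℝ)).congr_of_eventuallyEq ?_
    filter_upwards [gt_mem_nhds h] with r hr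
    rw [sinKer, if_neg (not_lt.2 (le_of_lt hr))]
  · rw [cosKer, if_pos h]
    have h1 : HasDerivAt (fun s => Real.sin (s * freq ξ) / freq ξ)
        (Real.cos (s * freq ξ) * (1 * freq ξ) / freq ξ) s :=
      (((hasDerivAt_id s).mul_const (freq ξ)).sin).div_const _
    rw [one_mul, mul_div_cancel_right₀ _ hξ.ne'] at h1
    refine h1.congr_of_eventuallyEq ?_
    filter_upwards [lt_mem_nhds h] with r hr
    rw [sinKer, if_pos hr]

theorem continuousAt_cosKer {s : ℝ} (hs : s ≠ 0) (ξ : E d) :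
    ContinuousAt (fun s => cosKer s ξ) s := by
  rcases hs.lt_or_gt with h | h
  · refine (continuousAt_const (y := (0 : ℝ))).congr ?_
    filter_upwards [gt_mem_nhds h] with r hr
    rw [cosKer, if_neg (not_lt.2 (le_of_lt hr))]
  · refine (Continuous.continuousAt (f := fun s => Real.cos (s * freq ξ)) (by fun_prop)).congr ?_
    filter_upwards [lt_mem_nhds h] with r hr
    rw [cosKer, if_pos hr]

theorem integrable_of_majorant_lt_top {g : ℝ → E d → ℂ} (hg : Measurable (Function.uncurry g))
    {ξ : E d} (h : majorant g ξ < ∞) : Integrable fun t => g t ξ :=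
  ⟨(hg.comp (measurable_prodMk_right (y := ξ))).aestronglyMeasurable, h⟩

theorem measurable_sinKer_slice (t : ℝ) (ξ : E d) : Measurable fun t' => sinKer (t - t') ξ :=
  measurable_sinKer.comp (f := fun t' => (t - t', ξ)) (by fun_prop)

theorem measurable_cosKer_slice (t : ℝ) (ξ : E d) : Measurable fun t' => cosKer (t - t') ξ :=
  measurable_cosKer.comp (f := fun t' => (t - t', ξ)) (by fun_prop)

/-- Differentiation under the integral with a Lipschitz bound: the kernel fails to be differentiable
only at `t' = t`, a null set, and no boundary term arises because the sine kernel is continuous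
there. -/
theorem hasDerivAt_duhamelFT {g : ℝ → E d → ℂ} (hg : Measurable (Function.uncurry g))
    {ξ : E d} (h : majorant g ξ < ∞) (hξ : 0 < freq ξ) (t : ℝ) :
    HasDerivAt (fun s => duhamelFT g s ξ) (duhamelDerivFT g t ξ) t := by
  have hi := integrable_of_majorant_lt_top hg h
  refine (hasDerivAt_integral_of_dominated_loc_of_lip (𝕜 := ℝ) (bound := fun t' => ‖g t' ξ‖)
    (F := fun s t' => (sinKer (s - t') ξ : ℂ) * g t' ξ) (s := univ) univ_mem
    (Eventually.of_forall fun s => ?_) ?_ ?_ ?_ hi.norm ?_).2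
  · exact (Complex.measurable_ofReal.comp (measurable_sinKer_slice s ξ)).aestronglyMeasurable.mul
      hi.1
  · refine hi.bdd_mul (c := (freq ξ)⁻¹)
      (Complex.measurable_ofReal.comp (measurable_sinKer_slice t ξ)).aestronglyMeasurable
      (ae_of_all _ fun t' => ?_)
    simp only [Complex.norm_real]
    exact abs_sinKer_le _ _
  · exact (Complex.measurable_ofReal.comp (measurable_cosKer_slice t ξ)).aestronglyMeasurable.mul
      hi.1
  · refine ae_of_all _ fun t' => LipschitzOnWith.of_dist_le_mul fun s _ s' _ => ?_
    rw [dist_eq_norm, ← sub_mul, norm_mul, ← Complex.ofReal_sub, Complex.norm_real,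
      Real.norm_eq_abs, Real.dist_eq, mul_comm, Real.coe_nnabs, abs_of_nonneg (norm_nonneg _)]
    refine mul_le_mul_of_nonneg_left ((abs_sinKer_sub_le _ _ _).trans (le_of_eq ?_)) (norm_nonneg _)
    congr 1
    ring
  · have hne : ∀ᵐ t' : ℝ, t' ≠ t := by rw [ae_iff]; simp
    filter_upwards [hne] with t' ht'
    have h1 : HasDerivAt (fun s => sinKer (s - t') ξ) (cosKer (t - t') ξ) t := by
      simpa using (hasDerivAt_sinKer (sub_ne_zero.2 ht'.symm) hξ).comp_sub_const t t'
    exact h1.ofReal_comp.mul_const _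

theorem continuous_duhamelDerivFT {g : ℝ → E d → ℂ} (hg : Measurable (Function.uncurry g))
    {ξ : E d} (h : majorant g ξ < ∞) : Continuous fun s => duhamelDerivFT g s ξ := by
  have hi := integrable_of_majorant_lt_top hg h
  refine continuous_iff_continuousAt.2 fun t => ?_
  refine continuousAt_of_dominated (bound := fun t' => ‖g t' ξ‖)
    (Eventually.of_forall fun s => ?_) (Eventually.of_forall fun s => ae_of_all _ fun t' => ?_)
    hi.norm ?_
  · exact (Complex.measurable_ofReal.comp (measurable_cosKer_slice s ξ)).aestronglyMeasurable.mul
      hi.1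
  · rw [norm_mul, Complex.norm_real]
    exact mul_le_of_le_one_left (norm_nonneg _) (abs_cosKer_le _ _)
  · have hne : ∀ᵐ t' : ℝ, t' ≠ t := by rw [ae_iff]; simp
    filter_upwards [hne] with t' ht'
    have h1 : ContinuousAt (fun s => cosKer (s - t') ξ) t :=
      ContinuousAt.comp (f := fun s => s - t') (continuousAt_cosKer (sub_ne_zero.2 ht'.symm) ξ)
        (by fun_prop)
    exact (Complex.continuous_ofReal.continuousAt.comp h1).mul continuousAt_const

/-- The Fourier transform of `∂ₜS(t)(v₀, v₁)`. -/
def freeDerivFT (g₀ g₁ : E d → ℂ) (t : ℝ) (ξ : E d) : ℂ :=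
  (cosSym t ξ : ℂ) * g₁ ξ - (Real.sin (t * freq ξ) : ℂ) * ((freq ξ : ℂ) * g₀ ξ)

theorem hasDerivAt_freeFT (g₀ g₁ : E d → ℂ) {ξ : E d} (hξ : 0 < freq ξ) (t : ℝ) :
    HasDerivAt (fun s => freeFT g₀ g₁ s ξ) (freeDerivFT g₀ g₁ t ξ) t := by
  have h1 : HasDerivAt (fun s => cosSym s ξ) (-Real.sin (t * freq ξ) * (1 * freq ξ)) t :=
    ((hasDerivAt_id t).mul_const (freq ξ)).cos
  have h2 : HasDerivAt (fun s => sinSym s ξ) (Real.cos (t * freq ξ) * (1 * freq ξ) / freq ξ) t :=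
    (((hasDerivAt_id t).mul_const (freq ξ)).sin).div_const _
  rw [one_mul, mul_div_cancel_right₀ _ hξ.ne'] at h2
  refine ((h1.ofReal_comp.mul_const (g₀ ξ)).fun_add
    (h2.ofReal_comp.mul_const (g₁ ξ))).congr_deriv ?_
  simp only [freeDerivFT, cosSym]
  push_cast
  ring

theorem continuous_freeDerivFT (g₀ g₁ : E d → ℂ) (ξ : E d) :
    Continuous fun s => freeDerivFT g₀ g₁ s ξ := by
  unfold freeDerivFT cosSym
  fun_prop

/-- The Fourier transform at time `t` of `S(t - t₀)(v₀, v₁) - ∫ Q(t - t') F(t') dt'`. -/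
def solFT (g₀ g₁ : E d → ℂ) (g : ℝ → E d → ℂ) (t₀ t : ℝ) (ξ : E d) : ℂ :=
  freeFT g₀ g₁ (t - t₀) ξ - duhamelFT g t ξ

/-- The time derivative of `solFT`. -/
def solDerivFT (g₀ g₁ : E d → ℂ) (g : ℝ → E d → ℂ) (t₀ t : ℝ) (ξ : E d) : ℂ :=
  freeDerivFT g₀ g₁ (t - t₀) ξ - duhamelDerivFT g t ξ

/-- A square-integrable function that dominates the energy density of `solFT` at all times. -/
def energyBound (g₀ g₁ : E d → ℂ) (g : ℝ → E d → ℂ) (ξ : E d) : ℝ :=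
  ‖(freq ξ : ℂ) * g₀ ξ‖ + ‖g₁ ξ‖ + (majorant g ξ).toReal

theorem energyBound_nonneg (g₀ g₁ : E d → ℂ) (g : ℝ → E d → ℂ) (ξ : E d) :
    0 ≤ energyBound g₀ g₁ g ξ := by
  unfold energyBound
  positivity

theorem hasDerivAt_solFT (g₀ g₁ : E d → ℂ) {g : ℝ → E d → ℂ}
    (hg : Measurable (Function.uncurry g)) {ξ : E d} (h : majorant g ξ < ∞) (hξ : 0 < freq ξ)
    (t₀ t : ℝ) :
    HasDerivAt (fun s => solFT g₀ g₁ g t₀ s ξ) (solDerivFT g₀ g₁ g t₀ t ξ) t :=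
  ((hasDerivAt_freeFT g₀ g₁ hξ (t - t₀)).comp_sub_const t t₀).sub
    (hasDerivAt_duhamelFT hg h hξ t)

theorem continuous_solDerivFT (g₀ g₁ : E d → ℂ) {g : ℝ → E d → ℂ}
    (hg : Measurable (Function.uncurry g)) {ξ : E d} (h : majorant g ξ < ∞) (t₀ : ℝ) :
    Continuous fun s => solDerivFT g₀ g₁ g t₀ s ξ :=
  ((continuous_freeDerivFT g₀ g₁ ξ).comp (continuous_id.sub continuous_const)).sub
    (continuous_duhamelDerivFT hg h)

theorem norm_freq_mul_solFT_le (g₀ g₁ : E d → ℂ) {g : ℝ → E d → ℂ} {ξ : E d}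
    (h : majorant g ξ < ∞) (t₀ t : ℝ) :
    ‖(freq ξ : ℂ) * solFT g₀ g₁ g t₀ t ξ‖ ≤ energyBound g₀ g₁ g ξ := by
  have h1 : ‖(freq ξ : ℂ) * duhamelFT g t ξ‖ ≤ (majorant g ξ).toReal := by
    rw [← toReal_enorm]
    exact ENNReal.toReal_mono h.ne (enorm_freq_mul_duhamelFT_le g t ξ)
  have h2 : ‖(freq ξ : ℂ) * ((cosSym (t - t₀) ξ : ℂ) * g₀ ξ)‖ ≤ ‖(freq ξ : ℂ) * g₀ ξ‖ := by
    rw [mul_left_comm, norm_mul, Complex.norm_real, Real.norm_eq_abs]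
    exact mul_le_of_le_one_left (norm_nonneg _) (Real.abs_cos_le_one _)
  have h3 : ‖(freq ξ : ℂ) * ((sinSym (t - t₀) ξ : ℂ) * g₁ ξ)‖ ≤ ‖g₁ ξ‖ := by
    rw [← mul_assoc, norm_mul, norm_mul, Complex.norm_real, Complex.norm_real,
      Real.norm_of_nonneg (freq_nonneg ξ), Real.norm_eq_abs]
    exact mul_le_of_le_one_left (norm_nonneg _) (freq_mul_abs_sinSym_le _ ξ)
  rw [solFT, freeFT, mul_sub, mul_add, energyBound]
  exact (norm_sub_le _ _).trans (add_le_add ((norm_add_le _ _).trans (add_le_add h2 h3)) h1)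

theorem norm_solDerivFT_le (g₀ g₁ : E d → ℂ) {g : ℝ → E d → ℂ} {ξ : E d}
    (h : majorant g ξ < ∞) (t₀ t : ℝ) :
    ‖solDerivFT g₀ g₁ g t₀ t ξ‖ ≤ energyBound g₀ g₁ g ξ := by
  have h1 : ‖duhamelDerivFT g t ξ‖ ≤ (majorant g ξ).toReal := by
    rw [← toReal_enorm]
    exact ENNReal.toReal_mono h.ne (enorm_duhamelDerivFT_le g t ξ)
  have h2 : ‖(cosSym (t - t₀) ξ : ℂ) * g₁ ξ‖ ≤ ‖g₁ ξ‖ := by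
    rw [norm_mul, Complex.norm_real, Real.norm_eq_abs]
    exact mul_le_of_le_one_left (norm_nonneg _) (Real.abs_cos_le_one _)
  have h3 : ‖(Real.sin ((t - t₀) * freq ξ) : ℂ) * ((freq ξ : ℂ) * g₀ ξ)‖ ≤
      ‖(freq ξ : ℂ) * g₀ ξ‖ := by
    rw [norm_mul, Complex.norm_real, Real.norm_eq_abs]
    exact mul_le_of_le_one_left (norm_nonneg _) (Real.abs_sin_le_one _)
  rw [solDerivFT, freeDerivFT, energyBound, add_comm ‖(freq ξ : ℂ) * g₀ ξ‖]
  exact (norm_sub_le _ _).trans (add_le_add ((norm_sub_le _ _).trans (add_le_add h2 h3)) h1)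

theorem norm_solFT_sub_le (g₀ g₁ : E d → ℂ) {g : ℝ → E d → ℂ}
    (hg : Measurable (Function.uncurry g)) {ξ : E d} (h : majorant g ξ < ∞) (hξ : 0 < freq ξ)
    (t₀ s t : ℝ) :
    ‖solFT g₀ g₁ g t₀ s ξ - solFT g₀ g₁ g t₀ t ξ‖ ≤ energyBound g₀ g₁ g ξ * ‖s - t‖ :=
  convex_univ.norm_image_sub_le_of_norm_hasDerivWithin_le
    (f := fun r => solFT g₀ g₁ g t₀ r ξ) (f' := fun r => solDerivFT g₀ g₁ g t₀ r ξ)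
    (fun r _ => (hasDerivAt_solFT g₀ g₁ hg h hξ t₀ r).hasDerivWithinAt)
    (fun r _ => norm_solDerivFT_le g₀ g₁ h t₀ r) (mem_univ t) (mem_univ s)

/-! ### Measurability and integrability -/

theorem IsEnergyData.memLp_energyBound {v₀ v₁ : E d → ℝ} {g₀ g₁ : E d → ℂ}
    (hE : IsEnergyData v₀ v₁ g₀ g₁) {F : ℝ → E d → ℝ} {g : ℝ → E d → ℂ} (hF : IsForcing F g) :
    MemLp (energyBound g₀ g₁ g) 2 volume := by
  refine (hE.memLp₀.norm.add hE.memLp₁.norm).add ?_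
  have hm : MemLp (fun ξ => (((majorant g ξ).toReal : ℝ) : ℂ)) 2 volume := by
    refine memLp_of_enorm_le (M := majorant g) ?_ (fun ξ => ?_) hF.lintegral_majorant_sq_lt_top
    · exact (Complex.measurable_ofReal.comp
        (measurable_majorant hF.measurable_ft).ennreal_toReal).aestronglyMeasurable
    · rw [← ofReal_norm, Complex.norm_real, Real.norm_of_nonneg ENNReal.toReal_nonneg]
      exact ENNReal.ofReal_toReal_le
  refine hm.norm.congr_norm ?_ (ae_of_all _ fun ξ => ?_)
  · exact (measurable_majorant hF.measurable_ft).ennreal_toReal.aestronglyMeasurable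
  · simp

theorem IsEnergyData.measurable_solFT {v₀ v₁ : E d → ℝ} {g₀ g₁ : E d → ℂ}
    (hE : IsEnergyData v₀ v₁ g₀ g₁) {g : ℝ → E d → ℂ} (hg : Measurable (Function.uncurry g))
    (t₀ t : ℝ) : Measurable (solFT g₀ g₁ g t₀ t) :=
  (hE.measurable_freeFT.comp (measurable_prodMk_left (x := t - t₀))).sub
    ((measurable_duhamelFT hg).comp (measurable_prodMk_left (x := t)))

theorem IsEnergyData.measurable_solDerivFT {v₀ v₁ : E d → ℝ} {g₀ g₁ : E d → ℂ}
    (hE : IsEnergyData v₀ v₁ g₀ g₁) {g : ℝ → E d → ℂ} (hg : Measurable (Function.uncurry g))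
    (t₀ t : ℝ) : Measurable (solDerivFT g₀ g₁ g t₀ t) := by
  have h1 : Measurable fun ξ => freeDerivFT g₀ g₁ (t - t₀) ξ := by
    have := (continuous_freq (d := d)).measurable
    have := hE.measurable₀
    have := hE.measurable₁
    unfold freeDerivFT cosSym
    fun_prop
  exact h1.sub ((measurable_duhamelDerivFT hg).comp (measurable_prodMk_left (x := t)))

theorem IsEnergyData.memLp_solDerivFT {v₀ v₁ : E d → ℝ} {g₀ g₁ : E d → ℂ}
    (hE : IsEnergyData v₀ v₁ g₀ g₁) {F : ℝ → E d → ℝ} {g : ℝ → E d → ℂ} (hF : IsForcing F g)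
    (t₀ t : ℝ) : MemLp (solDerivFT g₀ g₁ g t₀ t) 2 volume := by
  refine (hE.memLp_energyBound hF).mono'
    (hE.measurable_solDerivFT hF.measurable_ft t₀ t).aestronglyMeasurable ?_
  filter_upwards [hF.ae_majorant_lt_top] with ξ hξ
  exact norm_solDerivFT_le g₀ g₁ hξ t₀ t

theorem IsEnergyData.memLp_freq_mul_solFT {v₀ v₁ : E d → ℝ} {g₀ g₁ : E d → ℂ}
    (hE : IsEnergyData v₀ v₁ g₀ g₁) {F : ℝ → E d → ℝ} {g : ℝ → E d → ℂ} (hF : IsForcing F g)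
    (t₀ t : ℝ) : MemLp (fun ξ => (freq ξ : ℂ) * solFT g₀ g₁ g t₀ t ξ) 2 volume := by
  refine (hE.memLp_energyBound hF).mono' ((Complex.measurable_ofReal.comp
    continuous_freq.measurable).mul
      (hE.measurable_solFT hF.measurable_ft t₀ t)).aestronglyMeasurable ?_
  filter_upwards [hF.ae_majorant_lt_top] with ξ hξ
  exact norm_freq_mul_solFT_le g₀ g₁ hξ t₀ t

theorem IsEnergyData.hermitian_solDerivFT {v₀ v₁ : E d → ℝ} {g₀ g₁ : E d → ℂ}
    (hE : IsEnergyData v₀ v₁ g₀ g₁) {F : ℝ → E d → ℝ} {g : ℝ → E d → ℂ} (hF : IsForcing F g)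
    (t₀ t : ℝ) :
    ∀ᵐ ξ, solDerivFT g₀ g₁ g t₀ t (-ξ) = conj (solDerivFT g₀ g₁ g t₀ t ξ) := by
  filter_upwards [hE.ft₀.hermitian, hE.ft₁.hermitian] with ξ h0 h1
  simp only [solDerivFT, freeDerivFT, map_sub, map_mul, Complex.conj_ofReal, h0, h1, cosSym_neg,
    freq_neg, duhamelDerivFT_neg hF.hermitian]

theorem IsEnergyData.exists_timeDeriv {v₀ v₁ : E d → ℝ} {g₀ g₁ : E d → ℂ}
    (hE : IsEnergyData v₀ v₁ g₀ g₁) {F : ℝ → E d → ℝ} {g : ℝ → E d → ℂ} (hF : IsForcing F g)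
    (t₀ : ℝ) : ∃ w : ℝ → E d → ℝ, ∀ t, IsFourierTransform (w t) (solDerivFT g₀ g₁ g t₀ t) := by
  choose w hw using fun t => exists_isFourierTransform_of_memLp (hE.memLp_solDerivFT hF t₀ t)
    (hE.hermitian_solDerivFT hF t₀ t)
  exact ⟨w, hw⟩

/-! ### Regularity of solutions -/

/-- Pairings are differentiated on the Fourier side, where at almost every frequency the solution is
Lipschitz in time with constant `energyBound`; this times a Schwartz function is integrable. -/
theorem isTimeDeriv_of_isFourierTransform (hd : 3 ≤ d) {v₀ v₁ : E d → ℝ} {g₀ g₁ : E d → ℂ}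
    (hE : IsEnergyData v₀ v₁ g₀ g₁) {F : ℝ → E d → ℝ} {g : ℝ → E d → ℂ} (hF : IsForcing F g)
    {t₀ : ℝ} {v w : ℝ → E d → ℝ} (hv : ∀ t, IsFourierTransform (v t) (solFT g₀ g₁ g t₀ t))
    (hw : ∀ t, IsFourierTransform (w t) (solDerivFT g₀ g₁ g t₀ t)) (I : Set ℝ) :
    IsTimeDeriv I v w := by
  intro φ t _
  obtain ⟨ψ, hψ⟩ := exists_fourier_eq_ofReal φ
  have hbound : Integrable (fun ξ => energyBound g₀ g₁ g ξ * ‖ψ ξ‖) volume :=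
    (hE.memLp_energyBound hF).integrable_mul (ψ.memLp 2 volume).norm
  have key : HasDerivAt (fun s => ∫ ξ, solFT g₀ g₁ g t₀ s ξ * ψ ξ)
      (∫ ξ, solDerivFT g₀ g₁ g t₀ t ξ * ψ ξ) t := by
    refine (hasDerivAt_integral_of_dominated_loc_of_lip (𝕜 := ℝ)
      (bound := fun ξ => energyBound g₀ g₁ g ξ * ‖ψ ξ‖)
      (F := fun s ξ => solFT g₀ g₁ g t₀ s ξ * ψ ξ) (s := univ) univ_mem
      (Eventually.of_forall fun s => ((hv s).integral_mul hψ).2.1.1) ((hv t).integral_mul hψ).2.1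
      ((hw t).integral_mul hψ).2.1.1 ?_ hbound ?_).2
    · filter_upwards [hF.ae_majorant_lt_top, ae_freq_pos hd] with ξ h1 h2
      refine LipschitzOnWith.of_dist_le_mul fun s _ s' _ => ?_
      rw [dist_eq_norm, ← sub_mul, norm_mul, Real.coe_nnabs, abs_of_nonneg
        (mul_nonneg (energyBound_nonneg g₀ g₁ g ξ) (norm_nonneg _)), mul_right_comm, dist_eq_norm]
      exact mul_le_mul_of_nonneg_right
        (norm_solFT_sub_le g₀ g₁ hF.measurable_ft h1 h2 t₀ s s') (norm_nonneg _)
    · filter_upwards [hF.ae_majorant_lt_top, ae_freq_pos hd] with ξ h1 h2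
      exact (hasDerivAt_solFT g₀ g₁ hF.measurable_ft h1 h2 t₀ t).mul_const _
  have h2 := Complex.reCLM.hasFDerivAt.comp_hasDerivAt t key
  have e1 : ∀ s, (∫ x, v s x * φ x) = (∫ ξ, solFT g₀ g₁ g t₀ s ξ * ψ ξ).re := fun s => by
    rw [← ((hv s).integral_mul hψ).2.2, Complex.ofReal_re]
  have e2 : (∫ x, w t x * φ x) = (∫ ξ, solDerivFT g₀ g₁ g t₀ t ξ * ψ ξ).re := by
    rw [← ((hw t).integral_mul hψ).2.2, Complex.ofReal_re]
  simp_rw [e1, e2]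
  exact h2.hasDerivWithinAt

theorem tendsto_eLpNorm_two_of_dominated {t : ℝ} {l : Filter ℝ} [l.IsCountablyGenerated]
    {H : ℝ → E d → ℂ} {N : E d → ℝ} (hH : ∀ s, AEStronglyMeasurable (H s) volume)
    (hN : MemLp N 2 volume) (hb : ∀ s, ∀ᵐ ξ, ‖H s ξ‖ ≤ N ξ)
    (hlim : ∀ᵐ ξ, Tendsto (fun s => H s ξ) l (𝓝 (H t ξ))) :
    Tendsto (fun s => eLpNorm (fun ξ => H s ξ - H t ξ) 2 volume) l (𝓝 0) := by
  have h1 : Tendsto (fun s => ∫⁻ ξ, ‖H s ξ - H t ξ‖ₑ ^ 2) l (𝓝 (∫⁻ _ : E d, 0)) := by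
    refine tendsto_lintegral_filter_of_dominated_convergence' (fun ξ => ‖(2 : ℝ) * N ξ‖ₑ ^ 2)
      (Eventually.of_forall fun s => ((hH s).sub (hH t)).enorm.pow_const 2)
      (Eventually.of_forall fun s => ?_) ?_ ?_
    · filter_upwards [hb s, hb t] with ξ h1 h2
      gcongr
      rw [enorm_le_iff_norm_le]
      refine (norm_sub_le _ _).trans ((add_le_add h1 h2).trans (le_of_eq_of_le ?_ (le_abs_self _)))
      ring
    · rw [lintegral_enorm_sq_eq]
      exact (ENNReal.pow_lt_top (hN.const_mul 2).2).ne
    · filter_upwards [hlim] with ξ hξ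
      have h2 : Tendsto (fun s => H s ξ - H t ξ) l (𝓝 0) := by
        simpa using hξ.sub_const (H t ξ)
      simpa [Function.comp_def] using ((ENNReal.continuous_pow 2).tendsto _).comp h2.enorm
  simp_rw [lintegral_enorm_sq_eq, lintegral_zero] at h1
  have h3 := ((ENNReal.continuous_rpow_const (y := 1 / 2)).tendsto _).comp h1
  have h4 : ∀ a : ℝ≥0∞, (a ^ 2) ^ (1 / 2 : ℝ) = a := fun a => by
    rw [← ENNReal.rpow_natCast, ← ENNReal.rpow_mul]
    simp
  simp only [Function.comp_def, h4] at h3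
  simpa using h3

/-- By Plancherel both norms are `L²_ξ` norms. At almost every frequency the profiles are continuous
in time and dominated by `energyBound`, so dominated convergence applies. -/
theorem continuousInEnergySpace_of_isFourierTransform (hd : 3 ≤ d) {v₀ v₁ : E d → ℝ}
    {g₀ g₁ : E d → ℂ} (hE : IsEnergyData v₀ v₁ g₀ g₁) {F : ℝ → E d → ℝ} {g : ℝ → E d → ℂ}
    (hF : IsForcing F g) {t₀ : ℝ} {v w : ℝ → E d → ℝ}
    (hv : ∀ t, IsFourierTransform (v t) (solFT g₀ g₁ g t₀ t))
    (hw : ∀ t, IsFourierTransform (w t) (solDerivFT g₀ g₁ g t₀ t)) (I : Set ℝ) :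
    ContinuousInEnergySpace I v w := by
  intro t _
  have eL : ∀ {u : E d → ℝ} {h : E d → ℂ}, IsFourierTransform u h →
      eLpNorm u 2 volume = eLpNorm h 2 volume := fun {u h} huh => by
    rw [(isFourierTransform_iff.1 huh).eLpNorm_eq]
    exact eLpNorm_congr_norm_ae (ae_of_all _ fun x => by simp)
  refine ⟨⟨_, hv t, hE.memLp_freq_mul_solFT hF t₀ t⟩,
    ⟨(hw t).1, by rw [eL (hw t)]; exact (hE.memLp_solDerivFT hF t₀ t).2⟩, ?_, ?_⟩
  · have h1 : ∀ s, homH1Norm (fun x => v s x - v t x) = eLpNorm (fun ξ =>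
        (freq ξ : ℂ) * solFT g₀ g₁ g t₀ s ξ - (freq ξ : ℂ) * solFT g₀ g₁ g t₀ t ξ) 2 volume :=
      fun s => by
      refine eLpNorm_congr_ae ?_
      filter_upwards [((hv s).sub (hv t)).fourierFun_ae_eq] with ξ hξ
      rw [hξ, ← mul_sub]
      rfl
    simp_rw [h1]
    refine tendsto_eLpNorm_two_of_dominated
      (H := fun s ξ => (freq ξ : ℂ) * solFT g₀ g₁ g t₀ s ξ)
      (fun s => (hE.memLp_freq_mul_solFT hF t₀ s).1) (hE.memLp_energyBound hF) (fun s => ?_) ?_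
    · filter_upwards [hF.ae_majorant_lt_top] with ξ hξ
      exact norm_freq_mul_solFT_le g₀ g₁ hξ t₀ s
    · filter_upwards [hF.ae_majorant_lt_top, ae_freq_pos hd] with ξ h1 h2
      exact ((hasDerivAt_solFT g₀ g₁ hF.measurable_ft h1 h2 t₀
        t).continuousAt.tendsto.const_mul _).mono_left nhdsWithin_le_nhds
  · simp_rw [fun s => eL ((hw s).sub (hw t))]
    refine tendsto_eLpNorm_two_of_dominated (fun s => (hE.memLp_solDerivFT hF t₀ s).1)
      (hE.memLp_energyBound hF) (fun s => ?_) ?_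
    · filter_upwards [hF.ae_majorant_lt_top] with ξ hξ
      exact norm_solDerivFT_le g₀ g₁ hξ t₀ s
    · filter_upwards [hF.ae_majorant_lt_top] with ξ h1
      exact ((continuous_solDerivFT g₀ g₁ hF.measurable_ft h1 t₀).tendsto t).mono_left
        nhdsWithin_le_nhds

/-! ### Initial values -/

/-- The transform of a vanishing slice is zero only for almost every `ξ`, with a null set depending
on `t`. Tonelli exchanges the quantifiers, as the initial values are evaluated at fixed `ξ`. -/
theorem IsForcing.ae_ae_eq_zero_of_lt {F : ℝ → E d → ℝ} {g : ℝ → E d → ℂ} (hF : IsForcing F g)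
    {t₀ : ℝ} (h0 : ∀ t < t₀, F t = 0) : ∀ᵐ ξ, ∀ᵐ t : ℝ, t < t₀ → g t ξ = 0 := by
  have hms : MeasurableSet {q : ℝ × E d | q.1 < t₀ → g q.1 q.2 = 0} :=
    (measurableSet_lt measurable_fst measurable_const).imp
      (hF.measurable_ft (measurableSet_singleton 0))
  refine (Measure.ae_ae_comm hms).1 (ae_of_all _ fun t => ?_)
  by_cases ht : t < t₀
  · have h1 := hF.ft t
    rw [h0 t ht] at h1
    filter_upwards [h1.right_unique isFourierTransform_zero] with ξ hξ _
    simpa using hξ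
  · exact ae_of_all _ fun ξ h => absurd h ht

theorem IsForcing.ae_duhamel_eq_zero {F : ℝ → E d → ℝ} {g : ℝ → E d → ℂ} (hF : IsForcing F g)
    {t₀ : ℝ} (h0 : ∀ t < t₀, F t = 0) :
    ∀ᵐ ξ, duhamelFT g t₀ ξ = 0 ∧ duhamelDerivFT g t₀ ξ = 0 := by
  filter_upwards [hF.ae_ae_eq_zero_of_lt h0] with ξ hξ
  constructor
  · refine integral_eq_zero_of_ae ?_
    filter_upwards [hξ] with t ht
    rcases lt_or_ge t t₀ with h | h
    · simp [ht h]
    · simp [sinKer, h]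
  · refine integral_eq_zero_of_ae ?_
    filter_upwards [hξ] with t ht
    rcases lt_or_ge t t₀ with h | h
    · simp [ht h]
    · simp [cosKer, h]

theorem solFT_ae_eq (g₀ g₁ : E d → ℂ) {F : ℝ → E d → ℝ} {g : ℝ → E d → ℂ} (hF : IsForcing F g)
    {t₀ : ℝ} (h0 : ∀ t < t₀, F t = 0) : solFT g₀ g₁ g t₀ t₀ =ᵐ[volume] g₀ := by
  filter_upwards [hF.ae_duhamel_eq_zero h0] with ξ hξ
  simp [solFT, freeFT, cosSym, sinSym, hξ.1]

theorem solDerivFT_ae_eq (g₀ g₁ : E d → ℂ) {F : ℝ → E d → ℝ} {g : ℝ → E d → ℂ}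
    (hF : IsForcing F g) {t₀ : ℝ} (h0 : ∀ t < t₀, F t = 0) :
    solDerivFT g₀ g₁ g t₀ t₀ =ᵐ[volume] g₁ := by
  filter_upwards [hF.ae_duhamel_eq_zero h0] with ξ hξ
  simp [solDerivFT, freeDerivFT, cosSym, hξ.2]

end Regularity

/-! ### Uniqueness for measurable classes and the conclusion -/

section WellPosedness

variable {d : ℕ}

theorem MemX.exists_measurable {I : Set ℝ} {u : ℝ → E d → ℝ} (h : MemX I u) :
    ∃ u' : ℝ → E d → ℝ, Measurable (Function.uncurry u') ∧
      Function.uncurry u =ᵐ[(volume.restrict I).prod volume] Function.uncurry u' ∧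
      ∀ᵐ t ∂(volume.restrict I), u t =ᵐ[volume] u' t :=
  ⟨Function.curry (h.1.mk _), h.1.stronglyMeasurable_mk.measurable, h.1.ae_eq_mk,
    Measure.ae_ae_of_ae_prod h.1.ae_eq_mk⟩

theorem ae_prod_eq_of_ae_ae {I : Set ℝ} {u w : ℝ → E d → ℝ} (hu : Measurable (Function.uncurry u))
    (hw : Measurable (Function.uncurry w))
    (h : ∀ᵐ t ∂(volume.restrict I), u t =ᵐ[volume] w t) :
    Function.uncurry u =ᵐ[(volume.restrict I).prod volume] Function.uncurry w :=
  (Measure.ae_prod_iff_ae_ae (measurableSet_eq_fun hu hw)).2 h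

/-- Uniqueness of mild solutions in `X(I)`. -/
theorem IsMildSolution.uncurry_ae_eq (hd : 5 ≤ d) {v₀ v₁ : E d → ℝ} {g₀ g₁ : E d → ℂ}
    (hE : IsEnergyData v₀ v₁ g₀ g₁) {t₀ t₁ : ℝ} {L f f' v v' F D : ℝ → E d → ℝ} {g : ℝ → E d → ℂ}
    (hL : ∀ t, IsFourierTransform (L t) (freeFT g₀ g₁ (t - t₀)))
    (hf' : Measurable (Function.uncurry f')) (hfn : normX (Icc t₀ t₁) f' ≠ ∞)
    (hff' : ∀ᵐ t ∂(volume.restrict (Icc t₀ t₁)), f t =ᵐ[volume] f' t)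
    (hv : Measurable (Function.uncurry v)) (hvn : normX (Icc t₀ t₁) v ≠ ∞)
    (hD : IsHartreeDuhamel (Icc t₀ t₁) (fun t x => v t x + f' t x) F g D)
    (hvD : ∀ t x, v t x = L t x - D t x) (hX : MemX (Icc t₀ t₁) v')
    (h : IsMildSolution (Icc t₀ t₁) t₀ v₀ v₁ f v') :
    Function.uncurry v' =ᵐ[(volume.restrict (Icc t₀ t₁)).prod volume] Function.uncurry v := by
  have hd3 : 3 ≤ d := by omega
  -- A competing solution is only almost everywhere measurable, so it is replaced by a Borel
  -- representative; neither its norm nor the nonlinearity notices the change at almost every time.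
  obtain ⟨u, hu, huv, huv'⟩ := hX.exists_measurable
  have hun : normX (Icc t₀ t₁) u ≠ ∞ := by
    rw [← normX_congr huv']
    exact hX.2.ne
  have hsum : normX (Icc t₀ t₁) (fun t x => u t x + f' t x) ≠ ∞ :=
    ne_top_of_le_ne_top (ENNReal.add_ne_top.2 ⟨hun, hfn⟩) (normX_add_le hd3 hu hf')
  obtain ⟨F', g', D', hD'⟩ := exists_isHartreeDuhamel (I := Icc t₀ t₁) hd measurableSet_Icc
    (a := fun t x => u t x + f' t x) (hu.add hf') hsum
  have hD'' : IsHartreeDuhamel (Icc t₀ t₁) (fun t x => v' t x + f t x) F' g' D' := by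
    refine hD'.congr ?_
    filter_upwards [huv', hff'] with t h1 h2
    filter_upwards [h1, h2] with x h3 h4
    rw [h3, h4]
  have hv'D : ∀ᵐ t ∂(volume.restrict (Icc t₀ t₁)), u t =ᵐ[volume] fun x => L t x - D' t x := by
    filter_upwards [h.ae_eq hd3 hE hL hD'', huv'] with t h1 h2
    exact h2.symm.trans h1
  exact huv.trans (ae_prod_eq_of_ae_ae hu hv (ae_ae_eq_of_isHartreeDuhamel hd hf' hv hu hfn hvn hun
    hD hD' (ae_of_all _ fun t => ae_of_all _ (hvD t)) hv'D))

end WellPosedness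

end HartreeNLW

end

open HartreeNLW in
/-- Small-data local well-posedness of the perturbed energy-critical Hartree wave equation
`∂ₜ²v - Δv + 𝒩(v + f) = 0`, `(v, ∂ₜv)|_{t = t₀} = (v₀, v₁)`, on `I = [t₀, t₁]`. -/
theorem proposition3p1 (d : ℕ) (hd : 5 ≤ d) (v₀ v₁ : HartreeNLW.E d → ℝ)
    (hv₀ : HartreeNLW.MemHomH1 v₀) (hv₁ : MemLp v₁ 2 volume) :
    ∃ η₀ : ℝ, 0 < η₀ ∧ ∀ η : ℝ, 0 < η → η ≤ η₀ →
      ∀ t₀ t₁ : ℝ, t₀ < t₁ → ∀ f : ℝ → HartreeNLW.E d → ℝ,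
        HartreeNLW.MemX (Icc t₀ t₁) f →
        HartreeNLW.normX (Icc t₀ t₁) (fun t => HartreeNLW.S (t - t₀) v₀ v₁)
          ≤ ENNReal.ofReal η →
        HartreeNLW.normX (Icc t₀ t₁) f ≤ ENNReal.ofReal η →
        ∃ v w : ℝ → HartreeNLW.E d → ℝ,
          HartreeNLW.IsTimeDeriv (Icc t₀ t₁) v w ∧
          HartreeNLW.ContinuousInEnergySpace (Icc t₀ t₁) v w ∧
          v t₀ =ᵐ[volume] v₀ ∧ w t₀ =ᵐ[volume] v₁ ∧
          HartreeNLW.MemX (Icc t₀ t₁) v ∧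
          HartreeNLW.IsMildSolution (Icc t₀ t₁) t₀ v₀ v₁ f v ∧
          HartreeNLW.normX (Icc t₀ t₁) v ≤ ENNReal.ofReal (3 * η) ∧
          -- uniqueness in all of `X(I)`, hence in the ball of radius `3η`
          ∀ v' : ℝ → HartreeNLW.E d → ℝ, HartreeNLW.MemX (Icc t₀ t₁) v' →
            HartreeNLW.IsMildSolution (Icc t₀ t₁) t₀ v₀ v₁ f v' →
            Function.uncurry v'
              =ᵐ[(volume.restrict (Icc t₀ t₁)).prod volume] Function.uncurry v := by
  have hd3 : 3 ≤ d := by omega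
  obtain ⟨g₀, g₁, hE⟩ := exists_isEnergyData hv₀ hv₁
  -- The threshold comes from the constants of the estimates and depends on `d` only, not on the
  -- data.
  obtain ⟨η₀, hη₀, hfix⟩ := exists_fixedPoint hd
  refine ⟨η₀, hη₀, fun η hη hηle t₀ t₁ ht f hf hS hfη => ?_⟩
  obtain ⟨L, hLm, hL⟩ := hE.exists_free hd3 t₀
  obtain ⟨f', hf', -, hff'⟩ := hf.exists_measurable
  have hLη : normX (Icc t₀ t₁) L ≤ ENNReal.ofReal η := by
    rwa [normX_congr (ae_of_all _ fun t => (hL t).left_unique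
      (hE.isFourierTransform_S hd3 (t - t₀)))]
  have hf'η : normX (Icc t₀ t₁) f' ≤ ENNReal.ofReal η := by rwa [← normX_congr hff']
  obtain ⟨v, F, g, D, hv, hD, hvD, hvη⟩ := hfix η hη hηle t₀ t₁ L f' hLm hf' hLη hf'η
  have hF := hD.forcing
  have hF0 : ∀ t < t₀, F t = 0 := fun t h => hD.eq_zero t fun hmem => absurd hmem.1 (not_le.2 h)
  obtain ⟨w, hw⟩ := hE.exists_timeDeriv hF t₀
  -- Because `v = L - D` holds everywhere, the explicit Fourier formula is available at every time,
  -- not merely at almost every one.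
  have hvFT : ∀ t, IsFourierTransform (v t) (solFT g₀ g₁ g t₀ t) := fun t =>
    ((hL t).sub (hD.duhamel.ft t)).congr (ae_of_all _ fun x => (hvD t x).symm) EventuallyEq.rfl
  have hvn : normX (Icc t₀ t₁) v < ∞ := hvη.trans_lt ENNReal.ofReal_lt_top
  have hDf : IsHartreeDuhamel (Icc t₀ t₁) (fun t x => v t x + f t x) F g D := by
    refine hD.congr ?_
    filter_upwards [hff'] with t ht
    filter_upwards [ht] with x hx
    rw [hx]
  exact ⟨v, w, isTimeDeriv_of_isFourierTransform hd3 hE hF hvFT hw _,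
    continuousInEnergySpace_of_isFourierTransform hd3 hE hF hvFT hw _,
    (hvFT t₀).left_unique (hE.ft₀.congr EventuallyEq.rfl (solFT_ae_eq g₀ g₁ hF hF0).symm),
    (hw t₀).left_unique (hE.ft₁.congr EventuallyEq.rfl (solDerivFT_ae_eq g₀ g₁ hF hF0).symm),
    ⟨hv.aestronglyMeasurable, hvn⟩,
    isMildSolution_of_ae_eq hd3 hE hL hDf (ae_of_all _ fun t => ae_of_all _ (hvD t)), hvη,
    fun v' hv' hmild => hmild.uncurry_ae_eq hd hE hL hf' (hf'η.trans_lt ENNReal.ofReal_lt_top).ne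
      hff' hv hvn.ne hD hvD hv'⟩
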